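/- Let $h>0$, $f_0\in\mathbb R$, $M=(0,1)^2$, $\Omega=M\times(-h,h)$, and for $\varepsilon>0$ consider the system $$\partial_tv+(v\cdot\nabla_H)v-\Big(\int_{-h}^z\nabla_H\cdot v\,d\xi\Big)\partial_zv-\Delta_Hv-\varepsilon\partial_z^2v+f_0\,k\times v+\nabla_H\Big(p_s(x,y,t)-\int_{-h}^zT\,d\xi\Big)=0,$$ $$\int_{-h}^h\nabla_H\cdot v(x,y,\xi,t)\,d\xi=0,$$ $$\partial_tT+v\cdot\nabla_HT-\Big(\int_{-h}^z\nabla_H\cdot v\,d\xi\Big)\Big(\partial_zT+\frac1h\Big)-\Delta_HT-\varepsilon\partial_z^2T=0$$ for $v=(v^1,v^2)$, $T$ and $p_s$, where $\nabla_H=(\partial_x,\partial_y)$, $\Delta_H=\partial_x^2+\partial_y^2$, $k\times v=(-v^2,v^1)$. Here $v,T$ are periodic (period $1$ in $x,y$, period $2h$ in $z$), $p_s$ is periodic with period $1$ in $x,y$, $v$ is even and $T$ is odd in $z$, and $(v,T)|_{t=0}=(v_0,T_0)$ with periodic $v_0,T_0\in H^2(\Omega)$, even and odd in $z$, respectively.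 A global strong solution is a pair $(v,T)$ with these properties that satisfies the equations almost everywhere for some such $p_s$, and $$v\in L^\infty_{\rm loc}([0,\infty);H^2)\cap C([0,\infty);H^1)\cap L^2_{\rm loc}([0,\infty);H^3),\quad T\in L^\infty_{\rm loc}([0,\infty);H^2)\cap C([0,\infty);H^1),$$ $$\nabla_HT\in L^2_{\rm loc}([0,\infty);H^2),\quad \partial_tv,\partial_tT\in L^2_{\rm loc}([0,\infty);H^1).$$ Put $u=\partial_zv$ and $u_0=\partial_zv_0$; $\|\cdot\|_q$ is the norm of $L^q(\Omega)$, and $D_r(\mathbf x)\subset\mathbb R^2$ is the open disk of radius $r$ centred at $\mathbf x$. **Proposition.** There is a constant $\delta_0\in(0,1]$, depending only on $h$, with the following property. For all $f_0\in\mathbb R$, $r_0\in(0,1]$ and $K\ge0$ there is a constant $C_0>0$, depending only on $h,\delta_0,r_0$, the Coriolis parameter $f_0$ and $K$, such that, with $$t_0^*=\min\Big\{1,\frac{6r_0^2\delta_0^2}{C_0}\Big\},$$ the following holds. If $\varepsilon>0$, if $(v,T)$ is a global strong solution of the above system with initial data satisfying $\|v_0\|_6+\|T_0\|_6\le K$,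 and if $$\sup_{\mathbf x\in M}\int_{-h}^h\int_{D_{2r_0}(\mathbf x)}|u_0(x,y,z)|^2\,dx\,dy\,dz\le\delta_0^2,$$ then $$\sup_{0\le t\le t_0^*}\|u\|_2^2(t)+\int_0^{t_0^*}\big(\|\nabla_Hu\|_2^2+\varepsilon\|\partial_zu\|_2^2\big)(t)\,dt\le C,$$ where $C$ depends only on $\delta_0$ and $r_0$. In particular, $\delta_0$, $C_0$, $t_0^*$ and $C$ do not depend on $\varepsilon$. -/

import Mathlib

open MeasureTheory Set Filter Topology
open scoped ContDiff ENNReal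

noncomputable section

namespace PrimitiveEq

/-- The horizontal plane `ℝ²` with its Euclidean norm. It is also the space of values of the
horizontal velocity. -/
abbrev Plane : Type := EuclideanSpace ℝ (Fin 2)

/-- Points of `ℝ³`, written as (horizontal position, vertical coordinate). -/
abbrev Pt : Type := Plane × ℝ

/-- The unit vector of `ℝ³` in the horizontal direction `j` (`0` for `x`, `1` for `y`). -/
def eH (j : Fin 2) : Pt := (EuclideanSpace.single j 1, 0)

/-- The vertical unit vector of `ℝ³`. -/
def eZ : Pt := (0, 1)

/-- The unit square `M = (0,1) × (0,1)`. -/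
def M : Set Plane := {x | ∀ j, x j ∈ Ioo (0 : ℝ) 1}

/-- `Ω = M × (-h, h)`. -/
def Om (h : ℝ) : Set Pt := M ×ˢ Ioo (-h) h

section WeakDerivative

variable {E : Type*} [NormedAddCommGroup E] [NormedSpace ℝ E] [MeasureSpace E]
  {F : Type*} [NormedAddCommGroup F] [NormedSpace ℝ F]

/-- On the open set `U`, the function `g` is the weak derivative of `f` in the direction `d`:
both are locally integrable on `U`, and `∫ (∂_d φ) f = -∫ φ g` for all `φ ∈ C_c^∞(U)`. -/
def HasWeakDeriv (U : Set E) (d : E) (f g : E → F) : Prop :=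
  LocallyIntegrableOn f U ∧ LocallyIntegrableOn g U ∧
    ∀ φ : E → ℝ, ContDiff ℝ ∞ φ → HasCompactSupport φ → tsupport φ ⊆ U →
      ∫ X, (fderiv ℝ φ X d) • f X = -∫ X, φ X • g X

open Classical in
/-- The weak derivative on the whole space in the direction `d` (unique almost everywhere);
it is only used where it exists. -/
def wd (d : E) (f : E → F) : E → F :=
  if hf : ∃ g, HasWeakDeriv univ d f g then hf.choose else 0

end WeakDerivative

section FunctionSpaces

variable {F : Type*} [NormedAddCommGroup F] [NormedSpace ℝ F]

/-- Periodicity: period `1` in `x` and `y`, period `2h` in `z`. -/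
def Periodic (h : ℝ) (f : Pt → F) : Prop :=
  (∀ j, ∀ᵐ X : Pt, f (X + eH j) = f X) ∧ ∀ᵐ X : Pt, f (X + (2 * h) • eZ) = f X

/-- Evenness in `z`. -/
def EvenZ (f : Pt → F) : Prop := ∀ᵐ X : Pt, f (X.1, -X.2) = f X

/-- Oddness in `z`. -/
def OddZ (f : Pt → F) : Prop := ∀ᵐ X : Pt, f (X.1, -X.2) = -f X

/-- `‖f‖₂²`, the square of the norm of `L²(Ω)`. -/
def normSq (h : ℝ) (f : Pt → F) : ℝ≥0∞ := ∫⁻ X in Om h, ‖f X‖ₑ ^ 2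

/-- `H^m` membership: `f` and its weak derivatives on `ℝ³` up to the order `m` are
square integrable on `Ω`. It is used for periodic functions (defined on all of `ℝ³`) and for
their derivatives. -/
def MemH (h : ℝ) : ℕ → (Pt → F) → Prop
  | 0, f => MemLp f 2 (volume.restrict (Om h))
  | m + 1, f => MemLp f 2 (volume.restrict (Om h)) ∧
      (∀ j, (∃ g, HasWeakDeriv univ (eH j) f g) ∧ MemH h m (wd (eH j) f)) ∧
      ((∃ g, HasWeakDeriv univ eZ f g) ∧ MemH h m (wd eZ f))

/-- The square of (a norm equivalent to) the `H^m` norm, for functions satisfying `MemH h m`. -/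
def hNormSq (h : ℝ) : ℕ → (Pt → F) → ℝ≥0∞
  | 0, f => normSq h f
  | m + 1, f => normSq h f + (∑ j, hNormSq h m (wd (eH j) f)) + hNormSq h m (wd eZ f)

/-- Joint measurability on `(0,∞) × ℝ³`. -/
def JointlyMeasurable (f : ℝ → Pt → F) : Prop :=
  AEStronglyMeasurable (fun p : ℝ × Pt => f p.1 p.2) (volume.restrict (Ioi (0 : ℝ) ×ˢ univ))

/-- The bounds of `f ∈ L^∞_loc([0,∞); H^m)`. -/
def LinftyLocH (h : ℝ) (m : ℕ) (f : ℝ → Pt → F) : Prop :=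
  ∀ τ : ℝ, 0 < τ → ∃ B : ℝ, ∀ᵐ t ∂(volume.restrict (Ioo 0 τ)),
    MemH h m (f t) ∧ hNormSq h m (f t) ≤ ENNReal.ofReal B

/-- The bounds of `f ∈ L²_loc([0,∞); H^m)`. -/
def L2LocH (h : ℝ) (m : ℕ) (f : ℝ → Pt → F) : Prop :=
  (∀ᵐ t ∂(volume.restrict (Ioi (0 : ℝ))), MemH h m (f t)) ∧
    ∀ τ : ℝ, 0 < τ → ∫⁻ t in Ioo 0 τ, hNormSq h m (f t) < ⊤

/-- `f ∈ C([0,∞); H^m)`. -/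
def ContH (h : ℝ) (m : ℕ) (f : ℝ → Pt → F) : Prop :=
  (∀ t, 0 ≤ t → MemH h m (f t)) ∧
    ∀ s, 0 ≤ s → Tendsto (fun t => hNormSq h m (f t - f s)) (𝓝[Ici 0] s) (𝓝 0)

/-- `g` is the weak time derivative of `f` on `(0,∞) × ℝ³`. -/
def HasWeakTimeDeriv (f g : ℝ → Pt → F) : Prop :=
  HasWeakDeriv (Ioi (0 : ℝ) ×ˢ (univ : Set Pt)) ((1, 0) : ℝ × Pt)
    (fun p => f p.1 p.2) (fun p => g p.1 p.2)

/-- `Δ_H f = ∂_x² f + ∂_y² f`. -/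
def lapH (f : Pt → F) (X : Pt) : F := ∑ j, wd (eH j) (wd (eH j) f) X

/-- `(v · ∇_H) f`. -/
def advH (v : Pt → Plane) (f : Pt → F) (X : Pt) : F := ∑ j, (v X j) • wd (eH j) f X

end FunctionSpaces

/-- `∇_H · v`. -/
def divH (v : Pt → Plane) (X : Pt) : ℝ := ∑ j, (wd (eH j) v X) j

/-- `∇_H q` for a scalar function `q`. -/
def gradH (q : Pt → ℝ) (X : Pt) : Plane := !₂[wd (eH 0) q X, wd (eH 1) q X]

/-- `k × v = (-v², v¹)`. -/
def kCross (a : Plane) : Plane := !₂[-(a 1), a 0]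

/-- `∫_{-h}^z q(x, y, ξ) dξ`. -/
def vint (h : ℝ) (q : Pt → ℝ) (X : Pt) : ℝ := ∫ ξ in (-h)..X.2, q (X.1, ξ)

/-- `p_s(x, y) - ∫_{-h}^z T(x, y, ξ) dξ`. -/
def pressure (h : ℝ) (p : Plane → ℝ) (T : Pt → ℝ) (X : Pt) : ℝ := p X.1 - vint h T X

/-- Admissible initial data: periodic functions in `H²`, with `v₀` even and `T₀` odd in `z`. -/
structure InitialData (h : ℝ) (v₀ : Pt → Plane) (T₀ : Pt → ℝ) : Prop where
  v_mem : MemH h 2 v₀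
  T_mem : MemH h 2 T₀
  v_per : Periodic h v₀
  T_per : Periodic h T₀
  v_even : EvenZ v₀
  T_odd : OddZ T₀

/-- Admissible surface pressure for the temperature `T` at a fixed time: a locally integrable
function of `(x, y)`, with period `1` in both variables, for which the pressure
`p_s - ∫_{-h}^z T` has a weak horizontal gradient. -/
def AdmissiblePressure (h : ℝ) (p : Plane → ℝ) (T : Pt → ℝ) : Prop :=
  LocallyIntegrable p ∧
    (∀ j : Fin 2, ∀ᵐ x : Plane, p (x + EuclideanSpace.single j 1) = p x) ∧
    ∀ j : Fin 2, ∃ g, HasWeakDeriv univ (eH j) (pressure h p T) g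

/-- `(v, T)` is a global strong solution of the primitive equations with horizontal viscosity and
diffusivity `1` and vertical viscosity and diffusivity `ε`, with Coriolis parameter `f₀` and
initial data `(v₀, T₀)`. The surface pressure `p` and the time derivatives `vt`, `Tt` are
determined by `(v, T)` (the pressure up to a function of time). -/
def IsGlobalStrongSolution (h f₀ ε : ℝ) (v₀ : Pt → Plane) (T₀ : Pt → ℝ)
    (v : ℝ → Pt → Plane) (T : ℝ → Pt → ℝ) : Prop :=
  -- periodicity and symmetry
  (∀ t, 0 ≤ t → Periodic h (v t) ∧ Periodic h (T t) ∧ EvenZ (v t) ∧ OddZ (T t)) ∧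
  -- regularity
  JointlyMeasurable v ∧ JointlyMeasurable T ∧
  LinftyLocH h 2 v ∧ ContH h 1 v ∧ L2LocH h 3 v ∧
  LinftyLocH h 2 T ∧ ContH h 1 T ∧ (∀ j, L2LocH h 2 (fun t => wd (eH j) (T t))) ∧
  -- initial condition
  v 0 =ᵐ[volume] v₀ ∧ T 0 =ᵐ[volume] T₀ ∧
  ∃ (vt : ℝ → Pt → Plane) (Tt : ℝ → Pt → ℝ) (p : ℝ → Plane → ℝ),
    HasWeakTimeDeriv v vt ∧ L2LocH h 1 vt ∧
    HasWeakTimeDeriv T Tt ∧ L2LocH h 1 Tt ∧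
    ∀ᵐ t ∂(volume.restrict (Ioi (0 : ℝ))),
      AdmissiblePressure h (p t) (T t) ∧
      -- momentum equation
      (∀ᵐ X : Pt,
        vt t X + advH (v t) (v t) X - vint h (divH (v t)) X • wd eZ (v t) X
          - lapH (v t) X - ε • wd eZ (wd eZ (v t)) X + f₀ • kCross (v t X)
          + gradH (pressure h (p t) (T t)) X = 0) ∧
      -- incompressibility
      (∀ᵐ x : Plane, ∫ ξ in (-h)..h, divH (v t) (x, ξ) = 0) ∧
      -- temperature equation
      (∀ᵐ X : Pt,
        Tt t X + advH (v t) (T t) X - vint h (divH (v t)) X * (wd eZ (T t) X + 1 / h)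
          - lapH (T t) X - ε * wd eZ (wd eZ (T t)) X = 0)

/-- `sup_{x ∈ M} ∫_{-h}^h ∫_{D_r(x)} |f|²`. -/
def localMass (h r : ℝ) (f : Pt → Plane) : ℝ≥0∞ :=
  ⨆ x ∈ M, ∫⁻ X in Metric.ball x r ×ˢ Ioo (-h) h, ‖f X‖ₑ ^ 2

/-- `sup_{0 ≤ t ≤ s} ‖u‖₂² + ∫_0^s (‖∇_H u‖₂² + ε ‖∂_z u‖₂²) dt`. -/
def energy (h ε s : ℝ) (u : ℝ → Pt → Plane) : ℝ≥0∞ :=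
  (⨆ t ∈ Icc 0 s, normSq h (u t)) +
    ∫⁻ t in Ioo 0 s,
      ((∑ j, normSq h (wd (eH j) (u t))) + ENNReal.ofReal ε * normSq h (wd eZ (u t)))

end PrimitiveEq

end

/-!
# Local energy estimate for the primitive equations, uniform in the vertical viscosity

The vertical viscosity `ε` contributes only terms of a good sign, so every estimate below uses the
horizontal dissipation alone. Write `u = ∂_z v`, and let `P` be the horizontal gradient of the
surface pressure.

**Growth of `‖v‖₄` and `‖T‖₂`.** Testing the momentum equation with `|v|² v` and the temperature
equation with `T` leaves the pressure term `∫ ∇p · |v|² v`. The total pressure gradient `∇p` is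
`P - ∫_{-h}^z ∇_H T`, so its vertical derivative is `-∇_H T` and it is bounded on vertical lines by
`L²` norms (`lintegral_mul_le_mz`), while the vertical integral of `|v|³` is controlled by the
two-dimensional inequality `W^{1,1} ⊆ L²` (`PD.sobolev`, `Slice.lintegral_mz_qV_le`). To bound
`‖∇p‖₂`, the momentum equation is tested with `P`: the time derivative and the Laplacian drop out,
because the vertical mean of the velocity is divergence free (`Slice.integral_gradP_le`). Thus
`∫ |v|⁴ / 4 + ∫ T² / 2` grows at most like `(1 + ∫ |v|⁴)²` (`Slice.rate`) and stays bounded on a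
time interval that depends on `h`, `f₀` and the initial bound only (`Evolution.energy_bound`).

**Localized energy of `u`.** Let `φ` be a horizontal cutoff. Testing the momentum equation with
`-φ² ∂_z u` gives a balance for `∫ φ² |u|²` in which the term `∫ φ² |v|² |u|²` has to be absorbed
(`Slice.exists_local_balance`). Bounding `|v|²` on vertical lines by integrals of `|v|²` and `|u|²`
and applying the two-dimensional Sobolev inequality to the vertical integral of `φ |u|²`, this term
is at most `C m (∫ φ² |∇_H u|² + m) + C ∫ |v|⁴`, where `m` is the mass of `|u|²` near the support
of `φ` (`Slice.integral_cut_qu2_le`). It is absorbed as soon as `m` is small (`Slice.local_rate`).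

**Continuation.** The supports of nine translates of `φ` cover that of `φ`. If the localized
energies for all centres are at most `3 δ` up to some time, then all the masses `m` are at most
`27 δ`, the local inequality applies, and for short times all the localized energies are at most
`2 δ` (`Evolution.local_bound`). The localized energies are continuous in time uniformly in the
centre, so this extends to a full time interval (`continuation`). Summing over a grid of centres gives the full energy
(`Evolution.covered_bound`).

**Time derivatives.** The regularity of a strong solution does not make the energies differentiable
in an obvious way. For `∫ T²` and `∫ |v|⁴` the fundamental theorem of calculus is applied on almost
every time line (`TimePath.integral_four`). For `∫ φ² |u|²` the increment between two times is
written as `∫ (v(t) - v(s)) · φ² (∂_z u(s) + ∂_z u(t))` up to sign, and these identities are summed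
over finer and finer partitions of the time interval (`integral_diagonal`,
`TimePath.integral_vertical`).
-/


set_option linter.unusedSectionVars false

noncomputable section

namespace PrimitiveEq

/-! ### Derivatives along lines and almost everywhere periodic functions -/

section

/-- The product rule for primitives of integrable functions. -/
theorem mul_primitive {g₁ g₂ : ℝ → ℝ} (c₁ c₂ : ℝ) {t : ℝ}
    (h₁ : IntervalIntegrable g₁ volume 0 t) (h₂ : IntervalIntegrable g₂ volume 0 t) :
    (c₁ + ∫ s in (0 : ℝ)..t, g₁ s) * (c₂ + ∫ s in (0 : ℝ)..t, g₂ s) =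
      c₁ * c₂ + ∫ s in (0 : ℝ)..t, (g₁ s * (c₂ + ∫ r in (0 : ℝ)..s, g₂ r)
        + (c₁ + ∫ r in (0 : ℝ)..s, g₁ r) * g₂ s) := by
  have hconst : ∀ c : ℝ, AbsolutelyContinuousOnInterval (fun _ : ℝ => c) 0 t := fun c =>
    (LipschitzOnWith.absolutelyContinuousOnInterval (K := 0)
      (LipschitzWith.const c).lipschitzOnWith)
  have a₁ : AbsolutelyContinuousOnInterval (fun s => c₁ + ∫ r in (0 : ℝ)..s, g₁ r) 0 t :=
    (hconst c₁).add (h₁.absolutelyContinuousOnInterval_intervalIntegral (c := 0) (by simp))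
  have a₂ : AbsolutelyContinuousOnInterval (fun s => c₂ + ∫ r in (0 : ℝ)..s, g₂ r) 0 t :=
    (hconst c₂).add (h₂.absolutelyContinuousOnInterval_intervalIntegral (c := 0) (by simp))
  have := a₁.integral_deriv_mul_eq_sub a₂
  simp only [intervalIntegral.integral_same, add_zero] at this
  rw [← sub_eq_iff_eq_add'] 
  rw [← this]
  apply intervalIntegral.integral_congr_ae
  filter_upwards [h₁.ae_hasDerivAt_integral, h₂.ae_hasDerivAt_integral] with x hx₁ hx₂ hx
  have hx' : x ∈ uIcc 0 t := uIoc_subset_uIcc hx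
  have d₁ := ((hx₁ hx' 0 (by simp)).const_add c₁).deriv
  have d₂ := ((hx₂ hx' 0 (by simp)).const_add c₂).deriv
  rw [d₁, d₂]

theorem ae_periodic_zsmul {β : Type*} {G : ℝ → β} {L : ℝ} (hG : ∀ᵐ s, G (s + L) = G s) :
    ∀ᵐ s, ∀ n : ℤ, G (s + n • L) = G s := by
  rw [ae_all_iff]
  have sh : ∀ c : ℝ, ∀ᵐ s, G (s + c + L) = G (s + c) := fun c =>
    (measurePreserving_add_right volume c).quasiMeasurePreserving.ae hG
  intro n
  induction n with
  | zero => simp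
  | succ n ih =>
    filter_upwards [ih, sh ((n : ℤ) • L)] with s h1 h2
    rw [← h1, ← h2, add_smul, one_smul, add_assoc]
  | pred n ih =>
    filter_upwards [ih, sh ((-(n : ℤ) - 1) • L)] with s h1 h2
    rw [← h1, ← h2]
    congr 1
    rw [sub_smul, one_smul]; ring

/-- The periodic representative of an almost everywhere periodic function. -/
theorem ae_periodic_eq_toIocMod {β : Type*} {G : ℝ → β} {L : ℝ} (hL : 0 < L)
    (hG : ∀ᵐ s, G (s + L) = G s) : G =ᵐ[volume] fun s => G (toIocMod hL 0 s) := by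
  filter_upwards [ae_periodic_zsmul hG] with s hs
  simp only [toIocMod]
  have := hs (-(toIocDiv hL 0 s))
  rw [← this]; congr 1; rw [neg_smul]; rfl

theorem toIocMod_vadd {L : ℝ} (hL : 0 < L) (g : AddSubgroup.zmultiples L) (x : ℝ) :
    toIocMod hL 0 (g +ᵥ x) = toIocMod hL 0 x := by
  obtain ⟨g, hg⟩ := g
  obtain ⟨n, rfl⟩ := AddSubgroup.mem_zmultiples_iff.1 hg
  simp only [AddSubgroup.mk_vadd, vadd_eq_add]
  rw [add_comm]
  exact toIocMod_add_zsmul hL 0 x n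

/-- The integral of a periodic function over a period depends neither on the period chosen nor
on a translation of the argument. -/
theorem setLIntegral_translate {G : ℝ → ℝ≥0∞} {L : ℝ} (hL : 0 < L)
    (hG : ∀ᵐ s, G (s + L) = G s) (a b t : ℝ) :
    ∫⁻ s in Ioo a (a + L), G (s + t) = ∫⁻ s in Ioo b (b + L), G s := by
  have hae := ae_periodic_eq_toIocMod hL hG
  have key : ∫⁻ s in Ioc (a + t) (a + t + L), G s = ∫⁻ s in Ioc b (b + L), G s := by
    rw [lintegral_congr_ae (ae_restrict_of_ae hae),
      lintegral_congr_ae (ae_restrict_of_ae (s := Ioc b (b + L)) hae)]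
    refine (isAddFundamentalDomain_Ioc hL (a + t) volume).setLIntegral_eq
      (isAddFundamentalDomain_Ioc hL b volume) _ ?_
    intro g x
    simp only [toIocMod_vadd]
  rw [restrict_Ioo_eq_restrict_Ioc, restrict_Ioo_eq_restrict_Ioc, ← key]
  rw [← (measurePreserving_add_right volume t).setLIntegral_comp_preimage_emb
    (MeasurableEquiv.addRight t).measurableEmbedding G (Ioc (a + t) (a + t + L))]
  congr 2
  simp [add_right_comm]

theorem setIntegral_translate {G : ℝ → ℝ} {L : ℝ} (hL : 0 < L)
    (hG : ∀ᵐ s, G (s + L) = G s) (a b t : ℝ) :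
    ∫ s in Ioo a (a + L), G (s + t) = ∫ s in Ioo b (b + L), G s := by
  have hae := ae_periodic_eq_toIocMod hL hG
  have key : ∫ s in Ioc (a + t) (a + t + L), G s = ∫ s in Ioc b (b + L), G s := by
    rw [integral_congr_ae (ae_restrict_of_ae hae),
      integral_congr_ae (ae_restrict_of_ae (s := Ioc b (b + L)) hae)]
    refine (isAddFundamentalDomain_Ioc hL (a + t) volume).setIntegral_eq
      (isAddFundamentalDomain_Ioc hL b volume) ?_
    intro g x
    simp only [toIocMod_vadd]
  rw [restrict_Ioo_eq_restrict_Ioc, restrict_Ioo_eq_restrict_Ioc, ← key]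
  rw [← (measurePreserving_add_right volume t).setIntegral_preimage_emb
    (MeasurableEquiv.addRight t).measurableEmbedding G (Ioc (a + t) (a + t + L))]
  congr 2
  simp [add_right_comm]

section Line

variable {E : Type*} [NormedAddCommGroup E] [NormedSpace ℝ E] [FiniteDimensional ℝ E]
  [MeasureSpace E] [BorelSpace E] [(volume : Measure E).IsAddHaarMeasure]

/-- The map `(X, s) ↦ X + s d` pulls null sets back to null sets, so almost everywhere identities
may be transported along it. -/
theorem quasiMeasurePreserving_shear (d : E) :
    Measure.QuasiMeasurePreserving (fun p : E × ℝ => p.1 + p.2 • d)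
      ((volume : Measure E).prod (volume : Measure ℝ)) volume := by
  refine QuasiMeasurePreserving.prod_of_left (by fun_prop) ?_
  exact Eventually.of_forall fun s =>
    (measurePreserving_add_right volume (s • d)).quasiMeasurePreserving

/-- Integrability of a shifted locally integrable function in the point and in the shift. -/
theorem integrable_shear {U : Set E} {d : E} {g : E → ℝ} {s : ℝ}
    (hU : ∀ X ∈ U, ∀ r : ℝ, 0 ≤ r → X + r • d ∈ U) (hg : LocallyIntegrableOn g U)
    {K : Set E} (hK : IsCompact K) (hKU : K ⊆ U) :
    Integrable (fun p : E × ℝ => g (p.1 + p.2 • d))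
      ((volume.restrict K).prod (volume.restrict (Ioc 0 s))) := by
  set K' : Set E := (fun p : E × ℝ => p.1 + p.2 • d) '' (K ×ˢ Icc 0 s) with hK'
  have cK' : IsCompact K' := (hK.prod isCompact_Icc).image (by fun_prop)
  have sK' : K' ⊆ U := by
    rintro _ ⟨⟨X, r⟩, ⟨hX, hr⟩, rfl⟩
    exact hU X (hKU hX) r hr.1
  have ig : Integrable (K'.indicator g) volume :=
    (integrable_indicator_iff cK'.measurableSet).2 (hg.integrableOn_compact_subset sK' cK')
  have main : Integrable (fun p : E × ℝ => K'.indicator g (p.1 + p.2 • d))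
      ((volume : Measure E).prod (volume.restrict (Ioc 0 s))) := by
    have hm : AEStronglyMeasurable (fun p : E × ℝ => K'.indicator g (p.1 + p.2 • d))
        ((volume : Measure E).prod (volume.restrict (Ioc 0 s))) := by
      refine (ig.aestronglyMeasurable.comp_quasiMeasurePreserving
        (quasiMeasurePreserving_shear d)).mono_ac ?_
      exact Measure.AbsolutelyContinuous.prod (Measure.AbsolutelyContinuous.refl _)
        Measure.restrict_le_self.absolutelyContinuous
    rw [integrable_prod_iff' hm]
    refine ⟨Eventually.of_forall fun r => ig.comp_add_right (r • d), ?_⟩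
    have : (fun r : ℝ => ∫ X : E, ‖K'.indicator g (X + r • d)‖) =
        fun _ => ∫ X : E, ‖K'.indicator g X‖ := by
      funext r
      exact integral_add_right_eq_self (fun X => ‖K'.indicator g X‖) (r • d)
    simp only [this]
    exact integrable_const _
  rw [Measure.prod_restrict]
  have m2 : Integrable (fun p : E × ℝ => K'.indicator g (p.1 + p.2 • d))
      (((volume : Measure E).prod (volume : Measure ℝ)).restrict (K ×ˢ Ioc 0 s)) := by
    rw [← Measure.prod_restrict]
    refine main.mono_measure ?_
    exact Measure.prod_mono Measure.restrict_le_self le_rfl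
  refine m2.congr ?_
  filter_upwards [ae_restrict_mem (hK.measurableSet.prod measurableSet_Ioc)] with p hp
  rw [indicator_of_mem]
  exact ⟨p, ⟨hp.1, hp.2.1.le, hp.2.2⟩, rfl⟩

/-- A weak derivative in the direction `d` is a derivative along almost every line parallel
to `d`. The domain has to be stable under positive shifts in this direction. -/
theorem HasWeakDeriv.line {U : Set E} (hUo : IsOpen U) {d : E} {f g : E → ℝ}
    (hU : ∀ X ∈ U, ∀ r : ℝ, 0 ≤ r → X + r • d ∈ U) (h : HasWeakDeriv U d f g) {s : ℝ}
    (hs : 0 ≤ s) :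
    ∀ᵐ X, X ∈ U → f (X + s • d) - f X - ∫ r in (0 : ℝ)..s, g (X + r • d) = 0 := by
  obtain ⟨hf, hg, hφ⟩ := h
  have hfs : LocallyIntegrableOn (fun X => f (X + s • d)) U := by
    rw [locallyIntegrableOn_iff hUo.isLocallyClosed]
    intro K hKU hK
    have c : IsCompact ((fun X => X + s • d) '' K) := hK.image (by fun_prop)
    have := hf.integrableOn_compact_subset
      (by rintro _ ⟨X, hX, rfl⟩; exact hU X (hKU hX) s hs) c
    rw [(measurePreserving_add_right volume (s • d)).integrableOn_image
      (MeasurableEquiv.addRight (s • d)).measurableEmbedding] at this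
    exact this
  have hI : LocallyIntegrableOn (fun X => ∫ r in (0 : ℝ)..s, g (X + r • d)) U := by
    rw [locallyIntegrableOn_iff hUo.isLocallyClosed]
    intro K hKU hK
    have := (integrable_shear (s := s) hU hg hK hKU).integral_prod_left
    simp only [intervalIntegral.integral_of_le hs]
    exact this
  refine hUo.ae_eq_zero_of_integral_contDiff_smul_eq_zero ((hfs.sub hf).sub hI) ?_
  intro φ φs φc φU
  set K := tsupport φ with hKdef
  have hK : IsCompact K := φc
  have φz : ∀ X ∉ K, φ X = 0 := fun X hX => image_eq_zero_of_notMem_tsupport hX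
  have φcont : Continuous φ := φs.continuous
  obtain ⟨Cφ, hCφ⟩ := φcont.bounded_above_of_compact_support φc
  -- integrability of a product with the test function
  have prodint : ∀ k : E → ℝ, LocallyIntegrableOn k U → Integrable fun X => φ X * k X := by
    intro k hk
    have := (hk.integrableOn_compact_subset φU hK).bdd_mul (f := φ) (c := Cφ)
      φcont.aestronglyMeasurable (Eventually.of_forall hCφ)
    rw [← integrableOn_univ]
    refine IntegrableOn.of_forall_sdiff_eq_zero this MeasurableSet.univ ?_
    intro x hx
    simp [φz x hx.2]
  set K' : Set E := (fun p : E × ℝ => p.1 + p.2 • d) '' (K ×ˢ Icc 0 s) with hK'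
  have cK' : IsCompact K' := (hK.prod isCompact_Icc).image (by fun_prop)
  have sK' : K' ⊆ U := by
    rintro _ ⟨⟨X, r⟩, ⟨hX, hr⟩, rfl⟩
    exact hU X (φU hX) r hr.1
  set ψ : E → ℝ := fun X => fderiv ℝ φ X d with hψ
  have ψcont : Continuous ψ :=
    (φs.continuous_fderiv (by simp)).clm_apply continuous_const
  have ψc : HasCompactSupport ψ := φc.fderiv_apply (𝕜 := ℝ) d
  have ψz : ∀ X ∉ K, ψ X = 0 := by
    intro X hX
    have : X ∉ tsupport (fderiv ℝ φ) := fun h => hX (tsupport_fderiv_subset ℝ h)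
    simp [hψ, image_eq_zero_of_notMem_tsupport this]
  obtain ⟨Cψ, hCψ⟩ := ψcont.bounded_above_of_compact_support ψc
  -- the weak derivative tested with a shifted test function
  have weak : ∀ r ∈ Ioc 0 s, ∫ X, ψ (X - r • d) * f X = - ∫ X, φ X * g (X + r • d) := by
    intro r hr
    have e := hφ (fun X => φ (X - r • d)) (φs.comp (contDiff_id.sub contDiff_const))
      (φc.comp_homeomorph (Homeomorph.subRight (r • d))) ?_
    · have e2 : ∀ X, fderiv ℝ (fun X => φ (X - r • d)) X d = ψ (X - r • d) := by
        intro X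
        rw [fderiv_comp_sub]
      simp only [e2, smul_eq_mul] at e
      rw [e]
      congr 1
      rw [← integral_add_right_eq_self (fun X => φ (X - r • d) * g X) (r • d)]
      simp
    · intro X hX
      have : X - r • d ∈ K := by
        have := tsupport_comp_subset_preimage φ (f := fun X => X - r • d) (by fun_prop) hX
        exact this
      have := hU _ (φU this) r hr.1.le
      simpa using this
  -- Fubini on the left
  have if' : Integrable (K'.indicator f) volume :=
    (integrable_indicator_iff cK'.measurableSet).2 (hf.integrableOn_compact_subset sK' cK')
  have i1 : Integrable (fun p : E × ℝ => ψ (p.1 - p.2 • d) * f p.1)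
      ((volume : Measure E).prod (volume.restrict (Ioc 0 s))) := by
    have a1 : Integrable (fun p : E × ℝ => ψ (p.1 - p.2 • d) * K'.indicator f p.1)
        ((volume : Measure E).prod (volume.restrict (Ioc 0 s))) := by
      refine (if'.comp_fst _).bdd_mul (c := Cψ) ?_ ?_
      · exact (ψcont.comp (by fun_prop)).aestronglyMeasurable
      · exact Eventually.of_forall fun p => hCψ _
    refine a1.congr ?_
    have : ∀ᵐ p : E × ℝ ∂((volume : Measure E).prod (volume.restrict (Ioc 0 s))),
        p.2 ∈ Ioc 0 s :=
      Measure.quasiMeasurePreserving_snd.ae (ae_restrict_mem measurableSet_Ioc)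
    filter_upwards [this] with p hp
    by_cases hpK : p.1 ∈ K'
    · simp [hpK]
    · have : p.1 - p.2 • d ∉ K := by
        intro hh
        exact hpK ⟨(p.1 - p.2 • d, p.2), ⟨hh, hp.1.le, hp.2⟩, by simp⟩
      simp [ψz _ this]
  have i2 : Integrable (fun p : E × ℝ => φ p.1 * g (p.1 + p.2 • d))
      ((volume : Measure E).prod (volume.restrict (Ioc 0 s))) := by
    have a1 := (integrable_shear (s := s) hU hg hK φU).bdd_mul (f := fun p : E × ℝ => φ p.1)
      (c := Cφ) ((φcont.comp continuous_fst).aestronglyMeasurable)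
      (Eventually.of_forall fun p => hCφ _)
    have e1 : (volume.restrict K).prod (volume.restrict (Ioc 0 s)) =
        ((volume : Measure E).prod (volume.restrict (Ioc 0 s))).restrict (K ×ˢ univ) := by
      rw [← Measure.prod_restrict, Measure.restrict_univ]
    rw [e1] at a1
    rw [← integrableOn_univ]
    refine IntegrableOn.of_forall_sdiff_eq_zero a1 MeasurableSet.univ ?_
    intro p hp
    have : p.1 ∉ K := fun h => hp.2 ⟨h, mem_univ _⟩
    simp [φz _ this]
  have ftc : ∀ X, φ (X - s • d) - φ X = - ∫ r in (0 : ℝ)..s, ψ (X - r • d) := by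
    intro X
    have : ∀ r ∈ uIcc 0 s, HasDerivAt (fun r : ℝ => φ (X - r • d)) (-ψ (X - r • d)) r := by
      intro r _
      have hd : HasDerivAt (fun r : ℝ => X - r • d) (-d) r := by
        simpa using ((hasDerivAt_id r).smul_const d).const_sub X
      have := ((φs.differentiable (by simp)) (X - r • d)).hasFDerivAt.comp_hasDerivAt r hd
      exact this.congr_deriv (by simp [hψ])
    have hc : Continuous fun r : ℝ => ψ (X - r • d) := ψcont.comp (by fun_prop)
    have := intervalIntegral.integral_eq_sub_of_hasDerivAt this
      (hc.neg.intervalIntegrable _ _)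
    rw [intervalIntegral.integral_neg] at this
    simpa using this.symm
  have hfin : ∫ X, φ X * (f (X + s • d) - f X - ∫ r in (0 : ℝ)..s, g (X + r • d)) = 0 := by
    have p1 := prodint _ hfs
    have p2 := prodint _ hf
    have p3 := prodint _ hI
    have e0 : ∫ X, φ X * f (X + s • d) = ∫ X, φ (X - s • d) * f X := by
      rw [← integral_add_right_eq_self (fun X => φ (X - s • d) * f X) (s • d)]
      simp
    have p1' : Integrable fun X => φ (X - s • d) * f X := by
      have := p1.comp_sub_right (s • d)
      simpa using this
    simp only [mul_sub]
    have e1 := integral_sub (p1.sub p2) p3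
    simp only [Pi.sub_apply] at e1
    rw [e1, integral_sub p1 p2, e0, ← integral_sub p1' p2]
    simp only [← sub_mul, ftc]
    have L : ∫ X, -(∫ r in (0 : ℝ)..s, ψ (X - r • d)) * f X =
        - ∫ r in Ioc 0 s, ∫ X, ψ (X - r • d) * f X := by
      rw [← integral_integral_swap i1, ← integral_neg]
      congr 1; funext X
      rw [intervalIntegral.integral_of_le hs, neg_mul, integral_mul_const]
    have R : ∫ X, φ X * ∫ r in (0 : ℝ)..s, g (X + r • d) =
        ∫ r in Ioc 0 s, ∫ X, φ X * g (X + r • d) := by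
      rw [← integral_integral_swap i2]
      congr 1; funext X
      rw [intervalIntegral.integral_of_le hs, ← integral_const_mul]
    rw [L, R, setIntegral_congr_fun measurableSet_Ioc weak, integral_neg]
    ring
  simpa using hfin

theorem aestronglyMeasurable_line {g : E → ℝ} (hg : AEStronglyMeasurable g volume) (d : E) :
    AEStronglyMeasurable (fun p : E × ℝ => ∫ r in Ioc 0 p.2, g (p.1 + r • d))
      ((volume : Measure E).prod (volume : Measure ℝ)) := by
  have q : Measure.QuasiMeasurePreserving (fun p : (E × ℝ) × ℝ => p.1.1 + p.2 • d)
      (((volume : Measure E).prod (volume : Measure ℝ)).prod (volume : Measure ℝ)) volume := by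
    refine QuasiMeasurePreserving.prod_of_left (by fun_prop) ?_
    refine Eventually.of_forall fun r => ?_
    exact (measurePreserving_add_right volume (r • d)).quasiMeasurePreserving.comp
      Measure.quasiMeasurePreserving_fst
  have m := hg.comp_quasiMeasurePreserving q
  have ms : MeasurableSet {p : (E × ℝ) × ℝ | p.2 ∈ Ioc 0 p.1.2} := by
    have : {p : (E × ℝ) × ℝ | p.2 ∈ Ioc 0 p.1.2} =
        {p : (E × ℝ) × ℝ | 0 < p.2} ∩ {p : (E × ℝ) × ℝ | p.2 ≤ p.1.2} := by
      ext; simp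
    rw [this]
    exact (measurableSet_lt measurable_const (by fun_prop)).inter
      (measurableSet_le (by fun_prop) (by fun_prop))
  have m2 := (m.indicator ms).integral_prod_right'
  refine m2.congr (Eventually.of_forall fun p => ?_)
  simp only
  rw [← integral_indicator measurableSet_Ioc]
  congr 1

theorem nullMeasurableSet_line {f g : E → ℝ} (hf : AEStronglyMeasurable f volume)
    (hg : AEStronglyMeasurable g volume) (d : E) :
    NullMeasurableSet {p : E × ℝ | f (p.1 + p.2 • d) = f p.1 + ∫ r in Ioc 0 p.2, g (p.1 + r • d)}
      ((volume : Measure E).prod (volume : Measure ℝ)) := by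
  refine nullMeasurableSet_eq_fun ?_ ?_
  · exact (hf.comp_quasiMeasurePreserving (quasiMeasurePreserving_shear d)).aemeasurable
  · exact ((hf.comp_quasiMeasurePreserving Measure.quasiMeasurePreserving_fst).add
      (aestronglyMeasurable_line hg d)).aemeasurable

/-- Fubini for null sets: the order of two almost everywhere quantifiers can be exchanged. -/
theorem ae_ae_swap {α β : Type*} [MeasurableSpace α] [MeasurableSpace β] {μ : Measure α}
    {ν : Measure β} [SFinite μ] [SFinite ν] {p : α → β → Prop}
    (hp : NullMeasurableSet {x : α × β | p x.1 x.2} (μ.prod ν))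
    (h : ∀ᵐ y ∂ν, ∀ᵐ x ∂μ, p x y) : ∀ᵐ z ∂μ.prod ν, p z.1 z.2 := by
  obtain ⟨s, hs, hms, hse⟩ := hp.exists_measurable_superset_ae_eq
  have h2 : ∀ᵐ z ∂μ.prod ν, (z ∈ s ↔ p z.1 z.2) := by
    filter_upwards [hse] with z hz
    exact iff_of_eq hz
  have h4 : ∀ᵐ x ∂μ, ∀ᵐ y ∂ν, (x, y) ∈ s := by
    rw [Measure.ae_ae_comm (p := fun x y => (x, y) ∈ s) hms]
    filter_upwards [h] with y hy
    filter_upwards [hy] with x hx using hs hx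
  have h5 : ∀ᵐ z ∂μ.prod ν, z ∈ s := (Measure.ae_prod_mem_iff_ae_ae_mem hms).2 h4
  filter_upwards [h5, h2] with z a b using b.1 a

theorem ae_swap_of_prod {α β : Type*} [MeasurableSpace α] [MeasurableSpace β] {μ : Measure α}
    {ν : Measure β} [SFinite μ] [SFinite ν] {p : α × β → Prop} (h : ∀ᵐ z ∂μ.prod ν, p z) :
    ∀ᵐ y ∂ν, ∀ᵐ x ∂μ, p (x, y) := by
  have : ∀ᵐ z ∂ν.prod μ, p z.swap := by
    rw [← Measure.prod_swap] at h
    exact ae_of_ae_map measurable_swap.aemeasurable h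
  exact Measure.ae_ae_of_ae_prod this

end Line

end

/-! ### Coordinates of the period cell and invariance under translations -/

section

/-- The three coordinate directions of `ℝ³`: `0` and `1` are horizontal, `2` is vertical. -/
def dir : Fin 3 → Pt := ![eH 0, eH 1, eZ]

/-- The periods in the three coordinate directions. -/
def per (h : ℝ) : Fin 3 → ℝ := ![1, 1, 2 * h]

/-- The left end points of the three sides of `Ω`. -/
def lo (h : ℝ) : Fin 3 → ℝ := ![0, 0, -h]

/-- Coordinates of `ℝ³` in which the coordinate in direction `a` is singled out. -/
def ch : Fin 3 → ℝ × (ℝ × ℝ) → Pt :=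
  ![fun p => (!₂[p.1, p.2.1], p.2.2), fun p => (!₂[p.2.1, p.1], p.2.2),
    fun p => (!₂[p.2.1, p.2.2], p.1)]

/-- The cross section of `Ω` orthogonal to the direction `a`. -/
def cs (h : ℝ) : Fin 3 → Set (ℝ × ℝ) :=
  ![Ioo 0 1 ×ˢ Ioo (-h) h, Ioo 0 1 ×ˢ Ioo (-h) h, Ioo 0 1 ×ˢ Ioo 0 1]

/-- Lebesgue measure on `Ω`. -/
abbrev mu (h : ℝ) : Measure Pt := volume.restrict (Om h)

instance : (volume : Measure Pt).IsAddHaarMeasure :=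
  inferInstanceAs (((volume : Measure Plane).prod (volume : Measure ℝ)).IsAddHaarMeasure)

theorem measurePreserving_plane :
    MeasurePreserving (fun p : ℝ × ℝ => (!₂[p.1, p.2] : Plane)) volume volume := by
  have h1 := (volume_preserving_finTwoArrow ℝ).symm
  have h2 := (PiLp.volume_preserving_toLp (Fin 2)).comp h1
  have e : (fun p : ℝ × ℝ => (!₂[p.1, p.2] : Plane)) =
      WithLp.toLp 2 ∘ ⇑(MeasurableEquiv.finTwoArrow (α := ℝ)).symm := by
    funext p
    ext j; fin_cases j <;> simp [MeasurableEquiv.finTwoArrow]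
  rw [e]
  exact h2

theorem measurePreserving_ch (a : Fin 3) : MeasurePreserving (ch a) volume volume := by
  have hz : MeasurePreserving (fun p : (ℝ × ℝ) × ℝ => ((!₂[p.1.1, p.1.2], p.2) : Pt))
      volume volume :=
    measurePreserving_plane.prod (MeasurePreserving.id volume)
  have assoc : MeasurePreserving (fun p : ℝ × (ℝ × ℝ) => (((p.1, p.2.1), p.2.2) : (ℝ × ℝ) × ℝ))
      volume volume := (volume_preserving_prodAssoc (α₁ := ℝ) (β₁ := ℝ) (γ₁ := ℝ)).symm
  have sw : MeasurePreserving (Prod.swap : ℝ × ℝ → ℝ × ℝ) volume volume :=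
    Measure.measurePreserving_swap
  have sw2 : MeasurePreserving (Prod.swap : ℝ × (ℝ × ℝ) → (ℝ × ℝ) × ℝ) volume volume :=
    Measure.measurePreserving_swap
  fin_cases a
  · exact hz.comp assoc
  · have sw' : MeasurePreserving (Prod.map Prod.swap id : (ℝ × ℝ) × ℝ → (ℝ × ℝ) × ℝ)
      volume volume := sw.prod (MeasurePreserving.id volume)
    exact (hz.comp sw').comp assoc
  · exact hz.comp sw2

theorem ch_add (a : Fin 3) (s t : ℝ) (q : ℝ × ℝ) : ch a (s + t, q) = ch a (s, q) + t • dir a := by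
  fin_cases a
  · refine Prod.ext ?_ ?_
    · ext j; fin_cases j <;> simp [ch, dir, eH]
    · simp [ch, dir, eH]
  · refine Prod.ext ?_ ?_
    · ext j; fin_cases j <;> simp [ch, dir, eH]
    · simp [ch, dir, eH]
  · refine Prod.ext ?_ ?_
    · ext j; fin_cases j <;> simp [ch, dir, eZ]
    · simp [ch, dir, eZ]

theorem measurableSet_M : MeasurableSet M := by
  have : M = ⋂ j : Fin 2, (fun x : Plane => x j) ⁻¹' Ioo 0 1 := by ext; simp [M]
  rw [this]
  exact MeasurableSet.iInter fun j => (by fun_prop : Measurable fun x : Plane => x j)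
    measurableSet_Ioo

theorem measurableSet_Om (h : ℝ) : MeasurableSet (Om h) := measurableSet_M.prod measurableSet_Ioo

theorem ch_preimage_Om (h : ℝ) (a : Fin 3) :
    ch a ⁻¹' Om h = Ioo (lo h a) (lo h a + per h a) ×ˢ cs h a := by
  have e : -h + 2 * h = h := by ring
  ext ⟨s, p, q⟩
  fin_cases a <;> simp [ch, Om, M, lo, per, cs, Fin.forall_fin_two, e] <;> tauto

theorem ae_periodic_ch {β : Type*} (a : Fin 3) {F : Pt → β} {L : ℝ}
    (hF : ∀ᵐ X : Pt, F (X + L • dir a) = F X) :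
    ∀ᵐ q : ℝ × ℝ, ∀ᵐ s : ℝ, F (ch a (s + L, q)) = F (ch a (s, q)) := by
  have h1 : ∀ᵐ p : ℝ × (ℝ × ℝ), F (ch a p + L • dir a) = F (ch a p) :=
    (measurePreserving_ch a).quasiMeasurePreserving.ae hF
  have h2 := ae_swap_of_prod (μ := (volume : Measure ℝ)) (ν := (volume : Measure (ℝ × ℝ))) h1
  filter_upwards [h2] with q hq
  filter_upwards [hq] with s hs
  rw [ch_add, hs]

/-- In the coordinates singling out the direction `a`, the measure on `Ω` is a product of the
measure on one period and the measure on the cross section. -/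
theorem mu_ch (h : ℝ) (a : Fin 3) : MeasurePreserving (ch a)
    ((volume.restrict (Ioo (lo h a) (lo h a + per h a))).prod (volume.restrict (cs h a)))
    (mu h) := by
  rw [Measure.prod_restrict, ← ch_preimage_Om]
  exact (measurePreserving_ch a).restrict_preimage (measurableSet_Om h)

theorem lintegral_ch (h : ℝ) (a : Fin 3) {F : Pt → ℝ≥0∞} (hF : AEMeasurable F (mu h)) :
    ∫⁻ X in Om h, F X = ∫⁻ q in cs h a, ∫⁻ s in Ioo (lo h a) (lo h a + per h a),
      F (ch a (s, q)) := by
  have hm := mu_ch h a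
  change ∫⁻ X, F X ∂(mu h) = _
  rw [← hm.map_eq, lintegral_map' (by rwa [hm.map_eq]) hm.aemeasurable, lintegral_prod_symm]
  exact hF.comp_quasiMeasurePreserving hm.quasiMeasurePreserving

/-- A measurable function on `ℝ³` which is periodic with respect to `Ω`. -/
def Per (h : ℝ) (f : Pt → ℝ) : Prop := AEStronglyMeasurable f volume ∧ Periodic h f

theorem Periodic.dir {F : Type*} {h : ℝ} {f : Pt → F} (hf : Periodic h f) (a : Fin 3) :
    ∀ᵐ X : Pt, f (X + per h a • PrimitiveEq.dir a) = f X := by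
  fin_cases a
  · simpa [per, PrimitiveEq.dir] using hf.1 0
  · simpa [per, PrimitiveEq.dir] using hf.1 1
  · simpa [per, PrimitiveEq.dir] using hf.2

theorem Periodic.mk' {F : Type*} {h : ℝ} {f : Pt → F}
    (hf : ∀ a, ∀ᵐ X : Pt, f (X + per h a • PrimitiveEq.dir a) = f X) : Periodic h f := by
  refine ⟨fun j => ?_, ?_⟩
  · fin_cases j
    · simpa [per, PrimitiveEq.dir] using hf 0
    · simpa [per, PrimitiveEq.dir] using hf 1
  · simpa [per, PrimitiveEq.dir] using hf 2

theorem Periodic.comp {F G : Type*} {h : ℝ} {f : Pt → F} (hf : Periodic h f) (u : F → G) :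
    Periodic h fun X => u (f X) :=
  ⟨fun j => (hf.1 j).mono fun _ hX => congrArg u hX, hf.2.mono fun _ hX => congrArg u hX⟩

theorem Periodic.comp₂ {F G H : Type*} {h : ℝ} {f : Pt → F} {g : Pt → G} (hf : Periodic h f)
    (hg : Periodic h g) (u : F → G → H) : Periodic h fun X => u (f X) (g X) :=
  ⟨fun j => by filter_upwards [hf.1 j, hg.1 j] with X h1 h2; rw [h1, h2],
    by filter_upwards [hf.2, hg.2] with X h1 h2; rw [h1, h2]⟩

theorem Periodic.congr {F : Type*} {h : ℝ} {f g : Pt → F} (hf : Periodic h f)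
    (e : f =ᵐ[volume] g) : Periodic h g := by
  refine Periodic.mk' fun a => ?_
  filter_upwards [hf.dir a, e, (measurePreserving_add_right volume
    (per h a • PrimitiveEq.dir a)).quasiMeasurePreserving.ae e] with X h1 h2 h3
  rw [← h3, h1, h2]

theorem Periodic.shift {F : Type*} {h : ℝ} {f : Pt → F} (hf : Periodic h f) (Y : Pt) :
    Periodic h fun X => f (X + Y) := by
  refine Periodic.mk' fun a => ?_
  filter_upwards [(measurePreserving_add_right volume Y).quasiMeasurePreserving.ae (hf.dir a)]
    with X hX
  rw [← hX]; congr 1; abel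

theorem Per.map {h : ℝ} {f : Pt → ℝ} (hf : Per h f) {u : ℝ → ℝ} (hu : Continuous u) :
    Per h fun X => u (f X) :=
  ⟨hu.comp_aestronglyMeasurable hf.1, hf.2.comp u⟩

theorem Per.add {h : ℝ} {f g : Pt → ℝ} (hf : Per h f) (hg : Per h g) :
    Per h fun X => f X + g X := ⟨hf.1.add hg.1, hf.2.comp₂ hg.2 (· + ·)⟩

theorem Per.sub {h : ℝ} {f g : Pt → ℝ} (hf : Per h f) (hg : Per h g) :
    Per h fun X => f X - g X := ⟨hf.1.sub hg.1, hf.2.comp₂ hg.2 (· - ·)⟩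

theorem Per.mul {h : ℝ} {f g : Pt → ℝ} (hf : Per h f) (hg : Per h g) :
    Per h fun X => f X * g X := ⟨hf.1.mul hg.1, hf.2.comp₂ hg.2 (· * ·)⟩

theorem Per.const (h c : ℝ) : Per h fun _ => c :=
  ⟨aestronglyMeasurable_const, Periodic.mk' fun _ => by simp⟩

theorem Per.shift {h : ℝ} {f : Pt → ℝ} (hf : Per h f) (Y : Pt) : Per h fun X => f (X + Y) :=
  ⟨hf.1.comp_quasiMeasurePreserving (measurePreserving_add_right volume Y).quasiMeasurePreserving,
    hf.2.shift Y⟩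

variable {h : ℝ}

theorem per_pos (hh : 0 < h) (a : Fin 3) : 0 < per h a := by
  fin_cases a <;> simp [per, hh]

theorem lintegral_shift_dir (hh : 0 < h) {F : Pt → ℝ≥0∞} (hF : AEMeasurable F volume)
    (hp : Periodic h F) (a : Fin 3) (t : ℝ) :
    ∫⁻ X in Om h, F (X + t • dir a) = ∫⁻ X in Om h, F X := by
  have hF' : AEMeasurable (fun X => F (X + t • dir a)) volume :=
    hF.comp_quasiMeasurePreserving
      (measurePreserving_add_right volume (t • dir a)).quasiMeasurePreserving
  rw [lintegral_ch h a hF.restrict, lintegral_ch h a hF'.restrict]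
  refine lintegral_congr_ae (ae_restrict_of_ae ?_)
  filter_upwards [ae_periodic_ch a (hp.dir a)] with q hq
  simp only [← ch_add]
  exact setLIntegral_translate (G := fun s => F (ch a (s, q))) (per_pos hh a) hq _ _ t

/-- Integrals of periodic functions over `Ω` are invariant under all translations of `ℝ³`. -/
theorem lintegral_shift (hh : 0 < h) {F : Pt → ℝ≥0∞} (hF : AEMeasurable F volume)
    (hp : Periodic h F) (Y : Pt) :
    ∫⁻ X in Om h, F (X + Y) = ∫⁻ X in Om h, F X := by
  have e : Y = (Y.1 0) • dir 0 + (Y.1 1) • dir 1 + Y.2 • dir 2 := by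
    refine Prod.ext ?_ ?_
    · ext j; fin_cases j <;> simp [dir, eH, eZ]
    · simp [dir, eH, eZ]
  have sm : ∀ Z : Pt, AEMeasurable (fun X => F (X + Z)) volume := fun Z =>
    hF.comp_quasiMeasurePreserving (measurePreserving_add_right volume Z).quasiMeasurePreserving
  rw [e]
  simp only [← add_assoc]
  have h1 := lintegral_shift_dir hh (sm ((Y.1 1) • dir 1 + Y.2 • dir 2)) (hp.shift _) 0 (Y.1 0)
  have h2 := lintegral_shift_dir hh (sm (Y.2 • dir 2)) (hp.shift _) 1 (Y.1 1)
  have h3 := lintegral_shift_dir hh hF hp 2 Y.2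
  simp only [← add_assoc] at h1 h2 h3
  rw [h1, h2, h3]

theorem ae_shift (hh : 0 < h) {f g : Pt → ℝ} (hf : Per h f) (hg : Per h g)
    (e : f =ᵐ[mu h] g) (Y : Pt) : ∀ᵐ X ∂mu h, f (X + Y) = g (X + Y) := by
  have hd := hf.sub hg
  have hm : AEMeasurable (fun X => ‖f X - g X‖ₑ) volume := hd.1.enorm
  have s := lintegral_shift hh hm (hd.2.comp fun x => ‖x‖ₑ) Y
  have z : ∫⁻ X in Om h, ‖f X - g X‖ₑ = 0 := by
    rw [lintegral_congr_ae (g := fun _ => 0)]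
    · simp
    · filter_upwards [e] with X hX; simp [hX]
  rw [z, lintegral_eq_zero_iff' ((hd.shift Y).1.enorm.restrict)] at s
  filter_upwards [s] with X hX
  simpa [sub_eq_zero] using hX

theorem integrable_shift (hh : 0 < h) {f : Pt → ℝ} (hf : Per h f) (hi : Integrable f (mu h))
    (Y : Pt) : Integrable (fun X => f (X + Y)) (mu h) := by
  refine ⟨(hf.shift Y).1.restrict, ?_⟩
  have := lintegral_shift hh hf.1.enorm (hf.2.comp fun x => ‖x‖ₑ) Y
  rw [HasFiniteIntegral, this]
  exact hi.2

theorem integral_shift (hh : 0 < h) {f : Pt → ℝ} (hf : Per h f) (hi : Integrable f (mu h))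
    (Y : Pt) : ∫ X in Om h, f (X + Y) = ∫ X in Om h, f X := by
  rw [integral_eq_lintegral_pos_part_sub_lintegral_neg_part hi,
    integral_eq_lintegral_pos_part_sub_lintegral_neg_part (integrable_shift hh hf hi Y)]
  rw [lintegral_shift hh (F := fun X => ENNReal.ofReal (f X)) hf.1.aemeasurable.ennreal_ofReal
    (hf.2.comp _) Y, lintegral_shift hh (F := fun X => ENNReal.ofReal (-f X))
    hf.1.aemeasurable.neg.ennreal_ofReal (hf.2.comp fun x => ENNReal.ofReal (-x)) Y]

end

/-! ### Directional derivatives of periodic functions -/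

section

variable {h : ℝ}

/-- The functions `f` and `g` are periodic and integrable on `Ω`, and `g` is the derivative of
`f` in the direction `a`: on almost every line in this direction, `f` is (almost everywhere) a
primitive of `g`. -/
structure PD (h : ℝ) (a : Fin 3) (f g : Pt → ℝ) : Prop where
  pf : Per h f
  pg : Per h g
  intf : Integrable f (mu h)
  intg : Integrable g (mu h)
  line : ∀ᵐ X ∂mu h, ∀ᵐ s ∂volume.restrict (Ioi (0 : ℝ)),
    f (X + s • dir a) = f X + ∫ r in (0 : ℝ)..s, g (X + r • dir a)

theorem ac_mu_prod (h : ℝ) (S : Set ℝ) : (mu h).prod (volume.restrict S) ≪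
    (volume : Measure Pt).prod (volume : Measure ℝ) :=
  Measure.AbsolutelyContinuous.prod Measure.restrict_le_self.absolutelyContinuous
    Measure.restrict_le_self.absolutelyContinuous

theorem Per.aestronglyMeasurable_shear {g : Pt → ℝ} (hg : Per h g) (d : Pt) (S : Set ℝ) :
    AEStronglyMeasurable (fun p : Pt × ℝ => g (p.1 + p.2 • d))
      ((mu h).prod (volume.restrict S)) :=
  (hg.1.comp_quasiMeasurePreserving (quasiMeasurePreserving_shear d)).mono_ac (ac_mu_prod h S)

theorem integrable_shear_mu (hh : 0 < h) {g : Pt → ℝ} (hg : Per h g) (hi : Integrable g (mu h))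
    (d : Pt) (s : ℝ) : Integrable (fun p : Pt × ℝ => g (p.1 + p.2 • d))
      ((mu h).prod (volume.restrict (Ioc 0 s))) := by
  have hm : AEStronglyMeasurable (fun p : Pt × ℝ => g (p.1 + p.2 • d))
      ((mu h).prod (volume.restrict (Ioc 0 s))) := hg.aestronglyMeasurable_shear d _
  refine (integrable_prod_iff' hm).2
    ⟨Eventually.of_forall fun r => integrable_shift hh hg hi (r • d), ?_⟩
  have e : ∀ r : ℝ, ∫ X, ‖g (X + r • d)‖ ∂mu h = ∫ X, ‖g X‖ ∂mu h := fun r =>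
    integral_shift hh (hg.map continuous_norm) hi.norm (r • d)
  exact (integrable_const (∫ X, ‖g X‖ ∂mu h)).congr (Eventually.of_forall fun r => (e r).symm)

theorem ae_intervalIntegrable (hh : 0 < h) {g : Pt → ℝ} (hg : Per h g)
    (hi : Integrable g (mu h)) (d : Pt) :
    ∀ᵐ X ∂mu h, ∀ s : ℝ, 0 ≤ s → IntervalIntegrable (fun r => g (X + r • d)) volume 0 s := by
  have : ∀ n : ℕ, ∀ᵐ X ∂mu h, Integrable (fun r => g (X + r • d))
      (volume.restrict (Ioc 0 (n : ℝ))) := fun n =>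
    (integrable_shear_mu hh hg hi d n).prod_right_ae
  filter_upwards [ae_all_iff.2 this] with X hX s hs
  obtain ⟨n, hn⟩ := exists_nat_ge s
  rw [intervalIntegrable_iff_integrableOn_Ioc_of_le hs]
  exact IntegrableOn.mono_set (hX n) (Ioc_subset_Ioc_right hn)

theorem nullMeasurableSet_line_mu {f g : Pt → ℝ} (hf : Per h f) (hg : Per h g) (d : Pt) :
    NullMeasurableSet {p : Pt × ℝ | f (p.1 + p.2 • d) = f p.1 + ∫ r in Ioc 0 p.2, g (p.1 + r • d)}
      ((mu h).prod (volume.restrict (Ioi 0))) :=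
  (nullMeasurableSet_line hf.1 hg.1 d).mono_ac (ac_mu_prod h _)

/-- It suffices to have the fundamental theorem of calculus for almost every point, at almost every
length of the segment. -/
theorem PD.of_ae {a : Fin 3} {f g : Pt → ℝ} (hf : Per h f) (hg : Per h g)
    (hfi : Integrable f (mu h)) (hgi : Integrable g (mu h))
    (H : ∀ᵐ s ∂volume.restrict (Ioi (0 : ℝ)), ∀ᵐ X ∂mu h,
      f (X + s • dir a) = f X + ∫ r in (0 : ℝ)..s, g (X + r • dir a)) : PD h a f g := by
  refine ⟨hf, hg, hfi, hgi, ?_⟩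
  have : ∀ᵐ s ∂volume.restrict (Ioi (0 : ℝ)), ∀ᵐ X ∂mu h,
      f (X + s • dir a) = f X + ∫ r in Ioc 0 s, g (X + r • dir a) := by
    filter_upwards [H, ae_restrict_mem measurableSet_Ioi] with s H' hs
    filter_upwards [H'] with X hX
    rw [hX, intervalIntegral.integral_of_le (le_of_lt hs)]
  have := Measure.ae_ae_of_ae_prod
    (ae_ae_swap (p := fun X s => f (X + s • dir a) = f X + ∫ r in Ioc 0 s, g (X + r • dir a))
      (nullMeasurableSet_line_mu hf hg (dir a)) this)
  filter_upwards [this] with X hX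
  filter_upwards [hX, ae_restrict_mem measurableSet_Ioi] with s hs hs0
  rw [hs, intervalIntegral.integral_of_le (le_of_lt hs0)]

theorem PD.line' {a : Fin 3} {f g : Pt → ℝ} (H : PD h a f g) :
    ∀ᵐ s ∂volume.restrict (Ioi (0 : ℝ)), ∀ᵐ X ∂mu h,
    f (X + s • dir a) = f X + ∫ r in (0 : ℝ)..s, g (X + r • dir a) := by
  have hn := nullMeasurableSet_line_mu H.pf H.pg (dir a)
  have h1 : ∀ᵐ X ∂mu h, ∀ᵐ s ∂volume.restrict (Ioi (0 : ℝ)),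
      f (X + s • dir a) = f X + ∫ r in Ioc 0 s, g (X + r • dir a) := by
    filter_upwards [H.line] with X hX
    filter_upwards [hX, ae_restrict_mem measurableSet_Ioi] with s hs hs0
    rw [hs, intervalIntegral.integral_of_le (le_of_lt hs0)]
  have hn2 : NullMeasurableSet {p : ℝ × Pt |
      f (p.2 + p.1 • dir a) = f p.2 + ∫ r in Ioc 0 p.1, g (p.2 + r • dir a)}
      ((volume.restrict (Ioi 0)).prod (mu h)) :=
    hn.preimage (Measure.measurePreserving_swap).quasiMeasurePreserving
  have := Measure.ae_ae_of_ae_prod (ae_ae_swap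
    (p := fun s X => f (X + s • dir a) = f X + ∫ r in Ioc 0 s, g (X + r • dir a)) hn2 h1)
  filter_upwards [this, ae_restrict_mem measurableSet_Ioi] with s hs hs0
  filter_upwards [hs] with X hX
  rw [hX, intervalIntegral.integral_of_le (le_of_lt hs0)]

/-- Weak derivatives of periodic functions are derivatives in the sense of `PD`. All later calculus
takes place on lines, where products and primitives are handled without mollification. -/
theorem PD.of_hasWeakDeriv {a : Fin 3} {f g : Pt → ℝ} (H : HasWeakDeriv univ (dir a) f g)
    (hf : Per h f) (hg : Per h g)
    (hfi : Integrable f (mu h)) (hgi : Integrable g (mu h)) : PD h a f g := by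
  refine PD.of_ae hf hg hfi hgi ?_
  filter_upwards [ae_restrict_mem measurableSet_Ioi] with s hs
  refine ae_restrict_of_ae ?_
  filter_upwards [H.line isOpen_univ (fun _ _ _ _ => mem_univ _) (le_of_lt hs)] with X hX
  have := hX (mem_univ _)
  linarith

theorem PD.congr (hh : 0 < h) {a : Fin 3} {f f' g g' : Pt → ℝ} (H : PD h a f g)
    (hf : Per h f') (hg : Per h g')
    (ef : f =ᵐ[mu h] f') (eg : g =ᵐ[mu h] g') : PD h a f' g' := by
  refine ⟨hf, hg, H.intf.congr ef, H.intg.congr eg, ?_⟩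
  have hf2 := H.pf.sub hf
  have hg2 := H.pg.sub hg
  have z : ∀ k : Pt → ℝ, Per h k → k =ᵐ[mu h] 0 →
      ∀ᵐ X ∂mu h, ∀ᵐ s ∂volume.restrict (Ioi (0 : ℝ)), k (X + s • dir a) = 0 := by
    intro k hk hk0
    have hm : NullMeasurableSet {p : Pt × ℝ | k (p.1 + p.2 • dir a) = 0}
        ((mu h).prod (volume.restrict (Ioi 0))) := by
      refine nullMeasurableSet_eq_fun ?_ aemeasurable_const
      exact (hk.aestronglyMeasurable_shear (dir a) _).aemeasurable
    refine Measure.ae_ae_of_ae_prod (ae_ae_swap (p := fun X s => k (X + s • dir a) = 0) hm ?_)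
    exact Eventually.of_forall fun s => ae_shift hh hk (Per.const h 0) hk0 _
  have zf := z _ hf2 (by filter_upwards [ef] with X hX; simp [hX])
  have zg := z _ hg2 (by filter_upwards [eg] with X hX; simp [hX])
  filter_upwards [H.line, zf, zg, ef] with X h1 h2 h3 h4
  filter_upwards [h1, h2, ae_restrict_mem measurableSet_Ioi] with s h5 h6 h7
  rw [← sub_eq_zero.1 h6, h5, h4]
  congr 1
  rw [intervalIntegral.integral_of_le (le_of_lt h7), intervalIntegral.integral_of_le (le_of_lt h7)]
  refine integral_congr_ae ?_
  have := ae_restrict_of_ae_restrict_of_subset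
    (Ioc_subset_Ioi_self : Ioc (0 : ℝ) s ⊆ Ioi 0) h3
  filter_upwards [this] with r hr
  exact sub_eq_zero.1 hr

theorem PD.add (hh : 0 < h) {a : Fin 3} {f₁ f₂ g₁ g₂ : Pt → ℝ} (H₁ : PD h a f₁ g₁)
    (H₂ : PD h a f₂ g₂) : PD h a (fun X => f₁ X + f₂ X) (fun X => g₁ X + g₂ X) := by
  refine ⟨H₁.pf.add H₂.pf, H₁.pg.add H₂.pg, H₁.intf.add H₂.intf, H₁.intg.add H₂.intg, ?_⟩
  filter_upwards [H₁.line, H₂.line, ae_intervalIntegrable hh H₁.pg H₁.intg (dir a),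
    ae_intervalIntegrable hh H₂.pg H₂.intg (dir a)] with X h1 h2 h3 h4
  filter_upwards [h1, h2, ae_restrict_mem measurableSet_Ioi] with s h5 h6 h7
  rw [h5, h6, intervalIntegral.integral_add (h3 s (le_of_lt h7)) (h4 s (le_of_lt h7))]
  ring

theorem PD.smul {a : Fin 3} {f g : Pt → ℝ} (c : ℝ) (H : PD h a f g) :
    PD h a (fun X => c * f X) (fun X => c * g X) := by
  refine ⟨(Per.const h c).mul H.pf, (Per.const h c).mul H.pg, H.intf.const_mul c,
    H.intg.const_mul c, ?_⟩
  filter_upwards [H.line] with X h1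
  filter_upwards [h1] with s h5
  rw [h5, intervalIntegral.integral_const_mul]
  ring

/-- The product rule; only integrability of the product and of its derivative is required. -/
theorem PD.mul (hh : 0 < h) {a : Fin 3} {f₁ f₂ g₁ g₂ : Pt → ℝ} (H₁ : PD h a f₁ g₁)
    (H₂ : PD h a f₂ g₂) (hi : Integrable (fun X => f₁ X * f₂ X) (mu h))
    (hi' : Integrable (fun X => g₁ X * f₂ X + f₁ X * g₂ X) (mu h)) :
    PD h a (fun X => f₁ X * f₂ X) (fun X => g₁ X * f₂ X + f₁ X * g₂ X) := by
  refine ⟨H₁.pf.mul H₂.pf, (H₁.pg.mul H₂.pf).add (H₁.pf.mul H₂.pg), hi, hi', ?_⟩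
  filter_upwards [H₁.line, H₂.line, ae_intervalIntegrable hh H₁.pg H₁.intg (dir a),
    ae_intervalIntegrable hh H₂.pg H₂.intg (dir a)] with X h1 h2 h3 h4
  filter_upwards [h1, h2, ae_restrict_mem measurableSet_Ioi] with s h5 h6 h7
  have h7' : 0 ≤ s := le_of_lt h7
  rw [h5, h6, mul_primitive _ _ (h3 s h7') (h4 s h7')]
  congr 1
  refine intervalIntegral.integral_congr_ae ?_
  rw [uIoc_of_le h7']
  have h1' := ae_imp_of_ae_restrict h1
  have h2' := ae_imp_of_ae_restrict h2
  filter_upwards [h1', h2'] with r h8 h9 hr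
  rw [h8 hr.1, h9 hr.1]

/-- The values of a periodic function on a line are periodic. -/
theorem ae_line_periodic {β : Type*} {F : Pt → β} (hF : Periodic h F) (a : Fin 3) :
    ∀ᵐ X : Pt, ∀ᵐ s : ℝ, F (X + (s + per h a) • dir a) = F (X + s • dir a) := by
  have := (quasiMeasurePreserving_shear (dir a)).ae (hF.dir a)
  have := Measure.ae_ae_of_ae_prod this
  filter_upwards [this] with X hX
  filter_upwards [hX] with s hs
  rw [← hs, add_smul, add_assoc]

/-- A function whose primitive vanishes almost everywhere vanishes almost everywhere. -/
theorem eq_zero_of_integral_eq_zero {G : ℝ → ℝ}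
    (hG : ∀ s : ℝ, 0 ≤ s → IntervalIntegrable G volume 0 s)
    (h0 : ∀ᵐ s ∂volume.restrict (Ioi (0 : ℝ)), ∫ r in (0 : ℝ)..s, G r = 0) :
    (∀ s : ℝ, 0 ≤ s → ∫ r in (0 : ℝ)..s, G r = 0) ∧
      ∀ᵐ s ∂volume.restrict (Ioi (0 : ℝ)), G s = 0 := by
  have hc : ContinuousOn (fun s => ∫ r in (0 : ℝ)..s, G r) (Ici 0) := by
    intro s hs
    have hs' : (0 : ℝ) ≤ s + 1 := by linarith [mem_Ici.1 hs]
    have := intervalIntegral.continuousOn_primitive_interval (μ := volume) (f := G) (a := 0)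
      (b := s + 1) (by
        rw [uIcc_of_le hs']
        exact (intervalIntegrable_iff_integrableOn_Icc_of_le hs').1 (hG _ hs'))
    rw [uIcc_of_le hs'] at this
    refine (this s ⟨hs, by linarith⟩).mono_of_mem_nhdsWithin ?_
    rw [mem_nhdsWithin]
    exact ⟨Iio (s + 1), isOpen_Iio, by simp, fun x hx => ⟨hx.2, le_of_lt hx.1⟩⟩
  have hz : ∀ s : ℝ, 0 ≤ s → ∫ r in (0 : ℝ)..s, G r = 0 := by
    have ho : ∀ s ∈ Ioi (0 : ℝ), ∫ r in (0 : ℝ)..s, G r = (fun _ => (0 : ℝ)) s := by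
      have := Measure.eqOn_open_of_ae_eq (μ := (volume : Measure ℝ)) (U := Ioi (0 : ℝ))
        (f := fun s => ∫ r in (0 : ℝ)..s, G r) (g := fun _ => 0) h0 isOpen_Ioi
        (hc.mono Ioi_subset_Ici_self) continuousOn_const
      exact this
    intro s hs
    rcases hs.eq_or_lt with rfl | hs
    · simp
    · exact ho s hs
  refine ⟨hz, ?_⟩
  have hd : ∀ n : ℕ, ∀ᵐ s, s ∈ Ioo (0 : ℝ) n → G s = 0 := by
    intro n
    filter_upwards [(hG n (Nat.cast_nonneg n)).ae_hasDerivAt_integral] with s hs hsn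
    have hm : s ∈ uIcc (0 : ℝ) n := by
      rw [uIcc_of_le (Nat.cast_nonneg n)]; exact ⟨hsn.1.le, hsn.2.le⟩
    have d := hs hm 0 (by simp)
    have d0 : HasDerivAt (fun x => ∫ r in (0 : ℝ)..x, G r) 0 s := by
      refine (hasDerivAt_const s (0 : ℝ)).congr_of_eventuallyEq ?_
      filter_upwards [Ioi_mem_nhds hsn.1] with x hx
      exact hz x (le_of_lt hx)
    exact d.unique d0
  rw [ae_restrict_iff' measurableSet_Ioi]
  filter_upwards [ae_all_iff.2 hd] with s hs hs0
  obtain ⟨n, hn⟩ := exists_nat_gt s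
  exact hs n ⟨hs0, hn⟩

theorem PD.line_integral_period (hh : 0 < h) {a : Fin 3} {f g : Pt → ℝ} (H : PD h a f g) :
    ∀ᵐ X ∂mu h, ∫ r in (0 : ℝ)..per h a, g (X + r • dir a) = 0 := by
  have L := per_pos hh a
  filter_upwards [H.line, ae_intervalIntegrable hh H.pg H.intg (dir a),
    ae_restrict_of_ae (ae_line_periodic H.pf.2 a),
    ae_restrict_of_ae (ae_line_periodic H.pg.2 a)] with X h1 h2 h3 h4
  set G : ℝ → ℝ := fun r => g (X + r • dir a) with hG
  have h5 : ∀ᵐ s ∂volume.restrict (Ioi (0 : ℝ)), ∫ r in (0 : ℝ)..(s + per h a), G r =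
      ∫ r in (0 : ℝ)..s, G r := by
    have h1' : ∀ᵐ s : ℝ, s ∈ Ioi (0 : ℝ) → _ := ae_imp_of_ae_restrict h1
    have h1s := (measurePreserving_add_right volume (per h a)).quasiMeasurePreserving.ae h1'
    filter_upwards [h1, ae_restrict_of_ae h3, ae_restrict_of_ae h1s,
      ae_restrict_mem measurableSet_Ioi] with s e1 e2 e3 e4
    have e5 := e3 (by simp only [mem_Ioi] at e4 ⊢; linarith)
    rw [e2, e1] at e5
    linarith
  have h6 : ∀ᵐ s ∂volume.restrict (Ioi (0 : ℝ)), ∫ r in (0 : ℝ)..per h a, G r = 0 := by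
    filter_upwards [h5, ae_restrict_mem measurableSet_Ioi] with s e1 e4
    simp only [mem_Ioi] at e4
    have i1 := h2 s e4.le
    have i2 := h2 (s + per h a) (by linarith)
    have i3 : IntervalIntegrable G volume s (s + per h a) := i1.symm.trans i2
    rw [← intervalIntegral.integral_add_adjacent_intervals i1 i3] at e1
    have e2 : ∫ r in s..(s + per h a), G r = 0 := by linarith
    rw [intervalIntegral.integral_of_le (by linarith), integral_Ioc_eq_integral_Ioo] at e2 ⊢
    have := setIntegral_translate (G := G) L h4 s 0 0
    simp only [add_zero, zero_add] at this
    rw [← this]; exact e2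
  have : (volume.restrict (Ioi (0 : ℝ))) ≠ 0 := by simp [Measure.restrict_eq_zero]
  have : NeBot (ae (volume.restrict (Ioi (0 : ℝ)))) := ae_neBot.2 this
  exact h6.exists.choose_spec

/-- The integral of a derivative over a period cell vanishes. -/
theorem PD.integral_eq_zero (hh : 0 < h) {a : Fin 3} {f g : Pt → ℝ} (H : PD h a f g) :
    ∫ X in Om h, g X = 0 := by
  have L := per_pos hh a
  have i := integrable_shear_mu hh H.pg H.intg (dir a) (per h a)
  have e := integral_integral_swap (f := fun X r => g (X + r • dir a)) i
  have z : ∫ X, (∫ r in Ioc 0 (per h a), g (X + r • dir a)) ∂mu h = 0 := by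
    rw [integral_congr_ae (g := fun _ => 0)]
    · simp
    · filter_upwards [H.line_integral_period hh] with X hX
      rwa [intervalIntegral.integral_of_le L.le] at hX
  rw [z] at e
  have e2 : ∀ r : ℝ, ∫ X, g (X + r • dir a) ∂mu h = ∫ X in Om h, g X := fun r =>
    integral_shift hh H.pg H.intg _
  simp only [e2, setIntegral_const, smul_eq_mul] at e
  rcases mul_eq_zero.1 e.symm with h0 | h0
  · simp at h0; linarith
  · exact h0

theorem PD.unique (hh : 0 < h) {a : Fin 3} {f g g' : Pt → ℝ} (H : PD h a f g)
    (H' : PD h a f g') : g =ᵐ[mu h] g' := by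
  have hp := H.pg.sub H'.pg
  have hi := H.intg.sub H'.intg
  have key : ∀ᵐ X ∂mu h, ∀ᵐ s ∂volume.restrict (Ioi (0 : ℝ)),
      (fun X => g X - g' X) (X + s • dir a) = 0 := by
    filter_upwards [H.line, H'.line, ae_intervalIntegrable hh H.pg H.intg (dir a),
      ae_intervalIntegrable hh H'.pg H'.intg (dir a)] with X h1 h2 h3 h4
    refine (eq_zero_of_integral_eq_zero (fun s hs => (h3 s hs).sub (h4 s hs)) ?_).2
    filter_upwards [h1, h2, ae_restrict_mem measurableSet_Ioi] with s e1 e2 e3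
    have e3' : 0 ≤ s := le_of_lt e3
    rw [intervalIntegral.integral_sub (h3 s e3') (h4 s e3')]
    linarith
  have hm : AEStronglyMeasurable (fun p : Pt × ℝ => (fun X => g X - g' X) (p.1 + p.2 • dir a))
      ((mu h).prod (volume.restrict (Ioi 0))) := hp.aestronglyMeasurable_shear (dir a) _
  have hn : NullMeasurableSet {p : ℝ × Pt | (fun X => g X - g' X) (p.2 + p.1 • dir a) = 0}
      ((volume.restrict (Ioi 0)).prod (mu h)) := by
    have : NullMeasurableSet {p : Pt × ℝ | (fun X => g X - g' X) (p.1 + p.2 • dir a) = 0}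
      ((mu h).prod (volume.restrict (Ioi 0))) :=
      nullMeasurableSet_eq_fun hm.aemeasurable aemeasurable_const
    exact this.preimage (Measure.measurePreserving_swap).quasiMeasurePreserving
  have key2 := Measure.ae_ae_of_ae_prod (ae_ae_swap
    (p := fun s X => (fun X => g X - g' X) (X + s • dir a) = 0) hn key)
  have : (volume.restrict (Ioi (0 : ℝ))) ≠ 0 := by simp [Measure.restrict_eq_zero]
  have : NeBot (ae (volume.restrict (Ioi (0 : ℝ)))) := ae_neBot.2 this
  obtain ⟨s, hs⟩ := key2.exists
  have := ae_shift hh (hp.shift (s • dir a)) (Per.const h 0) hs (-(s • dir a))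
  filter_upwards [this] with X hX
  simpa [sub_eq_zero] using hX

end

/-! ### Vertical integration -/

section

variable {h : ℝ}

theorem isOpen_M : IsOpen M := by
  have : M = ⋂ j : Fin 2, (fun x : Plane => x j) ⁻¹' Ioo 0 1 := by ext; simp [M]
  rw [this]
  exact isOpen_iInter_of_finite fun j => isOpen_Ioo.preimage (by fun_prop)

theorem M_nonempty : M.Nonempty :=
  ⟨!₂[1 / 2, 1 / 2], fun j => by fin_cases j <;> norm_num⟩

/-- A property that holds almost everywhere on all translates of an open set holds almost
everywhere. -/
theorem ae_of_ae_translates {P : Plane → Prop}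
    (H : ∀ y : Plane, ∀ᵐ x ∂volume.restrict M, P (x + y)) : ∀ᵐ x, P x := by
  obtain ⟨c, hc⟩ := M_nonempty
  rw [ae_iff]
  refine measure_null_of_locally_null _ fun x₀ _ => ?_
  refine ⟨{x | ¬ P x} ∩ {x | x - (x₀ - c) ∈ M}, ?_, ?_⟩
  · refine inter_mem self_mem_nhdsWithin (mem_nhdsWithin_of_mem_nhds ?_)
    refine (isOpen_M.preimage (by fun_prop : Continuous fun x : Plane => x - (x₀ - c))).mem_nhds ?_
    simpa using hc
  · have h1 := (ae_restrict_iff' measurableSet_M).1 (H (x₀ - c))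
    have h2 := (measurePreserving_sub_right volume (x₀ - c)).quasiMeasurePreserving.ae h1
    rw [ae_iff] at h2
    refine measure_mono_null ?_ h2
    rintro x ⟨hx1, hx2⟩
    simp only [mem_ofPred_eq, sub_add_cancel, Classical.not_imp] at hx1 hx2 ⊢
    exact ⟨hx2, hx1⟩

theorem mu_eq_prod (h : ℝ) : mu h = (volume.restrict M).prod (volume.restrict (Ioo (-h) h)) := by
  rw [Measure.prod_restrict]; rfl

theorem intervalIntegrable_of_ae_periodic {G : ℝ → ℝ} {L : ℝ} (hL : 0 < L)
    (hG : ∀ᵐ s, G (s + L) = G s) {c : ℝ} (hi : IntegrableOn G (Ioo c (c + L))) (a b : ℝ) :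
    IntervalIntegrable G volume a b := by
  have hae := ae_periodic_eq_toIocMod hL hG
  have hp : Function.Periodic (fun s => G (toIocMod hL 0 s)) L := fun s => by
    simp [toIocMod_add_right]
  have h1 : IntervalIntegrable (fun s => G (toIocMod hL 0 s)) volume c (c + L) := by
    rw [intervalIntegrable_iff_integrableOn_Ioo_of_le (by linarith)]
    exact hi.congr (ae_restrict_of_ae hae)
  exact (hp.intervalIntegrable hL.ne' h1 a b).congr_ae (ae_restrict_of_ae hae.symm)

theorem integral_period_of_ae_periodic {G : ℝ → ℝ} {L : ℝ} (hL : 0 < L)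
    (hG : ∀ᵐ s, G (s + L) = G s) (a b : ℝ) :
    ∫ s in a..(a + L), G s = ∫ s in b..(b + L), G s := by
  have := setIntegral_translate hL hG a b 0
  simp only [add_zero] at this
  rw [intervalIntegral.integral_of_le (by linarith), intervalIntegral.integral_of_le (by linarith),
    integral_Ioc_eq_integral_Ioo, integral_Ioc_eq_integral_Ioo, this]

theorem vertical_ae (hh : 0 < h) {f : Pt → ℝ} (hf : Per h f) (hi : Integrable f (mu h)) :
    ∀ᵐ x : Plane, (∀ a b : ℝ, IntervalIntegrable (fun ζ => f (x, ζ)) volume a b) ∧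
      ∀ c : ℝ, ∫ ζ in c..(c + 2 * h), f (x, ζ) = ∫ ζ in (-h)..h, f (x, ζ) := by
  have L : 0 < 2 * h := by linarith
  have e : -h + 2 * h = h := by ring
  have h1 : ∀ᵐ x : Plane, ∀ᵐ ζ : ℝ, f (x, ζ + 2 * h) = f (x, ζ) := by
    have := Measure.ae_ae_of_ae_prod (μ := (volume : Measure Plane)) (ν := (volume : Measure ℝ))
      hf.2.2
    simpa [eZ] using this
  have h2 : ∀ᵐ x : Plane, IntegrableOn (fun ζ => f (x, ζ)) (Ioo (-h) h) := by
    refine ae_of_ae_translates fun y => ?_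
    have := integrable_shift hh hf hi (y, 0)
    rw [mu_eq_prod] at this
    simpa [IntegrableOn] using this.prod_right_ae
  filter_upwards [h1, h2] with x h3 h4
  refine ⟨fun a b => intervalIntegrable_of_ae_periodic L h3 (c := -h) (by rwa [e]) a b,
    fun c => ?_⟩
  rw [integral_period_of_ae_periodic L h3 c (-h), e]

/-- Vertical integration up to a measurable height is measurable. -/
theorem aestronglyMeasurable_vertical {f : Pt → ℝ} (hf : AEStronglyMeasurable f volume)
    {b : Pt → ℝ} (hb : Measurable b) (c : ℝ) :
    AEStronglyMeasurable (fun X : Pt => ∫ ξ in c..b X, f (X.1, ξ)) volume := by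
  have q : Measure.QuasiMeasurePreserving (fun p : Pt × ℝ => ((p.1.1, p.2) : Pt))
      ((volume : Measure Pt).prod (volume : Measure ℝ)) volume := by
    refine ⟨by fun_prop, Measure.AbsolutelyContinuous.mk fun s hs h0 => ?_⟩
    have hm : Measurable fun p : Pt × ℝ => ((p.1.1, p.2) : Pt) := by fun_prop
    rw [Measure.map_apply hm hs, Measure.measure_prod_null (hm hs)]
    have q1 : Measure.QuasiMeasurePreserving (Prod.fst : Pt → Plane) volume volume :=
      Measure.quasiMeasurePreserving_fst
    exact q1.ae ((Measure.measure_prod_null hs).1 h0)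
  have m := hf.comp_quasiMeasurePreserving q
  have s1 : MeasurableSet {p : Pt × ℝ | p.2 ∈ Ioc c (b p.1)} := by
    have : {p : Pt × ℝ | p.2 ∈ Ioc c (b p.1)} = {p | c < p.2} ∩ {p | p.2 ≤ b p.1} := by ext; simp
    rw [this]
    exact (measurableSet_lt measurable_const (by fun_prop)).inter
      (measurableSet_le (by fun_prop) (by fun_prop))
  have s2 : MeasurableSet {p : Pt × ℝ | p.2 ∈ Ioc (b p.1) c} := by
    have : {p : Pt × ℝ | p.2 ∈ Ioc (b p.1) c} = {p | b p.1 < p.2} ∩ {p | p.2 ≤ c} := by ext; simp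
    rw [this]
    exact (measurableSet_lt (by fun_prop) (by fun_prop)).inter
      (measurableSet_le (by fun_prop) measurable_const)
  have m1 := (m.indicator s1).integral_prod_right'
  have m2 := (m.indicator s2).integral_prod_right'
  refine (m1.sub m2).congr (Eventually.of_forall fun X => ?_)
  simp only [intervalIntegral, Pi.sub_apply]
  rw [← integral_indicator measurableSet_Ioc, ← integral_indicator measurableSet_Ioc]
  congr 1

/-- Derivatives in a horizontal direction `d` commute with vertical integration. -/
theorem PD.line_vertical (hh : 0 < h) {a : Fin 3} (ha : (PrimitiveEq.dir a).2 = 0) {f g : Pt → ℝ}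
    (H : PD h a f g) {b : Pt → ℝ} (hb : ∀ X ∈ Om h, b X ∈ Icc (-h) h)
    (hbs : ∀ (X : Pt) (s : ℝ), b (X + s • PrimitiveEq.dir a) = b X) :
    ∀ᵐ s ∂volume.restrict (Ioi (0 : ℝ)), ∀ᵐ X ∂mu h,
      ∫ ξ in (-h)..b (X + s • PrimitiveEq.dir a), f ((X + s • PrimitiveEq.dir a).1, ξ) =
        (∫ ξ in (-h)..b X, f (X.1, ξ)) +
        ∫ r in (0 : ℝ)..s, ∫ ξ in (-h)..b (X + r • PrimitiveEq.dir a),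
          g ((X + r • PrimitiveEq.dir a).1, ξ) := by
  set d := PrimitiveEq.dir a with hd
  have hX : ∀ (x : Plane) (ζ s : ℝ), ((x, ζ) : Pt) + s • d = (x + s • d.1, ζ) := by
    intro x ζ s; refine Prod.ext ?_ ?_ <;> simp [ha]
  filter_upwards [H.line', ae_restrict_mem measurableSet_Ioi] with s hs hs0
  have hs0' : 0 ≤ s := le_of_lt hs0
  have i := integrable_shear_mu hh H.pg H.intg d s
  rw [mu_eq_prod] at hs i
  have h1 := Measure.ae_ae_of_ae_prod hs
  have h2 : ∀ᵐ x ∂volume.restrict M, Integrable (fun p : ℝ × ℝ => g (x + p.2 • d.1, p.1))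
      ((volume.restrict (Ioo (-h) h)).prod (volume.restrict (Ioc 0 s))) := by
    have j : Integrable (fun q : Plane × (ℝ × ℝ) => g ((q.1, q.2.1) + q.2.2 • d))
        ((volume.restrict M).prod ((volume.restrict (Ioo (-h) h)).prod
          (volume.restrict (Ioc 0 s)))) := by
      have mp := measurePreserving_prodAssoc (volume.restrict M) (volume.restrict (Ioo (-h) h))
        (volume.restrict (Ioc 0 s))
      exact (mp.integrable_comp_emb MeasurableEquiv.prodAssoc.measurableEmbedding).1 i
    filter_upwards [j.prod_right_ae] with x hx
    simpa only [hX] using hx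
  have h3 : ∀ᵐ x ∂volume.restrict M, Integrable (fun ζ => f (x, ζ)) (volume.restrict (Ioo (-h) h)) := by
    have := H.intf
    rw [mu_eq_prod] at this
    exact this.prod_right_ae
  have key : ∀ᵐ x ∂volume.restrict M, ∀ z ∈ Ioo (-h) h,
      ∫ ξ in (-h)..b ((x, z) + s • d), f (((x, z) + s • d : Pt).1, ξ) =
        (∫ ξ in (-h)..b (x, z), f (x, ξ)) +
        ∫ r in (0 : ℝ)..s, ∫ ξ in (-h)..b ((x, z) + r • d),
          g (((x, z) + r • d : Pt).1, ξ) := by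
    filter_upwards [h1, h2, h3, ae_restrict_mem measurableSet_M] with x e1 e2 e3 hx z hz
    simp only [hbs]
    simp only [hX]
    set β := b (x, z) with hβ
    have hβm : β ∈ Icc (-h) h := hb _ ⟨hx, hz⟩
    have sub : Ioo (-h) β ⊆ Ioo (-h) h := Ioo_subset_Ioo_right hβm.2
    have e2' : Integrable (fun p : ℝ × ℝ => g (x + p.2 • d.1, p.1))
        ((volume.restrict (Ioo (-h) β)).prod (volume.restrict (Ioc 0 s))) :=
      e2.mono_measure (Measure.prod_mono (Measure.restrict_mono sub le_rfl) le_rfl)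
    simp only [intervalIntegral.integral_of_le hβm.1, intervalIntegral.integral_of_le hs0',
      integral_Ioc_eq_integral_Ioo (x := -h)]
    rw [← integral_integral_swap e2', ← integral_add (IntegrableOn.mono_set e3 sub)
      e2'.integral_prod_left]
    refine integral_congr_ae ?_
    filter_upwards [ae_restrict_of_ae_restrict_of_subset sub e1] with ζ hζ
    simp only [← hd, hX] at hζ
    rw [hζ, intervalIntegral.integral_of_le hs0']
  rw [mu_eq_prod]
  have : ∀ᵐ p : Plane × ℝ ∂(volume.restrict M).prod (volume.restrict (Ioo (-h) h)),
      p.2 ∈ Ioo (-h) h :=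
    Measure.quasiMeasurePreserving_snd.ae (ae_restrict_mem measurableSet_Ioo)
  filter_upwards [Measure.quasiMeasurePreserving_fst.ae key, this] with p hp hp2
  exact hp p.2 hp2

/-- Vertical integral over the whole height. -/
def vtot (h : ℝ) (q : Pt → ℝ) (X : Pt) : ℝ := ∫ ξ in (-h)..h, q (X.1, ξ)

theorem Per.vtot {f : Pt → ℝ} (hf : Per h f) : Per h (vtot h f) := by
  refine ⟨aestronglyMeasurable_vertical hf.1 measurable_const _, fun j => ?_, ?_⟩
  · have := Measure.ae_ae_of_ae_prod (μ := (volume : Measure Plane)) (ν := (volume : Measure ℝ))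
      (hf.2.1 j)
    have q1 : Measure.QuasiMeasurePreserving (Prod.fst : Pt → Plane) volume volume :=
      Measure.quasiMeasurePreserving_fst
    filter_upwards [q1.ae this] with X hX
    simp only [PrimitiveEq.vtot]
    refine intervalIntegral.integral_congr_ae ?_
    filter_upwards [hX] with ζ hζ _
    simpa [eH] using hζ
  · exact Eventually.of_forall fun X => by simp [PrimitiveEq.vtot, eZ]

theorem Per.vint (hh : 0 < h) {f : Pt → ℝ} (hf : Per h f) (hi : Integrable f (mu h))
    (h0 : ∀ᵐ x : Plane, ∫ ξ in (-h)..h, f (x, ξ) = 0) : Per h (vint h f) := by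
  refine ⟨aestronglyMeasurable_vertical hf.1 measurable_snd _, fun j => ?_, ?_⟩
  all_goals
    have q1 : Measure.QuasiMeasurePreserving (Prod.fst : Pt → Plane) volume volume :=
      Measure.quasiMeasurePreserving_fst
  · have := Measure.ae_ae_of_ae_prod (μ := (volume : Measure Plane)) (ν := (volume : Measure ℝ))
      (hf.2.1 j)
    filter_upwards [q1.ae this] with X hX
    simp only [PrimitiveEq.vint]
    have e : (X + eH j).2 = X.2 := by simp [eH]
    rw [e]
    refine intervalIntegral.integral_congr_ae ?_
    filter_upwards [hX] with ζ hζ _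
    simpa [eH] using hζ
  · filter_upwards [q1.ae (vertical_ae hh hf hi), q1.ae h0] with X hX h1
    simp only [PrimitiveEq.vint]
    have e : (X + (2 * h) • eZ).2 = X.2 + 2 * h := by simp [eZ]
    have e1 : (X + (2 * h) • eZ).1 = X.1 := by simp [eZ]
    rw [e, e1, ← intervalIntegral.integral_add_adjacent_intervals (hX.1 (-h) X.2) (hX.1 _ _),
      hX.2, h1, add_zero]

end

/-! ### Square integrable periodic functions -/

section

variable {h : ℝ}

/-- The integral over a vertical period, as a function of the horizontal position. -/
def mz (h : ℝ) (F : Pt → ℝ≥0∞) (x : Plane) : ℝ≥0∞ := ∫⁻ z in Ioo (-h) h, F (x, z)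

theorem aemeasurable_mz {F : Pt → ℝ≥0∞} (hF : AEMeasurable F (mu h)) :
    AEMeasurable (mz h F) (volume.restrict M) := by
  rw [mu_eq_prod] at hF
  exact hF.lintegral_prod_right'

theorem lintegral_mz {F : Pt → ℝ≥0∞} (hF : AEMeasurable F (mu h)) :
    ∫⁻ X in Om h, F X = ∫⁻ x in M, mz h F x := by
  change ∫⁻ X, F X ∂mu h = _
  rw [mu_eq_prod] at hF ⊢
  exact lintegral_prod _ hF

theorem ae_fst_of_ae_M {P : Plane → Prop} (H : ∀ᵐ x ∂volume.restrict M, P x) :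
    ∀ᵐ X ∂mu h, P X.1 := by
  rw [mu_eq_prod]
  exact Measure.quasiMeasurePreserving_fst.ae H

theorem ae_aemeasurable_fiber {F : Pt → ℝ≥0∞} (hF : AEMeasurable F (mu h)) :
    ∀ᵐ x ∂volume.restrict M, AEMeasurable (fun z => F (x, z)) (volume.restrict (Ioo (-h) h)) := by
  rw [mu_eq_prod] at hF
  exact hF.aestronglyMeasurable.prodMk_left.mono fun x hx => hx.aemeasurable

theorem lintegral_mz_mul {F : Pt → ℝ≥0∞} (hF : AEMeasurable F (mu h)) {A : Plane → ℝ≥0∞}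
    (hA : AEMeasurable A (volume.restrict M)) :
    ∫⁻ X in Om h, A X.1 * F X = ∫⁻ x in M, A x * mz h F x := by
  have hA' : AEMeasurable (fun X : Pt => A X.1) (mu h) := by
    rw [mu_eq_prod]
    exact hA.comp_quasiMeasurePreserving Measure.quasiMeasurePreserving_fst
  have e := lintegral_mz (hA'.mul hF)
  simp only [Pi.mul_apply] at e
  rw [e]
  refine lintegral_congr_ae ?_
  filter_upwards [ae_aemeasurable_fiber hF] with x hx
  simp only [mz, Pi.mul_apply]
  rw [lintegral_const_mul'' _ hx]

theorem ennnorm_vint_le (X : Pt) (hX : X ∈ Om h) (f : Pt → ℝ) :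
    ‖vint h f X‖ₑ ≤ mz h (fun X => ‖f X‖ₑ) X.1 := by
  have hX2 : X.2 ∈ Ioo (-h) h := hX.2
  unfold vint mz
  rw [intervalIntegral.integral_of_le hX2.1.le]
  refine (enorm_integral_le_lintegral_enorm _).trans ?_
  rw [restrict_Ioo_eq_restrict_Ioc]
  exact lintegral_mono_set (Ioc_subset_Ioc_right hX2.2.le)

theorem ennnorm_vtot_le (hh : 0 < h) (X : Pt) (f : Pt → ℝ) :
    ‖vtot h f X‖ₑ ≤ mz h (fun X => ‖f X‖ₑ) X.1 := by
  unfold vtot mz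
  rw [intervalIntegral.integral_of_le (by linarith)]
  refine (enorm_integral_le_lintegral_enorm _).trans ?_
  rw [restrict_Ioo_eq_restrict_Ioc]

theorem lintegral_mz_fst (F : Pt → ℝ≥0∞) (hF : AEMeasurable F (mu h)) :
    ∫⁻ X in Om h, mz h F X.1 = ENNReal.ofReal (2 * h) * ∫⁻ X in Om h, F X := by
  have := lintegral_mz_mul (h := h) (F := fun _ => 1) aemeasurable_const (aemeasurable_mz hF)
  simp only [mul_one] at this
  rw [this, lintegral_mz hF]
  have e : ∀ x : Plane, mz h (fun _ => 1) x = ENNReal.ofReal (2 * h) := by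
    intro x; simp only [mz, lintegral_const, one_mul, Measure.restrict_apply_univ,
      Real.volume_Ioo]; congr 1; ring
  simp only [e]
  rw [lintegral_mul_const'' _ (aemeasurable_mz hF), mul_comm]

/-- A periodic function which is square integrable on `Ω`. -/
structure L2P (h : ℝ) (f : Pt → ℝ) : Prop where
  per : Per h f
  mem : MemLp f 2 (mu h)

theorem volume_Om_lt_top (h : ℝ) : volume (Om h) < ⊤ := by
  have e := mu_eq_prod h
  have hM : volume M < ⊤ := by
    have hs : M ⊆ Metric.closedBall (0 : Plane) 2 := by
      intro x hx
      rw [mem_closedBall_zero_iff, EuclideanSpace.norm_eq, Fin.sum_univ_two]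
      have h0 := hx 0
      have h1 := hx 1
      rw [Real.sqrt_le_left (by norm_num)]
      simp only [Real.norm_eq_abs, sq_abs]
      nlinarith [h0.1, h0.2, h1.1, h1.2]
    exact (measure_mono hs).trans_lt measure_closedBall_lt_top
  have : volume (Om h) = volume M * volume (Ioo (-h) h) := by
    rw [Measure.volume_eq_prod, Om, Measure.prod_prod]
  rw [this]
  exact ENNReal.mul_lt_top hM (by simp)

instance (h : ℝ) : IsFiniteMeasure (mu h) :=
  ⟨by rw [Measure.restrict_apply_univ]; exact volume_Om_lt_top h⟩

theorem normSq_lt_top_iff {f : Pt → ℝ} (hf : Per h f) : MemLp f 2 (mu h) ↔ normSq h f < ⊤ := by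
  have : eLpNorm f 2 (mu h) ^ 2 = normSq h f := by
    have := eLpNorm_nnreal_pow_eq_lintegral (f := f) (μ := mu h) (p := 2) (by norm_num)
    simp only [NNReal.coe_ofNat, ENNReal.coe_ofNat, ENNReal.rpow_ofNat] at this
    exact this
  rw [← this]
  constructor
  · intro H
    exact ENNReal.pow_lt_top H.2
  · intro H
    refine ⟨hf.1.restrict, ?_⟩
    by_contra hc
    rw [not_lt, top_le_iff] at hc
    simp [hc] at H

theorem L2P.normSq_lt_top {f : Pt → ℝ} (hf : L2P h f) : normSq h f < ⊤ :=
  (normSq_lt_top_iff hf.per).1 hf.mem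

theorem L2P.of_normSq {f : Pt → ℝ} (hf : Per h f) (H : normSq h f < ⊤) : L2P h f :=
  ⟨hf, (normSq_lt_top_iff hf).2 H⟩

theorem L2P.integrable {f : Pt → ℝ} (hf : L2P h f) : Integrable f (mu h) :=
  hf.mem.integrable (by norm_num)

theorem L2P.integrable_mul {f g : Pt → ℝ} (hf : L2P h f) (hg : L2P h g) :
    Integrable (fun X => f X * g X) (mu h) := MemLp.integrable_mul hf.mem hg.mem

theorem L2P.add {f g : Pt → ℝ} (hf : L2P h f) (hg : L2P h g) : L2P h fun X => f X + g X :=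
  ⟨hf.per.add hg.per, hf.mem.add hg.mem⟩

theorem L2P.sub {f g : Pt → ℝ} (hf : L2P h f) (hg : L2P h g) : L2P h fun X => f X - g X :=
  ⟨hf.per.sub hg.per, hf.mem.sub hg.mem⟩

theorem L2P.smul {f : Pt → ℝ} (c : ℝ) (hf : L2P h f) : L2P h fun X => c * f X :=
  ⟨(Per.const h c).mul hf.per, hf.mem.const_mul c⟩

theorem L2P.neg {f : Pt → ℝ} (hf : L2P h f) : L2P h fun X => -f X := by
  simpa using hf.smul (-1)

theorem L2P.zero (h : ℝ) : L2P h fun _ => 0 := ⟨Per.const h 0, MemLp.zero'⟩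

theorem L2P.bdd_mul {φ f : Pt → ℝ} (hf : L2P h f) (hφ : Per h φ) {C : ℝ} (hC : ∀ X, |φ X| ≤ C) :
    L2P h fun X => φ X * f X := by
  refine ⟨hφ.mul hf.per, ?_⟩
  refine MemLp.of_le_mul (c := C) hf.mem (hφ.mul hf.per).1.restrict (Eventually.of_forall fun X => ?_)
  rw [norm_mul]
  exact mul_le_mul_of_nonneg_right (hC X) (norm_nonneg _)

theorem L2P.congr {f g : Pt → ℝ} (hf : L2P h f) (hg : Per h g) (e : f =ᵐ[mu h] g) : L2P h g :=
  ⟨hg, hf.mem.ae_eq e⟩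

/-- `g` is the derivative of `f` in the direction `a`; both are periodic and square integrable. -/
structure D1 (h : ℝ) (a : Fin 3) (f g : Pt → ℝ) : Prop where
  f2 : L2P h f
  g2 : L2P h g
  pd : PD h a f g

theorem D1.congr (hh : 0 < h) {a : Fin 3} {f f' g g' : Pt → ℝ} (H : D1 h a f g)
    (hf : Per h f') (hg : Per h g')
    (ef : f =ᵐ[mu h] f') (eg : g =ᵐ[mu h] g') : D1 h a f' g' :=
  ⟨H.f2.congr hf ef, H.g2.congr hg eg, H.pd.congr hh hf hg ef eg⟩

theorem D1.add (hh : 0 < h) {a : Fin 3} {f₁ f₂ g₁ g₂ : Pt → ℝ} (H₁ : D1 h a f₁ g₁)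
    (H₂ : D1 h a f₂ g₂) : D1 h a (fun X => f₁ X + f₂ X) (fun X => g₁ X + g₂ X) :=
  ⟨H₁.f2.add H₂.f2, H₁.g2.add H₂.g2, H₁.pd.add hh H₂.pd⟩

theorem D1.smul {a : Fin 3} {f g : Pt → ℝ} (c : ℝ) (H : D1 h a f g) :
    D1 h a (fun X => c * f X) (fun X => c * g X) := ⟨H.f2.smul c, H.g2.smul c, H.pd.smul c⟩

theorem D1.mul (hh : 0 < h) {a : Fin 3} {f₁ f₂ g₁ g₂ : Pt → ℝ} (H₁ : D1 h a f₁ g₁)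
    (H₂ : D1 h a f₂ g₂) (h0 : L2P h fun X => f₁ X * f₂ X) (h1 : L2P h fun X => g₁ X * f₂ X)
    (h2 : L2P h fun X => f₁ X * g₂ X) :
    D1 h a (fun X => f₁ X * f₂ X) (fun X => g₁ X * f₂ X + f₁ X * g₂ X) :=
  ⟨h0, h1.add h2, H₁.pd.mul hh H₂.pd h0.integrable (h1.add h2).integrable⟩

/-- Products of square integrable functions with square integrable derivatives. -/
theorem D1.mul_pd (hh : 0 < h) {a : Fin 3} {f₁ f₂ g₁ g₂ : Pt → ℝ} (H₁ : D1 h a f₁ g₁)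
    (H₂ : D1 h a f₂ g₂) :
    PD h a (fun X => f₁ X * f₂ X) (fun X => g₁ X * f₂ X + f₁ X * g₂ X) :=
  H₁.pd.mul hh H₂.pd (H₁.f2.integrable_mul H₂.f2)
    ((H₁.g2.integrable_mul H₂.f2).add (H₁.f2.integrable_mul H₂.g2))

/-- Integration by parts on the torus. -/
theorem D1.ibp (hh : 0 < h) {a : Fin 3} {f₁ f₂ g₁ g₂ : Pt → ℝ} (H₁ : D1 h a f₁ g₁)
    (H₂ : D1 h a f₂ g₂) :
    ∫ X in Om h, g₁ X * f₂ X = - ∫ X in Om h, f₁ X * g₂ X := by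
  have := (H₁.mul_pd hh H₂).integral_eq_zero hh
  rw [integral_add (H₁.g2.integrable_mul H₂.f2) (H₁.f2.integrable_mul H₂.g2)] at this
  linarith

theorem ofReal_one_div_mul {L : ℝ} (hL : 0 < L) {A B C : ℝ≥0∞}
    (H : ENNReal.ofReal L * A ≤ B + ENNReal.ofReal L * C) :
    A ≤ ENNReal.ofReal (1 / L) * B + C := by
  have e : ENNReal.ofReal (1 / L) * ENNReal.ofReal L = 1 := by
    rw [← ENNReal.ofReal_mul (by positivity)]
    rw [one_div_mul_cancel hL.ne', ENNReal.ofReal_one]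
  calc A = ENNReal.ofReal (1 / L) * (ENNReal.ofReal L * A) := by rw [← mul_assoc, e, one_mul]
    _ ≤ ENNReal.ofReal (1 / L) * (B + ENNReal.ofReal L * C) := by gcongr
    _ = _ := by rw [mul_add, ← mul_assoc, e, one_mul]

/-- The one-dimensional Sobolev inequality on almost every line. -/
theorem PD.sup_line (hh : 0 < h) {a : Fin 3} {f g : Pt → ℝ} (H : PD h a f g) :
    ∀ᵐ X ∂mu h, ‖f X‖ₑ ≤ ENNReal.ofReal (1 / per h a) *
      (∫⁻ s in Ioo 0 (per h a), ‖f (X + s • PrimitiveEq.dir a)‖ₑ) +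
      ∫⁻ s in Ioo 0 (per h a), ‖g (X + s • PrimitiveEq.dir a)‖ₑ := by
  have L := per_pos hh a
  filter_upwards [H.line, ae_intervalIntegrable hh H.pg H.intg (PrimitiveEq.dir a),
    ae_intervalIntegrable hh H.pf H.intf (PrimitiveEq.dir a)] with X h1 h2 h3
  refine ofReal_one_div_mul L ?_
  set G := ∫⁻ s in Ioo 0 (per h a), ‖g (X + s • PrimitiveEq.dir a)‖ₑ with hG
  have h4 : ∀ᵐ s ∂volume.restrict (Ioo 0 (per h a)),
      ‖f X‖ₑ ≤ ‖f (X + s • PrimitiveEq.dir a)‖ₑ + G := by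
    have h1' := ae_restrict_of_ae_restrict_of_subset
      (Ioo_subset_Ioi_self : Ioo 0 (per h a) ⊆ Ioi 0) h1
    filter_upwards [h1', ae_restrict_mem measurableSet_Ioo] with s hs hs0
    have e : f X = f (X + s • PrimitiveEq.dir a) -
      ∫ r in (0 : ℝ)..s, g (X + r • PrimitiveEq.dir a) := by rw [hs]; ring
    rw [e]
    refine (enorm_sub_le).trans ?_
    gcongr
    rw [intervalIntegral.integral_of_le hs0.1.le]
    refine (enorm_integral_le_lintegral_enorm _).trans ?_
    rw [hG, ]
    refine lintegral_mono_set ?_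
    intro r hr
    exact ⟨hr.1, hr.2.trans_lt hs0.2⟩
  have h5 := lintegral_mono_ae h4
  have hm : AEMeasurable (fun s => ‖f (X + s • PrimitiveEq.dir a)‖ₑ)
      (volume.restrict (Ioo 0 (per h a))) := by
    have := (h3 (per h a) L.le).1.aestronglyMeasurable.enorm
    rwa [restrict_Ioo_eq_restrict_Ioc]
  rw [lintegral_add_left' hm] at h5
  simp only [lintegral_const, Measure.restrict_apply_univ, Real.volume_Ioo, sub_zero] at h5
  rwa [mul_comm _ (ENNReal.ofReal _), mul_comm _ (ENNReal.ofReal _)] at h5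

theorem ae_mz_eq (hh : 0 < h) {F : Pt → ℝ≥0∞} (hF : Periodic h F) :
    ∀ᵐ X ∂mu h, ∫⁻ s in Ioo 0 (per h 2), F (X + s • dir 2) = mz h F X.1 := by
  filter_upwards [ae_restrict_of_ae (ae_line_periodic hF 2)] with X h2
  have h3 := setLIntegral_translate (G := fun s => F (X + s • dir 2)) (per_pos hh 2) h2
    (-h) 0 (-X.2)
  have e : ∀ s : ℝ, X + (s + -X.2) • dir 2 = (X.1, s) := by
    intro s; refine Prod.ext ?_ ?_ <;> simp [dir, eZ]
  have L : -h + per h 2 = h := by simp [per]; ring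
  simp only [e, L, zero_add] at h3
  exact h3.symm

/-- A function is bounded on vertical lines by integrals of itself and its derivative. -/
theorem PD.sup_vertical (hh : 0 < h) {f g : Pt → ℝ} (H : PD h 2 f g) :
    ∀ᵐ X ∂mu h, ‖f X‖ₑ ≤ ENNReal.ofReal (1 / (2 * h)) * mz h (fun X => ‖f X‖ₑ) X.1 +
      mz h (fun X => ‖g X‖ₑ) X.1 := by
  filter_upwards [H.sup_line hh, ae_mz_eq hh (H.pf.2.comp fun x => ‖x‖ₑ),
    ae_mz_eq hh (H.pg.2.comp fun x => ‖x‖ₑ)] with X h1 h2 h3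
  rw [← h2, ← h3]
  exact h1

theorem enorm_mul_le_Lp {α : Type*} [MeasurableSpace α] {μ : Measure α} {A B : α → ℝ≥0∞}
    (hA : AEMeasurable A μ) (hB : AEMeasurable B μ) {a b : ℝ≥0∞}
    (ha : ∫⁻ x, A x ^ 2 ∂μ ≤ a ^ 2) (hb : ∫⁻ x, B x ^ 2 ∂μ ≤ b ^ 2) :
    ∫⁻ x, A x * B x ∂μ ≤ a * b := by
  have := ENNReal.lintegral_mul_le_Lp_mul_Lq μ (p := 2) (q := 2)
    (by constructor <;> norm_num) hA hB
  simp only [ENNReal.rpow_ofNat, Pi.mul_apply] at this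
  refine this.trans ?_
  have r : ∀ c : ℝ≥0∞, (c ^ 2) ^ (1 / 2 : ℝ) = c := by
    intro c
    rw [← ENNReal.rpow_ofNat, ← ENNReal.rpow_mul]; norm_num
  calc _ ≤ (a ^ 2) ^ (1 / 2 : ℝ) * (b ^ 2) ^ (1 / 2 : ℝ) := by gcongr
    _ = a * b := by rw [r, r]

end

/-! ### Anisotropic Sobolev inequalities -/

section

variable {h : ℝ}

theorem ae_line_eq (hh : 0 < h) {F : Pt → ℝ≥0∞} (hF : Periodic h F) :
    (∀ᵐ X ∂mu h, ∫⁻ s in Ioo 0 (per h 0), F (X + s • dir 0) =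
      ∫⁻ s in Ioo (0 : ℝ) 1, F (!₂[s, X.1 1], X.2)) ∧
    ∀ᵐ X ∂mu h, ∫⁻ s in Ioo 0 (per h 1), F (X + s • dir 1) =
      ∫⁻ s in Ioo (0 : ℝ) 1, F (!₂[X.1 0, s], X.2) := by
  constructor
  · filter_upwards [ae_restrict_of_ae (ae_line_periodic hF 0)] with X h2
    have h3 := setLIntegral_translate (G := fun s => F (X + s • dir 0)) (per_pos hh 0) h2
      0 0 (-(X.1 0))
    have e : ∀ s : ℝ, X + (s + -(X.1 0)) • dir 0 = (!₂[s, X.1 1], X.2) := by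
      intro s
      refine Prod.ext ?_ ?_
      · ext j; fin_cases j <;> simp [dir, eH]
      · simp [dir, eH]
    have L : (0 : ℝ) + per h 0 = 1 := by simp [per]
    simp only [e, L] at h3
    rw [h3]; simp [per]
  · filter_upwards [ae_restrict_of_ae (ae_line_periodic hF 1)] with X h2
    have h3 := setLIntegral_translate (G := fun s => F (X + s • dir 1)) (per_pos hh 1) h2
      0 0 (-(X.1 1))
    have e : ∀ s : ℝ, X + (s + -(X.1 1)) • dir 1 = (!₂[X.1 0, s], X.2) := by
      intro s
      refine Prod.ext ?_ ?_
      · ext j; fin_cases j <;> simp [dir, eH]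
      · simp [dir, eH]
    have L : (0 : ℝ) + per h 1 = 1 := by simp [per]
    simp only [e, L] at h3
    rw [h3]; simp [per]

/-- The two-dimensional Sobolev inequality `W^{1,1} ⊆ L²` for the vertical integral of `|Q|`. -/
theorem PD.sobolev (hh : 0 < h) {Q Q₀ Q₁ : Pt → ℝ} (H₀ : PD h 0 Q Q₀) (H₁ : PD h 1 Q Q₁) :
    ∫⁻ x in M, mz h (fun X => ‖Q X‖ₑ) x ^ 2 ≤
      ((∫⁻ X in Om h, ‖Q X‖ₑ) + ∫⁻ X in Om h, ‖Q₀ X‖ₑ) *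
      ((∫⁻ X in Om h, ‖Q X‖ₑ) + ∫⁻ X in Om h, ‖Q₁ X‖ₑ) := by
  have mF : ∀ k : Pt → ℝ, Per h k → AEMeasurable (fun X => ‖k X‖ₑ) (mu h) := fun k hk =>
    hk.1.enorm.restrict
  set F₀ : Pt → ℝ≥0∞ := fun X => ‖Q X‖ₑ + ‖Q₀ X‖ₑ with hF₀
  set F₁ : Pt → ℝ≥0∞ := fun X => ‖Q X‖ₑ + ‖Q₁ X‖ₑ with hF₁
  have m₀ : AEMeasurable F₀ (mu h) := (mF _ H₀.pf).add (mF _ H₀.pg)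
  have m₁ : AEMeasurable F₁ (mu h) := (mF _ H₁.pf).add (mF _ H₁.pg)
  have p₀ : Periodic h F₀ := H₀.pf.2.comp₂ H₀.pg.2 fun x y => ‖x‖ₑ + ‖y‖ₑ
  have p₁ : Periodic h F₁ := H₁.pf.2.comp₂ H₁.pg.2 fun x y => ‖x‖ₑ + ‖y‖ₑ
  set K₀ : ℝ × ℝ → ℝ≥0∞ := fun q => ∫⁻ s in Ioo (0 : ℝ) 1, F₀ (!₂[s, q.1], q.2) with hK₀
  set K₁ : ℝ × ℝ → ℝ≥0∞ := fun q => ∫⁻ s in Ioo (0 : ℝ) 1, F₁ (!₂[q.1, s], q.2) with hK₁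
  have mK₀ : AEMeasurable K₀ ((volume.restrict (Ioo 0 1)).prod (volume.restrict (Ioo (-h) h))) := by
    have := m₀.comp_quasiMeasurePreserving (mu_ch h 0).quasiMeasurePreserving
    have := this.prod_swap.lintegral_prod_right'
    rw [Measure.prod_restrict]
    simp only [lo, per, cs, ch, zero_add, Matrix.cons_val_zero] at this
    exact this
  have mK₁ : AEMeasurable K₁ ((volume.restrict (Ioo 0 1)).prod (volume.restrict (Ioo (-h) h))) := by
    have := m₁.comp_quasiMeasurePreserving (mu_ch h 1).quasiMeasurePreserving
    have := this.prod_swap.lintegral_prod_right'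
    rw [Measure.prod_restrict]
    simp only [lo, per, cs, ch, zero_add, Matrix.cons_val_one, Matrix.cons_val_zero] at this
    exact this
  set A : ℝ → ℝ≥0∞ := fun b => ∫⁻ z in Ioo (-h) h, K₀ (b, z) with hA
  set B : ℝ → ℝ≥0∞ := fun a => ∫⁻ z in Ioo (-h) h, K₁ (a, z) with hB
  have mA : AEMeasurable A (volume.restrict (Ioo 0 1)) := mK₀.lintegral_prod_right'
  have mB : AEMeasurable B (volume.restrict (Ioo 0 1)) := mK₁.lintegral_prod_right'
  have iA : ∫⁻ b in Ioo (0 : ℝ) 1, A b = ∫⁻ X in Om h, F₀ X := by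
    rw [lintegral_ch h 0 m₀]
    have := lintegral_prod _ mK₀
    rw [Measure.prod_restrict] at this
    rw [hA, ← this]
    simp [lo, per, cs, ch, hK₀]
    rfl
  have iB : ∫⁻ b in Ioo (0 : ℝ) 1, B b = ∫⁻ X in Om h, F₁ X := by
    rw [lintegral_ch h 1 m₁]
    have := lintegral_prod _ mK₁
    rw [Measure.prod_restrict] at this
    rw [hB, ← this]
    simp [lo, per, cs, ch, hK₁]
    rfl
  have b₀ : ∀ᵐ X ∂mu h, ‖Q X‖ₑ ≤ K₀ (X.1 1, X.2) := by
    filter_upwards [H₀.sup_line hh, (ae_line_eq hh (H₀.pf.2.comp fun x => ‖x‖ₑ)).1,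
      (ae_line_eq hh (H₀.pg.2.comp fun x => ‖x‖ₑ)).1, (ae_line_eq hh p₀).1,
      ae_intervalIntegrable hh H₀.pf H₀.intf (PrimitiveEq.dir 0)] with X h1 h2 h3 h4 h5
    rw [hK₀]
    simp only
    rw [← h4, hF₀]
    have hm : AEMeasurable (fun s => ‖Q (X + s • PrimitiveEq.dir 0)‖ₑ)
        (volume.restrict (Ioo 0 (per h 0))) := by
      have := (h5 (per h 0) (per_pos hh 0).le).1.aestronglyMeasurable.enorm
      rwa [restrict_Ioo_eq_restrict_Ioc]
    rw [lintegral_add_left' hm]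
    simpa [per] using h1
  have b₁ : ∀ᵐ X ∂mu h, ‖Q X‖ₑ ≤ K₁ (X.1 0, X.2) := by
    filter_upwards [H₁.sup_line hh, (ae_line_eq hh (H₁.pf.2.comp fun x => ‖x‖ₑ)).2,
      (ae_line_eq hh (H₁.pg.2.comp fun x => ‖x‖ₑ)).2, (ae_line_eq hh p₁).2,
      ae_intervalIntegrable hh H₁.pf H₁.intf (PrimitiveEq.dir 1)] with X h1 h2 h3 h4 h5
    rw [hK₁]
    simp only
    rw [← h4, hF₁]
    have hm : AEMeasurable (fun s => ‖Q (X + s • PrimitiveEq.dir 1)‖ₑ)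
        (volume.restrict (Ioo 0 (per h 1))) := by
      have := (h5 (per h 1) (per_pos hh 1).le).1.aestronglyMeasurable.enorm
      rwa [restrict_Ioo_eq_restrict_Ioc]
    rw [lintegral_add_left' hm]
    simpa [per] using h1
  rw [mu_eq_prod] at b₀ b₁
  have c : ∀ᵐ x ∂volume.restrict M, mz h (fun X => ‖Q X‖ₑ) x ^ 2 ≤ A (x 1) * B (x 0) := by
    filter_upwards [Measure.ae_ae_of_ae_prod b₀, Measure.ae_ae_of_ae_prod b₁] with x h0 h1
    rw [sq]
    exact mul_le_mul' (lintegral_mono_ae h0) (lintegral_mono_ae h1)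
  have mp : MeasurePreserving (fun p : ℝ × ℝ => (!₂[p.1, p.2] : Plane))
      ((volume.restrict (Ioo 0 1)).prod (volume.restrict (Ioo 0 1))) (volume.restrict M) := by
    have e : (fun p : ℝ × ℝ => (!₂[p.1, p.2] : Plane)) ⁻¹' M = Ioo 0 1 ×ˢ Ioo 0 1 := by
      ext p; simp [M, Fin.forall_fin_two]
    rw [Measure.prod_restrict, ← e]
    exact measurePreserving_plane.restrict_preimage measurableSet_M
  have mQ : AEMeasurable (fun x => mz h (fun X => ‖Q X‖ₑ) x ^ 2) (volume.restrict M) :=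
    (aemeasurable_mz (mF _ H₀.pf)).pow_const 2
  have c' := mp.quasiMeasurePreserving.ae c
  calc ∫⁻ x in M, mz h (fun X => ‖Q X‖ₑ) x ^ 2
      = ∫⁻ p, mz h (fun X => ‖Q X‖ₑ) !₂[p.1, p.2] ^ 2
          ∂((volume.restrict (Ioo (0 : ℝ) 1)).prod (volume.restrict (Ioo (0 : ℝ) 1))) := by
        rw [← mp.map_eq, lintegral_map' (by rwa [mp.map_eq]) mp.aemeasurable]
    _ ≤ ∫⁻ p : ℝ × ℝ, B p.1 * A p.2
          ∂((volume.restrict (Ioo (0 : ℝ) 1)).prod (volume.restrict (Ioo (0 : ℝ) 1))) := by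
        refine lintegral_mono_ae ?_
        filter_upwards [c'] with p hp
        rw [mul_comm]; simpa using hp
    _ = (∫⁻ b in Ioo (0 : ℝ) 1, B b) * ∫⁻ b in Ioo (0 : ℝ) 1, A b := lintegral_prod_mul mB mA
    _ = _ := by
        rw [iA, iB, hF₀, hF₁, lintegral_add_left' (mF _ H₀.pf), lintegral_add_left' (mF _ H₀.pf),
          mul_comm]

theorem enorm_mul_two_le (a b : ℝ) : ‖2 * (a * b)‖ₑ ≤ ‖a‖ₑ ^ 2 + ‖b‖ₑ ^ 2 := by
  have e : ∀ x : ℝ, ‖x‖ₑ ^ 2 = ENNReal.ofReal (x ^ 2) := by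
    intro x
    rw [Real.enorm_eq_ofReal_abs, ← ENNReal.ofReal_pow (abs_nonneg _), sq_abs]
  rw [e, e, ← ENNReal.ofReal_add (sq_nonneg _) (sq_nonneg _), Real.enorm_eq_ofReal_abs]
  refine ENNReal.ofReal_le_ofReal ?_
  rw [abs_le]
  constructor <;> nlinarith [sq_nonneg (a - b), sq_nonneg (a + b)]

theorem enorm_sq_eq (x : ℝ) : ‖x * x‖ₑ = ‖x‖ₑ ^ 2 := by rw [enorm_mul, sq]

/-- The square of a function in `L²` with a derivative in `L²`. -/
theorem D1.sq_pd (hh : 0 < h) {a : Fin 3} {f g : Pt → ℝ} (H : D1 h a f g) :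
    PD h a (fun X => f X * f X) (fun X => 2 * (f X * g X)) := by
  have := H.mul_pd hh H
  refine this.congr hh this.pf ?_ EventuallyEq.rfl ?_
  · have := (Per.const h 2).mul (H.f2.per.mul H.g2.per)
    exact this
  · exact Eventually.of_forall fun X => by simp only; ring

theorem normSq_eq_mz {f : Pt → ℝ} (hf : Per h f) :
    normSq h f = ∫⁻ x in M, mz h (fun X => ‖f X‖ₑ ^ 2) x :=
  lintegral_mz (hf.1.enorm.restrict.pow_const 2)

/-- The vertical integral of `|k|²` is square integrable if `k` has horizontal derivatives in `L²`. -/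
theorem lintegral_mz_sq_le (hh : 0 < h) {k k₀ k₁ : Pt → ℝ} (H₀ : D1 h 0 k k₀) (H₁ : D1 h 1 k k₁) :
    ∫⁻ x in M, mz h (fun X => ‖k X‖ₑ ^ 2) x ^ 2 ≤
      (2 * (normSq h k + normSq h k₀ + normSq h k₁)) ^ 2 := by
  have := (H₀.sq_pd hh).sobolev hh (H₁.sq_pd hh)
  simp only [enorm_sq_eq] at this
  refine this.trans ?_
  have mk : AEMeasurable (fun X => ‖k X‖ₑ ^ 2) (mu h) := H₀.f2.per.1.enorm.restrict.pow_const 2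
  have b : ∀ l : Pt → ℝ, ∫⁻ X in Om h, ‖2 * (k X * l X)‖ₑ ≤ normSq h k + normSq h l := by
    intro l
    calc _ ≤ ∫⁻ X in Om h, (‖k X‖ₑ ^ 2 + ‖l X‖ₑ ^ 2) :=
          lintegral_mono fun X => enorm_mul_two_le _ _
      _ = _ := lintegral_add_left' mk _
  change (normSq h k + _) * (normSq h k + _) ≤ _
  rw [sq]
  refine mul_le_mul' ?_ ?_
  · calc _ ≤ normSq h k + (normSq h k + normSq h k₀) := by gcongr; exact b k₀
      _ ≤ normSq h k + (normSq h k + normSq h k₀) + (normSq h k₀ + 2 * normSq h k₁) := le_self_add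
      _ = _ := by ring
  · calc _ ≤ normSq h k + (normSq h k + normSq h k₁) := by gcongr; exact b k₁
      _ ≤ normSq h k + (normSq h k + normSq h k₁) + (normSq h k₁ + 2 * normSq h k₀) := le_self_add
      _ = _ := by ring

/-- The constant of the vertical Sobolev inequality for squares. -/
def cz (h : ℝ) : ℝ≥0∞ := ENNReal.ofReal (1 / (2 * h)) + 1

/-- The vertical Sobolev inequality for `f²`, with `2 |f ∂_z f| ≤ |f|² + |∂_z f|²`. -/
theorem sup_sq (hh : 0 < h) {f fz : Pt → ℝ} (H : D1 h 2 f fz) :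
    ∀ᵐ X ∂mu h, ‖f X‖ₑ ^ 2 ≤ cz h * (mz h (fun X => ‖f X‖ₑ ^ 2) X.1 +
      mz h (fun X => ‖fz X‖ₑ ^ 2) X.1) := by
  have mf : AEMeasurable (fun X => ‖f X‖ₑ ^ 2) (mu h) := H.f2.per.1.enorm.restrict.pow_const 2
  filter_upwards [(H.sq_pd hh).sup_vertical hh, ae_fst_of_ae_M (ae_aemeasurable_fiber mf)] with X hX hm
  simp only [enorm_sq_eq] at hX
  refine hX.trans ?_
  have : mz h (fun X => ‖2 * (f X * fz X)‖ₑ) X.1 ≤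
      mz h (fun X => ‖f X‖ₑ ^ 2) X.1 + mz h (fun X => ‖fz X‖ₑ ^ 2) X.1 := by
    unfold mz
    rw [← lintegral_add_left' hm]
    exact lintegral_mono fun z => enorm_mul_two_le _ _
  rw [cz, add_mul, one_mul]
  gcongr
  exact le_self_add

/-- Products of a function which has a vertical derivative with one which has not. -/
theorem normSq_mul_le (hh : 0 < h) {f f₀ f₁ g g₀ g₁ k k₀ k₁ : Pt → ℝ}
    (Hz : D1 h 2 f g) (F₀ : D1 h 0 f f₀) (F₁ : D1 h 1 f f₁) (G₀ : D1 h 0 g g₀) (G₁ : D1 h 1 g g₁)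
    (K₀ : D1 h 0 k k₀) (K₁ : D1 h 1 k k₁) :
    normSq h (fun X => f X * k X) ≤ 4 * cz h *
      ((normSq h f + normSq h f₀ + normSq h f₁) + (normSq h g + normSq h g₀ + normSq h g₁)) *
      (normSq h k + normSq h k₀ + normSq h k₁) := by
  have mk : AEMeasurable (fun X => ‖k X‖ₑ ^ 2) (mu h) := K₀.f2.per.1.enorm.restrict.pow_const 2
  have mf : AEMeasurable (fun X => ‖f X‖ₑ ^ 2) (mu h) := F₀.f2.per.1.enorm.restrict.pow_const 2
  have mg : AEMeasurable (fun X => ‖g X‖ₑ ^ 2) (mu h) := G₀.f2.per.1.enorm.restrict.pow_const 2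
  have hc : cz h ≠ ⊤ := by simp [cz]
  set R : (Pt → ℝ) → Plane → ℝ≥0∞ := fun f => mz h (fun X => ‖f X‖ₑ ^ 2) with hR
  calc normSq h (fun X => f X * k X)
      ≤ ∫⁻ X in Om h, (cz h * (R f X.1 + R g X.1)) * ‖k X‖ₑ ^ 2 := by
        refine lintegral_mono_ae ?_
        filter_upwards [sup_sq hh Hz] with X hX
        rw [enorm_mul, mul_pow]
        gcongr
    _ = ∫⁻ x in M, (cz h * (R f x + R g x)) * R k x :=
        lintegral_mz_mul mk (((aemeasurable_mz mf).add (aemeasurable_mz mg)).const_mul _)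
    _ = cz h * ((∫⁻ x in M, R f x * R k x) + ∫⁻ x in M, R g x * R k x) := by
        have e := lintegral_add_left' ((aemeasurable_mz mf).mul (aemeasurable_mz mk))
          (fun x => R g x * R k x)
        simp only [Pi.mul_apply] at e
        rw [← e, ← lintegral_const_mul' _ _ hc]
        refine lintegral_congr fun x => ?_
        simp only [hR]
        ring
    _ ≤ cz h * ((2 * (normSq h f + normSq h f₀ + normSq h f₁)) *
          (2 * (normSq h k + normSq h k₀ + normSq h k₁)) +
          (2 * (normSq h g + normSq h g₀ + normSq h g₁)) *
          (2 * (normSq h k + normSq h k₀ + normSq h k₁))) := by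
        gcongr
        · exact enorm_mul_le_Lp (aemeasurable_mz mf) (aemeasurable_mz mk)
            (lintegral_mz_sq_le hh F₀ F₁) (lintegral_mz_sq_le hh K₀ K₁)
        · exact enorm_mul_le_Lp (aemeasurable_mz mg) (aemeasurable_mz mk)
            (lintegral_mz_sq_le hh G₀ G₁) (lintegral_mz_sq_le hh K₀ K₁)
    _ = _ := by ring

theorem L2P.mul (hh : 0 < h) {f f₀ f₁ g g₀ g₁ k k₀ k₁ : Pt → ℝ}
    (Hz : D1 h 2 f g) (F₀ : D1 h 0 f f₀) (F₁ : D1 h 1 f f₁) (G₀ : D1 h 0 g g₀) (G₁ : D1 h 1 g g₁)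
    (K₀ : D1 h 0 k k₀) (K₁ : D1 h 1 k k₁) : L2P h fun X => f X * k X := by
  refine L2P.of_normSq (F₀.f2.per.mul K₀.f2.per)
    ((normSq_mul_le hh Hz F₀ F₁ G₀ G₁ K₀ K₁).trans_lt ?_)
  have hc : cz h < ⊤ := by simp [cz]
  have := F₀.f2.normSq_lt_top
  have := F₀.g2.normSq_lt_top
  have := F₁.g2.normSq_lt_top
  have := G₀.f2.normSq_lt_top
  have := G₀.g2.normSq_lt_top
  have := G₁.g2.normSq_lt_top
  have := K₀.f2.normSq_lt_top
  have := K₀.g2.normSq_lt_top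
  have := K₁.g2.normSq_lt_top
  refine ENNReal.mul_lt_top (ENNReal.mul_lt_top (ENNReal.mul_lt_top (by simp) hc) ?_) ?_ <;>
  simp only [ENNReal.add_lt_top] <;> tauto

end

/-! ### Weak derivatives and Sobolev classes of periodic functions -/

section

section Weak

variable {E : Type*} [NormedAddCommGroup E] [NormedSpace ℝ E] [FiniteDimensional ℝ E]
  [MeasureSpace E] [BorelSpace E] [(volume : Measure E).IsAddHaarMeasure]
  {F : Type*} [NormedAddCommGroup F] [NormedSpace ℝ F]

theorem integrable_test_smul {U : Set E} {f : E → F} (hf : LocallyIntegrableOn f U) {φ : E → ℝ}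
    (φs : Continuous φ) (φc : HasCompactSupport φ) (φU : tsupport φ ⊆ U) :
    Integrable fun X => φ X • f X := by
  obtain ⟨C, hC⟩ := φs.bounded_above_of_compact_support φc
  have := (hf.integrableOn_compact_subset φU φc).bdd_smul (φ := φ) C
    φs.aestronglyMeasurable (Eventually.of_forall hC)
  rw [← integrableOn_univ]
  refine IntegrableOn.of_forall_sdiff_eq_zero this MeasurableSet.univ ?_
  intro x hx
  simp [image_eq_zero_of_notMem_tsupport hx.2]

theorem contDiff_fderiv_apply {φ : E → ℝ} (φs : ContDiff ℝ ∞ φ) (d : E) :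
    ContDiff ℝ ∞ fun X => fderiv ℝ φ X d :=
  (φs.fderiv_right (m := ∞) (by norm_cast)).clm_apply contDiff_const

theorem tsupport_fderiv_apply_subset {φ : E → ℝ} (d : E) :
    tsupport (fun X => fderiv ℝ φ X d) ⊆ tsupport φ := by
  refine closure_minimal (fun X hX => ?_) (isClosed_tsupport φ)
  by_contra hn
  have : X ∉ tsupport (fderiv ℝ φ) := fun h => hn (tsupport_fderiv_subset ℝ h)
  exact hX (by simp [image_eq_zero_of_notMem_tsupport this])

theorem HasWeakDeriv.comp_clm {U : Set E} {d : E} {f g : E → F} [CompleteSpace F]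
    (H : HasWeakDeriv U d f g)
    (ℓ : F →L[ℝ] ℝ) : HasWeakDeriv U d (fun X => ℓ (f X)) fun X => ℓ (g X) := by
  obtain ⟨hf, hg, hφ⟩ := H
  refine ⟨fun x hx => ?_, fun x hx => ?_, fun φ φs φc φU => ?_⟩
  · obtain ⟨s, hs, hi⟩ := hf x hx
    exact ⟨s, hs, ℓ.integrable_comp hi⟩
  · obtain ⟨s, hs, hi⟩ := hg x hx
    exact ⟨s, hs, ℓ.integrable_comp hi⟩
  · have e := congrArg ℓ (hφ φ φs φc φU)
    have i1 := integrable_test_smul hf (contDiff_fderiv_apply φs d).continuous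
      (φc.fderiv_apply (𝕜 := ℝ) d) ((tsupport_fderiv_apply_subset d).trans φU)
    have i2 := integrable_test_smul hg φs.continuous φc φU
    rw [map_neg, ← ℓ.integral_comp_comm i1, ← ℓ.integral_comp_comm i2] at e
    simpa using e

theorem HasWeakDeriv.unique [CompleteSpace F] {d : E} {f g g' : E → F}
    (H : HasWeakDeriv univ d f g) (H' : HasWeakDeriv univ d f g') : g =ᵐ[volume] g' := by
  refine ae_eq_of_integral_contDiff_smul_eq (locallyIntegrableOn_univ.1 H.2.1)
    (locallyIntegrableOn_univ.1 H'.2.1) fun φ φs φc => ?_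
  have a := H.2.2 φ φs φc (subset_univ _)
  rw [H'.2.2 φ φs φc (subset_univ _)] at a
  exact (neg_injective a).symm

theorem locallyIntegrable_congr {f f' : E → F} (hf : LocallyIntegrable f) (e : f =ᵐ[volume] f') :
    LocallyIntegrable f' := fun x => by
  obtain ⟨s, hs, hi⟩ := hf x
  exact ⟨s, hs, hi.congr (ae_restrict_of_ae e)⟩

theorem HasWeakDeriv.congr {d : E} {f f' g g' : E → F} (H : HasWeakDeriv univ d f g)
    (e : f =ᵐ[volume] f') (e' : g =ᵐ[volume] g') : HasWeakDeriv univ d f' g' := by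
  refine ⟨?_, ?_, fun φ φs φc φU => ?_⟩
  · exact locallyIntegrableOn_univ.2 (locallyIntegrable_congr (locallyIntegrableOn_univ.1 H.1) e)
  · exact locallyIntegrableOn_univ.2 (locallyIntegrable_congr (locallyIntegrableOn_univ.1 H.2.1) e')
  · have := H.2.2 φ φs φc φU
    have e1 : ∫ X, fderiv ℝ φ X d • f X = ∫ X, fderiv ℝ φ X d • f' X :=
      integral_congr_ae (by filter_upwards [e] with X hX; rw [hX])
    have e2 : ∫ X, φ X • g X = ∫ X, φ X • g' X :=
      integral_congr_ae (by filter_upwards [e'] with X hX; rw [hX])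
    rwa [e1, e2] at this

theorem HasWeakDeriv.shift {d : E} {f g : E → F} (H : HasWeakDeriv univ d f g) (Y : E) :
    HasWeakDeriv univ d (fun X => f (X + Y)) fun X => g (X + Y) := by
  have li : ∀ k : E → F, LocallyIntegrable k → LocallyIntegrable fun X => k (X + Y) := by
    intro k hk
    rw [locallyIntegrable_iff] at hk ⊢
    intro K hK
    have c : IsCompact ((fun X => X + Y) '' K) := hK.image (by fun_prop)
    have := hk _ c
    rw [(measurePreserving_add_right volume Y).integrableOn_image
      (MeasurableEquiv.addRight Y).measurableEmbedding] at this
    exact this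
  refine ⟨locallyIntegrableOn_univ.2 (li _ (locallyIntegrableOn_univ.1 H.1)),
    locallyIntegrableOn_univ.2 (li _ (locallyIntegrableOn_univ.1 H.2.1)), fun φ φs φc φU => ?_⟩
  have := H.2.2 (fun X => φ (X - Y)) (φs.comp (contDiff_id.sub contDiff_const))
      (φc.comp_homeomorph (Homeomorph.subRight Y)) (subset_univ _)
  simp only [fderiv_comp_sub] at this
  rw [← integral_add_right_eq_self (fun X => (fderiv ℝ φ (X - Y) d) • f X) Y,
    ← integral_add_right_eq_self (fun X => φ (X - Y) • g X) Y] at this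
  simpa using this

theorem wd_spec {d : E} {f : E → F} (H : ∃ g, HasWeakDeriv univ d f g) :
    HasWeakDeriv univ d f (wd d f) := by
  unfold wd
  rw [dif_pos H]
  exact H.choose_spec

theorem HasWeakDeriv.wd_eq [CompleteSpace F] {d : E} {f g : E → F}
    (H : HasWeakDeriv univ d f g) : wd d f =ᵐ[volume] g :=
  (wd_spec ⟨g, H⟩).unique H

/-- Weak derivatives commute. -/
theorem HasWeakDeriv.comm {a b : E} {f fa fb g : E → F} (Ha : HasWeakDeriv univ a f fa)
    (Hb : HasWeakDeriv univ b f fb) (Hab : HasWeakDeriv univ b fa g) :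
    HasWeakDeriv univ a fb g := by
  refine ⟨Hb.2.1, Hab.2.1, fun φ φs φc φU => ?_⟩
  have sa := contDiff_fderiv_apply φs a
  have sb := contDiff_fderiv_apply φs b
  have ca := φc.fderiv_apply (𝕜 := ℝ) a
  have cb := φc.fderiv_apply (𝕜 := ℝ) b
  have e1 := Hb.2.2 _ sa ca (subset_univ _)
  have e2 := Ha.2.2 _ sb cb (subset_univ _)
  have e3 := Hab.2.2 φ φs φc (subset_univ _)
  have sym : ∀ X, fderiv ℝ (fun X => fderiv ℝ φ X a) X b = fderiv ℝ (fun X => fderiv ℝ φ X b) X a := by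
    intro X
    have hd : DifferentiableAt ℝ (fderiv ℝ φ) X :=
      (φs.fderiv_right (m := ∞) (by norm_cast)).differentiable (by simp) X
    have s := (φs.contDiffAt (x := X)).isSymmSndFDerivAt
      (by simp only [minSmoothness_of_isRCLikeNormedField]; exact WithTop.coe_le_coe.2 le_top)
    rw [fderiv_clm_apply hd (by fun_prop), fderiv_clm_apply hd (by fun_prop)]
    simpa using s.eq b a
  simp only [sym] at e1
  rw [e2, e3] at e1
  rw [neg_neg] at e1
  rw [e1, neg_neg]

end Weak

variable {h : ℝ} {F : Type*} [NormedAddCommGroup F] [NormedSpace ℝ F]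

/-- Weak derivatives of periodic functions are periodic, by uniqueness. -/
theorem HasWeakDeriv.periodic [CompleteSpace F] {d : Pt} {f g : Pt → F}
    (H : HasWeakDeriv univ d f g) (hf : Periodic h f) : Periodic h g := by
  refine Periodic.mk' fun a => ?_
  exact ((H.shift _).congr (hf.dir a) EventuallyEq.rfl).unique H

theorem HasWeakDeriv.aesm {d : Pt} {f g : Pt → F}
    (H : HasWeakDeriv univ d f g) : AEStronglyMeasurable g volume :=
  (locallyIntegrableOn_univ.1 H.2.1).aestronglyMeasurable

theorem memH_succ {m : ℕ} {f : Pt → F} (H : MemH h (m + 1) f) (a : Fin 3) :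
    HasWeakDeriv univ (dir a) f (wd (dir a) f) ∧ MemH h m (wd (dir a) f) := by
  obtain ⟨_, hj, hz⟩ := H
  fin_cases a
  · exact ⟨wd_spec (hj 0).1, (hj 0).2⟩
  · exact ⟨wd_spec (hj 1).1, (hj 1).2⟩
  · exact ⟨wd_spec hz.1, hz.2⟩

theorem memH_memLp {m : ℕ} {f : Pt → F} (H : MemH h m f) : MemLp f 2 (mu h) := by
  cases m with
  | zero => exact H
  | succ m => exact H.1

theorem hNormSq_succ (m : ℕ) (f : Pt → F) :
    hNormSq h (m + 1) f = normSq h f + ∑ a, hNormSq h m (wd (dir a) f) := by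
  rw [Fin.sum_univ_three]
  simp only [hNormSq, Fin.sum_univ_two, dir]
  simp [add_assoc]

theorem normSq_le_hNormSq (m : ℕ) (f : Pt → F) : normSq h f ≤ hNormSq h m f := by
  cases m with
  | zero => exact le_rfl
  | succ m => rw [hNormSq_succ]; exact le_self_add

theorem hNormSq_wd_le (m : ℕ) (f : Pt → F) (a : Fin 3) :
    hNormSq h m (wd (dir a) f) ≤ hNormSq h (m + 1) f := by
  rw [hNormSq_succ]
  exact (Finset.single_le_sum (f := fun a => hNormSq h m (wd (dir a) f)) (fun _ _ => zero_le)
    (Finset.mem_univ a)).trans le_add_self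

/-- `f` and its first derivatives `Df` are periodic and square integrable. -/
def H1 (h : ℝ) (f : Pt → ℝ) (Df : Fin 3 → Pt → ℝ) : Prop := ∀ a, D1 h a f (Df a)

/-- `f` and its derivatives `Df`, `D2f` up to order two are periodic and square integrable. -/
def H2 (h : ℝ) (f : Pt → ℝ) (Df : Fin 3 → Pt → ℝ) (D2f : Fin 3 → Fin 3 → Pt → ℝ) : Prop :=
  H1 h f Df ∧ ∀ a, H1 h (Df a) (D2f a)

/-- `f` and its derivatives up to order three are periodic and square integrable. -/
def H3 (h : ℝ) (f : Pt → ℝ) (Df : Fin 3 → Pt → ℝ) (D2f : Fin 3 → Fin 3 → Pt → ℝ)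
    (D3f : Fin 3 → Fin 3 → Fin 3 → Pt → ℝ) : Prop :=
  H1 h f Df ∧ ∀ a, H2 h (Df a) (D2f a) (D3f a)

theorem H3.h2 {f Df D2f D3f} (H : H3 h f Df D2f D3f) : H2 h f Df D2f := ⟨H.1, fun a => (H.2 a).1⟩

theorem H1.l2 {f Df} (H : H1 h f Df) : L2P h f := (H 0).f2
theorem H1.l2' {f Df} (H : H1 h f Df) (a : Fin 3) : L2P h (Df a) := (H a).g2

theorem L2P.of_memLp {f : Pt → F} [CompleteSpace F] (hp : Periodic h f)
    (hm : AEStronglyMeasurable f volume)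
    (H : MemLp f 2 (mu h)) (ℓ : F →L[ℝ] ℝ) : L2P h fun X => ℓ (f X) :=
  ⟨⟨ℓ.continuous.comp_aestronglyMeasurable hm, hp.comp ℓ⟩, ℓ.comp_memLp' H⟩

theorem D1.of_hasWeakDeriv [CompleteSpace F] {f g : Pt → F} {a : Fin 3} (hp : Periodic h f)
    (H : HasWeakDeriv univ (PrimitiveEq.dir a) f g)
    (hf : MemLp f 2 (mu h)) (hg : MemLp g 2 (mu h)) (ℓ : F →L[ℝ] ℝ) :
    D1 h a (fun X => ℓ (f X)) fun X => ℓ (g X) := by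
  have h1 := L2P.of_memLp hp (locallyIntegrableOn_univ.1 H.1).aestronglyMeasurable hf ℓ
  have h2 := L2P.of_memLp (H.periodic hp) H.aesm hg ℓ
  exact ⟨h1, h2, PD.of_hasWeakDeriv (H.comp_clm ℓ) h1.per h2.per h1.integrable h2.integrable⟩

theorem MemH.h1 [CompleteSpace F] {f : Pt → F} (H : MemH h 1 f) (hp : Periodic h f)
    (ℓ : F →L[ℝ] ℝ) : H1 h (fun X => ℓ (f X)) fun a X => ℓ (wd (PrimitiveEq.dir a) f X) :=
  fun a => D1.of_hasWeakDeriv hp (memH_succ H a).1 (memH_memLp H) (memH_memLp (memH_succ H a).2) ℓ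

theorem MemH.mono {m : ℕ} : ∀ {f : Pt → F}, MemH h (m + 1) f → MemH h m f := by
  induction m with
  | zero => intro f H; exact H.1
  | succ m ih => intro f H; exact ⟨H.1, fun j => ⟨(H.2.1 j).1, ih (H.2.1 j).2⟩, H.2.2.1, ih H.2.2.2⟩

theorem MemH.wd_periodic [CompleteSpace F] {m : ℕ} {f : Pt → F} (H : MemH h (m + 1) f)
    (hp : Periodic h f) (a : Fin 3) : Periodic h (wd (PrimitiveEq.dir a) f) :=
  (memH_succ H a).1.periodic hp

theorem MemH.h2 [CompleteSpace F] {f : Pt → F} (H : MemH h 2 f) (hp : Periodic h f)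
    (ℓ : F →L[ℝ] ℝ) : H2 h (fun X => ℓ (f X)) (fun a X => ℓ (wd (PrimitiveEq.dir a) f X))
      fun a b X => ℓ (wd (PrimitiveEq.dir b) (wd (PrimitiveEq.dir a) f) X) :=
  ⟨H.mono.h1 hp ℓ, fun a => (memH_succ H a).2.h1 (H.wd_periodic hp a) ℓ⟩

theorem MemH.h3 [CompleteSpace F] {f : Pt → F} (H : MemH h 3 f) (hp : Periodic h f)
    (ℓ : F →L[ℝ] ℝ) : H3 h (fun X => ℓ (f X)) (fun a X => ℓ (wd (PrimitiveEq.dir a) f X))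
      (fun a b X => ℓ (wd (PrimitiveEq.dir b) (wd (PrimitiveEq.dir a) f) X))
      fun a b c X => ℓ (wd (PrimitiveEq.dir c) (wd (PrimitiveEq.dir b)
        (wd (PrimitiveEq.dir a) f)) X) :=
  ⟨H.mono.mono.h1 hp ℓ, fun a => (memH_succ H a).2.h2 (H.wd_periodic hp a) ℓ⟩

/-- Second weak derivatives are symmetric. -/
theorem MemH.symm [CompleteSpace F] {m : ℕ} {f : Pt → F} (H : MemH h (m + 2) f) (a b : Fin 3) :
    wd (PrimitiveEq.dir b) (wd (PrimitiveEq.dir a) f) =ᵐ[volume]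
      wd (PrimitiveEq.dir a) (wd (PrimitiveEq.dir b) f) := by
  have ha := memH_succ H a
  have hb := memH_succ H b
  have hab := (memH_succ ha.2 b).1
  exact ((ha.1.comm hb.1 hab).wd_eq).symm

theorem H2.mul_l2 (hh : 0 < h) {f Df D2f k Dk} (hf : H2 h f Df D2f) (hk : H1 h k Dk) :
    L2P h fun X => f X * k X :=
  L2P.mul hh (hf.1 2) (hf.1 0) (hf.1 1) (hf.2 2 0) (hf.2 2 1) (hk 0) (hk 1)

theorem L2P.mul_comm {f k : Pt → ℝ} (H : L2P h fun X => f X * k X) : L2P h fun X => k X * f X := by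
  simpa only [_root_.mul_comm] using H

theorem H2.mul (hh : 0 < h) {f Df D2f k Dk D2k} (hf : H2 h f Df D2f) (hk : H2 h k Dk D2k) :
    H1 h (fun X => f X * k X) fun a X => Df a X * k X + f X * Dk a X := fun a =>
  (hf.1 a).mul hh (hk.1 a) (hf.mul_l2 hh hk.1) (hk.mul_l2 hh (hf.2 a)).mul_comm
    (hf.mul_l2 hh (hk.2 a))

theorem H1.add (hh : 0 < h) {f Df g Dg} (hf : H1 h f Df) (hg : H1 h g Dg) :
    H1 h (fun X => f X + g X) fun a X => Df a X + Dg a X := fun a => (hf a).add hh (hg a)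

/-- The product of two functions in `H³` is in `H²`. -/
theorem H3.mul (hh : 0 < h) {f Df D2f D3f k Dk D2k D3k} (hf : H3 h f Df D2f D3f)
    (hk : H3 h k Dk D2k D3k) :
    H2 h (fun X => f X * k X) (fun a X => Df a X * k X + f X * Dk a X)
      fun a b X => (D2f a b X * k X + Df a X * Dk b X) + (Df b X * Dk a X + f X * D2k a b X) :=
  ⟨hf.h2.mul hh hk.h2, fun a => ((hf.2 a).mul hh hk.h2).add hh (hf.h2.mul hh (hk.2 a))⟩

end

/-! ### Vertical primitives and the surface pressure -/

section

variable {h : ℝ}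

/-- The Cauchy–Schwarz inequality on a vertical segment. -/
theorem mz_sq_le {f : Pt → ℝ} (hf : Per h f) : ∀ᵐ x ∂volume.restrict M,
    mz h (fun X => ‖f X‖ₑ) x ^ 2 ≤ ENNReal.ofReal (2 * h) * mz h (fun X => ‖f X‖ₑ ^ 2) x := by
  filter_upwards [ae_aemeasurable_fiber (h := h) hf.1.enorm.restrict] with x hx
  simp only [mz]
  have H := ENNReal.lintegral_mul_le_Lp_mul_Lq (volume.restrict (Ioo (-h) h))
    Real.HolderConjugate.two_two (f := fun _ => 1) (g := fun z => ‖f (x, z)‖ₑ)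
    aemeasurable_const hx
  simp only [Pi.mul_apply, one_mul, lintegral_const,
    Measure.restrict_apply_univ, Real.volume_Ioo, ENNReal.rpow_two] at H
  have e : (h - -h) = 2 * h := by ring
  rw [e] at H
  refine (pow_le_pow_left' H 2).trans (le_of_eq ?_)
  rw [mul_pow, ← ENNReal.rpow_mul_natCast, ← ENNReal.rpow_mul_natCast]
  norm_num

theorem aemeasurable_mz_fst {F : Pt → ℝ≥0∞} (hF : AEMeasurable F (mu h)) :
    AEMeasurable (fun X : Pt => mz h F X.1) (mu h) := by
  have := aemeasurable_mz hF
  rw [mu_eq_prod]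
  exact this.comp_quasiMeasurePreserving Measure.quasiMeasurePreserving_fst

/-- The vertical primitive is a bounded operation in `L²(Ω)`. -/
theorem normSq_vint_le {f : Pt → ℝ} (hf : Per h f) :
    normSq h (vint h f) ≤ ENNReal.ofReal (2 * h) * (ENNReal.ofReal (2 * h) * normSq h f) := by
  have m : AEMeasurable (fun X => ‖f X‖ₑ ^ 2) (mu h) := (hf.1.enorm.pow_const 2).restrict
  unfold normSq
  rw [← lintegral_mz_fst _ m, ← lintegral_const_mul'' _
    (aemeasurable_mz_fst m)]
  refine lintegral_mono_ae ?_
  filter_upwards [ae_fst_of_ae_M (h := h) (mz_sq_le hf), ae_restrict_mem (measurableSet_Om h)]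
    with X hX hX'
  exact (pow_le_pow_left' (ennnorm_vint_le X hX' f) 2).trans hX

/-- The vertical mean of `f` vanishes. -/
def VZ (h : ℝ) (f : Pt → ℝ) : Prop := ∀ᵐ x : Plane, ∫ ξ in (-h)..h, f (x, ξ) = 0

theorem L2P.vint (hh : 0 < h) {f : Pt → ℝ} (hf : L2P h f) (h0 : VZ h f) :
    L2P h (vint h f) :=
  L2P.of_normSq (hf.per.vint hh hf.integrable h0) ((normSq_vint_le hf.per).trans_lt
    (ENNReal.mul_lt_top ENNReal.ofReal_lt_top (ENNReal.mul_lt_top ENNReal.ofReal_lt_top hf.normSq_lt_top)))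

theorem vz_of_vtot {f : Pt → ℝ} (hh : 0 < h) (hf : Per h f) (H : vtot h f =ᵐ[mu h] fun _ => 0) :
    VZ h f := by
  refine ae_of_ae_translates fun y => ?_
  have h1 := ae_shift hh hf.vtot (Per.const h 0) H (y, 0)
  rw [mu_eq_prod] at h1
  have h2 := Measure.ae_ae_of_ae_prod h1
  filter_upwards [h2] with x hx
  have : NeBot (ae (volume.restrict (Ioo (-h) h))) := by
    rw [ae_restrict_neBot, Real.volume_Ioo]
    simp; linarith
  obtain ⟨z, hz⟩ := hx.exists
  simpa [vtot] using hz

theorem VZ.vtot {f : Pt → ℝ} (H : VZ h f) : vtot h f =ᵐ[volume] fun _ => 0 := by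
  have q1 : Measure.QuasiMeasurePreserving (Prod.fst : Pt → Plane) volume volume :=
    Measure.quasiMeasurePreserving_fst
  exact q1.ae H

theorem vint_congr_mu {f g : Pt → ℝ} (e : f =ᵐ[mu h] g) :
    (vtot h f =ᵐ[mu h] vtot h g) ∧ vint h f =ᵐ[mu h] vint h g := by
  have e' := e
  rw [mu_eq_prod] at e'
  have h2 := ae_fst_of_ae_M (h := h) (Measure.ae_ae_of_ae_prod e')
  refine ⟨?_, ?_⟩
  · filter_upwards [h2, ae_restrict_mem (measurableSet_Om h)] with X hX hX'
    have hX2 : X.2 ∈ Ioo (-h) h := hX'.2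
    refine intervalIntegral.integral_congr_ae ?_
    rw [← ae_restrict_iff' measurableSet_uIoc, uIoc_of_le (by linarith [hX2.1, hX2.2]),
      ← restrict_Ioo_eq_restrict_Ioc]
    exact hX
  · filter_upwards [h2, ae_restrict_mem (measurableSet_Om h)] with X hX hX'
    have hX2 : X.2 ∈ Ioo (-h) h := hX'.2
    refine intervalIntegral.integral_congr_ae ?_
    rw [← ae_restrict_iff' measurableSet_uIoc, uIoc_of_le hX2.1.le,
      ← restrict_Ioo_eq_restrict_Ioc]
    exact ae_restrict_of_ae_restrict_of_subset (Ioo_subset_Ioo_right hX2.2.le) hX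

theorem VZ.congr (hh : 0 < h) {f g : Pt → ℝ} (H : VZ h f) (hg : Per h g) (e : f =ᵐ[mu h] g) :
    VZ h g :=
  vz_of_vtot hh hg ((vint_congr_mu e).1.symm.trans (ae_restrict_of_ae H.vtot))

/-- An odd function has vanishing vertical mean. -/
theorem OddZ.vz {f : Pt → ℝ} (H : OddZ f) : VZ h f := by
  have := Measure.ae_ae_of_ae_prod (μ := (volume : Measure Plane)) (ν := (volume : Measure ℝ)) H
  filter_upwards [this] with x hx
  have e : ∫ ξ in (-h)..h, f (x, -ξ) = ∫ ξ in (-h)..h, f (x, ξ) := by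
    rw [intervalIntegral.integral_comp_neg (fun ξ => f (x, ξ))]; simp
  have e2 : ∫ ξ in (-h)..h, f (x, -ξ) = - ∫ ξ in (-h)..h, f (x, ξ) := by
    rw [← intervalIntegral.integral_neg]
    refine intervalIntegral.integral_congr_ae ?_
    filter_upwards [hx] with ξ hξ _ using hξ
  linarith

theorem integrable_vtot {f : Pt → ℝ} (hh : 0 < h) (hf : Per h f) (hi : Integrable f (mu h)) :
    Integrable (vtot h f) (mu h) := by
  refine ⟨hf.vtot.1.restrict, ?_⟩
  have := lintegral_mz_fst (h := h) (fun X => ‖f X‖ₑ) hf.1.enorm.restrict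
  refine (lintegral_mono (fun X => ennnorm_vtot_le hh X f)).trans_lt ?_
  rw [this]
  exact ENNReal.mul_lt_top ENNReal.ofReal_lt_top hi.2

theorem PD.vtot (hh : 0 < h) {a : Fin 3} (ha : (PrimitiveEq.dir a).2 = 0) {f g : Pt → ℝ}
    (H : PD h a f g) : PD h a (vtot h f) (vtot h g) := by
  refine PD.of_ae H.pf.vtot H.pg.vtot (integrable_vtot hh H.pf H.intf)
    (integrable_vtot hh H.pg H.intg) ?_
  have := H.line_vertical hh ha (b := fun _ => h) (fun _ _ => ⟨by linarith, le_rfl⟩)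
    (fun _ _ => rfl)
  exact this

/-- Horizontal derivatives preserve vanishing vertical means. -/
theorem PD.vz (hh : 0 < h) {a : Fin 3} (ha : (PrimitiveEq.dir a).2 = 0) {f g : Pt → ℝ}
    (H : PD h a f g) (h0 : VZ h f) : VZ h g := by
  refine vz_of_vtot hh H.pg ?_
  have z : PD h a (fun _ => 0) (fun _ => 0) := by
    have := H.smul 0
    simpa using this
  exact (H.vtot hh ha).unique hh (z.congr hh H.pf.vtot (Per.const h 0)
    (ae_restrict_of_ae h0.vtot.symm) EventuallyEq.rfl)

/-- Vertical primitives commute with horizontal derivatives. -/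
theorem D1.vint (hh : 0 < h) {a : Fin 3} (ha : (PrimitiveEq.dir a).2 = 0) {f g : Pt → ℝ}
    (H : D1 h a f g) (h0 : VZ h f) : D1 h a (vint h f) (vint h g) := by
  have f2 := H.f2.vint hh h0
  have g2 := H.g2.vint hh (H.pd.vz hh ha h0)
  refine ⟨f2, g2, PD.of_ae f2.per g2.per f2.integrable g2.integrable ?_⟩
  exact H.pd.line_vertical hh ha (b := fun X => X.2) (fun X hX => ⟨hX.2.1.le, hX.2.2.le⟩)
    (fun X s => by simp [ha])

/-- The vertical derivative of a vertical primitive. -/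
theorem D1.vint_vertical (hh : 0 < h) {f : Pt → ℝ} (hf : L2P h f) (h0 : VZ h f) :
    D1 h 2 (PrimitiveEq.vint h f) f := by
  have f2 := hf.vint hh h0
  refine ⟨f2, hf, PD.of_ae f2.per hf.per f2.integrable hf.integrable ?_⟩
  have q1 : Measure.QuasiMeasurePreserving (Prod.fst : Pt → Plane) volume volume :=
    Measure.quasiMeasurePreserving_fst
  refine Eventually.of_forall fun s => ?_
  refine ae_restrict_of_ae ?_
  filter_upwards [q1.ae (vertical_ae hh hf.per hf.integrable)] with X hX
  have e : ∀ r : ℝ, X + r • PrimitiveEq.dir 2 = (X.1, X.2 + r) := fun r => by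
    ext <;> simp [PrimitiveEq.dir, eZ]
  simp only [e, PrimitiveEq.vint]
  rw [intervalIntegral.integral_comp_add_left (fun ζ => f (X.1, ζ)), add_zero,
    intervalIntegral.integral_add_adjacent_intervals (hX.1 _ _) (hX.1 _ _)]

/-- A function independent of `z` is orthogonal to functions with vanishing vertical mean. -/
theorem integral_mul_eq_zero_of_vz (hh : 0 < h) {p g : Pt → ℝ} (hp : D1 h 2 p fun _ => 0)
    (hg : L2P h g) (h0 : VZ h g) : ∫ X in Om h, p X * g X = 0 := by
  have := hp.ibp hh (D1.vint_vertical hh hg h0)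
  simp only [zero_mul, integral_zero] at this
  linarith

/-- A horizontal gradient of a function independent of `z` is orthogonal to fields whose
horizontal divergence has vanishing vertical mean. -/
theorem integral_grad_mul_eq_zero (hh : 0 < h) {p p₀ p₁ F₀ F₁ g₀ g₁ : Pt → ℝ}
    (hp : D1 h 2 p fun _ => 0) (hp₀ : D1 h 0 p p₀) (hp₁ : D1 h 1 p p₁)
    (hF₀ : D1 h 0 F₀ g₀) (hF₁ : D1 h 1 F₁ g₁) (h0 : VZ h fun X => g₀ X + g₁ X) :
    ∫ X in Om h, (p₀ X * F₀ X + p₁ X * F₁ X) = 0 := by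
  rw [integral_add (hp₀.g2.integrable_mul hF₀.f2) (hp₁.g2.integrable_mul hF₁.f2),
    hp₀.ibp hh hF₀, hp₁.ibp hh hF₁, ← neg_add,
    ← integral_add (hp.f2.integrable_mul hF₀.g2) (hp.f2.integrable_mul hF₁.g2)]
  have := integral_mul_eq_zero_of_vz hh hp (hF₀.g2.add hF₁.g2) h0
  simp only [mul_add] at this
  rw [this, neg_zero]

theorem PD.shift (hh : 0 < h) {a : Fin 3} {f g : Pt → ℝ} (H : PD h a f g) (Y : Pt) :
    PD h a (fun X => f (X + Y)) fun X => g (X + Y) := by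
  refine PD.of_ae (H.pf.shift Y) (H.pg.shift Y) (integrable_shift hh H.pf H.intf Y)
    (integrable_shift hh H.pg H.intg Y) ?_
  have ms := (aestronglyMeasurable_line H.pg.1 (PrimitiveEq.dir a)).prod_swap.prodMk_left
  filter_upwards [H.line', ae_restrict_of_ae ms, ae_restrict_mem measurableSet_Ioi]
    with s hs ms hs0
  have hk : Per h fun X => ∫ r in (0:ℝ)..s, g (X + r • PrimitiveEq.dir a) := by
    simp only [intervalIntegral.integral_of_le (le_of_lt (mem_Ioi.1 hs0))]
    refine ⟨ms, Periodic.mk' fun b => ?_⟩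
    filter_upwards [Measure.ae_ae_of_ae_prod ((quasiMeasurePreserving_shear
      (PrimitiveEq.dir a)).ae (H.pg.2.dir b))] with X hX
    refine integral_congr_ae (ae_restrict_of_ae ?_)
    filter_upwards [hX] with r hr
    rw [← hr]
    congr 1
    abel
  filter_upwards [ae_shift hh (H.pf.shift _) (H.pf.add hk) hs Y] with X hX
  have e : ∀ r : ℝ, X + Y + r • PrimitiveEq.dir a = X + r • PrimitiveEq.dir a + Y := fun r => by
    abel
  simp only [e] at hX
  exact hX

theorem ofReal_two_mul_ne_zero (hh : 0 < h) : ENNReal.ofReal (2 * h) ≠ 0 := by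
  simp; linarith

theorem mz_const (c : ℝ≥0∞) (x : Plane) : mz h (fun _ => c) x = ENNReal.ofReal (2 * h) * c := by
  simp only [mz, lintegral_const, Measure.restrict_apply_univ, Real.volume_Ioo]
  rw [mul_comm]; congr 2; ring

theorem mz_of_fst (A : Plane → ℝ≥0∞) (x : Plane) :
    mz h (fun X => A X.1) x = ENNReal.ofReal (2 * h) * A x := mz_const (A x) x

/-- A function of the horizontal variables with an integrable horizontal gradient is square
integrable. -/
theorem L2P.of_fst (hh : 0 < h) {p : Plane → ℝ} {p₀ p₁ : Pt → ℝ}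
    (H₀ : PD h 0 (fun X => p X.1) p₀) (H₁ : PD h 1 (fun X => p X.1) p₁) :
    L2P h fun X => p X.1 := by
  refine L2P.of_normSq H₀.pf ?_
  have := H₀.sobolev hh H₁
  have e : ∀ x : Plane, mz h (fun X => ‖p X.1‖ₑ) x = ENNReal.ofReal (2 * h) * ‖p x‖ₑ :=
    fun x => mz_of_fst (fun x => ‖p x‖ₑ) x
  simp only [e] at this
  have e2 : normSq h (fun X => p X.1) =
      ∫⁻ x in M, ENNReal.ofReal (2 * h) * ‖p x‖ₑ ^ 2 := by
    rw [normSq_eq_mz H₀.pf]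
    exact lintegral_congr fun x => mz_of_fst (fun x => ‖p x‖ₑ ^ 2) x
  have fin := this.trans_lt (ENNReal.mul_lt_top (ENNReal.add_lt_top.2 ⟨H₀.intf.2, H₀.intg.2⟩)
    (ENNReal.add_lt_top.2 ⟨H₀.intf.2, H₁.intg.2⟩))
  rw [e2]
  have e3 : ∀ x : Plane, ENNReal.ofReal (2 * h) * ‖p x‖ₑ ^ 2 =
      (ENNReal.ofReal (2 * h))⁻¹ * (ENNReal.ofReal (2 * h) * ‖p x‖ₑ) ^ 2 := fun x => by
    rw [mul_pow, ← mul_assoc, sq (ENNReal.ofReal (2 * h)), ← mul_assoc,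
      ENNReal.inv_mul_cancel (ofReal_two_mul_ne_zero hh) ENNReal.ofReal_ne_top, one_mul]
  simp only [e3]
  rw [lintegral_const_mul' _ _ (ENNReal.inv_ne_top.2 (ofReal_two_mul_ne_zero hh))]
  exact ENNReal.mul_lt_top (ENNReal.inv_lt_top.2 (pos_iff_ne_zero.2 (ofReal_two_mul_ne_zero hh)))
    fin

/-- Horizontal derivatives of a function of the horizontal variables do not depend on `z`. -/
theorem PD.vertical_of_fst (hh : 0 < h) {a : Fin 3} {p : Plane → ℝ} {g : Pt → ℝ}
    (H : PD h a (fun X => p X.1) g) : PD h 2 g fun _ => 0 := by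
  refine PD.of_ae H.pg (Per.const h 0) H.intg (integrable_zero _ _ _) ?_
  refine Eventually.of_forall fun s => ?_
  have h1 := H.shift hh (s • PrimitiveEq.dir 2)
  have e : ∀ X : Pt, (X + s • PrimitiveEq.dir 2).1 = X.1 := fun X => by
    simp [PrimitiveEq.dir, eZ]
  simp only [e] at h1
  filter_upwards [h1.unique hh H] with X hX
  simpa using hX

theorem fst_vertical {p : Plane → ℝ} (H : L2P h fun X => p X.1) :
    D1 h 2 (fun X => p X.1) fun _ => 0 :=
  ⟨H, L2P.zero h, PD.of_ae H.per (Per.const h 0) H.integrable (integrable_zero _ _ _)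
    (Eventually.of_forall fun s => Eventually.of_forall fun X => by
      simp [PrimitiveEq.dir, eZ])⟩

theorem locallyIntegrable_integrable {f : Pt → ℝ} (hf : LocallyIntegrable f) :
    Integrable f (mu h) := by
  have hb : Bornology.IsBounded (Om h) := by
    refine Bornology.IsBounded.prod ?_ (Metric.isBounded_Ioo _ _)
    refine (Metric.isBounded_closedBall (x := (0 : Plane)) (r := 2)).subset ?_
    intro x hx
    rw [mem_closedBall_zero_iff, EuclideanSpace.norm_eq, Fin.sum_univ_two]
    have h0 := hx 0
    have h1 := hx 1
    rw [Real.sqrt_le_left (by norm_num)]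
    simp only [Real.norm_eq_abs, sq_abs]
    nlinarith [h0.1, h0.2, h1.1, h1.2]
  exact (hf.integrableOn_isCompact hb.isCompact_closure).mono_set subset_closure

/-- The pressure is the sum of a square integrable function of the horizontal variables, whose
gradient does not depend on `z`, and of `-∫_{-h}^z T`. -/
theorem AdmissiblePressure.decomp (hh : 0 < h) {p : Plane → ℝ} {T : Pt → ℝ}
    {Tg : Fin 2 → Pt → ℝ} (H : AdmissiblePressure h p T)
    (hT : ∀ j : Fin 2, D1 h j.castSucc T (Tg j)) (hz : VZ h T) :
    ∀ j : Fin 2, PD h j.castSucc (fun X => p X.1)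
      fun X => wd (eH j) (pressure h p T) X + PrimitiveEq.vint h (Tg j) X := by
  obtain ⟨hp, hper, hg⟩ := H
  intro j
  have d0 : (PrimitiveEq.dir j.castSucc).2 = 0 := by fin_cases j <;> simp [PrimitiveEq.dir, eH]
  have ed : PrimitiveEq.dir j.castSucc = eH j := by fin_cases j <;> simp [PrimitiveEq.dir]
  have hv := (hT j).vint hh d0 hz
  have w := wd_spec (hg j)
  have q1 : Measure.QuasiMeasurePreserving (Prod.fst : Pt → Plane) volume volume :=
    Measure.quasiMeasurePreserving_fst
  have pp : Periodic h fun X : Pt => p X.1 := by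
    refine ⟨fun i => ?_, Eventually.of_forall fun X => by simp [eZ]⟩
    exact q1.ae (hper i)
  have pper : Periodic h (pressure h p T) := pp.comp₂ hv.f2.per.2 (· - ·)
  have P1 : Per h (pressure h p T) := ⟨(locallyIntegrableOn_univ.1 w.1).aestronglyMeasurable, pper⟩
  have P2 : Per h (wd (eH j) (pressure h p T)) := ⟨w.aesm, w.periodic pper⟩
  rw [← ed] at w P2 ⊢
  have := (PD.of_hasWeakDeriv w P1 P2
    (locallyIntegrable_integrable (locallyIntegrableOn_univ.1 w.1))
    (locallyIntegrable_integrable (locallyIntegrableOn_univ.1 w.2.1))).add hh hv.pd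
  simpa [pressure] using this

end

/-! ### The equations at a fixed time -/

section

variable {h : ℝ}

theorem PD.sum (hh : 0 < h) {a : Fin 3} {f g : Fin 2 → Pt → ℝ} (H : ∀ i, PD h a (f i) (g i)) :
    PD h a (fun X => ∑ i, f i X) fun X => ∑ i, g i X := by
  simpa only [Fin.sum_univ_two] using (H 0).add hh (H 1)

theorem L2P.sum {f : Fin 2 → Pt → ℝ} (H : ∀ i, L2P h (f i)) : L2P h fun X => ∑ i, f i X := by
  simpa only [Fin.sum_univ_two] using (H 0).add (H 1)

theorem D1.sum (hh : 0 < h) {a : Fin 3} {f g : Fin 2 → Pt → ℝ} (H : ∀ i, D1 h a (f i) (g i)) :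
    D1 h a (fun X => ∑ i, f i X) fun X => ∑ i, g i X :=
  ⟨L2P.sum fun i => (H i).f2, L2P.sum fun i => (H i).g2, PD.sum hh fun i => (H i).pd⟩

theorem D1.neg {a : Fin 3} {f g : Pt → ℝ} (H : D1 h a f g) :
    D1 h a (fun X => -f X) fun X => -g X := by
  simpa using H.smul (-1)

theorem H2.sum (hh : 0 < h) {f : Fin 2 → Pt → ℝ} {Df : Fin 2 → Fin 3 → Pt → ℝ}
    {D2f : Fin 2 → Fin 3 → Fin 3 → Pt → ℝ}
    (H : ∀ i, H2 h (f i) (Df i) (D2f i)) : H2 h (fun X => ∑ i, f i X)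
      (fun a X => ∑ i, Df i a X) fun a b X => ∑ i, D2f i a b X :=
  ⟨fun a => D1.sum hh fun i => (H i).1 a, fun a b => D1.sum hh fun i => (H i).2 a b⟩

/-- `g` is integrable on `Ω` and has integral zero, as every derivative of a periodic function. -/
def NullInt (h : ℝ) (g : Pt → ℝ) : Prop := Integrable g (mu h) ∧ ∫ X in Om h, g X = 0

theorem PD.null (hh : 0 < h) {a : Fin 3} {f g : Pt → ℝ} (H : PD h a f g) : NullInt h g :=
  ⟨H.intg, H.integral_eq_zero hh⟩

theorem NullInt.add {f g : Pt → ℝ} (hf : NullInt h f) (hg : NullInt h g) :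
    NullInt h fun X => f X + g X :=
  ⟨hf.1.add hg.1, by rw [integral_add hf.1 hg.1, hf.2, hg.2, add_zero]⟩

theorem NullInt.smul {f : Pt → ℝ} (c : ℝ) (hf : NullInt h f) : NullInt h fun X => c * f X :=
  ⟨hf.1.const_mul c, by rw [integral_const_mul, hf.2, mul_zero]⟩

theorem NullInt.sum {f : Fin 2 → Pt → ℝ} (H : ∀ i, NullInt h (f i)) :
    NullInt h fun X => ∑ i, f i X := by
  simpa only [Fin.sum_univ_two] using (H 0).add (H 1)

/-- The velocity, the temperature and their spatial derivatives at a fixed time, in components,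
together with the time derivatives and the gradient of the surface pressure. -/
structure Fields where
  V : Fin 2 → Pt → ℝ
  V1 : Fin 2 → Fin 3 → Pt → ℝ
  V2 : Fin 2 → Fin 3 → Fin 3 → Pt → ℝ
  V3 : Fin 2 → Fin 3 → Fin 3 → Fin 3 → Pt → ℝ
  T : Pt → ℝ
  T1 : Fin 3 → Pt → ℝ
  T2 : Fin 3 → Fin 3 → Pt → ℝ
  Vt : Fin 2 → Pt → ℝ
  Tt : Pt → ℝ
  P : Fin 2 → Pt → ℝ

namespace Fields

variable (s : Fields)

/-- `|v|²`. -/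
def q (X : Pt) : ℝ := ∑ i, s.V i X * s.V i X

/-- The first derivatives of `|v|²`. -/
def q1 (a : Fin 3) (X : Pt) : ℝ := ∑ i, (s.V1 i a X * s.V i X + s.V i X * s.V1 i a X)

/-- The horizontal divergence. -/
def div (X : Pt) : ℝ := ∑ j : Fin 2, s.V1 j j.castSucc X

/-- Horizontal derivatives of the horizontal divergence. -/
def div1 (a : Fin 3) (X : Pt) : ℝ := ∑ j : Fin 2, s.V2 j j.castSucc a X

/-- Minus the vertical velocity. -/
def W (h : ℝ) : Pt → ℝ := vint h s.div

/-- `k × v`. -/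
def rot : Fin 2 → Pt → ℝ := ![fun X => -s.V 1 X, fun X => s.V 0 X]

/-- The horizontal gradient of the pressure. -/
def gradP (h : ℝ) (i : Fin 2) (X : Pt) : ℝ := s.P i X - vint h (s.T1 i.castSucc) X

end Fields

/-- The primitive equations at a fixed time. -/
structure Slice (h f₀ ε : ℝ) (s : Fields) : Prop where
  hV : ∀ i, H3 h (s.V i) (s.V1 i) (s.V2 i) (s.V3 i)
  sym : ∀ i a b, s.V2 i a b =ᵐ[mu h] s.V2 i b a
  sym' : ∀ i a b c, s.V3 i a b c =ᵐ[mu h] s.V3 i a c b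
  hT : H2 h s.T s.T1 s.T2
  vzT : VZ h s.T
  vzD : VZ h s.div
  hVt : ∀ i, MemLp (s.Vt i) 2 (mu h)
  hTt : MemLp s.Tt 2 (mu h)
  hP : ∃ p : Plane → ℝ, ∀ j : Fin 2, PD h j.castSucc (fun X => p X.1) (s.P j)
  mom : ∀ i, ∀ᵐ X ∂mu h, s.Vt i X + ∑ j, s.V j X * s.V1 i j.castSucc X - s.W h X * s.V1 i 2 X
    - ∑ j : Fin 2, s.V2 i j.castSucc j.castSucc X - ε * s.V2 i 2 2 X + f₀ * s.rot i X
    + s.gradP h i X = 0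
  temp : ∀ᵐ X ∂mu h, s.Tt X + ∑ j, s.V j X * s.T1 j.castSucc X - s.W h X * (s.T1 2 X + 1 / h)
    - ∑ j : Fin 2, s.T2 j.castSucc j.castSucc X - ε * s.T2 2 2 X = 0

/-- The directions `Fin.castSucc j` with `j : Fin 2` are the horizontal ones. -/
theorem dir_castSucc_snd (j : Fin 2) : (dir j.castSucc).2 = 0 := by
  fin_cases j <;> simp [dir, eH]

namespace Slice

variable {f₀ ε : ℝ} {s : Fields} (S : Slice h f₀ ε s) (hh : 0 < h)

include S in
theorem hV2 (i) : H2 h (s.V i) (s.V1 i) (s.V2 i) := (S.hV i).h2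

include S hh

theorem hq : ∃ D2, H2 h s.q s.q1 D2 := by
  exact ⟨_, H2.sum hh fun i => (S.hV i).mul hh (S.hV i)⟩

theorem hq1 : H1 h s.q s.q1 := (S.hq hh).choose_spec.1

theorem hqq : H1 h (fun X => s.q X * s.q X) fun a X => s.q1 a X * s.q X + s.q X * s.q1 a X := by
  obtain ⟨D2, H⟩ := S.hq hh
  exact H.mul hh H

theorem hqV (i : Fin 2) : H1 h (fun X => s.q X * s.V i X)
    fun a X => s.q1 a X * s.V i X + s.q X * s.V1 i a X := by
  obtain ⟨D2, H⟩ := S.hq hh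
  exact H.mul hh (S.hV2 i)

theorem hdiv : H1 h s.div s.div1 := fun a =>
  D1.sum hh fun j => (S.hV j).2 j.castSucc |>.1 a

theorem vzD1 (j : Fin 2) : VZ h (s.div1 j.castSucc) :=
  (S.hdiv hh j.castSucc).pd.vz hh (dir_castSucc_snd j) S.vzD

theorem hWz : D1 h 2 (s.W h) s.div := D1.vint_vertical hh (S.hdiv hh).l2 S.vzD

theorem hWj (j : Fin 2) : D1 h j.castSucc (s.W h) (vint h (s.div1 j.castSucc)) :=
  (S.hdiv hh j.castSucc).vint hh (dir_castSucc_snd j) S.vzD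

/-- The vertical velocity can be multiplied by functions in `H¹`. -/
theorem W_mul {k Dk} (hk : H1 h k Dk) : L2P h fun X => s.W h X * k X :=
  L2P.mul hh (S.hWz hh) (S.hWj hh 0) (S.hWj hh 1) (S.hdiv hh 0) (S.hdiv hh 1) (hk 0) (hk 1)

theorem hWV (i : Fin 2) : D1 h 2 (fun X => s.W h X * s.V i X)
    fun X => s.div X * s.V i X + s.W h X * s.V1 i 2 X :=
  (S.hWz hh).mul hh ((S.hV i).1 2) (S.W_mul hh (S.hV i).1)
    ((S.hV2 i).mul_l2 hh (S.hdiv hh)).mul_comm (S.W_mul hh ((S.hV2 i).2 2))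

theorem vzTj (j : Fin 2) : VZ h (s.T1 j.castSucc) :=
  (S.hT.1 j.castSucc).pd.vz hh (dir_castSucc_snd j) S.vzT

theorem hΘz : D1 h 2 (vint h s.T) s.T := D1.vint_vertical hh S.hT.1.l2 S.vzT

theorem hΘj (j : Fin 2) : D1 h j.castSucc (vint h s.T) (vint h (s.T1 j.castSucc)) :=
  (S.hT.1 j.castSucc).vint hh (dir_castSucc_snd j) S.vzT

theorem hΘjz (j : Fin 2) : D1 h 2 (vint h (s.T1 j.castSucc)) (s.T1 j.castSucc) :=
  D1.vint_vertical hh (S.hT.1 j.castSucc).g2 (S.vzTj hh j)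

theorem V_mul_l2 (i : Fin 2) {k Dk} (hk : H1 h k Dk) : L2P h fun X => s.V i X * k X :=
  (S.hV2 i).mul_l2 hh hk

theorem rot_l2 (i : Fin 2) : L2P h (s.rot i) := by
  fin_cases i
  · exact (S.hV 1).1.l2.neg
  · exact (S.hV 0).1.l2

theorem gradP_l2 (i : Fin 2) : L2P h (s.gradP h i) := by
  obtain ⟨p, hp⟩ := S.hP
  have per : Per h (s.gradP h i) := (hp i).pg.sub (S.hΘjz hh i).f2.per
  have hz := (S.hV i).1.l2
  have l := (((L2P.sum fun j => S.V_mul_l2 hh j ((S.hV i).2 j.castSucc).1).sub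
    (S.W_mul hh ((S.hV i).2 2).1)).sub (L2P.sum fun j : Fin 2 =>
      ((S.hV i).2 j.castSucc).1.l2' j.castSucc)).sub
    ((((S.hV i).2 2).1.l2' 2).smul ε) |>.add ((S.rot_l2 hh i).smul f₀)
  refine ⟨per, ((S.hVt i).add l.mem).neg.ae_eq ?_⟩
  filter_upwards [S.mom i] with X hX
  simp only [Pi.neg_apply, Pi.add_apply]
  linarith

theorem P_l2 (i : Fin 2) : L2P h (s.P i) := by
  have := (S.gradP_l2 hh i).add (S.hΘjz hh i).f2
  simpa [Fields.gradP] using this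

theorem pressure_exists : ∃ p : Plane → ℝ, D1 h 2 (fun X => p X.1) (fun _ => 0) ∧
    D1 h 0 (fun X => p X.1) (s.P 0) ∧ D1 h 1 (fun X => p X.1) (s.P 1) := by
  obtain ⟨p, hp⟩ := S.hP
  have l2 := L2P.of_fst hh (hp 0) (hp 1)
  exact ⟨p, fst_vertical l2, ⟨l2, S.P_l2 hh 0, hp 0⟩, ⟨l2, S.P_l2 hh 1, hp 1⟩⟩

theorem hPz (i : Fin 2) : D1 h 2 (s.P i) fun _ => 0 := by
  obtain ⟨p, hp⟩ := S.hP
  exact ⟨S.P_l2 hh i, L2P.zero h, (hp i).vertical_of_fst hh⟩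

theorem hgradPz (i : Fin 2) : D1 h 2 (s.gradP h i) fun X => -s.T1 i.castSucc X := by
  have e : s.gradP h i = fun X => s.P i X + -vint h (s.T1 i.castSucc) X := by
    funext X; simp [Fields.gradP, sub_eq_add_neg]
  rw [e]
  have := (S.hPz hh i).add hh (S.hΘjz hh i).neg
  simpa using this

theorem hqV1 (i : Fin 2) (a : Fin 3) : L2P h fun X => s.q X * s.V1 i a X := by
  obtain ⟨D2, H⟩ := S.hq hh
  exact H.mul_l2 hh ((S.hV i).2 a).1

theorem integrable_qVVt (i : Fin 2) : Integrable (fun X => s.q X * s.V i X * s.Vt i X) (mu h) :=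
  (S.hqV hh i).l2.mem.integrable_mul (S.hVt i)

theorem integrable_qV1V1 (i : Fin 2) (a : Fin 3) :
    Integrable (fun X => s.q X * (s.V1 i a X * s.V1 i a X)) (mu h) := by
  simpa only [mul_assoc] using (S.hqV1 hh i a).integrable_mul ((S.hV i).2 a).1.l2

theorem integrable_gradP_qV (i : Fin 2) :
    Integrable (fun X => s.gradP h i X * (s.q X * s.V i X)) (mu h) :=
  (S.gradP_l2 hh i).integrable_mul (S.hqV hh i).l2

/-- The balance of `∫ |v|⁴`. -/
theorem energy_four (hε : 0 < ε) :
    ∫ X in Om h, ((∑ i, s.q X * s.V i X * s.Vt i X) +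
      (∑ i, ∑ j : Fin 2, s.q X * (s.V1 i j.castSucc X * s.V1 i j.castSucc X)) +
      (∑ i, s.gradP h i X * (s.q X * s.V i X))) ≤ 0 := by
  have A : ∀ j : Fin 2, _ := fun j =>
    (((S.hV j).1 j.castSucc).mul_pd hh (S.hqq hh j.castSucc)).null hh
  have B : ∀ (i : Fin 2) (a : Fin 3), _ := fun i a =>
    ((((S.hV i).2 a).1 a).mul_pd hh (S.hqV hh i a)).null hh
  have C := ((S.hWz hh).mul_pd hh (S.hqq hh 2)).null hh
  have N := (((NullInt.sum A).smul (-1 / 4)).add (C.smul (1 / 4))).add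
    ((NullInt.sum fun i => NullInt.sum fun j : Fin 2 => B i j.castSucc).add
      ((NullInt.sum fun i => B i 2).smul ε))
  have I := ((integrable_finsetSum Finset.univ fun i _ => S.integrable_qVVt hh i).add
    (integrable_finsetSum Finset.univ fun i _ => integrable_finsetSum Finset.univ
      fun (j : Fin 2) _ => S.integrable_qV1V1 hh i j.castSucc)).add
    (integrable_finsetSum Finset.univ fun i _ => S.integrable_gradP_qV hh i)
  rw [← N.2]
  refine integral_mono_ae I N.1 ?_
  filter_upwards [S.mom 0, S.mom 1] with X m0 m1
  have hq : 0 ≤ s.q X := Finset.sum_nonneg fun i _ => mul_self_nonneg _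
  have p1 : 0 ≤ ε * (s.q X * ∑ i, s.V1 i 2 X * s.V1 i 2 X) :=
    mul_nonneg hε.le (mul_nonneg hq (Finset.sum_nonneg fun i _ => mul_self_nonneg _))
  have p2 : 0 ≤ ε * (s.q1 2 X * s.q1 2 X) := mul_nonneg hε.le (mul_self_nonneg _)
  have p3 := mul_self_nonneg (s.q1 0 X)
  have p4 := mul_self_nonneg (s.q1 1 X)
  have e : ∀ a, s.q1 a X = 2 * (s.V 0 X * s.V1 0 a X + s.V 1 X * s.V1 1 a X) := fun a => by
    simp only [Fields.q1, Fin.sum_univ_two]; ring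
  simp only [Fin.sum_univ_two, Fields.rot, Fields.div, Fin.castSucc_zero, Fin.castSucc_one,
    Matrix.cons_val_zero, Matrix.cons_val_one] at *
  simp only [e] at p2 p3 p4 ⊢
  generalize s.q X = Q at *
  linear_combination s.V 0 X * Q * m0 + s.V 1 X * Q * m1 + p1 + p2 / 2 + p3 / 2 + p4 / 2

/-- The balance of `∫ T²`. -/
theorem energy_T (hε : 0 < ε) :
    ∫ X in Om h, (s.T X * s.Tt X + (∑ j : Fin 2, s.T1 j.castSucc X * s.T1 j.castSucc X) -
      1 / h * ∑ j, s.V j X * vint h (s.T1 j.castSucc) X) ≤ 0 := by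
  have TT := S.hT.mul hh S.hT
  have A : ∀ j : Fin 2, _ := fun j =>
    (((S.hV j).1 j.castSucc).mul_pd hh (TT j.castSucc)).null hh
  have B : ∀ (a : Fin 3), _ := fun a => ((S.hT.2 a a).mul_pd hh (S.hT.1 a)).null hh
  have C := ((S.hWz hh).mul_pd hh (TT 2)).null hh
  have D := ((S.hWz hh).mul_pd hh (S.hΘz hh)).null hh
  have E : ∀ j : Fin 2, _ := fun j =>
    (((S.hV j).1 j.castSucc).mul_pd hh (S.hΘj hh j)).null hh
  have N := ((((NullInt.sum A).smul (-1 / 2)).add (C.smul (1 / 2))).add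
    ((NullInt.sum fun j : Fin 2 => B j.castSucc).add ((B 2).smul ε))).add
    ((D.smul (1 / h)).add ((NullInt.sum E).smul (-1 / h)))
  have I := ((S.hT.1.l2.mem.integrable_mul S.hTt).add
    (integrable_finsetSum Finset.univ fun (j : Fin 2) _ =>
      (S.hT.1 j.castSucc).g2.integrable_mul (S.hT.1 j.castSucc).g2)).sub
    ((integrable_finsetSum Finset.univ fun (j : Fin 2) _ =>
      (S.hV j).1.l2.integrable_mul (S.hΘjz hh j).f2).const_mul (1 / h))
  rw [← N.2]
  refine integral_mono_ae I N.1 ?_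
  filter_upwards [S.temp] with X m
  have p1 : 0 ≤ ε * (s.T1 2 X * s.T1 2 X) := mul_nonneg hε.le (mul_self_nonneg _)
  simp only [Fin.sum_univ_two, Fields.div, Fin.castSucc_zero, Fin.castSucc_one] at *
  linear_combination s.T X * m + p1

theorem hlap (i j : Fin 2) : D1 h i.castSucc (s.V2 i j.castSucc j.castSucc)
    (s.V3 i j.castSucc j.castSucc i.castSucc) :=
  ((S.hV i).2 j.castSucc).2 j.castSucc i.castSucc

theorem V3_comm (i : Fin 2) (a b : Fin 3) : s.V3 i a b b =ᵐ[mu h] s.V3 i b b a := by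
  -- `∂_b ∂_b ∂_a = ∂_b ∂_a ∂_b = ∂_a ∂_b ∂_b`
  have h1 := ((S.hV i).2 a).2 b b
  have h2 := ((S.hV i).2 b).2 a b
  have := (h1.congr hh h2.f2.per h1.g2.per (S.sym i a b) EventuallyEq.rfl).pd.unique hh h2.pd
  exact this.trans (S.sym' i b a b)

theorem vz_div2 (j : Fin 2) : VZ h fun X => ∑ i : Fin 2,
    s.V3 i i.castSucc j.castSucc j.castSucc X := by
  have H : D1 h j.castSucc (s.div1 j.castSucc) fun X => ∑ i : Fin 2,
      s.V3 i i.castSucc j.castSucc j.castSucc X :=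
    D1.sum hh fun i => ((S.hV i).2 i.castSucc).2 j.castSucc j.castSucc
  exact H.pd.vz hh (dir_castSucc_snd j) (S.vzD1 hh j)

/-- The Laplacian of the velocity is orthogonal to the gradient of the surface pressure. -/
theorem integral_P_lap (j : Fin 2) :
    ∫ X in Om h, (s.P 0 X * s.V2 0 j.castSucc j.castSucc X +
      s.P 1 X * s.V2 1 j.castSucc j.castSucc X) = 0 := by
  obtain ⟨p, hp, h0, h1⟩ := S.pressure_exists hh
  refine integral_grad_mul_eq_zero hh hp h0 h1 (S.hlap hh 0 j) (S.hlap hh 1 j) ?_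
  have v := S.vz_div2 hh j
  have k0 := S.V3_comm hh 0 0 j.castSucc
  have k1 := S.V3_comm hh 1 1 j.castSucc
  refine v.congr hh ((S.hlap hh 0 j).g2.per.add (S.hlap hh 1 j).g2.per) ?_
  filter_upwards [k0, k1] with X e0 e1
  simp only [Fin.sum_univ_two, Fin.castSucc_zero, Fin.castSucc_one]
  rw [e0, e1]

/-- Testing the momentum equation with the gradient of the surface pressure. -/
theorem energy_P (hPt : ∫ X in Om h, (s.P 0 X * s.Vt 0 X + s.P 1 X * s.Vt 1 X) = 0) :
    ∫ X in Om h, (∑ i, s.P i X * (s.P i X + ((∑ j, s.V j X * s.V1 i j.castSucc X) +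
      s.div X * s.V i X + f₀ * s.rot i X - vint h (s.T1 i.castSucc) X))) = 0 := by
  have nP : NullInt h fun X => (s.P 0 X * s.Vt 0 X + s.P 1 X * s.Vt 1 X) :=
    ⟨((S.P_l2 hh 0).mem.integrable_mul (S.hVt 0)).add
      ((S.P_l2 hh 1).mem.integrable_mul (S.hVt 1)), hPt⟩
  have nL : ∀ j : Fin 2, NullInt h fun X => (s.P 0 X * s.V2 0 j.castSucc j.castSucc X +
      s.P 1 X * s.V2 1 j.castSucc j.castSucc X) := fun j =>
    ⟨((S.P_l2 hh 0).integrable_mul (S.hlap hh 0 j).f2).add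
      ((S.P_l2 hh 1).integrable_mul (S.hlap hh 1 j).f2), S.integral_P_lap hh j⟩
  have A := NullInt.sum fun i => ((S.hPz hh i).mul_pd hh (S.hWV hh i)).null hh
  have B := NullInt.sum fun i => ((S.hPz hh i).mul_pd hh (((S.hV i).2 2).1 2)).null hh
  have N := ((nP.smul (-1)).add (NullInt.sum nL)).add (A.add (B.smul ε))
  rw [← N.2]
  refine integral_congr_ae ?_
  filter_upwards [S.mom 0, S.mom 1] with X m0 m1
  simp only [Fin.sum_univ_two, Fin.castSucc_zero, Fin.castSucc_one, Fields.gradP] at *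
  linear_combination s.P 0 X * m0 + s.P 1 X * m1

end Slice

end

/-! ### Bounds of the pressure gradient -/

section

variable {h : ℝ}

theorem L2P.normSq_eq {f : Pt → ℝ} (hf : L2P h f) :
    normSq h f = ENNReal.ofReal (∫ X in Om h, f X * f X) := by
  rw [ofReal_integral_eq_lintegral_ofReal (hf.integrable_mul hf)
    (Eventually.of_forall fun X => mul_self_nonneg _)]
  refine lintegral_congr fun X => ?_
  rw [← enorm_sq_eq, Real.enorm_of_nonneg (mul_self_nonneg _)]

theorem lintegral_mul_sq_le {α : Type*} [MeasurableSpace α] {μ : Measure α} {A B : α → ℝ≥0∞}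
    (hA : AEMeasurable A μ) (hB : AEMeasurable B μ) :
    (∫⁻ x, A x * B x ∂μ) ^ 2 ≤ (∫⁻ x, A x ^ 2 ∂μ) * ∫⁻ x, B x ^ 2 ∂μ := by
  have e : ∀ c : ℝ≥0∞, (c ^ (1 / 2 : ℝ)) ^ 2 = c := fun c => by
    rw [← ENNReal.rpow_mul_natCast]; norm_num
  have := enorm_mul_le_Lp hA hB (e _).ge (e _).ge
  refine (pow_le_pow_left' this 2).trans (le_of_eq ?_)
  rw [mul_pow, e, e]

/-- A constant of the anisotropic Hölder inequality below. -/
def cp (h : ℝ) : ℝ := 2 * (1 / (2 * h) + 1) ^ 2 * (2 * h)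

/-- An anisotropic Hölder inequality: a factor with a vertical derivative is bounded in `z`. -/
theorem lintegral_mul_le_mz (hh : 0 < h) {p pz k : Pt → ℝ} (hp : D1 h 2 p pz) (hk : Per h k) :
    (∫⁻ X in Om h, ‖p X * k X‖ₑ) ^ 2 ≤ ENNReal.ofReal (cp h) * (normSq h p + normSq h pz) *
      ∫⁻ x in M, mz h (fun X => ‖k X‖ₑ) x ^ 2 := by
  set c := ENNReal.ofReal (1 / (2 * h)) + 1 with hc
  set A : Plane → ℝ≥0∞ := fun x => c * (mz h (fun X => ‖p X‖ₑ) x + mz h (fun X => ‖pz X‖ₑ) x)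
  have mp : AEMeasurable (mz h fun X => ‖p X‖ₑ) (volume.restrict M) :=
    aemeasurable_mz hp.f2.per.1.enorm.restrict
  have mpz : AEMeasurable (mz h fun X => ‖pz X‖ₑ) (volume.restrict M) :=
    aemeasurable_mz hp.g2.per.1.enorm.restrict
  have mA : AEMeasurable A (volume.restrict M) := (mp.add mpz).const_mul c
  have mk := hk.1.enorm.restrict (s := Om h)
  have h1 : ∫⁻ X in Om h, ‖p X * k X‖ₑ ≤ ∫⁻ x in M, A x * mz h (fun X => ‖k X‖ₑ) x := by
    rw [← lintegral_mz_mul mk mA]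
    refine lintegral_mono_ae ?_
    filter_upwards [hp.pd.sup_vertical hh] with X hX
    rw [enorm_mul]
    refine mul_le_mul_left (hX.trans ?_) _
    simp only [A, hc, mul_add, add_mul, one_mul]
    exact add_le_add le_self_add le_add_self
  refine (pow_le_pow_left' h1 2).trans ((lintegral_mul_sq_le mA (aemeasurable_mz mk)).trans ?_)
  refine mul_le_mul_left ?_ _
  have h2 : ∀ᵐ x ∂volume.restrict M, A x ^ 2 ≤ ENNReal.ofReal (cp h) *
      (mz h (fun X => ‖p X‖ₑ ^ 2) x + mz h (fun X => ‖pz X‖ₑ ^ 2) x) := by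
    filter_upwards [mz_sq_le hp.f2.per, mz_sq_le hp.g2.per] with x e1 e2
    have e3 : ENNReal.ofReal (cp h) = 2 * c ^ 2 * ENNReal.ofReal (2 * h) := by
      rw [cp, ENNReal.ofReal_mul (by positivity), ENNReal.ofReal_mul (by positivity),
        ENNReal.ofReal_pow (by positivity), ENNReal.ofReal_add (by positivity) (by positivity)]
      simp [hc]
    simp only [A]
    rw [mul_pow, e3]
    have e4 := ENNReal.rpow_add_le_mul_rpow_add_rpow (mz h (fun X => ‖p X‖ₑ) x)
      (mz h (fun X => ‖pz X‖ₑ) x) (p := 2) (by norm_num)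
    norm_num at e4
    calc _ ≤ c ^ 2 * (2 * (ENNReal.ofReal (2 * h) * mz h (fun X => ‖p X‖ₑ ^ 2) x +
          ENNReal.ofReal (2 * h) * mz h (fun X => ‖pz X‖ₑ ^ 2) x)) := by gcongr; exact e4.trans (by gcongr)
      _ = _ := by ring
  refine (lintegral_mono_ae h2).trans (le_of_eq ?_)
  have m1 : AEMeasurable (mz h fun X => ‖p X‖ₑ ^ 2) (volume.restrict M) :=
    aemeasurable_mz (hp.f2.per.1.enorm.pow_const 2).restrict
  rw [lintegral_const_mul' _ _ ENNReal.ofReal_ne_top, lintegral_add_left' m1,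
    normSq_eq_mz hp.f2.per, normSq_eq_mz hp.g2.per]

theorem integral_sq_vint_le {f : Pt → ℝ} (hh : 0 < h) (hf : L2P h f) (h0 : VZ h f) :
    ∫ X in Om h, vint h f X * vint h f X ≤ (2 * h) ^ 2 * ∫ X in Om h, f X * f X := by
  have := normSq_vint_le hf.per
  rw [(hf.vint hh h0).normSq_eq, hf.normSq_eq, ← ENNReal.ofReal_mul (by positivity),
    ← ENNReal.ofReal_mul (by positivity), ENNReal.ofReal_le_ofReal_iff] at this
  · linarith
  · exact mul_nonneg (by positivity) (mul_nonneg (by positivity)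
      (integral_nonneg fun X => mul_self_nonneg _))

/-- A bound of the squared integral of `|f|` in `[0, ∞]` bounds the real integral of `f`. -/
theorem abs_integral_le_of_lintegral {f : Pt → ℝ} {B : ℝ} (hB : 0 ≤ B)
    (H : (∫⁻ X in Om h, ‖f X‖ₑ) ^ 2 ≤ ENNReal.ofReal (B ^ 2)) : |∫ X in Om h, f X| ≤ B := by
  rw [ENNReal.ofReal_pow hB] at H
  have h1 := (ENNReal.pow_le_pow_left_iff two_ne_zero).1 H
  have h2 := (enorm_integral_le_lintegral_enorm (μ := mu h) f).trans h1
  rwa [← Real.norm_eq_abs, ← toReal_enorm, ← ENNReal.toReal_ofReal hB,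
    ENNReal.toReal_le_toReal (by simp) (by simp)]

theorem integral_linear_four {A B C D : Pt → ℝ} {a b c d : ℝ} (hA : Integrable A (mu h))
    (hB : Integrable B (mu h)) (hC : Integrable C (mu h)) (hD : Integrable D (mu h)) :
    ∫ X in Om h, (a * A X + (b * B X + c * C X + d * D X)) =
      a * (∫ X in Om h, A X) + (b * (∫ X in Om h, B X) + c * (∫ X in Om h, C X) +
        d * ∫ X in Om h, D X) := by
  have h1 : Integrable (fun X => b * B X + c * C X) (mu h) := (hB.const_mul b).add (hC.const_mul c)
  have h2 : Integrable (fun X => b * B X + c * C X + d * D X) (mu h) := h1.add (hD.const_mul d)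
  rw [integral_add (hA.const_mul a) h2, integral_add h1 (hD.const_mul d),
    integral_add (hB.const_mul b) (hC.const_mul c)]
  simp only [integral_const_mul]

/-- Pointwise Young inequality for the pressure: `p` stands for the surface pressure gradient, `t` for
`∫_{-h}^z ∇_H T`, and `N`, `L`, `F` for the advective and Coriolis terms. The first term on the right
has integral zero by `Slice.energy_P`. -/
theorem pressure_quadratic (p N L F t : ℝ) : (p - t) * (p - t) ≤
    4 * (p * (p + (N + L + F - t))) + 8 * N ^ 2 + 8 * L ^ 2 + 8 * F ^ 2 + 10 * t ^ 2 := by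
  linear_combination sq_nonneg (p + t) + 2 * sq_nonneg (p + (N + L + F - t)) +
    2 * sq_nonneg (N - L) + 2 * sq_nonneg (N - F) + 2 * sq_nonneg (L - F) +
    2 * sq_nonneg (N + t) + 2 * sq_nonneg (L + t) + 2 * sq_nonneg (F + t)

namespace Fields
variable (s : Fields)

/-- `∫ |v|⁴`. -/
def y4 (h : ℝ) : ℝ := ∫ X in Om h, s.q X * s.q X

/-- `∫ |v|²`. -/
def y2 (h : ℝ) : ℝ := ∫ X in Om h, s.q X

/-- `∫ |v|² |∇_H v|²`. -/
def diss (h : ℝ) : ℝ := ∫ X in Om h, ∑ i, ∑ j : Fin 2,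
  s.q X * (s.V1 i j.castSucc X * s.V1 i j.castSucc X)

/-- `∫ |∇_H T|²`. -/
def dissT (h : ℝ) : ℝ := ∫ X in Om h, ∑ j : Fin 2, s.T1 j.castSucc X * s.T1 j.castSucc X

theorem q_nonneg (X : Pt) : 0 ≤ s.q X := Finset.sum_nonneg fun _ _ => mul_self_nonneg _

theorem V_sq_le_q (i : Fin 2) (X : Pt) : s.V i X * s.V i X ≤ s.q X :=
  Finset.single_le_sum (f := fun i => s.V i X * s.V i X) (fun _ _ => mul_self_nonneg _)
    (Finset.mem_univ i)

theorem y4_nonneg : 0 ≤ s.y4 h := integral_nonneg fun _ => mul_self_nonneg _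
theorem y2_nonneg : 0 ≤ s.y2 h := integral_nonneg s.q_nonneg
theorem diss_nonneg : 0 ≤ s.diss h := integral_nonneg fun X =>
  Finset.sum_nonneg fun _ _ => Finset.sum_nonneg fun _ _ =>
    mul_nonneg (s.q_nonneg X) (mul_self_nonneg _)
theorem dissT_nonneg : 0 ≤ s.dissT h := integral_nonneg fun _ =>
  Finset.sum_nonneg fun _ _ => mul_self_nonneg _

end Fields

namespace Slice

variable {f₀ ε : ℝ} {s : Fields} (S : Slice h f₀ ε s) (hh : 0 < h)

include S hh

theorem integrable_diss : Integrable (fun X => ∑ i, ∑ j : Fin 2,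
    s.q X * (s.V1 i j.castSucc X * s.V1 i j.castSucc X)) (mu h) :=
  integrable_finsetSum _ fun i _ => integrable_finsetSum _ fun j _ =>
    S.integrable_qV1V1 hh i j.castSucc

theorem integrable_dissT : Integrable (fun X => ∑ j : Fin 2,
    s.T1 j.castSucc X * s.T1 j.castSucc X) (mu h) :=
  integrable_finsetSum _ fun j _ =>
    (S.hT.1 j.castSucc).g2.integrable_mul (S.hT.1 j.castSucc).g2

/-- The gradient of `|v|⁴` in `L¹`, by Cauchy–Schwarz with weights `|v|²` and `|v| |∇_H v|`. -/
theorem lintegral_grad_qq_le (j : Fin 2) :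
    ∫⁻ X in Om h, ‖s.q1 j.castSucc X * s.q X + s.q X * s.q1 j.castSucc X‖ₑ ≤
      ENNReal.ofReal (4 * √(s.y4 h * s.diss h)) := by
  set a := j.castSucc
  have hq := (S.hq1 hh).l2
  have hqa := (S.hq1 hh).l2' a
  have e : ∀ X, ‖s.q1 a X * s.q X + s.q X * s.q1 a X‖ₑ = ‖s.q X‖ₑ * ‖2 * s.q1 a X‖ₑ := fun X => by
    rw [← enorm_mul]; congr 1; ring
  simp only [e]
  have h1 := lintegral_mul_sq_le (μ := mu h) hq.per.1.enorm.restrict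
    (hqa.smul 2).per.1.enorm.restrict
  have h2 : ∫⁻ X in Om h, ‖s.q X‖ₑ ^ 2 = _ := hq.normSq_eq
  have h3 : ∫⁻ X in Om h, ‖2 * s.q1 a X‖ₑ ^ 2 = _ := (hqa.smul 2).normSq_eq
  rw [h2, h3, ← ENNReal.ofReal_mul (show 0 ≤ ∫ X in Om h, s.q X * s.q X from s.y4_nonneg)] at h1
  have h4 : ∫ X in Om h, 2 * s.q1 a X * (2 * s.q1 a X) ≤ 16 * s.diss h := by
    rw [Fields.diss, ← integral_const_mul]
    refine integral_mono ((hqa.smul 2).integrable_mul (hqa.smul 2))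
      ((S.integrable_diss hh).const_mul 16) fun X => ?_
    have key : s.q1 a X * s.q1 a X ≤ 4 * (s.q X * (s.V1 0 a X ^ 2 + s.V1 1 a X ^ 2)) := by
      simp only [Fields.q1, Fields.q, Fin.sum_univ_two]
      nlinarith [sq_nonneg (s.V 0 X * s.V1 1 a X - s.V 1 X * s.V1 0 a X)]
    have key2 : s.q X * (s.V1 0 a X ^ 2 + s.V1 1 a X ^ 2) ≤ ∑ i, ∑ j : Fin 2,
        s.q X * (s.V1 i j.castSucc X * s.V1 i j.castSucc X) := by
      rw [mul_add, ← Fin.sum_univ_two fun i => s.q X * s.V1 i a X ^ 2]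
      refine Finset.sum_le_sum fun i _ => ?_
      rw [sq]
      exact Finset.single_le_sum (f := fun j : Fin 2 =>
        s.q X * (s.V1 i j.castSucc X * s.V1 i j.castSucc X))
        (fun _ _ => mul_nonneg (s.q_nonneg X) (mul_self_nonneg _)) (Finset.mem_univ j)
    simp only
    nlinarith
  have h5 : (∫⁻ X in Om h, ‖s.q X‖ₑ * ‖2 * s.q1 a X‖ₑ) ^ 2 ≤
      ENNReal.ofReal (4 * √(s.y4 h * s.diss h)) ^ 2 := by
    refine h1.trans ?_
    rw [← ENNReal.ofReal_pow (by positivity), mul_pow,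
      Real.sq_sqrt (mul_nonneg s.y4_nonneg s.diss_nonneg)]
    refine ENNReal.ofReal_le_ofReal ?_
    have := mul_le_mul_of_nonneg_left h4 s.y4_nonneg (a := s.y4 h)
    simp only [Fields.y4] at *
    linarith
  exact (ENNReal.pow_le_pow_left_iff two_ne_zero).1 h5

/-- The vertical integral of `|v|³` in `L²`: by Cauchy–Schwarz in `z` it is bounded by the vertical
integrals of `|v|²` and `|v|⁴`, and the latter obeys the two-dimensional Sobolev inequality. -/
theorem lintegral_mz_qV_le (i : Fin 2) :
    ∫⁻ x in M, mz h (fun X => ‖s.q X * s.V i X‖ₑ) x ^ 2 ≤ ENNReal.ofReal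
      (√(2 * h * s.y4 h) * (s.y4 h + 4 * √(s.y4 h * s.diss h))) := by
  have hq := (S.hq1 hh).l2
  have hV := (S.hV i).1.l2
  have hqq := (S.hqq hh).l2
  have mq : AEMeasurable (mz h fun X => ‖s.q X‖ₑ) (volume.restrict M) :=
    aemeasurable_mz hq.per.1.enorm.restrict
  have mqq : AEMeasurable (mz h fun X => ‖s.q X * s.q X‖ₑ) (volume.restrict M) :=
    aemeasurable_mz hqq.per.1.enorm.restrict
  have h1 : ∫⁻ x in M, mz h (fun X => ‖s.q X * s.V i X‖ₑ) x ^ 2 ≤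
      ∫⁻ x in M, mz h (fun X => ‖s.q X‖ₑ) x * mz h (fun X => ‖s.q X * s.q X‖ₑ) x := by
    refine lintegral_mono_ae ?_
    filter_upwards [ae_aemeasurable_fiber (h := h) hq.per.1.enorm.restrict,
      ae_aemeasurable_fiber (h := h) hV.per.1.enorm.restrict] with x m1 m2
    have := lintegral_mul_sq_le m2 m1
    simp only [mz, enorm_mul]
    simp only [mul_comm ‖s.q _‖ₑ ‖s.V i _‖ₑ]
    refine this.trans ?_
    simp only [sq]
    refine mul_le_mul_left (lintegral_mono fun z => ?_) _
    rw [← enorm_mul, Real.enorm_of_nonneg (mul_self_nonneg _),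
      Real.enorm_of_nonneg (s.q_nonneg _)]
    exact ENNReal.ofReal_le_ofReal (s.V_sq_le_q i _)
  have h2 := lintegral_mul_sq_le mq mqq
  have h3 : ∫⁻ x in M, mz h (fun X => ‖s.q X‖ₑ) x ^ 2 ≤ ENNReal.ofReal (2 * h * s.y4 h) := by
    refine (lintegral_mono_ae (mz_sq_le hq.per)).trans (le_of_eq ?_)
    rw [lintegral_const_mul' _ _ ENNReal.ofReal_ne_top, ← normSq_eq_mz hq.per, hq.normSq_eq,
      ← ENNReal.ofReal_mul (by positivity)]
    rfl
  have h4 := ((S.hqq hh) 0).pd.sobolev hh ((S.hqq hh) 1).pd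
  have e5 : ∫⁻ X in Om h, ‖s.q X * s.q X‖ₑ = ENNReal.ofReal (s.y4 h) := by
    have : ∫⁻ X in Om h, ‖s.q X‖ₑ ^ 2 = _ := hq.normSq_eq
    simp only [enorm_sq_eq]
    exact this
  have e6 : ∀ j : Fin 2, (∫⁻ X in Om h, ‖s.q X * s.q X‖ₑ) +
      ∫⁻ X in Om h, ‖s.q1 j.castSucc X * s.q X + s.q X * s.q1 j.castSucc X‖ₑ ≤
      ENNReal.ofReal (s.y4 h + 4 * √(s.y4 h * s.diss h)) := fun j => by
    rw [ENNReal.ofReal_add s.y4_nonneg (by positivity), e5]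
    exact add_le_add le_rfl (S.lintegral_grad_qq_le hh j)
  have h5 := h4.trans (mul_le_mul' (e6 0) (e6 1))
  have h6 := (pow_le_pow_left' h1 2).trans (h2.trans (mul_le_mul' h3 h5))
  have y0 := s.y4_nonneg (h := h)
  rw [← sq, ← ENNReal.ofReal_pow (by positivity), ← ENNReal.ofReal_mul (by positivity),
    ← Real.sq_sqrt (show 0 ≤ 2 * h * s.y4 h by positivity), ← mul_pow,
    ENNReal.ofReal_pow (by positivity)] at h6
  exact (ENNReal.pow_le_pow_left_iff two_ne_zero).1 h6

theorem integrable_q : Integrable s.q (mu h) := (S.hq1 hh).l2.integrable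

/-- `‖v‖₂²` is controlled by `‖v‖₄⁴`, since `a ≤ 1 + a²`. -/
theorem y2_le : s.y2 h ≤ (mu h).real univ + s.y4 h := by
  have : s.y2 h ≤ ∫ X in Om h, (1 + s.q X * s.q X) := by
    refine integral_mono (S.integrable_q hh)
      ((integrable_const 1).add ((S.hq1 hh).l2.integrable_mul (S.hq1 hh).l2)) fun X => ?_
    simp only
    nlinarith [s.q_nonneg X]
  rw [integral_add (integrable_const 1) ((S.hq1 hh).l2.integrable_mul (S.hq1 hh).l2),
    integral_const] at this
  simpa [Fields.y4] using this

theorem integral_sum_sq_vint_le :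
    ∫ X in Om h, (∑ i : Fin 2, vint h (s.T1 i.castSucc) X * vint h (s.T1 i.castSucc) X) ≤
      4 * h ^ 2 * s.dissT h := by
  have I : ∀ i : Fin 2, _ := fun i => (S.hΘjz hh i).f2.integrable_mul (S.hΘjz hh i).f2
  rw [integral_finsetSum _ fun i _ => I i, Fields.dissT, integral_finsetSum _ fun j _ =>
    (S.hT.1 (Fin.castSucc j)).g2.integrable_mul (S.hT.1 (Fin.castSucc j)).g2, Finset.mul_sum]
  refine Finset.sum_le_sum fun i _ => ?_
  have := integral_sq_vint_le hh (S.hT.1 i.castSucc).g2 (S.vzTj hh i)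
  linarith

/-- The pressure gradient is controlled by the dissipation. -/
theorem integral_gradP_le
    (hPt : ∫ X in Om h, (s.P 0 X * s.Vt 0 X + s.P 1 X * s.Vt 1 X) = 0) :
    ∫ X in Om h, (∑ i, s.gradP h i X * s.gradP h i X) ≤
      24 * s.diss h + 8 * f₀ ^ 2 * s.y2 h + 40 * h ^ 2 * s.dissT h := by
  have N := S.energy_P hh hPt
  have IP : Integrable (fun X => ∑ i, s.P i X * s.P i X) (mu h) :=
    integrable_finsetSum _ fun i _ => (S.P_l2 hh i).integrable_mul (S.P_l2 hh i)
  have IG : Integrable (fun X => ∑ i, s.gradP h i X * s.gradP h i X) (mu h) :=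
    integrable_finsetSum _ fun i _ => (S.gradP_l2 hh i).integrable_mul (S.gradP_l2 hh i)
  have IT : Integrable (fun X => ∑ i : Fin 2, vint h (s.T1 i.castSucc) X *
      vint h (s.T1 i.castSucc) X) (mu h) :=
    integrable_finsetSum _ fun i _ => (S.hΘjz hh i).f2.integrable_mul (S.hΘjz hh i).f2
  have IN : Integrable (fun X => ∑ i, s.P i X * (s.P i X +
      ((∑ j, s.V j X * s.V1 i j.castSucc X) +
      s.div X * s.V i X + f₀ * s.rot i X - vint h (s.T1 i.castSucc) X))) (mu h) :=
    integrable_finsetSum _ fun i _ => (S.P_l2 hh i).integrable_mul ((S.P_l2 hh i).add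
      ((((L2P.sum fun j => S.V_mul_l2 hh j ((S.hV i).2 j.castSucc).1).add
        (S.V_mul_l2 hh i (S.hdiv hh)).mul_comm).add ((S.rot_l2 hh i).smul f₀)).sub
        (S.hΘjz hh i).f2))
  have h1 : ∫ X in Om h, (∑ i, s.gradP h i X * s.gradP h i X) ≤
      ∫ X in Om h, (4 * (∑ i, s.P i X * (s.P i X + ((∑ j, s.V j X * s.V1 i j.castSucc X) +
        s.div X * s.V i X + f₀ * s.rot i X - vint h (s.T1 i.castSucc) X))) +
        (24 * (∑ i, ∑ j : Fin 2, s.q X * (s.V1 i j.castSucc X * s.V1 i j.castSucc X)) +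
        8 * f₀ ^ 2 * s.q X + 10 * ∑ i : Fin 2, vint h (s.T1 i.castSucc) X *
      vint h (s.T1 i.castSucc) X)) := by
    refine integral_mono IG ((IN.const_mul 4).add ((((S.integrable_diss hh).const_mul 24).add
      ((S.integrable_q hh).const_mul (8 * f₀ ^ 2))).add (IT.const_mul 10))) fun X => ?_
    simp only [Fin.sum_univ_two, Fields.rot, Fields.div, Fields.gradP, Fields.q,
      Fin.castSucc_zero, Fin.castSucc_one, Matrix.cons_val_zero, Matrix.cons_val_one]
    generalize s.P 0 X = p0
    generalize s.P 1 X = p1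
    generalize vint h (s.T1 0) X = t0
    generalize vint h (s.T1 1) X = t1
    generalize s.V 0 X = a
    generalize s.V 1 X = b
    generalize s.V1 0 0 X = a0
    generalize s.V1 0 1 X = a1
    generalize s.V1 1 0 X = b0
    generalize s.V1 1 1 X = b1
    have e0 := pressure_quadratic p0 (a * a0 + b * a1) ((a0 + b1) * a) (f₀ * -b) t0
    have e1 := pressure_quadratic p1 (a * b0 + b * b1) ((a0 + b1) * b) (f₀ * a) t1
    have k1 := sq_nonneg (a * a1 - b * a0)
    have k2 := sq_nonneg (a * b1 - b * b0)
    have k3 : 0 ≤ (a ^ 2 + b ^ 2) * (a0 - b1) ^ 2 := by positivity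
    have k4 : 0 ≤ (a ^ 2 + b ^ 2) * (a1 ^ 2 + b0 ^ 2) := by positivity
    linear_combination e0 + e1 + 8 * k1 + 8 * k2 + 8 * k3 + 16 * k4
  have h2 := S.integral_sum_sq_vint_le hh
  rw [integral_linear_four IN (S.integrable_diss hh) (S.integrable_q hh) IT, N] at h1
  change _ ≤ 4 * 0 + (24 * s.diss h + 8 * f₀ ^ 2 * s.y2 h + _) at h1
  linarith

end Slice

end

/-! ### Growth rate of the global energies -/

section

variable {h : ℝ}

/-- Young inequality which absorbs the dissipation `d` in the pressure term. -/
theorem sobolev_young {κ h y d : ℝ} (hh : 0 ≤ h) (hy : 0 ≤ y) (hd : 0 ≤ d) :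
    κ * (√(2 * h * y) * (y + 4 * √(y * d))) ≤
      d / 4 + y ^ 2 + κ ^ 2 * h * y / 2 + 32 * κ ^ 2 * h * y ^ 2 := by
  have r2 := Real.sq_sqrt (show 0 ≤ 2 * h * y by positivity)
  have w2 := Real.sq_sqrt (show 0 ≤ y * d by positivity)
  set r := √(2 * h * y)
  set w := √(y * d)
  have h1 : κ * r * y ≤ y ^ 2 + κ ^ 2 * h * y / 2 := by nlinarith [sq_nonneg (y - κ * r / 2)]
  have h2 : 4 * κ * (r * w) ≤ d / 4 + 32 * κ ^ 2 * h * y ^ 2 := by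
    refine abs_le_of_sq_le_sq' ?_ (by positivity) |>.2
    have e : (4 * κ * (r * w)) ^ 2 = d * (32 * κ ^ 2 * h * y ^ 2) := by
      rw [mul_pow, mul_pow r w, r2, w2]; ring
    rw [e]
    nlinarith [sq_nonneg (d / 4 - 32 * κ ^ 2 * h * y ^ 2)]
  nlinarith

namespace Slice

variable {f₀ ε : ℝ} {s : Fields} (S : Slice h f₀ ε s) (hh : 0 < h)

include S hh

/-- The pressure term in the balance of `∫ |v|⁴`. The free parameter `η` is chosen small enough that
the pressure gradient can be absorbed by the dissipation. -/
theorem abs_integral_gradP_qV_le (i : Fin 2) {η : ℝ} (hη : 0 < η) :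
    |∫ X in Om h, s.gradP h i X * (s.q X * s.V i X)| ≤
      η * ((∫ X in Om h, s.gradP h i X * s.gradP h i X) +
        ∫ X in Om h, s.T1 i.castSucc X * s.T1 i.castSucc X) +
      cp h / (4 * η) * (√(2 * h * s.y4 h) * (s.y4 h + 4 * √(s.y4 h * s.diss h))) := by
  have c0 : 0 ≤ cp h := by unfold cp; positivity
  have y0 := s.y4_nonneg (h := h)
  have G0 : 0 ≤ ∫ X in Om h, s.gradP h i X * s.gradP h i X :=
    integral_nonneg fun _ => mul_self_nonneg _
  have T0 : 0 ≤ ∫ X in Om h, s.T1 i.castSucc X * s.T1 i.castSucc X :=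
    integral_nonneg fun _ => mul_self_nonneg _
  have H := lintegral_mul_le_mz hh (S.hgradPz hh i) (S.hqV hh i).l2.per
  have e := (S.hgradPz hh i).g2.normSq_eq
  simp only [neg_mul_neg] at e
  rw [(S.gradP_l2 hh i).normSq_eq, e, ← ENNReal.ofReal_add G0 T0, ← ENNReal.ofReal_mul c0] at H
  refine abs_integral_le_of_lintegral (by positivity) (H.trans ((mul_le_mul_right
    (S.lintegral_mz_qV_le hh i) _).trans ?_))
  set N := (∫ X in Om h, s.gradP h i X * s.gradP h i X) +
    ∫ X in Om h, s.T1 i.castSucc X * s.T1 i.castSucc X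
  set X := √(2 * h * s.y4 h) * (s.y4 h + 4 * √(s.y4 h * s.diss h))
  rw [← ENNReal.ofReal_mul (by positivity)]
  refine ENNReal.ofReal_le_ofReal ?_
  have : cp h * N * X = 4 * (η * N) * (cp h / (4 * η) * X) := by field_simp
  rw [this]
  nlinarith [sq_nonneg (η * N - cp h / (4 * η) * X)]

/-- The stratification term `(1/h) ∫ v · ∫_{-h}^z ∇_H T` in the balance of `∫ T²`. -/
theorem integral_V_vint_le :
    ∫ X in Om h, 1 / h * ∑ j, s.V j X * vint h (s.T1 j.castSucc) X ≤
      4 * s.y2 h + s.dissT h / 4 := by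
  have IT : Integrable (fun X => ∑ i : Fin 2, vint h (s.T1 i.castSucc) X *
      vint h (s.T1 i.castSucc) X) (mu h) :=
    integrable_finsetSum _ fun i _ => (S.hΘjz hh i).f2.integrable_mul (S.hΘjz hh i).f2
  have h1 : ∫ X in Om h, 1 / h * ∑ j, s.V j X * vint h (s.T1 j.castSucc) X ≤
      ∫ X in Om h, (4 * s.q X + 1 / (16 * h ^ 2) * ∑ i : Fin 2, vint h (s.T1 i.castSucc) X *
      vint h (s.T1 i.castSucc) X) := by
    refine integral_mono ((integrable_finsetSum Finset.univ fun (j : Fin 2) _ =>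
      (S.hV j).1.l2.integrable_mul (S.hΘjz hh j).f2).const_mul (1 / h))
      (((S.integrable_q hh).const_mul 4).add (IT.const_mul _)) fun X => ?_
    simp only [Fields.q, Finset.mul_sum, ← Finset.sum_add_distrib]
    refine Finset.sum_le_sum fun j _ => ?_
    have e : 1 / (16 * h ^ 2) * (vint h (s.T1 j.castSucc) X * vint h (s.T1 j.castSucc) X) =
        (1 / h * vint h (s.T1 j.castSucc) X) ^ 2 / 16 := by field_simp
    rw [e]
    nlinarith [sq_nonneg (2 * s.V j X - (1 / h * vint h (s.T1 j.castSucc) X) / 4)]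
  rw [integral_add ((S.integrable_q hh).const_mul 4) (IT.const_mul _)] at h1
  simp only [integral_const_mul] at h1 ⊢
  have h2 := mul_le_mul_of_nonneg_left (S.integral_sum_sq_vint_le hh)
    (show 0 ≤ 1 / (16 * h ^ 2) by positivity)
  have e : 1 / (16 * h ^ 2) * (4 * h ^ 2 * s.dissT h) = s.dissT h / 4 := by field_simp; ring
  rw [e] at h2
  change _ ≤ 4 * s.y2 h + _ at h1
  linarith

end Slice

/-- Growth rate of `∫ |v|⁴ / 4 + ∫ T² / 2`. -/
def rateConst (h f₀ : ℝ) : ℝ :=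
  (2 * f₀ ^ 2 + 4) * ((mu h).real univ + 1) + 1 +
    33 * (2 * cp h * (25 + 40 * h ^ 2)) ^ 2 * h

theorem rateConst_pos (hh : 0 < h) (f₀ : ℝ) : 0 < rateConst h f₀ := by
  unfold rateConst; positivity

/-- The arithmetic of `Slice.rate`. Here `y`, `m`, `μ` stand for `‖v‖₄⁴`, `‖v‖₂²` and the volume of `Ω`,
`d` and `g` for the dissipations, `J` for the pressure terms, `G` and `t` for the `L²` norms of the
pressure gradient and of the temperature gradient, `A` and `B` for the two time derivatives. -/
theorem rate_arith {f₀ c K y d g m μ A B J₀ J₁ G₀ G₁ t₀ t₁ X v : ℝ} (hh : 0 ≤ h)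
    (hK : K = 25 + 40 * h ^ 2) (y0 : 0 ≤ y) (d0 : 0 ≤ d) (g0 : 0 ≤ g) (m0 : 0 ≤ m) (μ0 : 0 ≤ μ)
    (E4 : A + d + (J₀ + J₁) ≤ 0) (ET : B + g - v ≤ 0) (hV : v ≤ 4 * m + g / 4)
    (a0 : -J₀ ≤ 1 / (4 * K) * (G₀ + t₀) + c * K * X)
    (a1 : -J₁ ≤ 1 / (4 * K) * (G₁ + t₁) + c * K * X)
    (hG : G₀ + G₁ ≤ 24 * d + 8 * f₀ ^ 2 * m + 40 * h ^ 2 * g) (hT : g = t₀ + t₁)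
    (ys : 2 * c * K * X ≤ d / 4 + y ^ 2 + (2 * c * K) ^ 2 * h * y / 2 +
      32 * (2 * c * K) ^ 2 * h * y ^ 2) (my : m ≤ μ + y) :
    A + B ≤ ((2 * f₀ ^ 2 + 4) * (μ + 1) + 1 + 33 * (2 * c * (25 + 40 * h ^ 2)) ^ 2 * h) *
      (1 + y) ^ 2 := by
  have K0 : 0 < K := by rw [hK]; positivity
  have hN : 1 / (4 * K) * ((G₀ + G₁) + g) ≤ (d + g) / 4 + 2 * f₀ ^ 2 * m := by
    rw [one_div, inv_mul_le_iff₀ (by positivity)]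
    have k1 : 1 ≤ K := by rw [hK]; nlinarith [sq_nonneg h]
    have k2 : 0 ≤ f₀ ^ 2 * m := by positivity
    have k3 : 0 ≤ h ^ 2 * d := by positivity
    have k4 := mul_le_mul_of_nonneg_right k1 k2
    have k5 : 4 * K * ((d + g) / 4 + 2 * f₀ ^ 2 * m) =
      25 * d + 40 * (h ^ 2 * d) + 25 * g + 40 * h ^ 2 * g + 8 * (K * (f₀ ^ 2 * m)) := by
      nth_rewrite 1 [hK]
      ring_nf
      rw [hK]
      ring
    rw [k5]
    linarith
  have mm : (2 * f₀ ^ 2 + 4) * m ≤ (2 * f₀ ^ 2 + 4) * (μ + y) :=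
    mul_le_mul_of_nonneg_left my (by positivity)
  have fin : A + B ≤ (2 * f₀ ^ 2 + 4) * (μ + y) + y ^ 2 + (2 * c * K) ^ 2 * h * y / 2 +
      32 * (2 * c * K) ^ 2 * h * y ^ 2 := by
    have e1 : 1 / (4 * K) * ((G₀ + G₁) + g) =
      1 / (4 * K) * (G₀ + t₀) + 1 / (4 * K) * (G₁ + t₁) := by rw [hT]; ring
    linarith
  refine fin.trans ?_
  have z : 0 ≤ (2 * c * K) ^ 2 * h := by positivity
  have f2 : 0 ≤ 2 * f₀ ^ 2 + 4 := by positivity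
  rw [← hK]
  have e0 : 33 * (2 * c * K) ^ 2 * h = 33 * ((2 * c * K) ^ 2 * h) := by ring
  have e2 : 32 * (2 * c * K) ^ 2 * h * y ^ 2 = 32 * ((2 * c * K) ^ 2 * h) * y ^ 2 := by ring
  rw [e0, e2]
  generalize (2 * c * K) ^ 2 * h = Z at *
  generalize 2 * f₀ ^ 2 + 4 = Φ at *
  have e1 : Φ * (μ + y) ≤ Φ * (μ + 1) * (1 + y) ^ 2 := by
    have : μ + y ≤ (μ + 1) * (1 + y) ^ 2 := by
      nlinarith [mul_nonneg μ0 y0, mul_nonneg μ0 (sq_nonneg y)]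
    rw [mul_assoc]
    exact mul_le_mul_of_nonneg_left this f2
  have e3 : 0 ≤ Z * y := mul_nonneg z y0
  have e4 : 0 ≤ Z * y ^ 2 := mul_nonneg z (sq_nonneg y)
  linear_combination e1 + 33 * z + (131 / 2) * e3 + e4 + 2 * y0

/-- The time derivative of `∫ |v|⁴ / 4 + ∫ T² / 2` is at most a multiple of `(1 + ∫ |v|⁴)²`. The
hypothesis says that the surface pressure gradient is orthogonal to the time derivative. -/
theorem Slice.rate {f₀ ε : ℝ} {s : Fields} (S : Slice h f₀ ε s) (hh : 0 < h) (hε : 0 < ε)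
    (hPt : ∫ X in Om h, (s.P 0 X * s.Vt 0 X + s.P 1 X * s.Vt 1 X) = 0) :
    (∫ X in Om h, ∑ i, s.q X * s.V i X * s.Vt i X) + ∫ X in Om h, s.T X * s.Tt X ≤
      rateConst h f₀ * (1 + s.y4 h) ^ 2 := by
  have y0 := s.y4_nonneg (h := h)
  have d0 := s.diss_nonneg (h := h)
  have g0 := s.dissT_nonneg (h := h)
  have m0 := s.y2_nonneg (h := h)
  have E4 := S.energy_four hh hε
  have ET := S.energy_T hh hε
  have I1 : Integrable (fun X => ∑ i, s.q X * s.V i X * s.Vt i X) (mu h) :=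
    integrable_finsetSum _ fun i _ => S.integrable_qVVt hh i
  have I2 := S.integrable_diss hh
  have I3 : ∀ i, Integrable (fun X => s.gradP h i X * (s.q X * s.V i X)) (mu h) :=
    fun i => S.integrable_gradP_qV hh i
  have I12 : Integrable (fun X => (∑ i, s.q X * s.V i X * s.Vt i X) + ∑ i, ∑ j : Fin 2,
    s.q X * (s.V1 i j.castSucc X * s.V1 i j.castSucc X)) (mu h) := I1.add I2
  rw [integral_add I12 (integrable_finsetSum _ fun i _ => I3 i), integral_add I1 I2,
    integral_finsetSum _ fun i _ => I3 i, Fin.sum_univ_two] at E4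
  have J1 : Integrable (fun X => s.T X * s.Tt X) (mu h) := S.hT.1.l2.mem.integrable_mul S.hTt
  have J2 := S.integrable_dissT hh
  have J12 : Integrable (fun X => s.T X * s.Tt X + ∑ j : Fin 2,
    s.T1 j.castSucc X * s.T1 j.castSucc X) (mu h) := J1.add J2
  rw [integral_sub J12 ((integrable_finsetSum Finset.univ fun (j : Fin 2) _ =>
      (S.hV j).1.l2.integrable_mul (S.hΘjz hh j).f2).const_mul (1 / h)),
    integral_add J1 J2] at ET
  have hV := S.integral_V_vint_le hh
  set K := 25 + 40 * h ^ 2 with hK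
  have K0 : 0 < K := by positivity
  -- the weight `1 / (4 K)` makes the pressure gradient, of size at most `24 d + 40 h² g + …`,
  -- smaller than a quarter of the dissipation `d + g`
  have η0 : 0 < 1 / (4 * K) := by positivity
  have a0 := (neg_le_abs _).trans (S.abs_integral_gradP_qV_le hh 0 η0)
  have a1 := (neg_le_abs _).trans (S.abs_integral_gradP_qV_le hh 1 η0)
  have hG := S.integral_gradP_le hh hPt
  rw [integral_finsetSum _ fun i _ => (S.gradP_l2 hh i).integrable_mul (S.gradP_l2 hh i),
    Fin.sum_univ_two] at hG
  have hT : s.dissT h = (∫ X in Om h, s.T1 0 X * s.T1 0 X) + ∫ X in Om h, s.T1 1 X * s.T1 1 X := by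
    rw [Fields.dissT, integral_finsetSum _ fun j _ =>
      (S.hT.1 (Fin.castSucc j)).g2.integrable_mul (S.hT.1 (Fin.castSucc j)).g2, Fin.sum_univ_two]
    rfl
  have ek : cp h / (4 * (1 / (4 * K))) = cp h * K := by field_simp
  rw [ek] at a0 a1
  exact rate_arith hh.le hK y0 d0 g0 m0 measureReal_nonneg E4 ET hV a0 a1 hG hT
    (sobolev_young hh.le y0 d0) (S.y2_le hh)

end

/-! ### The localized energy balance of the vertical shear -/

section

variable {h : ℝ}

/-- A horizontal cutoff function `φ` with values in `[0,1]` and gradient `φ1` bounded by `L`,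
together with a majorant `χ` of the indicator function of its support. -/
structure Cutoff (h L : ℝ) (φ : Plane → ℝ) (φ1 : Fin 3 → Plane → ℝ) (χ : Plane → ℝ) : Prop where
  d : H1 h (fun X => φ X.1) fun a X => φ1 a X.1
  nonneg : ∀ x, 0 ≤ φ x
  le_one : ∀ x, φ x ≤ 1
  bd : ∀ a x, |φ1 a x| ≤ L
  vert : φ1 2 = fun _ => 0
  supp : ∀ x, φ x ≠ 0 → 1 ≤ χ x
  supp1 : ∀ a x, φ1 a x ≠ 0 → 1 ≤ χ x
  χ_nonneg : ∀ x, 0 ≤ χ x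
  χ_le : ∃ C, ∀ x, χ x ≤ C
  χ_per : Per h fun X => χ X.1

namespace Cutoff

variable {L : ℝ} {φ : Plane → ℝ} {φ1 : Fin 3 → Plane → ℝ} {χ : Plane → ℝ}
  (H : Cutoff h L φ φ1 χ) (hh : 0 < h)

include H

theorem abs_le_one (x) : |φ x| ≤ 1 := by rw [abs_of_nonneg (H.nonneg x)]; exact H.le_one x

theorem le_χ (x) : φ x ≤ χ x := by
  by_cases h0 : φ x = 0
  · rw [h0]; exact H.χ_nonneg x
  · exact (H.le_one x).trans (H.supp x h0)

theorem L_nonneg : 0 ≤ L := (abs_nonneg _).trans (H.bd 0 0)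

theorem abs_φ1_le (a x) : |φ1 a x| ≤ L * χ x := by
  by_cases h0 : φ1 a x = 0
  · rw [h0, abs_zero]; exact mul_nonneg H.L_nonneg (H.χ_nonneg x)
  · exact (H.bd a x).trans (le_mul_of_one_le_right H.L_nonneg (H.supp1 a x h0))

theorem sq_φ1_le (a x) : φ1 a x ^ 2 ≤ L ^ 2 * χ x := by
  rw [← sq_abs, sq, sq, mul_assoc]
  exact mul_le_mul (H.bd a x) (H.abs_φ1_le a x) (abs_nonneg _) H.L_nonneg

theorem l2 {f : Pt → ℝ} (hf : L2P h f) : L2P h fun X => φ X.1 * f X :=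
  hf.bdd_mul (H.d 0).f2.per fun X => H.abs_le_one X.1

include hh in
theorem cut {a : Fin 3} {f g : Pt → ℝ} (hf : D1 h a f g) :
    D1 h a (fun X => φ X.1 * f X) fun X => φ1 a X.1 * f X + φ X.1 * g X :=
  (H.d a).mul hh hf (H.l2 hf.f2) (hf.f2.bdd_mul (H.d a).g2.per fun X => H.bd a X.1) (H.l2 hf.g2)

include hh in
theorem cut2 {a : Fin 3} {f g : Pt → ℝ} (hf : D1 h a f g) :
    D1 h a (fun X => φ X.1 * (φ X.1 * f X)) fun X => φ1 a X.1 * (φ X.1 * f X) +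
      φ X.1 * (φ1 a X.1 * f X + φ X.1 * g X) := H.cut hh (H.cut hh hf)

end Cutoff

/-- Pointwise Young inequality for the localized balance, with `x i j = φ ∂_j u_i`, `y i j = φ v_i u_j`,
`z i j = ∂_j φ u_i` and `t = φ T`. -/
theorem local_quadratic (x y z : Fin 2 → Fin 2 → ℝ) (t : ℝ) :
    -(x 0 0 + x 1 1) * t - 2 * (z 0 0 + z 1 1) * t
      + ∑ i, ∑ j, (-2 * (z i j * x i j) + 2 * (y i j * z i j) + x i j * y i j + y i i * x j j
        - y j i * z i j - 2 * (y j i * x i j)) ≤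
      (∑ i, ∑ j, x i j ^ 2) / 2 + 40 * (∑ i, ∑ j, y i j ^ 2) + 20 * (∑ i, ∑ j, z i j ^ 2)
        + 10 * t ^ 2 := by
  have key : ∀ i j, -2 * (z i j * x i j) + 2 * (y i j * z i j) + x i j * y i j + y i i * x j j
        - y j i * z i j - 2 * (y j i * x i j) ≤
      3 / 16 * x i j ^ 2 + x j j ^ 2 / 32 + 18 * z i j ^ 2 + 5 * y i j ^ 2 + 8 * y i i ^ 2
        + 17 * y j i ^ 2 := fun i j => by
    nlinarith [sq_nonneg (x i j + 16 * z i j), sq_nonneg (y i j - z i j),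
      sq_nonneg (x i j - 8 * y i j), sq_nonneg (x j j - 16 * y i i),
      sq_nonneg (y j i + z i j), sq_nonneg (x i j + 16 * y j i), sq_nonneg (z i j),
      sq_nonneg (y j i)]
  have k00 := key 0 0
  have k01 := key 0 1
  have k10 := key 1 0
  have k11 := key 1 1
  simp only [Fin.sum_univ_two]
  nlinarith [sq_nonneg (x 0 0 + 8 * t), sq_nonneg (x 1 1 + 8 * t), sq_nonneg (z 0 0 + t),
    sq_nonneg (z 1 1 + t), sq_nonneg (x 0 1), sq_nonneg (x 1 0), sq_nonneg (y 0 0),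
    sq_nonneg (y 0 1), sq_nonneg (y 1 0), sq_nonneg (y 1 1), sq_nonneg (z 0 0), sq_nonneg (z 1 1),
    sq_nonneg (z 0 1), sq_nonneg (z 1 0), sq_nonneg (x 0 0), sq_nonneg (x 1 1)]

namespace Fields
variable (s : Fields)

/-- `|u|²`, where `u = ∂_z v`. -/
def u2 (X : Pt) : ℝ := ∑ i, s.V1 i 2 X * s.V1 i 2 X

/-- `|∇_H u|²`. -/
def gradu (X : Pt) : ℝ := ∑ i, ∑ j : Fin 2, s.V2 i 2 j.castSucc X * s.V2 i 2 j.castSucc X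

/-- `|∂_z u|²`. -/
def uz (X : Pt) : ℝ := ∑ i, s.V2 i 2 2 X * s.V2 i 2 2 X

/-- `∂_z u · ∂_t v`. -/
def uzVt (X : Pt) : ℝ := ∑ i, s.V2 i 2 2 X * s.Vt i X

end Fields

namespace Slice

variable {f₀ ε : ℝ} {s : Fields} (S : Slice h f₀ ε s) (hh : 0 < h)
  {L : ℝ} {φ : Plane → ℝ} {φ1 : Fin 3 → Plane → ℝ} {χ : Plane → ℝ} (Φ : Cutoff h L φ φ1 χ)

include S hh Φ

/-- The localized energy balance of `u`: the momentum equation is multiplied by `-φ² ∂_z u`, and all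
terms that are derivatives of periodic functions are collected in `N`, which has integral zero. -/
theorem exists_local_balance : ∃ N : Pt → ℝ, NullInt h N ∧ ∀ᵐ X ∂mu h,
    -(φ X.1 ^ 2 * s.uzVt X) + φ X.1 ^ 2 * s.gradu X / 2 + ε * (φ X.1 ^ 2 * s.uz X) ≤
      N X + (40 * (φ X.1 ^ 2 * (s.q X * s.u2 X)) + 40 * L ^ 2 * (χ X.1 * s.u2 X) +
        10 * (s.T X * s.T X)) := by
  have U : ∀ i, H2 h (s.V1 i 2) (s.V2 i 2) (s.V3 i 2) := fun i => (S.hV i).2 2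
  have U2 : ∀ i a, D1 h a (fun X => φ X.1 * (φ X.1 * s.V1 i 2 X)) _ :=
    fun i a => Φ.cut2 hh ((U i).1 a)
  have V2 : ∀ i a, D1 h a (fun X => φ X.1 * (φ X.1 * s.V i X)) _ :=
    fun i a => Φ.cut2 hh ((S.hV i).1 a)
  have UU : ∀ i j, H1 h (fun X => s.V1 i 2 X * s.V1 j 2 X) _ := fun i j => (U i).mul hh (U j)
  -- the surface pressure does not depend on `z`
  have nP := NullInt.sum fun i => ((U2 i 2).mul_pd hh (S.hPz hh i)).null hh
  -- the baroclinic pressure, moved first off `∂_z` and then off the horizontal gradient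
  have nΘ := NullInt.sum fun i => ((U2 i 2).mul_pd hh (S.hΘjz hh i)).null hh
  have nT := NullInt.sum fun i : Fin 2 =>
    ((U2 i i.castSucc).mul_pd hh (S.hT.1 i.castSucc)).null hh
  -- the Coriolis force
  have nf0 := ((U2 0 2).mul_pd hh ((S.hV 1).1 2)).null hh
  have nf1 := ((U2 1 2).mul_pd hh ((S.hV 0).1 2)).null hh
  -- the horizontal viscosity
  have nd := NullInt.sum fun i => NullInt.sum fun j : Fin 2 =>
    ((U2 i 2).mul_pd hh (((S.hV i).2 j.castSucc).2 j.castSucc 2)).null hh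
  have nd' := NullInt.sum fun i => NullInt.sum fun j : Fin 2 =>
    ((U2 i j.castSucc).mul_pd hh ((U i).2 j.castSucc j.castSucc)).null hh
  -- the advection, differentiated in `z`, with its transport part in divergence form
  have nn := NullInt.sum fun i => NullInt.sum fun j : Fin 2 =>
    ((U2 i 2).mul_pd hh ((S.hV2 j).mul hh ((S.hV i).2 j.castSucc) 2)).null hh
  have nV := NullInt.sum fun i => NullInt.sum fun j : Fin 2 =>
    ((V2 j j.castSucc).mul_pd hh (UU i i j.castSucc)).null hh
  have nW := NullInt.sum fun i => ((S.hWz hh).mul_pd hh (Φ.cut2 hh (UU i i 2))).null hh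
  have nV' := NullInt.sum fun i => NullInt.sum fun j : Fin 2 =>
    ((V2 i j.castSucc).mul_pd hh (UU i j j.castSucc)).null hh
  refine ⟨_, (((nP.add (nΘ.smul (-1))).add (nT.add ((nf0.smul (-f₀)).add (nf1.smul f₀)))).add
    ((nd.smul (-1)).add nd')).add ((nn.add (nV.smul (1 / 2))).add
      ((nW.smul (-1 / 2)).add (nV'.smul (-1)))), ?_⟩
  filter_upwards [S.mom 0, S.mom 1, S.sym 0 0 2, S.sym 0 1 2, S.sym 1 0 2, S.sym 1 1 2,
    S.V3_comm hh 0 2 0, S.V3_comm hh 0 2 1, S.V3_comm hh 1 2 0, S.V3_comm hh 1 2 1]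
    with X m0 m1 s00 s01 s10 s11 t00 t01 t10 t11
  have Q := local_quadratic (fun i j => φ X.1 * s.V2 i 2 j.castSucc X)
    (fun i j => φ X.1 * s.V i X * s.V1 j 2 X) (fun i j => φ1 j.castSucc X.1 * s.V1 i 2 X)
    (φ X.1 * s.T X)
  have b0 := Φ.sq_φ1_le 0 X.1
  have b1 := Φ.sq_φ1_le 1 X.1
  have c0 : φ X.1 ^ 2 ≤ 1 := pow_le_one₀ (Φ.nonneg _) (Φ.le_one _)
  have v0 := congrFun Φ.vert X.1
  have B0 := mul_le_mul_of_nonneg_right b0 (add_nonneg (sq_nonneg (s.V1 0 2 X))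
    (sq_nonneg (s.V1 1 2 X)))
  have B1 := mul_le_mul_of_nonneg_right b1 (add_nonneg (sq_nonneg (s.V1 0 2 X))
    (sq_nonneg (s.V1 1 2 X)))
  have C0 := mul_le_mul_of_nonneg_right c0 (sq_nonneg (s.T X))
  simp only [Fin.sum_univ_two, Fields.rot, Fields.div, Fields.gradP, Fields.q, Fields.u2,
    Fields.gradu, Fields.uz, Fields.uzVt,
      Fin.castSucc_zero, Fin.castSucc_one, Matrix.cons_val_zero, Matrix.cons_val_one] at *
  simp only [s00, s01, s10, s11, ← t00, ← t01, ← t10, ← t11, v0] at *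
  linear_combination Q + 20 * B0 + 20 * B1 + 10 * C0 - φ X.1 ^ 2 * s.V2 0 2 2 X * m0 -
    φ X.1 ^ 2 * s.V2 1 2 2 X * m1

end Slice

end

/-! ### The localized energy inequality -/

section

variable {h : ℝ}

theorem Fields.u2_nonneg (s : Fields) (X : Pt) : 0 ≤ s.u2 X :=
  Finset.sum_nonneg fun _ _ => mul_self_nonneg _

theorem Fields.gradu_nonneg (s : Fields) (X : Pt) : 0 ≤ s.gradu X :=
  Finset.sum_nonneg fun _ _ => Finset.sum_nonneg fun _ _ => mul_self_nonneg _

theorem Fields.uz_nonneg (s : Fields) (X : Pt) : 0 ≤ s.uz X :=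
  Finset.sum_nonneg fun _ _ => mul_self_nonneg _

theorem Fields.U_sq_le_u2 (s : Fields) (i : Fin 2) (X : Pt) :
    s.V1 i 2 X * s.V1 i 2 X ≤ s.u2 X :=
  Finset.single_le_sum (f := fun i => s.V1 i 2 X * s.V1 i 2 X) (fun _ _ => mul_self_nonneg _)
    (Finset.mem_univ i)

namespace Cutoff

variable {L : ℝ} {φ : Plane → ℝ} {φ1 : Fin 3 → Plane → ℝ} {χ : Plane → ℝ}
  (H : Cutoff h L φ φ1 χ)

include H

theorem integrable_mul {f : Pt → ℝ} (hf : Integrable f (mu h)) :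
    Integrable (fun X => φ X.1 * f X) (mu h) :=
  hf.bdd_mul (c := 1) (H.d 0).f2.per.1.restrict (Eventually.of_forall fun X => H.abs_le_one X.1)

theorem integrable_sq_mul {f : Pt → ℝ} (hf : Integrable f (mu h)) :
    Integrable (fun X => φ X.1 ^ 2 * f X) (mu h) := by
  simpa only [sq, mul_assoc] using H.integrable_mul (H.integrable_mul hf)

theorem integrable_χ_mul {f : Pt → ℝ} (hf : Integrable f (mu h)) :
    Integrable (fun X => χ X.1 * f X) (mu h) := by
  obtain ⟨C, hC⟩ := H.χ_le
  exact hf.bdd_mul (c := C) H.χ_per.1.restrict (Eventually.of_forall fun X => by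
    rw [Real.norm_of_nonneg (H.χ_nonneg _)]; exact hC _)

end Cutoff

/-- A bound of the time derivative of the localized energy. -/
def localConst (h L : ℝ) : ℝ :=
  80 * (1 / (2 * h) + 1) * (2 * h) + 320 * (1 / (2 * h) + 1) * (1 + L) ^ 2 + 40 * L ^ 2 + 10

/-- The inverse of the threshold for the local smallness of `u`. -/
def smallConst (h : ℝ) : ℝ := 5120 * (1 / (2 * h) + 1)

namespace Slice

variable {f₀ ε : ℝ} {s : Fields} (S : Slice h f₀ ε s) (hh : 0 < h)

section
include S hh

theorem integrable_u2 : Integrable s.u2 (mu h) :=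
  integrable_finsetSum _ fun i _ => ((S.hV i).1.l2' 2).integrable_mul ((S.hV i).1.l2' 2)

theorem integrable_gradu : Integrable s.gradu (mu h) :=
  integrable_finsetSum _ fun i _ => integrable_finsetSum _ fun (j : Fin 2) _ =>
    (((S.hV i).2 2).1.l2' j.castSucc).integrable_mul (((S.hV i).2 2).1.l2' j.castSucc)

theorem integrable_uz : Integrable s.uz (mu h) :=
  integrable_finsetSum _ fun i _ =>
    (((S.hV i).2 2).1.l2' 2).integrable_mul (((S.hV i).2 2).1.l2' 2)

theorem integrable_uzVt : Integrable s.uzVt (mu h) :=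
  integrable_finsetSum _ fun i _ => (((S.hV i).2 2).1.l2' 2).mem.integrable_mul (S.hVt i)

theorem integrable_qu2 : Integrable (fun X => s.q X * s.u2 X) (mu h) := by
  have : ∀ i, Integrable (fun X => s.q X * s.V1 i 2 X * s.V1 i 2 X) (mu h) := fun i =>
    (S.hqV1 hh i 2).integrable_mul ((S.hV i).1.l2' 2)
  have := integrable_finsetSum Finset.univ fun i _ => this i
  simpa only [Fields.u2, Finset.mul_sum, mul_assoc] using this

theorem hu2 (a : Fin 3) : D1 h a s.u2
    fun X => ∑ i, (s.V2 i 2 a X * s.V1 i 2 X + s.V1 i 2 X * s.V2 i 2 a X) :=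
  D1.sum hh fun i => ((S.hV i).2 2).mul hh ((S.hV i).2 2) a

end

variable {L : ℝ} {φ : Plane → ℝ} {φ1 : Fin 3 → Plane → ℝ} {χ : Plane → ℝ}
  (Φ : Cutoff h L φ φ1 χ)

include S hh Φ

theorem mass_nonneg : 0 ≤ ∫ X in Om h, χ X.1 * s.u2 X :=
  integral_nonneg fun X => mul_nonneg (Φ.χ_nonneg _) (s.u2_nonneg X)

theorem lintegral_cut_u2_le : ∫⁻ X in Om h, ‖φ X.1 * s.u2 X‖ₑ ≤
    ENNReal.ofReal (∫ X in Om h, χ X.1 * s.u2 X) := by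
  rw [ofReal_integral_eq_lintegral_ofReal (Φ.integrable_χ_mul (S.integrable_u2 hh))
    (Eventually.of_forall fun X => mul_nonneg (Φ.χ_nonneg _) (s.u2_nonneg X))]
  refine lintegral_mono fun X => ?_
  rw [Real.enorm_of_nonneg (mul_nonneg (Φ.nonneg _) (s.u2_nonneg X))]
  exact ENNReal.ofReal_le_ofReal (mul_le_mul_of_nonneg_right (Φ.le_χ _) (s.u2_nonneg X))

/-- The horizontal gradient of `φ |u|²` in `L¹`. Where `φ ≠ 0`, the majorant `χ` is at least `1`. -/
theorem lintegral_cut_grad_le (j : Fin 2) :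
    ∫⁻ X in Om h, ‖φ1 j.castSucc X.1 * s.u2 X + φ X.1 * ∑ i, (s.V2 i 2 j.castSucc X * s.V1 i 2 X +
      s.V1 i 2 X * s.V2 i 2 j.castSucc X)‖ₑ ≤
    ENNReal.ofReal (L * (∫ X in Om h, χ X.1 * s.u2 X) +
      2 * √((∫ X in Om h, χ X.1 * s.u2 X) * ∫ X in Om h, φ X.1 ^ 2 * s.gradu X)) := by
  have L0 := Φ.L_nonneg
  have iM := Φ.integrable_χ_mul (S.integrable_u2 hh)
  have iA := Φ.integrable_sq_mul (S.integrable_gradu hh)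
  have nM : ∀ X : Pt, 0 ≤ χ X.1 * s.u2 X := fun X => mul_nonneg (Φ.χ_nonneg _) (s.u2_nonneg X)
  have nA : ∀ X : Pt, 0 ≤ φ X.1 ^ 2 * s.gradu X := fun X =>
    mul_nonneg (sq_nonneg _) (s.gradu_nonneg X)
  have M0 : 0 ≤ ∫ X in Om h, χ X.1 * s.u2 X := S.mass_nonneg hh Φ
  have A0 : 0 ≤ ∫ X in Om h, φ X.1 ^ 2 * s.gradu X := integral_nonneg nA
  have pt : ∀ X : Pt, ‖φ1 j.castSucc X.1 * s.u2 X + φ X.1 * ∑ i, (s.V2 i 2 j.castSucc X *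
      s.V1 i 2 X + s.V1 i 2 X * s.V2 i 2 j.castSucc X)‖ₑ ≤
      ENNReal.ofReal (L * (χ X.1 * s.u2 X)) +
        ENNReal.ofReal (√(χ X.1 * s.u2 X)) * ENNReal.ofReal (2 * √(φ X.1 ^ 2 * s.gradu X)) := by
    intro X
    refine (enorm_add_le _ _).trans (add_le_add ?_ ?_)
    · rw [Real.enorm_eq_ofReal_abs, abs_mul, abs_of_nonneg (s.u2_nonneg X), ← mul_assoc]
      exact ENNReal.ofReal_le_ofReal (mul_le_mul_of_nonneg_right (Φ.abs_φ1_le _ _)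
        (s.u2_nonneg X))
    · rw [Real.enorm_eq_ofReal_abs, ← ENNReal.ofReal_mul (Real.sqrt_nonneg _)]
      refine ENNReal.ofReal_le_ofReal ?_
      refine abs_le_of_sq_le_sq ?_ (by positivity)
      have e1 := Real.sq_sqrt (nM X)
      have e2 := Real.sq_sqrt (nA X)
      have e3 : (√(χ X.1 * s.u2 X) * (2 * √(φ X.1 ^ 2 * s.gradu X))) ^ 2 =
          4 * (χ X.1 * s.u2 X) * (φ X.1 ^ 2 * s.gradu X) := by
        rw [mul_pow, mul_pow, e1, e2]; ring
      rw [e3]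
      by_cases h0 : φ X.1 = 0
      · simp [h0]
      · have h1 := Φ.supp _ h0
        have cs : (∑ i, (s.V2 i 2 j.castSucc X * s.V1 i 2 X +
            s.V1 i 2 X * s.V2 i 2 j.castSucc X)) ^ 2 ≤ 4 * (s.u2 X * s.gradu X) := by
          have g1 : s.V2 0 2 j.castSucc X ^ 2 + s.V2 1 2 j.castSucc X ^ 2 ≤ s.gradu X := by
            rw [← Fin.sum_univ_two fun i => s.V2 i 2 j.castSucc X ^ 2]
            refine Finset.sum_le_sum fun i _ => ?_
            rw [sq]
            exact Finset.single_le_sum (f := fun j : Fin 2 =>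
              s.V2 i 2 j.castSucc X * s.V2 i 2 j.castSucc X)
              (fun _ _ => mul_self_nonneg _) (Finset.mem_univ j)
          have g2 := mul_le_mul_of_nonneg_left g1 (s.u2_nonneg X)
          simp only [Fields.u2, Fin.sum_univ_two] at *
          nlinarith [sq_nonneg (s.V1 0 2 X * s.V2 1 2 j.castSucc X -
            s.V1 1 2 X * s.V2 0 2 j.castSucc X)]
        have p : 0 ≤ φ X.1 ^ 2 * (4 * (s.u2 X * s.gradu X)) := by
          have := s.u2_nonneg X
          have := s.gradu_nonneg X
          positivity
        calc (φ X.1 * ∑ i, _) ^ 2 = φ X.1 ^ 2 * (∑ i, (s.V2 i 2 j.castSucc X * s.V1 i 2 X +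
            s.V1 i 2 X * s.V2 i 2 j.castSucc X)) ^ 2 := by ring
          _ ≤ φ X.1 ^ 2 * (4 * (s.u2 X * s.gradu X)) :=
              mul_le_mul_of_nonneg_left cs (sq_nonneg _)
          _ ≤ χ X.1 * (φ X.1 ^ 2 * (4 * (s.u2 X * s.gradu X))) := le_mul_of_one_le_left p h1
          _ = _ := by ring
  have m1 : AEMeasurable (fun X : Pt => ENNReal.ofReal (L * (χ X.1 * s.u2 X))) (mu h) :=
    (iM.1.aemeasurable.const_mul L).ennreal_ofReal
  have m2 : AEMeasurable (fun X : Pt => ENNReal.ofReal (√(χ X.1 * s.u2 X))) (mu h) :=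
    iM.1.aemeasurable.sqrt.ennreal_ofReal
  have m3 : AEMeasurable (fun X : Pt => ENNReal.ofReal (2 * √(φ X.1 ^ 2 * s.gradu X))) (mu h) :=
    (iA.1.aemeasurable.sqrt.const_mul 2).ennreal_ofReal
  refine (lintegral_mono pt).trans ?_
  rw [lintegral_add_left' m1, ENNReal.ofReal_add (by positivity) (by positivity)]
  refine add_le_add (le_of_eq ?_) ?_
  · rw [← integral_const_mul, ofReal_integral_eq_lintegral_ofReal (iM.const_mul L)
      (Eventually.of_forall fun X => mul_nonneg L0 (nM X))]
  · have cs := lintegral_mul_sq_le m2 m3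
    have e1 : ∫⁻ X in Om h, ENNReal.ofReal (√(χ X.1 * s.u2 X)) ^ 2 =
        ENNReal.ofReal (∫ X in Om h, χ X.1 * s.u2 X) := by
      rw [ofReal_integral_eq_lintegral_ofReal iM (Eventually.of_forall nM)]
      refine lintegral_congr fun X => ?_
      rw [← ENNReal.ofReal_pow (Real.sqrt_nonneg _), Real.sq_sqrt (nM X)]
    have e2 : ∫⁻ X in Om h, ENNReal.ofReal (2 * √(φ X.1 ^ 2 * s.gradu X)) ^ 2 =
        ENNReal.ofReal (4 * ∫ X in Om h, φ X.1 ^ 2 * s.gradu X) := by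
      rw [← integral_const_mul, ofReal_integral_eq_lintegral_ofReal (iA.const_mul 4)
        (Eventually.of_forall fun X => mul_nonneg (by norm_num) (nA X))]
      refine lintegral_congr fun X => ?_
      rw [← ENNReal.ofReal_pow (by positivity), mul_pow, Real.sq_sqrt (nA X)]
      norm_num
    rw [e1, e2, ← ENNReal.ofReal_mul M0] at cs
    refine (ENNReal.pow_le_pow_left_iff two_ne_zero).1 (cs.trans (le_of_eq ?_))
    rw [← ENNReal.ofReal_pow (by positivity), mul_pow, Real.sq_sqrt (mul_nonneg M0 A0)]
    congr 1; ring

/-- The two-dimensional Sobolev inequality for the localized vertical integral of `|u|²`. -/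
theorem lintegral_mz_cut_u2_le : ∫⁻ x in M, mz h (fun X => ‖φ X.1 * s.u2 X‖ₑ) x ^ 2 ≤
    ENNReal.ofReal (2 * (1 + L) ^ 2 * (∫ X in Om h, χ X.1 * s.u2 X) ^ 2 +
      8 * (∫ X in Om h, χ X.1 * s.u2 X) * ∫ X in Om h, φ X.1 ^ 2 * s.gradu X) := by
  have H := (Φ.cut hh (S.hu2 hh 0)).pd.sobolev hh (Φ.cut hh (S.hu2 hh 1)).pd
  have L0 := Φ.L_nonneg
  have M0 := S.mass_nonneg hh Φ
  have A0 : 0 ≤ ∫ X in Om h, φ X.1 ^ 2 * s.gradu X :=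
    integral_nonneg fun X => mul_nonneg (sq_nonneg _) (s.gradu_nonneg X)
  have b0 := S.lintegral_cut_u2_le hh Φ
  have e := fun j => add_le_add b0 (S.lintegral_cut_grad_le hh Φ j)
  set m := ∫ X in Om h, χ X.1 * s.u2 X
  set A := ∫ X in Om h, φ X.1 ^ 2 * s.gradu X
  refine (H.trans (mul_le_mul' (e 0) (e 1))).trans ?_
  rw [← ENNReal.ofReal_add M0 (by positivity), ← ENNReal.ofReal_mul (by positivity)]
  refine ENNReal.ofReal_le_ofReal ?_
  have e2 := Real.sq_sqrt (mul_nonneg M0 A0)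
  nlinarith [sq_nonneg ((1 + L) * m - 2 * √(m * A))]

/-- The critical term `∫ φ² |v|² |u|²`. On vertical lines `|v|²` is bounded by the integrals of `|v|²` and
`|u|²`; the horizontal Sobolev inequality bounds the square of the vertical integral of `φ |u|²`. -/
theorem integral_cut_qu2_le : ∫ X in Om h, φ X.1 ^ 2 * (s.q X * s.u2 X) ≤
    2 * (1 / (2 * h) + 1) * (2 * h * s.y4 h + 2 * (2 * (1 + L) ^ 2 *
      (∫ X in Om h, χ X.1 * s.u2 X) ^ 2 +
      8 * (∫ X in Om h, χ X.1 * s.u2 X) * ∫ X in Om h, φ X.1 ^ 2 * s.gradu X)) := by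
  have M0 := S.mass_nonneg hh Φ
  have A0 : 0 ≤ ∫ X in Om h, φ X.1 ^ 2 * s.gradu X :=
    integral_nonneg fun X => mul_nonneg (sq_nonneg _) (s.gradu_nonneg X)
  have y0 := s.y4_nonneg (h := h)
  have Hs := S.lintegral_mz_cut_u2_le hh Φ
  set R := 2 * (1 + L) ^ 2 * (∫ X in Om h, χ X.1 * s.u2 X) ^ 2 +
      8 * (∫ X in Om h, χ X.1 * s.u2 X) * ∫ X in Om h, φ X.1 ^ 2 * s.gradu X with hR
  have R0 : 0 ≤ R := by positivity
  have hq := (S.hq1 hh).l2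
  have mq : AEMeasurable (mz h fun X => ‖s.q X‖ₑ) (volume.restrict M) :=
    aemeasurable_mz hq.per.1.enorm.restrict
  have mu2 : AEMeasurable (mz h fun X => ‖s.u2 X‖ₑ) (volume.restrict M) :=
    aemeasurable_mz (S.hu2 hh 0).f2.per.1.enorm.restrict
  have mφ : AEMeasurable (fun x => ‖φ x‖ₑ) (volume.restrict M) := by
    have := aemeasurable_mz (h := h) (Φ.d 0).f2.per.1.enorm.restrict
    have e : (fun x => ‖φ x‖ₑ) = fun x => (ENNReal.ofReal (2 * h))⁻¹ *
        mz h (fun X => ‖φ X.1‖ₑ) x := by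
      funext x
      rw [mz_of_fst (fun x => ‖φ x‖ₑ), ← mul_assoc,
        ENNReal.inv_mul_cancel (ofReal_two_mul_ne_zero hh) ENNReal.ofReal_ne_top, one_mul]
    rw [e]
    exact this.const_mul _
  have nn : ∀ X : Pt, 0 ≤ φ X.1 ^ 2 * (s.q X * s.u2 X) := fun X =>
    mul_nonneg (sq_nonneg _) (mul_nonneg (s.q_nonneg X) (s.u2_nonneg X))
  have ii := Φ.integrable_sq_mul (S.integrable_qu2 hh)
  set A : Plane → ℝ≥0∞ := fun x => 2 * cz h * (mz h (fun X => ‖s.q X‖ₑ) x +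
    mz h (fun X => ‖s.u2 X‖ₑ) x) * ‖φ x‖ₑ ^ 2 with hA
  have mA : AEMeasurable A (volume.restrict M) := ((mq.add mu2).const_mul _).mul (mφ.pow_const 2)
  -- replace `|v|²` by its bound on vertical lines
  have st1 : ENNReal.ofReal (∫ X in Om h, φ X.1 ^ 2 * (s.q X * s.u2 X)) ≤
      ∫⁻ X in Om h, A X.1 * ‖s.u2 X‖ₑ := by
    rw [ofReal_integral_eq_lintegral_ofReal ii (Eventually.of_forall nn)]
    refine lintegral_mono_ae ?_
    filter_upwards [sup_sq hh ((S.hV 0).1 2), sup_sq hh ((S.hV 1).1 2)] with X h0 h1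
    have k : ∀ i, mz h (fun X => ‖s.V i X‖ₑ ^ 2) X.1 + mz h (fun X => ‖s.V1 i 2 X‖ₑ ^ 2) X.1 ≤
        mz h (fun X => ‖s.q X‖ₑ) X.1 + mz h (fun X => ‖s.u2 X‖ₑ) X.1 := by
      intro i
      refine add_le_add (lintegral_mono fun z => ?_) (lintegral_mono fun z => ?_)
      · simp only
        rw [← enorm_sq_eq, Real.enorm_of_nonneg (mul_self_nonneg _),
          Real.enorm_of_nonneg (s.q_nonneg _)]
        exact ENNReal.ofReal_le_ofReal (s.V_sq_le_q i _)
      · simp only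
        rw [← enorm_sq_eq, Real.enorm_of_nonneg (mul_self_nonneg _),
          Real.enorm_of_nonneg (s.u2_nonneg _)]
        exact ENNReal.ofReal_le_ofReal (s.U_sq_le_u2 i _)
    have hq' : ENNReal.ofReal (s.q X) ≤ 2 * cz h * (mz h (fun X => ‖s.q X‖ₑ) X.1 +
        mz h (fun X => ‖s.u2 X‖ₑ) X.1) := by
      rw [Fields.q, Fin.sum_univ_two, ENNReal.ofReal_add (mul_self_nonneg _) (mul_self_nonneg _),
        ← Real.enorm_of_nonneg (mul_self_nonneg _), ← Real.enorm_of_nonneg (mul_self_nonneg _),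
        enorm_sq_eq, enorm_sq_eq]
      refine (add_le_add (h0.trans (mul_le_mul_right (k 0) _))
        (h1.trans (mul_le_mul_right (k 1) _))).trans (le_of_eq ?_)
      ring
    rw [ENNReal.ofReal_mul (sq_nonneg _), ENNReal.ofReal_mul (s.q_nonneg X)]
    simp only [hA]
    rw [Real.enorm_of_nonneg (s.u2_nonneg X), Real.enorm_of_nonneg (Φ.nonneg _),
      ← ENNReal.ofReal_pow (Φ.nonneg _)]
    calc _ = ENNReal.ofReal (s.q X) * ENNReal.ofReal (φ X.1 ^ 2) * ENNReal.ofReal (s.u2 X) := by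
          ring
      _ ≤ _ := by gcongr
  rw [lintegral_mz_mul (S.hu2 hh 0).f2.per.1.enorm.restrict mA] at st1
  -- the remaining integrals over vertical lines are products, estimated by squares
  have st2 : ∀ x, A x * mz h (fun X => ‖s.u2 X‖ₑ) x ≤ 2 * cz h *
      (mz h (fun X => ‖s.q X‖ₑ) x ^ 2 + 2 * mz h (fun X => ‖φ X.1 * s.u2 X‖ₑ) x ^ 2) := by
    intro x
    have eP : mz h (fun X => ‖φ X.1 * s.u2 X‖ₑ) x = ‖φ x‖ₑ * mz h (fun X => ‖s.u2 X‖ₑ) x := by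
      simp only [mz, enorm_mul]
      exact lintegral_const_mul' _ _ enorm_ne_top
    have p1 : ‖φ x‖ₑ ≤ 1 := by
      rw [Real.enorm_of_nonneg (Φ.nonneg _)]
      exact (ENNReal.ofReal_le_ofReal (Φ.le_one x)).trans (by simp)
    set a := mz h (fun X => ‖s.q X‖ₑ) x
    set b := mz h (fun X => ‖s.u2 X‖ₑ) x
    rw [eP, hA]
    have ab : a * (‖φ x‖ₑ * b) ≤ a ^ 2 + (‖φ x‖ₑ * b) ^ 2 := by
      rcases le_total a (‖φ x‖ₑ * b) with h1 | h1
      · exact (mul_le_mul_left h1 _).trans (by rw [← sq]; exact le_add_self)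
      · exact (mul_le_mul_right h1 _).trans (by rw [← sq]; exact le_self_add)
    calc _ = 2 * cz h * (‖φ x‖ₑ * (a * (‖φ x‖ₑ * b)) + (‖φ x‖ₑ * b) ^ 2) := by ring
      _ ≤ 2 * cz h * (1 * (a ^ 2 + (‖φ x‖ₑ * b) ^ 2) + (‖φ x‖ₑ * b) ^ 2) := by gcongr
      _ = _ := by ring
  have czt : cz h ≠ ⊤ := by simp [cz]
  have st3 := st1.trans (lintegral_mono st2)
  rw [lintegral_const_mul' _ _ (ENNReal.mul_ne_top (by simp) czt),
    lintegral_add_left' (mq.pow_const 2), lintegral_const_mul' _ _ (by simp)] at st3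
  have st4 : ∫⁻ x in M, mz h (fun X => ‖s.q X‖ₑ) x ^ 2 ≤ ENNReal.ofReal (2 * h * s.y4 h) := by
    refine (lintegral_mono_ae (mz_sq_le hq.per)).trans (le_of_eq ?_)
    rw [lintegral_const_mul' _ _ ENNReal.ofReal_ne_top, ← normSq_eq_mz hq.per, hq.normSq_eq,
      ← ENNReal.ofReal_mul (by positivity)]
    rfl
  have st5 : ENNReal.ofReal (∫ X in Om h, φ X.1 ^ 2 * (s.q X * s.u2 X)) ≤
      ENNReal.ofReal (2 * (1 / (2 * h) + 1) * (2 * h * s.y4 h + 2 * R)) := by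
    refine st3.trans ?_
    rw [ENNReal.ofReal_mul (by positivity), ENNReal.ofReal_add (by positivity) (by positivity),
      ENNReal.ofReal_mul (by positivity) (q := 1 / (2 * h) + 1),
      ENNReal.ofReal_add (by positivity) (by norm_num), ENNReal.ofReal_mul (by norm_num) (q := R)]
    simp only [ENNReal.ofReal_one, ENNReal.ofReal_ofNat, cz]
    gcongr
  rwa [ENNReal.ofReal_le_ofReal_iff (by positivity)] at st5

/-- The localized energy inequality for `u`, under the smallness condition on `χ|u|²`. -/
theorem local_rate (hs : smallConst h * ∫ X in Om h, χ X.1 * s.u2 X ≤ 1) :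
    -(∫ X in Om h, φ X.1 ^ 2 * s.uzVt X) + (∫ X in Om h, φ X.1 ^ 2 * s.gradu X) / 4 +
      ε * (∫ X in Om h, φ X.1 ^ 2 * s.uz X) ≤
      localConst h L * (1 + s.y4 h + ∫ X in Om h, s.T X * s.T X) := by
  obtain ⟨N, hN, hb⟩ := S.exists_local_balance hh Φ
  have i1 := Φ.integrable_sq_mul (S.integrable_uzVt hh)
  have i2 := Φ.integrable_sq_mul (S.integrable_gradu hh)
  have i3 := Φ.integrable_sq_mul (S.integrable_uz hh)
  have i4 := Φ.integrable_sq_mul (S.integrable_qu2 hh)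
  have i5 := Φ.integrable_χ_mul (S.integrable_u2 hh)
  have i6 := S.hT.1.l2.integrable_mul S.hT.1.l2
  have i1' : Integrable (fun X : Pt => -(φ X.1 ^ 2 * s.uzVt X)) (mu h) := i1.neg
  have i12 : Integrable (fun X : Pt => -(φ X.1 ^ 2 * s.uzVt X) + φ X.1 ^ 2 * s.gradu X / 2)
    (mu h) := i1.neg.add (i2.div_const 2)
  have H : ∫ X in Om h, (-(φ X.1 ^ 2 * s.uzVt X) + φ X.1 ^ 2 * s.gradu X / 2 +
      ε * (φ X.1 ^ 2 * s.uz X)) ≤ ∫ X in Om h, (N X + (40 * (φ X.1 ^ 2 * (s.q X * s.u2 X)) +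
        40 * L ^ 2 * (χ X.1 * s.u2 X) + 10 * (s.T X * s.T X))) :=
    integral_mono_ae (i12.add (i3.const_mul ε)) (hN.1.add (((i4.const_mul 40).add
      (i5.const_mul (40 * L ^ 2))).add (i6.const_mul 10))) hb
  have e := integral_linear_four (a := 1) (b := 40) (c := 40 * L ^ 2) (d := 10) hN.1 i4 i5 i6
  simp only [one_mul] at e
  rw [e, hN.2, integral_add i12 (i3.const_mul ε), integral_add i1' (i2.div_const 2),
    integral_neg, integral_div, integral_const_mul] at H
  have Q := S.integral_cut_qu2_le hh Φ
  have M0 := S.mass_nonneg hh Φ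
  have A0 : 0 ≤ ∫ X in Om h, φ X.1 ^ 2 * s.gradu X :=
    integral_nonneg fun X => mul_nonneg (sq_nonneg _) (s.gradu_nonneg X)
  have T0 : 0 ≤ ∫ X in Om h, s.T X * s.T X := integral_nonneg fun X => mul_self_nonneg _
  have y0 := s.y4_nonneg (h := h)
  set m := ∫ X in Om h, χ X.1 * s.u2 X
  set A := ∫ X in Om h, φ X.1 ^ 2 * s.gradu X
  set τ := ∫ X in Om h, s.T X * s.T X
  set c := 1 / (2 * h) + 1 with hc
  have c1 : 1 ≤ c := by rw [hc]; have : 0 < 1 / (2 * h) := by positivity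
                        linarith
  -- `5120 = 40 · 2 · 2 · 8 · 4`: the factor of `m ∫ φ² |∇_H u|²` is then at most `1/4`
  have hs' : 5120 * c * m ≤ 1 := hs
  have m1 : m ≤ 1 := by nlinarith
  have m2 : m ^ 2 ≤ 1 := pow_le_one₀ M0 m1
  have k1 : 5120 * c * m * A ≤ A := mul_le_of_le_one_left A0 hs'
  have k2 : 320 * c * (1 + L) ^ 2 * m ^ 2 ≤ 320 * c * (1 + L) ^ 2 :=
    mul_le_of_le_one_right (by positivity) m2
  have k3 : 40 * L ^ 2 * m ≤ 40 * L ^ 2 := mul_le_of_le_one_right (by positivity) m1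
  have fin : localConst h L * (1 + s.y4 h + τ) = (80 * c * (2 * h) + 320 * c * (1 + L) ^ 2 +
    40 * L ^ 2 + 10) * (1 + s.y4 h + τ) := rfl
  rw [fin]
  have p1 : 0 ≤ 80 * c * (2 * h) * (1 + τ) := by positivity
  have p2 : 0 ≤ (320 * c * (1 + L) ^ 2 + 40 * L ^ 2) * (s.y4 h + τ) := by positivity
  have p3 : 0 ≤ 10 * (1 + s.y4 h) := by positivity
  linear_combination H + 40 * Q + k1 / 4 + k2 + k3 + p1 + p2 + p3

end Slice

end

/-! ### Periodic cutoff functions -/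

section

variable {h ρ : ℝ}

/-- A smooth function of period `1` which equals `1` at distance at most `ρ` from `ℤ` and
vanishes at distance at least `2ρ` from `ℤ`. -/
def theta (ρ s : ℝ) : ℝ :=
  Real.smoothTransition ((Real.cos (2 * Real.pi * s) - Real.cos (4 * Real.pi * ρ)) /
    (Real.cos (2 * Real.pi * ρ) - Real.cos (4 * Real.pi * ρ)))

/-- Both angles lie in `[0, π]`, where the cosine decreases. -/
theorem theta_den_pos (h0 : 0 < ρ) (h1 : ρ ≤ 1 / 8) :
    0 < Real.cos (2 * Real.pi * ρ) - Real.cos (4 * Real.pi * ρ) := by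
  have p := Real.pi_pos
  have := Real.strictAntiOn_cos (a := 2 * Real.pi * ρ) (b := 4 * Real.pi * ρ)
    ⟨by positivity, by nlinarith⟩ ⟨by positivity, by nlinarith⟩ (by nlinarith)
  linarith

theorem theta_contDiff (ρ : ℝ) : ContDiff ℝ ∞ (theta ρ) := by
  unfold theta
  refine Real.smoothTransition.contDiff.comp ?_
  fun_prop

theorem theta_periodic (ρ : ℝ) : Function.Periodic (theta ρ) 1 := fun s => by
  unfold theta
  rw [mul_add, mul_one, Real.cos_add_two_pi]

theorem theta_nonneg (ρ s : ℝ) : 0 ≤ theta ρ s := Real.smoothTransition.nonneg _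
theorem theta_le_one (ρ s : ℝ) : theta ρ s ≤ 1 := Real.smoothTransition.le_one _

theorem cos_two_pi_sub_int (s : ℝ) (n : ℤ) :
    Real.cos (2 * Real.pi * (s - n)) = Real.cos (2 * Real.pi * s) := by
  rw [mul_sub, mul_comm (2 * Real.pi) (n : ℝ), Real.cos_sub_int_mul_two_pi]

theorem theta_eq_one (h0 : 0 < ρ) (h1 : ρ ≤ 1 / 8) {s : ℝ} {n : ℤ} (hs : |s - n| ≤ ρ) :
    theta ρ s = 1 := by
  have p := Real.pi_pos
  unfold theta
  refine Real.smoothTransition.one_of_one_le ?_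
  rw [one_le_div (theta_den_pos h0 h1)]
  refine sub_le_sub_right ?_ _
  rw [← cos_two_pi_sub_int s n, ← Real.cos_abs (2 * Real.pi * (s - n)), abs_mul,
    abs_of_pos (by positivity : 0 < 2 * Real.pi)]
  exact Real.cos_le_cos_of_nonneg_of_le_pi (by positivity) (by nlinarith) (by nlinarith)

theorem exists_int_of_cos_le (h0 : 0 < ρ) (h1 : ρ ≤ 1 / 8) {s : ℝ}
    (hs : Real.cos (4 * Real.pi * ρ) ≤ Real.cos (2 * Real.pi * s)) : ∃ n : ℤ, |s - n| ≤ 2 * ρ := by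
  have p := Real.pi_pos
  refine ⟨round s, ?_⟩
  have hr := abs_sub_round s
  by_contra hc
  rw [not_le] at hc
  rw [← cos_two_pi_sub_int s (round s), ← Real.cos_abs (2 * Real.pi * (s - _)), abs_mul,
    abs_of_pos (by positivity : 0 < 2 * Real.pi)] at hs
  have := Real.cos_lt_cos_of_nonneg_of_le_pi (x := 4 * Real.pi * ρ)
    (y := 2 * Real.pi * |s - round s|) (by positivity) (by nlinarith) (by nlinarith)
  linarith

theorem theta_eq_zero_of_cos_lt (h0 : 0 < ρ) (h1 : ρ ≤ 1 / 8) {s : ℝ}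
    (hs : Real.cos (2 * Real.pi * s) < Real.cos (4 * Real.pi * ρ)) : theta ρ s = 0 :=
  Real.smoothTransition.zero_of_nonpos
    (div_nonpos_of_nonpos_of_nonneg (by linarith) (theta_den_pos h0 h1).le)

theorem exists_int_of_theta_ne_zero (h0 : 0 < ρ) (h1 : ρ ≤ 1 / 8) {s : ℝ}
    (hs : theta ρ s ≠ 0) : ∃ n : ℤ, |s - n| ≤ 2 * ρ := by
  refine exists_int_of_cos_le h0 h1 ?_
  by_contra hc
  exact hs (theta_eq_zero_of_cos_lt h0 h1 (not_le.1 hc))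

theorem exists_int_of_deriv_theta_ne_zero (h0 : 0 < ρ) (h1 : ρ ≤ 1 / 8) {s : ℝ}
    (hs : deriv (theta ρ) s ≠ 0) : ∃ n : ℤ, |s - n| ≤ 2 * ρ := by
  refine exists_int_of_cos_le h0 h1 ?_
  by_contra hc
  refine hs ?_
  have ho : IsOpen {s : ℝ | Real.cos (2 * Real.pi * s) < Real.cos (4 * Real.pi * ρ)} :=
    isOpen_lt (by fun_prop) continuous_const
  have e : theta ρ =ᶠ[𝓝 s] fun _ => 0 := by
    filter_upwards [ho.mem_nhds (not_le.1 hc)] with r hr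
    exact theta_eq_zero_of_cos_lt h0 h1 hr
  rw [e.deriv_eq, deriv_const]

/-- The sum of the squares of three translates of `theta` is a majorant of its support. -/
def theta3 (ρ s : ℝ) : ℝ :=
  theta ρ (s + 2 * ρ) ^ 2 + theta ρ s ^ 2 + theta ρ (s - 2 * ρ) ^ 2

theorem theta3_nonneg (ρ s : ℝ) : 0 ≤ theta3 ρ s := by unfold theta3; positivity

theorem theta3_le (ρ s : ℝ) : theta3 ρ s ≤ 3 := by
  have : ∀ r, theta ρ r ^ 2 ≤ 1 := fun r => pow_le_one₀ (theta_nonneg _ _) (theta_le_one _ _)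
  unfold theta3
  linarith [this (s + 2 * ρ), this s, this (s - 2 * ρ)]

theorem one_le_theta3 (h0 : 0 < ρ) (h1 : ρ ≤ 1 / 8) {s : ℝ} {n : ℤ} (hs : |s - n| ≤ 2 * ρ) :
    1 ≤ theta3 ρ s := by
  have a := sq_nonneg (theta ρ (s + 2 * ρ))
  have b := sq_nonneg (theta ρ s)
  have c := sq_nonneg (theta ρ (s - 2 * ρ))
  rw [abs_le] at hs
  unfold theta3
  rcases le_total (s - n) (-ρ) with h2 | h2
  · have := theta_eq_one h0 h1 (s := s + 2 * ρ) (n := n) (abs_le.2 ⟨by linarith, by linarith⟩)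
    rw [this] at a ⊢; linarith
  rcases le_total (s - n) ρ with h3 | h3
  · have := theta_eq_one h0 h1 (s := s) (n := n) (abs_le.2 ⟨by linarith, by linarith⟩)
    rw [this] at b ⊢; linarith
  · have := theta_eq_one h0 h1 (s := s - 2 * ρ) (n := n) (abs_le.2 ⟨by linarith, by linarith⟩)
    rw [this] at c ⊢; linarith

theorem exists_deriv_theta_bound (ρ : ℝ) : ∃ B, ∀ s, |deriv (theta ρ) s| ≤ B := by
  have hc : Continuous (deriv (theta ρ)) :=
    (theta_contDiff ρ).continuous_deriv (by norm_cast)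
  have hp : Function.Periodic (deriv (theta ρ)) 1 := fun s => by
    have : (fun x => theta ρ (x + 1)) = theta ρ := funext (theta_periodic ρ)
    rw [← deriv_comp_add_const, this]
  obtain ⟨B, hB⟩ := (hp.isBounded_of_continuous one_ne_zero hc).exists_norm_le
  exact ⟨B, fun s => hB _ (mem_range_self s)⟩

theorem deriv_theta_periodic (ρ : ℝ) : Function.Periodic (deriv (theta ρ)) 1 := fun s => by
  have : (fun x => theta ρ (x + 1)) = theta ρ := funext (theta_periodic ρ)
  rw [← deriv_comp_add_const, this]

/-- The cutoff function centred at `a`. -/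
def cutφ (ρ : ℝ) (a x : Plane) : ℝ := theta ρ (x 0 - a 0) * theta ρ (x 1 - a 1)

/-- The derivatives of the cutoff function. -/
def cutφ1 (ρ : ℝ) (a : Plane) : Fin 3 → Plane → ℝ :=
  ![fun x => deriv (theta ρ) (x 0 - a 0) * theta ρ (x 1 - a 1),
    fun x => theta ρ (x 0 - a 0) * deriv (theta ρ) (x 1 - a 1), fun _ => 0]

/-- A majorant of the indicator function of the support of the cutoff function. -/
def cutχ (ρ : ℝ) (a x : Plane) : ℝ := theta3 ρ (x 0 - a 0) * theta3 ρ (x 1 - a 1)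

/-- A product of continuous functions of period one in the horizontal variables. -/
theorem l2P_tensor {f g : ℝ → ℝ} (hf : Continuous f) (hg : Continuous g)
    (pf : Function.Periodic f 1) (pg : Function.Periodic g 1) (a : Plane) :
    L2P h fun X => f (X.1 0 - a 0) * g (X.1 1 - a 1) := by
  have c0 : ∀ j : Fin 2, Continuous fun X : Pt => X.1 j := fun j => by fun_prop
  have hc : Continuous fun X : Pt => f (X.1 0 - a 0) * g (X.1 1 - a 1) :=
    (hf.comp ((c0 0).sub continuous_const)).mul (hg.comp ((c0 1).sub continuous_const))
  obtain ⟨A, hA⟩ := (pf.isBounded_of_continuous one_ne_zero hf).exists_norm_le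
  obtain ⟨B, hB⟩ := (pg.isBounded_of_continuous one_ne_zero hg).exists_norm_le
  refine ⟨⟨hc.aestronglyMeasurable, fun j => Eventually.of_forall fun X => ?_,
    Eventually.of_forall fun X => ?_⟩, ?_⟩
  · fin_cases j
    · have := pf (X.1 0 - a 0)
      simp only [eH]
      simp [← this]
      left; congr 1; ring
    · have := pg (X.1 1 - a 1)
      simp only [eH]
      simp [← this]
      left; congr 1; ring
  · simp [eZ]
  · refine MemLp.of_bound hc.aestronglyMeasurable (A * B) (Eventually.of_forall fun X => ?_)
    rw [norm_mul]
    exact mul_le_mul (hA _ (mem_range_self _)) (hB _ (mem_range_self _)) (norm_nonneg _)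
      ((norm_nonneg _).trans (hA _ (mem_range_self 0)))

theorem theta_ftc (ρ c s : ℝ) :
    theta ρ (c + s) = theta ρ c + ∫ r in (0 : ℝ)..s, deriv (theta ρ) (c + r) := by
  have hc : Continuous (deriv (theta ρ)) :=
    (theta_contDiff ρ).continuous_deriv (by norm_cast)
  rw [intervalIntegral.integral_comp_add_left (fun r => deriv (theta ρ) r),
    intervalIntegral.integral_deriv_eq_sub
      (fun x _ => ((theta_contDiff ρ).differentiable (by simp)) x) (hc.intervalIntegrable _ _)]
  simp

theorem cutφ_h1 (ρ : ℝ) (a : Plane) :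
    H1 h (fun X => cutφ ρ a X.1) fun b X => cutφ1 ρ a b X.1 := by
  have hc : Continuous (theta ρ) := (theta_contDiff ρ).continuous
  have hc' : Continuous (deriv (theta ρ)) := (theta_contDiff ρ).continuous_deriv (by norm_cast)
  have l0 : L2P h fun X => cutφ ρ a X.1 :=
    l2P_tensor hc hc (theta_periodic ρ) (theta_periodic ρ) a
  intro b
  fin_cases b
  · have l1 : L2P h fun X => cutφ1 ρ a 0 X.1 :=
      l2P_tensor hc' hc (deriv_theta_periodic ρ) (theta_periodic ρ) a
    refine ⟨l0, l1, PD.of_ae l0.per l1.per l0.integrable l1.integrable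
      (Eventually.of_forall fun s => Eventually.of_forall fun X => ?_)⟩
    have := theta_ftc ρ (X.1 0 - a 0) s
    simp [cutφ, cutφ1, dir, eH]
    have e : ∀ r, X.1 0 + r - a 0 = X.1 0 - a 0 + r := fun r => by ring
    simp only [e, this]
    ring
  · have l1 : L2P h fun X => cutφ1 ρ a 1 X.1 :=
      l2P_tensor hc hc' (theta_periodic ρ) (deriv_theta_periodic ρ) a
    refine ⟨l0, l1, PD.of_ae l0.per l1.per l0.integrable l1.integrable
      (Eventually.of_forall fun s => Eventually.of_forall fun X => ?_)⟩
    have := theta_ftc ρ (X.1 1 - a 1) s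
    simp [cutφ, cutφ1, dir, eH]
    have e : ∀ r, X.1 1 + r - a 1 = X.1 1 - a 1 + r := fun r => by ring
    simp only [e, this]
    ring
  · exact fst_vertical l0

/-- The cutoff functions, with a bound of their gradients which does not depend on the centre. -/
theorem exists_cutoff (h0 : 0 < ρ) (h1 : ρ ≤ 1 / 8) :
    ∃ L, ∀ (h : ℝ) (a : Plane), Cutoff h L (cutφ ρ a) (cutφ1 ρ a) (cutχ ρ a) := by
  obtain ⟨B, hB⟩ := exists_deriv_theta_bound ρ
  have B0 : 0 ≤ B := (abs_nonneg _).trans (hB 0)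
  have hc : Continuous (theta ρ) := (theta_contDiff ρ).continuous
  have c3 : Continuous (theta3 ρ) := by unfold theta3; fun_prop
  have p3 : Function.Periodic (theta3 ρ) 1 := fun s => by
    have e1 := theta_periodic ρ (s + 2 * ρ)
    have e2 := theta_periodic ρ s
    have e3 := theta_periodic ρ (s - 2 * ρ)
    unfold theta3
    rw [← e1, ← e2, ← e3]
    congr 3 <;> ring_nf
  have at1 : ∀ s, |theta ρ s| ≤ 1 := fun s => by
    rw [abs_of_nonneg (theta_nonneg _ _)]; exact theta_le_one _ _
  have p1 : ∀ x y : ℝ, 1 ≤ x → 1 ≤ y → 1 ≤ x * y := fun x y hx hy => by nlinarith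
  refine ⟨B, fun h a => ⟨cutφ_h1 ρ a, fun x => mul_nonneg (theta_nonneg _ _) (theta_nonneg _ _),
    fun x => mul_le_one₀ (theta_le_one _ _) (theta_nonneg _ _) (theta_le_one _ _), ?_, rfl, ?_, ?_,
    fun x => mul_nonneg (theta3_nonneg _ _) (theta3_nonneg _ _), ⟨9, fun x => ?_⟩,
    (l2P_tensor c3 c3 p3 p3 a).per⟩⟩
  · intro b x
    fin_cases b
    · change |_ * _| ≤ B
      rw [abs_mul]
      exact (mul_le_of_le_one_right (abs_nonneg _) (at1 _)).trans (hB _)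
    · change |_ * _| ≤ B
      rw [abs_mul, mul_comm]
      exact (mul_le_of_le_one_right (abs_nonneg _) (at1 _)).trans (hB _)
    · change |(0 : ℝ)| ≤ B
      rwa [abs_zero]
  · intro x hx
    obtain ⟨n, hn⟩ := exists_int_of_theta_ne_zero h0 h1 (left_ne_zero_of_mul hx)
    obtain ⟨m, hm⟩ := exists_int_of_theta_ne_zero h0 h1 (right_ne_zero_of_mul hx)
    exact p1 _ _ (one_le_theta3 h0 h1 hn) (one_le_theta3 h0 h1 hm)
  · intro b x hx
    fin_cases b
    · obtain ⟨n, hn⟩ := exists_int_of_deriv_theta_ne_zero h0 h1 (left_ne_zero_of_mul hx)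
      obtain ⟨m, hm⟩ := exists_int_of_theta_ne_zero h0 h1 (right_ne_zero_of_mul hx)
      exact p1 _ _ (one_le_theta3 h0 h1 hn) (one_le_theta3 h0 h1 hm)
    · obtain ⟨n, hn⟩ := exists_int_of_theta_ne_zero h0 h1 (left_ne_zero_of_mul hx)
      obtain ⟨m, hm⟩ := exists_int_of_deriv_theta_ne_zero h0 h1 (right_ne_zero_of_mul hx)
      exact p1 _ _ (one_le_theta3 h0 h1 hn) (one_le_theta3 h0 h1 hm)
    · exact absurd rfl hx
  · have := mul_le_mul (theta3_le ρ (x 0 - a 0)) (theta3_le ρ (x 1 - a 1)) (theta3_nonneg _ _)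
      (by norm_num)
    unfold cutχ
    linarith

/-- The centres of the nine cutoff functions which cover the support of a cutoff function. -/
def nine (ρ : ℝ) (a : Plane) (k : Fin 3 × Fin 3) : Plane :=
  !₂[a 0 + ![-(2 * ρ), 0, 2 * ρ] k.1, a 1 + ![-(2 * ρ), 0, 2 * ρ] k.2]

/-- The majorant of the support is the sum of the squares of nine cutoff functions, so its integral
against `|u|²` is a sum of nine localized energies. -/
theorem cutχ_eq (ρ : ℝ) (a x : Plane) : cutχ ρ a x = ∑ k, cutφ ρ (nine ρ a k) x ^ 2 := by
  have e : ∀ s c : ℝ, theta3 ρ (s - c) =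
      ∑ k : Fin 3, theta ρ (s - (c + ![-(2 * ρ), 0, 2 * ρ] k)) ^ 2 := fun s c => by
    rw [Fin.sum_univ_three]
    simp only [theta3, Matrix.cons_val_zero, Matrix.cons_val_one, Matrix.cons_val, add_zero]
    have e1 : s - c + 2 * ρ = s - (c + -(2 * ρ)) := by ring
    have e2 : s - c - 2 * ρ = s - (c + 2 * ρ) := by ring
    rw [e1, e2]
  rw [cutχ, e, e, Fintype.sum_mul_sum, Fintype.sum_prod_type]
  refine Finset.sum_congr rfl fun k _ => Finset.sum_congr rfl fun l _ => ?_
  simp [cutφ, nine, mul_pow]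

/-- The number of translates needed to cover a period. -/
def ncover (ρ : ℝ) : ℕ := ⌈1 / ρ⌉₊

/-- A grid of centres. -/
def grid (ρ : ℝ) (k : Fin (ncover ρ) × Fin (ncover ρ)) : Plane :=
  !₂[(k.1 : ℝ) / ncover ρ, (k.2 : ℝ) / ncover ρ]

/-- Every point has distance at most `ρ` from the grid of mesh `1 / ncover ρ`, up to periods. -/
theorem exists_theta_grid (h0 : 0 < ρ) (h1 : ρ ≤ 1 / 8) (s : ℝ) :
    ∃ k : Fin (ncover ρ), theta ρ (s - (k : ℝ) / ncover ρ) = 1 := by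
  have hn : 1 / ρ ≤ ncover ρ := Nat.le_ceil _
  have hn0 : 0 < (ncover ρ : ℝ) := lt_of_lt_of_le (by positivity) hn
  have f0 := Int.fract_nonneg s
  have f1 := Int.fract_lt_one s
  have k0 : 0 ≤ ncover ρ * Int.fract s := by positivity
  have hk : ⌊ncover ρ * Int.fract s⌋₊ < ncover ρ := by
    rw [Nat.floor_lt k0]; nlinarith
  refine ⟨⟨_, hk⟩, theta_eq_one h0 h1 (n := ⌊s⌋) ?_⟩
  have a1 := Nat.floor_le k0
  have a2 := Nat.lt_floor_add_one (ncover ρ * Int.fract s)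
  have e : s - (⌊ncover ρ * Int.fract s⌋₊ : ℝ) / ncover ρ - ⌊s⌋ =
      (ncover ρ * Int.fract s - ⌊ncover ρ * Int.fract s⌋₊) / ncover ρ := by
    generalize ⌊ncover ρ * Int.fract s⌋₊ = m
    rw [← Int.self_sub_floor]; field_simp; ring
  have h2 : 1 / (ncover ρ : ℝ) ≤ ρ := by
    rw [div_le_iff₀ hn0]; rw [div_le_iff₀ h0] at hn; linarith
  simp only
  rw [e, abs_of_nonneg (div_nonneg (by linarith) hn0.le)]
  refine le_trans ?_ h2
  gcongr
  linarith

theorem one_le_sum_grid (h0 : 0 < ρ) (h1 : ρ ≤ 1 / 8) (x : Plane) :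
    1 ≤ ∑ k, cutφ ρ (grid ρ k) x ^ 2 := by
  obtain ⟨i, hi⟩ := exists_theta_grid h0 h1 (x 0)
  obtain ⟨j, hj⟩ := exists_theta_grid h0 h1 (x 1)
  have : cutφ ρ (grid ρ (i, j)) x ^ 2 = 1 := by
    simp [cutφ, grid, hi, hj]
  rw [← this]
  exact Finset.single_le_sum (f := fun k => cutφ ρ (grid ρ k) x ^ 2) (fun _ _ => sq_nonneg _)
    (Finset.mem_univ (i, j))

end

/-! ### Integration in time of bilinear pairings -/

section

theorem ae_affine {P : ℝ → Prop} (hP : ∀ᵐ x, P x) (s : ℝ) {c : ℝ} (hc : c ≠ 0) :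
    ∀ᵐ L : ℝ, P (s + c * L) := by
  have h1 : Measure.QuasiMeasurePreserving (fun L : ℝ => c * L) volume volume := by
    refine ⟨measurable_const_mul c, ?_⟩
    rw [Real.map_volume_mul_left hc]
    exact Measure.smul_absolutelyContinuous
  exact ((measurePreserving_add_left volume s).quasiMeasurePreserving.comp h1).ae hP

theorem exists_of_ae_Ioo {P : ℝ → Prop} {a b : ℝ} (hab : a < b)
    (hP : ∀ᵐ x ∂volume.restrict (Ioo a b), P x) : ∃ x ∈ Ioo a b, P x := by
  have : NeBot (ae (volume.restrict (Ioo a b))) := by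
    rw [ae_neBot, Ne, Measure.restrict_eq_zero, Real.volume_Ioo]
    simpa using hab
  exact ((ae_restrict_mem measurableSet_Ioo).and hP).exists

/-- Integration in time of a bilinear pairing `B`: if the increments of `E` between two good times
`s ≤ t` are `∫_s^t (B r s + B r t) dr`, and `B r` is continuous at `r` along good times, then
summing over finer and finer partitions gives `E' = 2 B r r` in integrated form. -/
theorem integral_diagonal_step {E N : ℝ → ℝ} {B : ℝ → ℝ → ℝ} {P : ℝ → Prop} {τ : ℝ}
    (hP : ∀ t, P t → t ∈ Ioo 0 τ)
    (hN : IntegrableOn N (Ioo 0 τ))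
    (hB : ∀ t, P t → AEStronglyMeasurable (fun r => B r t) (volume.restrict (Ioo 0 τ)))
    (hBN : ∀ t, P t → ∀ᵐ r ∂volume.restrict (Ioo 0 τ), |B r t| ≤ N r)
    (hlim : ∀ᵐ r ∂volume.restrict (Ioo 0 τ), ∀ t : ℕ → ℝ, (∀ n, P (t n)) →
      Tendsto t atTop (𝓝 r) → Tendsto (fun n => B r (t n)) atTop (𝓝 (B r r)))
    (hinc : ∀ s t, P s → P t → s ≤ t → E t - E s = ∫ r in s..t, (B r s + B r t))
    {s L : ℝ} (hL : 0 < L) (hg : ∀ n k : ℕ, k ≤ n + 1 → P (s + (k / (n + 1 : ℝ)) * L)) :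
    AEStronglyMeasurable (fun r => B r r) (volume.restrict (Ioo s (s + L))) ∧
      E (s + L) - E s = 2 * ∫ r in s..(s + L), B r r := by
  have hs : P s := by simpa using hg 0 0 (by norm_num)
  have ht : P (s + L) := by simpa using hg 0 1 (by norm_num)
  have hsub : Ioo s (s + L) ⊆ Ioo 0 τ := Ioo_subset_Ioo (hP s hs).1.le (hP _ ht).2.le
  have sub2 : ∀ {a b : ℝ}, P a → P b → Ioo a b ⊆ Ioo 0 τ := fun ha hb =>
    Ioo_subset_Ioo (hP _ ha).1.le (hP _ hb).2.le
  have hBi : ∀ a b t, P a → P b → P t → a ≤ b → IntervalIntegrable (fun r => B r t) volume a b := by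
    intro a b t ha hb ht hab
    rw [intervalIntegrable_iff_integrableOn_Ioo_of_le hab]
    refine Integrable.mono' (hN.mono_set (sub2 ha hb)) ((hB t ht).mono_set (sub2 ha hb)) ?_
    exact ae_restrict_of_ae_restrict_of_subset (sub2 ha hb) (hBN t ht)
  -- the partition into `n + 1` intervals, and the index of the interval that contains `r`
  let a : ℕ → ℕ → ℝ := fun n k => s + (k / (n + 1 : ℝ)) * L
  let m : ℕ → ℝ → ℕ := fun n r => ⌊(r - s) * (n + 1) / L⌋₊
  have hstep : ∀ n k, a n (k + 1) = a n k + L / (n + 1) := by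
    intro n k; simp only [a]; push_cast; field_simp; ring
  have hlt : ∀ n k, a n k < a n (k + 1) := by
    intro n k; rw [hstep]; have : 0 < L / ((n : ℝ) + 1) := by positivity
    linarith
  have hm : ∀ n k r, r ∈ Ioo (a n k) (a n (k + 1)) → m n r = k := by
    intro n k r hr
    have e : a n k = s + (k / (n + 1 : ℝ)) * L := rfl
    have h1 := hr.1
    have h2 := hr.2
    rw [hstep] at h2
    rw [e] at h1 h2
    have hn : (0 : ℝ) < n + 1 := by positivity
    have hx : r - s = ((r - s) * (n + 1) / L) * (L / (n + 1)) := by field_simp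
    have hq : 0 < L / ((n : ℝ) + 1) := by positivity
    have hk : (k / (n + 1 : ℝ)) * L = k * (L / (n + 1)) := by ring
    rw [hk] at h1 h2
    simp only [m]
    rw [Nat.floor_eq_iff (by
      have : 0 ≤ r - s := by
        have : (0 : ℝ) ≤ k * (L / (n + 1)) := by positivity
        linarith
      positivity)]
    constructor
    · by_contra! hc
      have := mul_lt_mul_of_pos_right hc hq
      linarith
    · by_contra! hc
      have := mul_le_mul_of_nonneg_right hc hq.le
      linarith
  let b : ℕ → ℝ → ℝ := fun n r => B r (a n (m n r)) + B r (a n (m n r + 1))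
  have hbk : ∀ n k, ∀ r ∈ Ioo (a n k) (a n (k + 1)), b n r = B r (a n k) + B r (a n (k + 1)) := by
    intro n k r hr
    simp only [b, hm n k r hr]
  have hbint : ∀ n, ∀ k < n + 1, IntervalIntegrable (b n) volume (a n k) (a n (k + 1)) := by
    intro n k hk
    have p1 := hg n k (by omega)
    have p2 := hg n (k + 1) (by omega)
    have := (hBi (a n k) (a n (k + 1)) _ p1 p2 p1 (hlt n k).le).add
      (hBi (a n k) (a n (k + 1)) _ p1 p2 p2 (hlt n k).le)
    rw [intervalIntegrable_iff_integrableOn_Ioo_of_le (hlt n k).le] at this ⊢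
    exact this.congr_fun (fun r hr => (hbk n k r hr).symm) measurableSet_Ioo
  have a0 : ∀ n, a n 0 = s := fun n => by simp [a]
  have an : ∀ n, a n (n + 1) = s + L := fun n => by
    simp only [a]; push_cast; rw [div_self (by positivity), one_mul]
  -- the increments add up
  have hbs : ∀ n, E (s + L) - E s = ∫ r in s..(s + L), b n r := by
    intro n
    have h1 := intervalIntegral.sum_integral_adjacent_intervals (hbint n)
    rw [a0, an] at h1
    have h2 := Finset.sum_range_sub (fun k => E (a n k)) (n + 1)
    rw [a0, an] at h2
    rw [← h1, ← h2]
    refine Finset.sum_congr rfl fun k hk => ?_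
    have hk' := Finset.mem_range.1 hk
    rw [hinc _ _ (hg n k (by omega)) (hg n (k + 1) (by omega)) (hlt n k).le,
      intervalIntegral.integral_of_le (hlt n k).le, intervalIntegral.integral_of_le (hlt n k).le,
      integral_Ioc_eq_integral_Ioo, integral_Ioc_eq_integral_Ioo]
    exact setIntegral_congr_fun measurableSet_Ioo fun r hr => (hbk n k r hr).symm
  have hmlt : ∀ n, ∀ r ∈ Ioo s (s + L), m n r < n + 1 := by
    intro n r hr
    simp only [m]
    have h1 : 0 ≤ r - s := by linarith [hr.1]
    rw [Nat.floor_lt (by positivity)]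
    push_cast
    rw [div_lt_iff₀ hL, mul_comm]
    have := hr.2
    have hn : (0 : ℝ) < n + 1 := by positivity
    nlinarith
  have hnear : ∀ n, ∀ r ∈ Ioo s (s + L), |a n (m n r) - r| ≤ L / (n + 1) ∧
      |a n (m n r + 1) - r| ≤ L / (n + 1) := by
    intro n r hr
    have h1 : 0 ≤ r - s := by linarith [hr.1]
    have hn : (0 : ℝ) < n + 1 := by positivity
    have f1 := Nat.floor_le (show 0 ≤ (r - s) * (n + 1) / L by positivity)
    have f2 := Nat.lt_floor_add_one ((r - s) * (n + 1) / L)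
    have hq : 0 < L / ((n : ℝ) + 1) := by positivity
    have hx : r - s = ((r - s) * (n + 1) / L) * (L / (n + 1)) := by field_simp
    have e : a n (m n r) = s + (m n r) * (L / (n + 1)) := by simp only [a]; ring
    have g1 := mul_le_mul_of_nonneg_right f1 hq.le
    have g2 := mul_le_mul_of_nonneg_right f2.le hq.le
    rw [← hx] at g1 g2
    change (m n r : ℝ) * (L / (n + 1)) ≤ _ at g1
    change _ ≤ ((m n r : ℝ) + 1) * (L / (n + 1)) at g2
    rw [hstep, e]
    constructor <;> rw [abs_le] <;> constructor <;> nlinarith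
  have hto : Tendsto (fun n : ℕ => L / ((n : ℝ) + 1)) atTop (𝓝 0) := by
    have := tendsto_one_div_add_atTop_nhds_zero_nat (𝕜 := ℝ)
    simpa [div_eq_mul_inv] using this.const_mul L
  -- the end points of the interval that contains `r` converge to `r`
  have hcv : ∀ᵐ r ∂volume.restrict (Ioo s (s + L)),
      Tendsto (fun n => b n r) atTop (𝓝 (B r r + B r r)) := by
    filter_upwards [ae_restrict_of_ae_restrict_of_subset hsub hlim,
      ae_restrict_mem measurableSet_Ioo] with r hr hrm
    refine (hr _ (fun n => hg n _ (hmlt n r hrm).le) ?_).add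
      (hr _ (fun n => hg n (m n r + 1) (hmlt n r hrm)) ?_)
    · rw [tendsto_iff_dist_tendsto_zero]
      exact squeeze_zero (fun _ => dist_nonneg) (fun n => (hnear n r hrm).1) hto
    · rw [tendsto_iff_dist_tendsto_zero]
      exact squeeze_zero (fun _ => dist_nonneg) (fun n => (hnear n r hrm).2) hto
  have hbi : ∀ n, IntervalIntegrable (b n) volume s (s + L) := by
    intro n
    have := IntervalIntegrable.trans_iterate (hbint n)
    rwa [a0, an] at this
  have hbm : ∀ n, AEStronglyMeasurable (b n) (volume.restrict (Ioo s (s + L))) := by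
    intro n
    have := hbi n
    rw [intervalIntegrable_iff_integrableOn_Ioo_of_le (by linarith)] at this
    exact this.1
  have hmeas := aestronglyMeasurable_of_tendsto_ae atTop hbm hcv
  have hbd : ∀ n, ∀ᵐ r ∂volume.restrict (Ioo s (s + L)), ‖b n r‖ ≤ N r + N r := by
    intro n
    have : ∀ᵐ r ∂volume.restrict (Ioo 0 τ), ∀ k, k ≤ n + 1 → |B r (a n k)| ≤ N r := by
      rw [ae_all_iff]; intro k
      by_cases hk : k ≤ n + 1
      · filter_upwards [hBN _ (hg n k hk)] with r hr _ using hr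
      · filter_upwards with r h using absurd h hk
    filter_upwards [ae_restrict_of_ae_restrict_of_subset hsub this,
      ae_restrict_mem measurableSet_Ioo] with r hr hrm
    exact (abs_add_le _ _).trans (add_le_add (hr _ (hmlt n r hrm).le) (hr _ (hmlt n r hrm)))
  refine ⟨(hmeas.const_mul (1 / 2)).congr (Eventually.of_forall fun r => by ring), ?_⟩
  have hle : s ≤ s + L := by linarith
  have hlimI : Tendsto (fun n => ∫ r in s..(s + L), b n r) atTop
      (𝓝 (∫ r in s..(s + L), (B r r + B r r))) := by
    simp only [intervalIntegral.integral_of_le hle, integral_Ioc_eq_integral_Ioo]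
    refine tendsto_integral_of_dominated_convergence (fun r => N r + N r) hbm ?_ hbd hcv
    exact (hN.mono_set hsub).add (hN.mono_set hsub)
  have hc : Tendsto (fun n => ∫ r in s..(s + L), b n r) atTop (𝓝 (E (s + L) - E s)) := by
    simp only [← hbs]; exact tendsto_const_nhds
  rw [tendsto_nhds_unique hc hlimI, ← intervalIntegral.integral_const_mul]
  exact intervalIntegral.integral_congr fun r _ => by ring

/-- The version of `integral_diagonal_step` in which almost every time is good, on the whole of
`[0, τ]`. -/
theorem integral_diagonal {E N : ℝ → ℝ} {B : ℝ → ℝ → ℝ} {P : ℝ → Prop} {τ : ℝ} (hτ : 0 < τ)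
    (hE : ContinuousOn E (Icc 0 τ))
    (hP : ∀ t, P t → t ∈ Ioo 0 τ) (hPae : ∀ᵐ t ∂volume.restrict (Ioo 0 τ), P t)
    (hN : IntegrableOn N (Ioo 0 τ))
    (hB : ∀ t, P t → AEStronglyMeasurable (fun r => B r t) (volume.restrict (Ioo 0 τ)))
    (hBN : ∀ t, P t → ∀ᵐ r ∂volume.restrict (Ioo 0 τ), |B r t| ≤ N r)
    (hlim : ∀ᵐ r ∂volume.restrict (Ioo 0 τ), ∀ t : ℕ → ℝ, (∀ n, P (t n)) →
      Tendsto t atTop (𝓝 r) → Tendsto (fun n => B r (t n)) atTop (𝓝 (B r r)))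
    (hdiag : ∀ᵐ r ∂volume.restrict (Ioo 0 τ), |B r r| ≤ N r)
    (hinc : ∀ s t, P s → P t → s ≤ t → E t - E s = ∫ r in s..t, (B r s + B r t)) :
    IntegrableOn (fun r => B r r) (Ioo 0 τ) ∧
      ∀ t ∈ Icc 0 τ, E t = E 0 + 2 * ∫ r in (0 : ℝ)..t, B r r := by
  have hPae' : ∀ᵐ t : ℝ, t ∈ Ioo 0 τ → P t := (ae_restrict_iff' measurableSet_Ioo).1 hPae
  -- for almost every end point, all the points of all the uniform partitions are good
  have good : ∀ s, P s → ∀ᵐ t : ℝ, t ∈ Ioo s τ →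
      ∀ n k : ℕ, k ≤ n + 1 → P (s + (k / (n + 1 : ℝ)) * (t - s)) := by
    intro s hs
    have : ∀ᵐ L : ℝ, ∀ n k : ℕ, k ≠ 0 → s + (k / (n + 1 : ℝ)) * L ∈ Ioo 0 τ →
        P (s + (k / (n + 1 : ℝ)) * L) := by
      rw [ae_all_iff]; intro n
      rw [ae_all_iff]; intro k
      by_cases hk : k = 0
      · filter_upwards with L h using absurd hk h
      · filter_upwards [ae_affine hPae' s (c := k / (n + 1 : ℝ)) (by positivity)] with L hL _ using hL
    have h2 := (measurePreserving_sub_right volume s).quasiMeasurePreserving.ae this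
    filter_upwards [h2] with t ht htm n k hk
    by_cases hk0 : k = 0
    · simpa [hk0] using hs
    · refine ht n k hk0 ⟨?_, ?_⟩
      · have h1 : 0 < t - s := by linarith [htm.1]
        have h3 := (hP s hs).1
        positivity
      · have h1 : 0 < t - s := by linarith [htm.1]
        have h3 : (k : ℝ) / (n + 1) ≤ 1 := by
          rw [div_le_one (by positivity)]; exact_mod_cast hk
        have := htm.2
        nlinarith
  have step : ∀ s, P s → ∀ᵐ t : ℝ, t ∈ Ioo s τ →
      AEStronglyMeasurable (fun r => B r r) (volume.restrict (Ioo s t)) ∧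
        E t - E s = 2 * ∫ r in s..t, B r r := by
    intro s hs
    filter_upwards [good s hs] with t ht htm
    have := integral_diagonal_step hP hN hB hBN hlim hinc (L := t - s) (by linarith [htm.1])
      (ht htm)
    simpa using this
  -- only measurability is in question: exhaust `(0, τ)` by intervals with good end points
  have hint : IntegrableOn (fun r => B r r) (Ioo 0 τ) := by
    refine Integrable.mono' hN ?_ hdiag
    have : ∀ n : ℕ, ∃ s t, s < τ / (n + 2) ∧ τ - τ / (n + 2) < t ∧
        AEStronglyMeasurable (fun r => B r r) (volume.restrict (Ioo s t)) := by
      intro n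
      have hn : 0 < τ / ((n : ℝ) + 2) := by positivity
      have hn2 : τ / ((n : ℝ) + 2) ≤ τ / 2 := by
        apply div_le_div_of_nonneg_left hτ.le (by norm_num); linarith [n.cast_nonneg (α := ℝ)]
      obtain ⟨s, hs, hPs⟩ := exists_of_ae_Ioo hn
        (ae_restrict_of_ae_restrict_of_subset (Ioo_subset_Ioo le_rfl (by linarith)) hPae)
      obtain ⟨t, ht, hPt⟩ := exists_of_ae_Ioo (a := τ - τ / (n + 2)) (b := τ) (by linarith)
        (ae_restrict_of_ae (step s hPs))
      exact ⟨s, t, hs.2, ht.1, (hPt ⟨by linarith [hs.2, ht.1], ht.2⟩).1⟩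
    choose s t hs ht hm using this
    refine AEStronglyMeasurable.mono_set (t := ⋃ n, Ioo (s n) (t n)) ?_
      (aestronglyMeasurable_iUnion_iff.2 hm)
    intro r hr
    have hto : Tendsto (fun n : ℕ => τ / ((n : ℝ) + 2)) atTop (𝓝 0) :=
      tendsto_const_nhds.div_atTop (tendsto_atTop_add_const_right _ _ tendsto_natCast_atTop_atTop)
    obtain ⟨n, hn1, hn2⟩ := ((hto.eventually_lt_const hr.1).and
      (hto.eventually_lt_const (show (0 : ℝ) < τ - r by linarith [hr.2]))).exists
    exact mem_iUnion.2 ⟨n, by linarith [hs n], by linarith [ht n]⟩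
  refine ⟨hint, ?_⟩
  have hI : IntervalIntegrable (fun r => B r r) volume 0 τ :=
    (intervalIntegrable_iff_integrableOn_Ioo_of_le hτ.le).2 hint
  let D : ℝ → ℝ := fun t => E t - 2 * ∫ r in (0 : ℝ)..t, B r r
  have hD : ContinuousOn D (Icc 0 τ) := by
    refine hE.sub (continuousOn_const.mul ?_)
    have := intervalIntegral.continuousOn_primitive_interval' hI left_mem_uIcc
    rwa [uIcc_of_le hτ.le] at this
  have hsub : ∀ {a b : ℝ}, a ∈ Icc 0 τ → b ∈ Icc 0 τ →
      IntervalIntegrable (fun r => B r r) volume a b := fun ha hb =>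
    hI.mono_set (uIcc_subset_uIcc (by rwa [uIcc_of_le hτ.le]) (by rwa [uIcc_of_le hτ.le]))
  have h0 : (0 : ℝ) ∈ Icc 0 τ := ⟨le_rfl, hτ.le⟩
  -- `D` agrees almost everywhere, hence everywhere on `[0, τ]`, with each of its good values
  have key : ∀ s, P s → ∀ t ∈ Icc s τ, D t = D s := by
    intro s hs t ht
    have hs' := hP s hs
    have hcl : Icc s τ ⊆ closure {t ∈ Icc s τ | D t = D s} := by
      refine (closure_Ioo hs'.2.ne).ge.trans (closure_minimal ?_ isClosed_closure)
      intro x hx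
      rw [Metric.mem_closure_iff]
      intro η hη
      obtain ⟨y, hy, hyP⟩ := exists_of_ae_Ioo (a := x) (b := min τ (x + η))
        (lt_min hx.2 (by linarith)) (ae_restrict_of_ae (step s hs))
      have hyτ : y < τ := hy.2.trans_le (min_le_left _ _)
      have hy2 := (hyP ⟨hx.1.trans hy.1, hyτ⟩).2
      have hyI : y ∈ Icc 0 τ := ⟨by linarith [hs'.1, hx.1, hy.1], hyτ.le⟩
      refine ⟨y, ⟨⟨(hx.1.trans hy.1).le, hyτ.le⟩, ?_⟩, ?_⟩
      · have := intervalIntegral.integral_add_adjacent_intervals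
          (hsub h0 ⟨hs'.1.le, hs'.2.le⟩) (hsub ⟨hs'.1.le, hs'.2.le⟩ hyI)
        simp only [D]; linarith
      · rw [dist_comm, Real.dist_eq, abs_lt]
        have := hy.2.trans_le (min_le_right _ _)
        constructor <;> linarith [hy.1]
    have hcl2 : IsClosed {t ∈ Icc s τ | D t = D s} := by
      have := (hD.mono (Icc_subset_Icc_left hs'.1.le)).preimage_isClosed_of_isClosed isClosed_Icc
        (isClosed_singleton (x := D s))
      exact this
    rw [hcl2.closure_eq] at hcl
    exact (hcl ht).2
  have hconst : ∀ t ∈ Icc 0 τ, D t = D 0 := by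
    have h1 : ∀ t ∈ Ioc 0 τ, D t = D τ := by
      intro t ht
      obtain ⟨s, hs, hPs⟩ := exists_of_ae_Ioo ht.1
        (ae_restrict_of_ae_restrict_of_subset (Ioo_subset_Ioo le_rfl ht.2) hPae)
      rw [key s hPs t ⟨hs.2.le, ht.2⟩, key s hPs τ ⟨(hs.2.trans_le ht.2).le, le_rfl⟩]
    have h2 : D 0 = D τ := by
      have hcl2 : IsClosed {t ∈ Icc 0 τ | D t = D τ} := by
        have := hD.preimage_isClosed_of_isClosed isClosed_Icc (isClosed_singleton (x := D τ))
        exact this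
      have : Icc 0 τ ⊆ {t ∈ Icc 0 τ | D t = D τ} := by
        exact (closure_Ioc hτ.ne).ge.trans
          (closure_minimal (fun t ht => ⟨⟨ht.1.le, ht.2⟩, h1 t ht⟩) hcl2)
      exact (this h0).2
    intro t ht
    rcases ht.1.eq_or_lt with rfl | h
    · rfl
    · rw [h1 t ⟨h, ht.2⟩, h2]
  intro t ht
  have := hconst t ht
  simp only [D, intervalIntegral.integral_same] at this
  linarith

end

/-! ### Paths with a weak time derivative -/

section

variable {h : ℝ}

instance : (volume : Measure (ℝ × Pt)).IsAddHaarMeasure :=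
  inferInstanceAs (((volume : Measure ℝ).prod (volume : Measure Pt)).IsAddHaarMeasure)

/-- The measure of space-time cylinders `S × Ω`. -/
abbrev nu (h : ℝ) (S : Set ℝ) : Measure (ℝ × Pt) := (volume.restrict S).prod (mu h)

/-- A path `f` in `L²(Ω)` with weak time derivative `g ∈ L²_loc([0,∞); L²(Ω))`, in the form of
the fundamental theorem of calculus. -/
structure TimePath (h : ℝ) (f g : ℝ → Pt → ℝ) : Prop where
  mf : AEStronglyMeasurable (fun p : ℝ × Pt => f p.1 p.2) (nu h (Ioi 0))
  mg : AEStronglyMeasurable (fun p : ℝ × Pt => g p.1 p.2) (nu h (Ioi 0))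
  memf : ∀ t, 0 ≤ t → MemLp (f t) 2 (mu h)
  memg : ∀ᵐ t ∂volume.restrict (Ioi (0 : ℝ)), MemLp (g t) 2 (mu h)
  sqg : ∀ τ : ℝ, 0 < τ → ∫⁻ t in Ioo 0 τ, normSq h (g t) < ⊤
  line : ∀ t, 0 ≤ t → ∀ᵐ X ∂mu h, f t X = f 0 X + ∫ r in (0 : ℝ)..t, g r X

theorem integrable_of_sq {g : ℝ → Pt → ℝ} {τ : ℝ}
    (mg : AEStronglyMeasurable (fun p : ℝ × Pt => g p.1 p.2) (nu h (Ioo 0 τ)))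
    (sqg : ∫⁻ t in Ioo 0 τ, normSq h (g t) < ⊤) :
    Integrable (fun p : ℝ × Pt => g p.1 p.2 ^ 2) (nu h (Ioo 0 τ)) ∧
    Integrable (fun p : ℝ × Pt => g p.1 p.2) (nu h (Ioo 0 τ)) := by
  have h2 : Integrable (fun p : ℝ × Pt => g p.1 p.2 ^ 2) (nu h (Ioo 0 τ)) := by
    refine ⟨mg.pow 2, ?_⟩
    have m2 : AEMeasurable (fun p : ℝ × Pt => ‖g p.1 p.2‖ₑ ^ 2) (nu h (Ioo 0 τ)) :=
      mg.enorm.pow_const 2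
    have e := lintegral_prod (fun p : ℝ × Pt => ‖g p.1 p.2‖ₑ ^ 2) m2
    rw [HasFiniteIntegral]
    simp only [enorm_pow]
    exact e.trans_lt sqg
  refine ⟨h2, Integrable.mono' (h2.add (integrable_const 1)) mg ?_⟩
  refine Eventually.of_forall fun p => ?_
  simp only [Pi.add_apply, Real.norm_eq_abs]
  nlinarith [sq_abs (g p.1 p.2), sq_nonneg (|g p.1 p.2| - 1)]

theorem eLpNorm_two_sq (f : Pt → ℝ) : eLpNorm f 2 (mu h) ^ 2 = normSq h f := by
  have := eLpNorm_nnreal_pow_eq_lintegral (f := f) (μ := mu h) (p := 2) (by norm_num)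
  simp only [NNReal.coe_ofNat, ENNReal.coe_ofNat, ENNReal.rpow_ofNat] at this
  exact this

theorem tendsto_eLpNorm_of_normSq {ι : Type*} {l : Filter ι} {f : ι → Pt → ℝ}
    (H : Tendsto (fun n => normSq h (f n)) l (𝓝 0)) :
    Tendsto (fun n => eLpNorm (f n) 2 (mu h)) l (𝓝 0) := by
  have h1 := (ENNReal.continuous_rpow_const (y := (1 / 2 : ℝ))).tendsto 0 |>.comp H
  rw [ENNReal.zero_rpow_of_pos (by norm_num)] at h1
  refine h1.congr fun n => ?_
  simp only [Function.comp]
  rw [← eLpNorm_two_sq, ← ENNReal.rpow_natCast, ← ENNReal.rpow_mul]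
  norm_num

theorem exists_ae_subseq {f : ℕ → Pt → ℝ} {g : Pt → ℝ} (hf : ∀ n, AEStronglyMeasurable (f n) (mu h))
    (hg : AEStronglyMeasurable g (mu h))
    (H : Tendsto (fun n => normSq h (f n - g)) atTop (𝓝 0)) :
    ∃ ns : ℕ → ℕ, StrictMono ns ∧ ∀ᵐ X ∂mu h, Tendsto (fun i => f (ns i) X) atTop (𝓝 (g X)) :=
  (tendstoInMeasure_of_tendsto_eLpNorm two_ne_zero hf hg
    (tendsto_eLpNorm_of_normSq H)).exists_seq_tendsto_ae

/-- A path that is continuous in `L²(Ω)` and has a weak time derivative in `L²` satisfies the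
fundamental theorem of calculus at every time, including the initial time. -/
theorem TimePath.of_hasWeakDeriv {f g : ℝ → Pt → ℝ}
    (H : HasWeakDeriv (Ioi (0 : ℝ) ×ˢ (univ : Set Pt)) ((1, 0) : ℝ × Pt)
      (fun p => f p.1 p.2) fun p => g p.1 p.2)
    (memf : ∀ t, 0 ≤ t → MemLp (f t) 2 (mu h))
    (cont : ∀ s, 0 ≤ s → Tendsto (fun t => normSq h (f t - f s)) (𝓝[Ici 0] s) (𝓝 0))
    (memg : ∀ᵐ t ∂volume.restrict (Ioi (0 : ℝ)), MemLp (g t) 2 (mu h))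
    (sqg : ∀ τ : ℝ, 0 < τ → ∫⁻ t in Ioo 0 τ, normSq h (g t) < ⊤) : TimePath h f g := by
  have hac : nu h (Ioi 0) ≪ (volume : Measure (ℝ × Pt)).restrict (Ioi 0 ×ˢ univ) := by
    rw [Measure.volume_eq_prod, ← Measure.prod_restrict, Measure.restrict_univ]
    exact Measure.AbsolutelyContinuous.rfl.prod Measure.absolutelyContinuous_restrict
  have mf := H.1.aestronglyMeasurable.mono_ac hac
  have mg := H.2.1.aestronglyMeasurable.mono_ac hac
  refine ⟨mf, mg, memf, memg, sqg, fun t ht => ?_⟩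
  have hline := HasWeakDeriv.line (isOpen_Ioi.prod isOpen_univ) (by
    rintro ⟨r, X⟩ ⟨h1, -⟩ s hs
    simp only [mem_prod, mem_Ioi, mem_univ, and_true, Prod.smul_mk, smul_zero, Prod.mk_add_mk,
      smul_eq_mul, mul_one] at h1 ⊢
    linarith) H ht
  rw [Measure.volume_eq_prod] at hline
  have hl2 : ∀ᵐ r : ℝ, 0 < r → ∀ᵐ X ∂mu h,
      f (t + r) X - f r X = ∫ ρ in r..(t + r), g ρ X := by
    filter_upwards [Measure.ae_ae_of_ae_prod hline] with r hr h0
    filter_upwards [ae_restrict_of_ae hr] with X hX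
    have := hX ⟨h0, mem_univ _⟩
    simp only [Prod.smul_mk, smul_zero, Prod.mk_add_mk, smul_eq_mul, mul_one, add_zero] at this
    rw [sub_eq_zero] at this
    rw [add_comm t r, this, intervalIntegral.integral_comp_add_left (fun ρ => g ρ X), add_zero]
  -- the line identity holds for almost every starting time; let the starting time tend to `0`
  have hsel : ∀ n : ℕ, ∃ r ∈ Ioo (0 : ℝ) (1 / (n + 1)), ∀ᵐ X ∂mu h,
      f (t + r) X - f r X = ∫ ρ in r..(t + r), g ρ X := by
    intro n
    obtain ⟨r, hr, hr2⟩ := exists_of_ae_Ioo (a := 0) (b := 1 / ((n : ℝ) + 1)) (by positivity)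
      (ae_restrict_of_ae hl2)
    exact ⟨r, hr, hr2 hr.1⟩
  choose a ha hae using hsel
  have a0 : Tendsto a atTop (𝓝 0) := squeeze_zero (fun n => (ha n).1.le) (fun n => (ha n).2.le)
    tendsto_one_div_add_atTop_nhds_zero_nat
  have t1 : Tendsto a atTop (𝓝[Ici 0] 0) := tendsto_nhdsWithin_iff.2
    ⟨a0, Eventually.of_forall fun n => (ha n).1.le⟩
  have t2 : Tendsto (fun n => t + a n) atTop (𝓝[Ici 0] t) := tendsto_nhdsWithin_iff.2
    ⟨by simpa using a0.const_add t, Eventually.of_forall fun n => add_nonneg ht (ha n).1.le⟩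
  obtain ⟨ns, hns, hn⟩ := exists_ae_subseq (fun n => (memf _ (ha n).1.le).1) (memf 0 le_rfl).1
    ((cont 0 le_rfl).comp t1)
  obtain ⟨ms, hms, hm⟩ := exists_ae_subseq
    (fun n => (memf _ (add_nonneg ht (ha (ns n)).1.le)).1) (memf t ht).1
    (((cont t ht).comp t2).comp hns.tendsto_atTop)
  have hgi := (integrable_of_sq (mg.mono_measure (Measure.prod_mono
    (Measure.restrict_mono Ioo_subset_Ioi_self le_rfl) le_rfl)) (sqg (t + 1) (by linarith))).2
  filter_upwards [hn, hm, hgi.prod_left_ae, ae_all_iff.2 hae] with X h1 h2 h3 h4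
  have hI : IntervalIntegrable (fun r => g r X) volume 0 (t + 1) :=
    (intervalIntegrable_iff_integrableOn_Ioo_of_le (by linarith)).2 h3
  have hc := intervalIntegral.continuousOn_primitive_interval' hI left_mem_uIcc
  rw [uIcc_of_le (by linarith)] at hc
  have hsub : ∀ {b : ℝ}, b ∈ Icc 0 (t + 1) → IntervalIntegrable (fun r => g r X) volume 0 b :=
    fun hb => hI.mono_set (uIcc_subset_uIcc left_mem_uIcc (by rwa [uIcc_of_le (by linarith)]))
  have mem1 : ∀ n, a n ∈ Icc 0 (t + 1) := fun n => ⟨(ha n).1.le, by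
    have := (ha n).2.le.trans (div_le_one_of_le₀ (by linarith [n.cast_nonneg (α := ℝ)])
      (by positivity)); linarith⟩
  have mem2 : ∀ n, t + a n ∈ Icc 0 (t + 1) := fun n => ⟨add_nonneg ht (ha n).1.le, by
    have := (ha n).2.le.trans (div_le_one_of_le₀ (by linarith [n.cast_nonneg (α := ℝ)])
      (by positivity)); linarith⟩
  have hns' := (hns.comp hms).tendsto_atTop
  have l1 : Tendsto (fun n => ∫ r in (0 : ℝ)..a (ns (ms n)), g r X) atTop (𝓝 0) := by
    have := (hc 0 ⟨le_rfl, by linarith⟩).tendsto.comp (tendsto_nhdsWithin_iff.2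
      ⟨a0.comp hns', Eventually.of_forall fun n => mem1 _⟩)
    rw [intervalIntegral.integral_same] at this
    exact this
  have l2 : Tendsto (fun n => ∫ r in (0 : ℝ)..(t + a (ns (ms n))), g r X) atTop
      (𝓝 (∫ r in (0 : ℝ)..t, g r X)) :=
    (hc t ⟨ht, by linarith⟩).tendsto.comp (tendsto_nhdsWithin_iff.2
      ⟨by simpa using (a0.comp hns').const_add t, Eventually.of_forall fun n => mem2 _⟩)
  have l3 := h2.sub (h1.comp hms.tendsto_atTop)
  have e : ∀ n, f (t + a (ns (ms n))) X - f (a (ns (ms n))) X =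
      (∫ r in (0 : ℝ)..(t + a (ns (ms n))), g r X) - ∫ r in (0 : ℝ)..a (ns (ms n)), g r X := by
    intro n
    rw [h4, intervalIntegral.integral_interval_sub_left (hsub (mem2 _)) (hsub (mem1 _))]
  have l4 := l2.sub l1
  simp only [Function.comp, e] at l3
  have := tendsto_nhds_unique l3 l4
  linarith

namespace TimePath

variable {f g : ℝ → Pt → ℝ} (H : TimePath h f g)

theorem nu_mono {S S' : Set ℝ} (hS : S ⊆ S') : nu h S ≤ nu h S' :=
  Measure.prod_mono (Measure.restrict_mono hS le_rfl) le_rfl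

include H

theorem integrable_sq {τ : ℝ} (hτ : 0 < τ) :
    Integrable (fun p : ℝ × Pt => g p.1 p.2 ^ 2) (nu h (Ioo 0 τ)) :=
  (integrable_of_sq (H.mg.mono_measure (nu_mono Ioo_subset_Ioi_self)) (H.sqg τ hτ)).1

theorem integrable_rate {τ : ℝ} (hτ : 0 < τ) :
    Integrable (fun p : ℝ × Pt => g p.1 p.2) (nu h (Ioo 0 τ)) :=
  (integrable_of_sq (H.mg.mono_measure (nu_mono Ioo_subset_Ioi_self)) (H.sqg τ hτ)).2

theorem ae_intervalIntegrable : ∀ᵐ X ∂mu h, ∀ a b : ℝ, 0 ≤ a → 0 ≤ b →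
    IntervalIntegrable (fun r => g r X) volume a b := by
  have : ∀ᵐ X ∂mu h, ∀ n : ℕ, IntervalIntegrable (fun r => g r X) volume 0 (n + 1) := by
    rw [ae_all_iff]; intro n
    filter_upwards [(H.integrable_rate (τ := n + 1) (by positivity)).prod_left_ae] with X hX
    exact (intervalIntegrable_iff_integrableOn_Ioo_of_le (by positivity)).2 hX
  filter_upwards [this] with X hX a b ha hb
  obtain ⟨n, hn⟩ := exists_nat_ge (max a b)
  have h1 : a ≤ n + 1 := by linarith [le_max_left a b]
  have h2 : b ≤ n + 1 := by linarith [le_max_right a b]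
  have h3 : (0 : ℝ) ≤ n + 1 := by positivity
  refine (hX n).mono_set (uIcc_subset_uIcc ?_ ?_) <;> rw [uIcc_of_le h3]
  exacts [⟨ha, h1⟩, ⟨hb, h2⟩]

theorem increment {s t : ℝ} (hs : 0 ≤ s) (ht : 0 ≤ t) :
    ∀ᵐ X ∂mu h, f t X - f s X = ∫ r in s..t, g r X := by
  filter_upwards [H.line s hs, H.line t ht, H.ae_intervalIntegrable] with X h1 h2 h3
  rw [h1, h2, ← intervalIntegral.integral_interval_sub_left (h3 0 t le_rfl ht) (h3 0 s le_rfl hs)]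
  ring

theorem integrable_pairing {ψ : Pt → ℝ} (hψ : MemLp ψ 2 (mu h)) {τ : ℝ} (hτ : 0 < τ) :
    Integrable (fun p : ℝ × Pt => g p.1 p.2 * ψ p.2) (nu h (Ioo 0 τ)) := by
  have hψ2 : Integrable (fun p : ℝ × Pt => ψ p.2 ^ 2) (nu h (Ioo 0 τ)) :=
    (hψ.integrable_sq).comp_snd _
  refine Integrable.mono' ((H.integrable_sq hτ).add hψ2)
    ((H.mg.mono_measure (nu_mono Ioo_subset_Ioi_self)).mul hψ.1.comp_snd) ?_
  refine Eventually.of_forall fun p => ?_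
  simp only [Pi.add_apply, Real.norm_eq_abs, abs_mul]
  nlinarith [sq_abs (g p.1 p.2), sq_abs (ψ p.2), sq_nonneg (|g p.1 p.2| - |ψ p.2|),
    sq_nonneg (g p.1 p.2), sq_nonneg (ψ p.2)]

/-- Pairing an increment in time with a fixed function in `L²`. -/
theorem pairing {ψ : Pt → ℝ} (hψ : MemLp ψ 2 (mu h)) {s t : ℝ} (hs : 0 ≤ s) (hst : s ≤ t) :
    ∫ X in Om h, (f t X - f s X) * ψ X = ∫ r in s..t, ∫ X in Om h, g r X * ψ X := by
  rcases hst.eq_or_lt with rfl | hlt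
  · simp
  have hi := (H.integrable_pairing hψ (hs.trans_lt hlt)).mono_measure
    (nu_mono (h := h) (Ioo_subset_Ioo hs (le_refl t)))
  rw [intervalIntegral.integral_of_le hst, integral_Ioc_eq_integral_Ioo,
    integral_integral_swap hi]
  refine integral_congr_ae ?_
  filter_upwards [H.increment hs (hs.trans hst)] with X hX
  rw [hX, integral_mul_const, intervalIntegral.integral_of_le hst, integral_Ioc_eq_integral_Ioo]

theorem primitive_aesm : AEStronglyMeasurable
    (fun p : ℝ × Pt => ∫ r in Ioc 0 p.1, g r p.2) (nu h (Ioi 0)) := by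
  have q : Measure.QuasiMeasurePreserving (fun p : (ℝ × Pt) × ℝ => (p.2, p.1.2))
      ((nu h (Ioi 0)).prod (volume.restrict (Ioi 0))) (nu h (Ioi 0)) := by
    have q1 : Measure.QuasiMeasurePreserving (fun p : (ℝ × Pt) × ℝ => (p.1.2, p.2))
        ((nu h (Ioi 0)).prod (volume.restrict (Ioi 0))) ((mu h).prod (volume.restrict (Ioi 0))) :=
      Measure.quasiMeasurePreserving_snd.comp
        (measurePreserving_prodAssoc _ _ _).quasiMeasurePreserving
    exact Measure.measurePreserving_swap.quasiMeasurePreserving.comp q1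
  have m := H.mg.comp_quasiMeasurePreserving q
  have ms : MeasurableSet {p : (ℝ × Pt) × ℝ | p.2 ≤ p.1.1} :=
    measurableSet_le (by fun_prop) (by fun_prop)
  have m2 := (m.indicator ms).integral_prod_right'
  refine m2.congr (Eventually.of_forall fun p => ?_)
  simp only
  rw [← Iic_inter_Ioi, ← Measure.restrict_restrict measurableSet_Iic,
    ← integral_indicator measurableSet_Iic]
  rfl

theorem ae_line : ∀ᵐ X ∂mu h, ∀ᵐ t ∂volume.restrict (Ioi (0 : ℝ)),
    f t X = f 0 X + ∫ r in (0 : ℝ)..t, g r X := by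
  have hn : NullMeasurableSet {p : ℝ × Pt | f p.1 p.2 = f 0 p.2 + ∫ r in Ioc 0 p.1, g r p.2}
      (nu h (Ioi 0)) :=
    nullMeasurableSet_eq_fun H.mf.aemeasurable
      (((H.memf 0 le_rfl).1.comp_snd).add H.primitive_aesm).aemeasurable
  have h1 : ∀ᵐ t ∂volume.restrict (Ioi (0 : ℝ)), ∀ᵐ X ∂mu h,
      f t X = f 0 X + ∫ r in Ioc 0 t, g r X := by
    filter_upwards [ae_restrict_mem measurableSet_Ioi] with t ht
    filter_upwards [H.line t (le_of_lt ht)] with X hX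
    rw [hX, intervalIntegral.integral_of_le (le_of_lt ht)]
  have h2 : ∀ᵐ p ∂nu h (Ioi 0), f p.1 p.2 = f 0 p.2 + ∫ r in Ioc 0 p.1, g r p.2 := by
    have hn' := hn.preimage (μa := (mu h).prod (volume.restrict (Ioi 0)))
      Measure.measurePreserving_swap.quasiMeasurePreserving
    have := ae_ae_swap (p := fun X t => f t X = f 0 X + ∫ r in Ioc 0 t, g r X) hn' h1
    exact (Measure.measurePreserving_swap (μ := volume.restrict (Ioi 0))
      (ν := mu h)).quasiMeasurePreserving.ae this
  filter_upwards [ae_swap_of_prod h2] with X hX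
  filter_upwards [hX, ae_restrict_mem measurableSet_Ioi] with t ht ht0
  rw [intervalIntegral.integral_of_le (le_of_lt ht0)]; exact ht

end TimePath

/-- Integration over `Ω` of a pointwise fundamental theorem of calculus. -/
theorem integral_of_line {F₀ F₁ : Pt → ℝ} {G : ℝ → Pt → ℝ} {t : ℝ} (ht : 0 ≤ t)
    (hF : Integrable F₀ (mu h))
    (hG : Integrable (fun p : ℝ × Pt => G p.1 p.2) (nu h (Ioo 0 t)))
    (H : ∀ᵐ X ∂mu h, F₁ X = F₀ X + ∫ r in (0 : ℝ)..t, G r X) :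
    ∫ X in Om h, F₁ X = (∫ X in Om h, F₀ X) + ∫ r in (0 : ℝ)..t, ∫ X in Om h, G r X := by
  rw [integral_congr_ae H]
  simp only [intervalIntegral.integral_of_le ht, integral_Ioc_eq_integral_Ioo]
  rw [integral_add hF hG.integral_prod_right, integral_integral_swap hG]

end

/-! ### Time derivatives of quadratic and quartic energies -/

section

variable {h : ℝ}

theorem integrable_mul_of_memLp {a b : Pt → ℝ} (ha : MemLp a 2 (mu h)) (hb : MemLp b 2 (mu h)) :
    Integrable (fun X => a X * b X) (mu h) := MemLp.integrable_mul ha hb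

theorem sq_integral_mul_le {a b : Pt → ℝ} (ha : MemLp a 2 (mu h)) (hb : MemLp b 2 (mu h)) :
    (∫ X in Om h, a X * b X) ^ 2 ≤ (∫ X in Om h, a X * a X) * ∫ X in Om h, b X * b X := by
  have iab : Integrable (fun X => a X * b X) (mu h) := integrable_mul_of_memLp ha hb
  have iaa : Integrable (fun X => a X * a X) (mu h) := integrable_mul_of_memLp ha ha
  have ibb : Integrable (fun X => b X * b X) (mu h) := integrable_mul_of_memLp hb hb
  have key : ∀ x : ℝ, 0 ≤ (∫ X in Om h, b X * b X) * (x * x) + (2 * ∫ X in Om h, a X * b X) * x +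
      ∫ X in Om h, a X * a X := by
    intro x
    have h0 : 0 ≤ ∫ X in Om h, ((x * x) * (b X * b X) + (2 * x) * (a X * b X) + a X * a X) :=
      integral_nonneg fun X => by
        have := sq_nonneg (x * b X + a X)
        simp only [Pi.zero_apply]; linarith
    have i1 : Integrable (fun X => x * x * (b X * b X) + 2 * x * (a X * b X)) (mu h) :=
      (ibb.const_mul _).add (iab.const_mul _)
    rw [integral_add i1 iaa, integral_add (ibb.const_mul _) (iab.const_mul _),
      integral_const_mul, integral_const_mul] at h0
    linarith
  have := discrim_le_zero key
  rw [discrim] at this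
  nlinarith

theorem normSq_eq_ofReal {f : Pt → ℝ} (hf : MemLp f 2 (mu h)) :
    normSq h f = ENNReal.ofReal (∫ X in Om h, f X * f X) := by
  rw [ofReal_integral_eq_lintegral_ofReal (integrable_mul_of_memLp hf hf)
    (Eventually.of_forall fun X => mul_self_nonneg _)]
  refine lintegral_congr fun X => ?_
  rw [← enorm_sq_eq, Real.enorm_of_nonneg (mul_self_nonneg _)]

theorem integral_mul_self_le {f : Pt → ℝ} (hf : MemLp f 2 (mu h)) {B : ℝ}
    (H : normSq h f ≤ ENNReal.ofReal B) : ∫ X in Om h, f X * f X ≤ max B 0 := by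
  rw [normSq_eq_ofReal hf, ENNReal.ofReal_le_ofReal_iff'] at H
  rcases H with H | H
  · exact H.trans (le_max_left _ _)
  · exact H.trans (le_max_right _ _)

theorem tendsto_integral_mul_self {ι : Type*} {l : Filter ι} {d : ι → Pt → ℝ}
    (hd : ∀ᶠ n in l, MemLp (d n) 2 (mu h)) (H : Tendsto (fun n => normSq h (d n)) l (𝓝 0)) :
    Tendsto (fun n => ∫ X in Om h, d n X * d n X) l (𝓝 0) := by
  have := (ENNReal.tendsto_toReal ENNReal.zero_ne_top).comp H
  refine this.congr' ?_
  filter_upwards [hd] with n hn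
  simp only [Function.comp]
  rw [normSq_eq_ofReal hn, ENNReal.toReal_ofReal (integral_nonneg fun X => mul_self_nonneg _)]

theorem tendsto_integral_mul {ι : Type*} {l : Filter ι} {d : ι → Pt → ℝ} {b : Pt → ℝ}
    (hd : ∀ᶠ n in l, MemLp (d n) 2 (mu h)) (hb : MemLp b 2 (mu h))
    (H : Tendsto (fun n => normSq h (d n)) l (𝓝 0)) :
    Tendsto (fun n => ∫ X in Om h, d n X * b X) l (𝓝 0) := by
  have h1 := (tendsto_integral_mul_self hd H).mul_const (∫ X in Om h, b X * b X)
  rw [zero_mul] at h1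
  have h2 := h1.sqrt
  rw [Real.sqrt_zero] at h2
  refine squeeze_zero_norm' ?_ h2
  filter_upwards [hd] with n hn
  exact Real.abs_le_sqrt (sq_integral_mul_le hn hb)

/-- Continuity of a localized energy, uniformly in the weight. -/
theorem abs_weighted_sub_le {η a b : Pt → ℝ} (mη : AEStronglyMeasurable η (mu h))
    (hη : ∀ X, |η X| ≤ 1) (ha : MemLp a 2 (mu h)) (hb : MemLp b 2 (mu h)) :
    |(∫ X in Om h, η X * (a X * a X)) - ∫ X in Om h, η X * (b X * b X)| ≤
      (∫ X in Om h, (a X - b X) * (a X - b X)) +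
        2 * √((∫ X in Om h, (a X - b X) * (a X - b X)) * ∫ X in Om h, b X * b X) := by
  have hd : MemLp (fun X => a X - b X) 2 (mu h) := ha.sub hb
  have bd : ∀ {f : Pt → ℝ}, Integrable f (mu h) → Integrable (fun X => η X * f X) (mu h) :=
    fun hf => hf.bdd_mul (c := 1) mη (Eventually.of_forall hη)
  have hηb : MemLp (fun X => η X * b X) 2 (mu h) := by
    refine hb.of_le (mη.mul hb.1) (Eventually.of_forall fun X => ?_)
    simp only [Real.norm_eq_abs, abs_mul]
    have := hη X
    nlinarith [abs_nonneg (b X), abs_nonneg (η X)]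
  have i1 : Integrable (fun X => (a X - b X) * (a X - b X)) (mu h) := integrable_mul_of_memLp hd hd
  have i2 : Integrable (fun X => (a X - b X) * (η X * b X)) (mu h) := integrable_mul_of_memLp hd hηb
  have ib : Integrable (fun X => b X * b X) (mu h) := integrable_mul_of_memLp hb hb
  have e : (∫ X in Om h, η X * (a X * a X)) - ∫ X in Om h, η X * (b X * b X) =
      (∫ X in Om h, η X * ((a X - b X) * (a X - b X))) +
        2 * ∫ X in Om h, (a X - b X) * (η X * b X) := by
    rw [← integral_sub (bd (integrable_mul_of_memLp ha ha)) (bd ib), ← integral_const_mul,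
      ← integral_add (bd i1) (i2.const_mul 2)]
    exact integral_congr_ae (Eventually.of_forall fun X => by simp only; ring)
  rw [e]
  refine (abs_add_le _ _).trans (add_le_add ?_ ?_)
  · refine (abs_integral_le_integral_abs).trans (integral_mono (bd i1).abs i1 fun X => ?_)
    simp only [abs_mul, abs_mul_abs_self]
    exact mul_le_of_le_one_left (mul_self_nonneg _) (hη X)
  · rw [abs_mul, abs_two]
    refine mul_le_mul_of_nonneg_left (Real.abs_le_sqrt ((sq_integral_mul_le hd hηb).trans ?_))
      zero_le_two
    refine mul_le_mul_of_nonneg_left (integral_mono (integrable_mul_of_memLp hηb hηb) ib fun X => ?_)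
      (integral_nonneg fun X => mul_self_nonneg _)
    have := hη X
    have h1 : η X * η X ≤ 1 := by
      rw [← abs_mul_abs_self]; nlinarith [abs_nonneg (η X)]
    have : η X * b X * (η X * b X) = η X * η X * (b X * b X) := by ring
    simp only [this]
    exact mul_le_of_le_one_left (mul_self_nonneg _) h1

namespace TimePath

/-- `d/dt ∫ f² = 2 ∫ f f_t`, integrated in time. -/
theorem integral_sq {f g : ℝ → Pt → ℝ} (H : TimePath h f g) {t : ℝ} (ht : 0 < t)
    (hf : ∫⁻ r in Ioo 0 t, normSq h (f r) < ⊤) :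
    IntegrableOn (fun r => ∫ X in Om h, f r X * g r X) (Ioo 0 t) ∧
      ∫ X in Om h, f t X * f t X = (∫ X in Om h, f 0 X * f 0 X) +
        2 * ∫ r in (0 : ℝ)..t, ∫ X in Om h, f r X * g r X := by
  have mf := H.mf.mono_measure (nu_mono (h := h) (S := Ioo 0 t) Ioo_subset_Ioi_self)
  have mg := H.mg.mono_measure (nu_mono (h := h) (S := Ioo 0 t) Ioo_subset_Ioi_self)
  have hi : Integrable (fun p : ℝ × Pt => f p.1 p.2 * g p.1 p.2) (nu h (Ioo 0 t)) := by
    refine Integrable.mono' ((integrable_of_sq mf hf).1.add (H.integrable_sq ht)) (mf.mul mg) ?_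
    refine Eventually.of_forall fun p => ?_
    simp only [Pi.add_apply, Real.norm_eq_abs, abs_mul]
    nlinarith [sq_abs (f p.1 p.2), sq_abs (g p.1 p.2),
      sq_nonneg (|f p.1 p.2| - |g p.1 p.2|), sq_nonneg (f p.1 p.2), sq_nonneg (g p.1 p.2)]
  refine ⟨hi.integral_prod_left, ?_⟩
  rw [integral_of_line (F₀ := fun X => f 0 X * f 0 X) (G := fun r X => 2 * (f r X * g r X)) ht.le
    (integrable_mul_of_memLp (H.memf 0 le_rfl) (H.memf 0 le_rfl)) (hi.const_mul 2)]
  · simp only [integral_const_mul, intervalIntegral.integral_const_mul]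
  · filter_upwards [H.line t ht.le, H.ae_line, H.ae_intervalIntegrable] with X h1 h2 h3
    have := mul_primitive (f 0 X) (f 0 X) (h3 0 t le_rfl ht.le) (h3 0 t le_rfl ht.le)
    rw [h1, this]
    congr 1
    simp only [intervalIntegral.integral_of_le ht.le]
    refine integral_congr_ae (ae_restrict_of_ae_restrict_of_subset Ioc_subset_Ioi_self ?_)
    filter_upwards [h2] with r hr
    rw [hr]; ring

/-- `d/dt ∫ |f|⁴ = 4 ∫ |f|² f · f_t`, integrated in time, for a vector field `f`. -/
theorem integral_four {f g : Fin 2 → ℝ → Pt → ℝ} (H : ∀ i, TimePath h (f i) (g i)) {t : ℝ}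
    (ht : 0 < t)
    (h0 : Integrable (fun X => (∑ i, f i 0 X * f i 0 X) * ∑ i, f i 0 X * f i 0 X) (mu h))
    (hf : ∀ j, ∫⁻ r in Ioo 0 t, normSq h (fun X => (∑ i, f i r X * f i r X) * f j r X) < ⊤) :
    IntegrableOn (fun r => ∫ X in Om h, ∑ j, (∑ i, f i r X * f i r X) * f j r X * g j r X)
        (Ioo 0 t) ∧
      ∫ X in Om h, (∑ i, f i t X * f i t X) * (∑ i, f i t X * f i t X) =
        (∫ X in Om h, (∑ i, f i 0 X * f i 0 X) * (∑ i, f i 0 X * f i 0 X)) +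
        4 * ∫ r in (0 : ℝ)..t, ∫ X in Om h,
          ∑ j, (∑ i, f i r X * f i r X) * f j r X * g j r X := by
  have mf := fun i => (H i).mf.mono_measure (nu_mono (h := h) (S := Ioo 0 t) Ioo_subset_Ioi_self)
  have mg := fun i => (H i).mg.mono_measure (nu_mono (h := h) (S := Ioo 0 t) Ioo_subset_Ioi_self)
  have mq : AEStronglyMeasurable (fun p : ℝ × Pt => ∑ i, f i p.1 p.2 * f i p.1 p.2)
      (nu h (Ioo 0 t)) := by
    simp only [Fin.sum_univ_two]
    exact ((mf 0).mul (mf 0)).add ((mf 1).mul (mf 1))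
  have hij : ∀ j, Integrable (fun p : ℝ × Pt => (∑ i, f i p.1 p.2 * f i p.1 p.2) * f j p.1 p.2 *
      g j p.1 p.2) (nu h (Ioo 0 t)) := by
    intro j
    refine Integrable.mono' ((integrable_of_sq (mq.mul (mf j)) (hf j)).1.add
      ((H j).integrable_sq ht)) ((mq.mul (mf j)).mul (mg j)) ?_
    refine Eventually.of_forall fun p => ?_
    simp only [Pi.add_apply, Real.norm_eq_abs]
    rw [abs_mul]
    generalize (∑ i, f i p.1 p.2 * f i p.1 p.2) * f j p.1 p.2 = a
    nlinarith [sq_abs a, sq_abs (g j p.1 p.2),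
      sq_nonneg (|a| - |g j p.1 p.2|), sq_nonneg a, sq_nonneg (g j p.1 p.2)]
  have hi : Integrable (fun p : ℝ × Pt => ∑ j, (∑ i, f i p.1 p.2 * f i p.1 p.2) * f j p.1 p.2 *
      g j p.1 p.2) (nu h (Ioo 0 t)) := integrable_finsetSum _ fun j _ => hij j
  refine ⟨hi.integral_prod_left, ?_⟩
  rw [integral_of_line (F₀ := fun X => (∑ i, f i 0 X * f i 0 X) * ∑ i, f i 0 X * f i 0 X)
    (G := fun r X => 4 * ∑ j, (∑ i, f i r X * f i r X) * f j r X * g j r X) ht.le h0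
    (hi.const_mul 4)]
  · simp only [integral_const_mul, intervalIntegral.integral_const_mul]
  · filter_upwards [ae_all_iff.2 fun i => (H i).line t ht.le, ae_all_iff.2 fun i => (H i).ae_line,
      ae_all_iff.2 fun i => (H i).ae_intervalIntegrable] with X h1 h2 h3
    let Φ : Fin 2 → ℝ → ℝ := fun i s => f i 0 X + ∫ r in (0 : ℝ)..s, g i r X
    let k : ℝ → ℝ := fun s => ∑ i, (g i s X * Φ i s + Φ i s * g i s X)
    have hc : ∀ i, ContinuousOn (Φ i) (uIcc 0 t) := fun i =>
      continuousOn_const.add (intervalIntegral.continuousOn_primitive_interval'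
        (h3 i 0 t le_rfl ht.le) left_mem_uIcc)
    have ki : ∀ i, IntervalIntegrable (fun s => g i s X * Φ i s + Φ i s * g i s X) volume 0 t :=
      fun i => ((h3 i 0 t le_rfl ht.le).mul_continuousOn (hc i)).add
        ((h3 i 0 t le_rfl ht.le).continuousOn_mul (hc i))
    have hsub : ∀ s ∈ Icc 0 t, uIcc 0 s ⊆ uIcc 0 t := fun s hs =>
      uIcc_subset_uIcc left_mem_uIcc (by rwa [uIcc_of_le ht.le])
    have hk : IntervalIntegrable k volume 0 t := by
      simp only [k, Fin.sum_univ_two]; exact (ki 0).add (ki 1)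
    have hq : ∀ s ∈ Icc 0 t, ∑ i, Φ i s * Φ i s =
        (∑ i, f i 0 X * f i 0 X) + ∫ r in (0 : ℝ)..s, k r := by
      intro s hs
      have e : ∀ i, Φ i s * Φ i s = f i 0 X * f i 0 X +
          ∫ r in (0 : ℝ)..s, (g i r X * Φ i r + Φ i r * g i r X) := fun i =>
        mul_primitive (f i 0 X) (f i 0 X) (h3 i 0 s le_rfl hs.1) (h3 i 0 s le_rfl hs.1)
      simp only [e, Fin.sum_univ_two, k]
      rw [intervalIntegral.integral_add ((ki 0).mono_set (hsub s hs))
        ((ki 1).mono_set (hsub s hs))]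
      ring
    have h4 : ∀ i, f i t X = Φ i t := fun i => h1 i
    simp only [h4]
    rw [hq t ⟨ht.le, le_rfl⟩, mul_primitive _ _ hk hk]
    congr 1
    simp only [intervalIntegral.integral_of_le ht.le]
    refine integral_congr_ae ?_
    filter_upwards [ae_restrict_of_ae_restrict_of_subset Ioc_subset_Ioi_self (ae_all_iff.2 h2),
      ae_restrict_mem measurableSet_Ioc] with r hr hrt
    have h5 : ∀ i, f i r X = Φ i r := fun i => hr i
    rw [← hq r ⟨hrt.1.le, hrt.2⟩]
    simp only [h5, k, Fin.sum_univ_two]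
    ring

end TimePath

theorem Cutoff.cut_vertical {L : ℝ} {φ : Plane → ℝ} {φ1 : Fin 3 → Plane → ℝ} {χ : Plane → ℝ}
    (H : Cutoff h L φ φ1 χ) (hh : 0 < h) {f g : Pt → ℝ} (hf : D1 h 2 f g) :
    D1 h 2 (fun X => φ X.1 ^ 2 * f X) fun X => φ X.1 ^ 2 * g X := by
  have := H.cut2 hh hf
  simp only [H.vert, zero_mul, zero_add] at this
  convert this using 2 <;> ring

/-- `d/dt ∫ φ² (∂_z f)² = -2 ∫ φ² ∂_z² f f_t`, integrated in time. No time regularity of `∂_z² f`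
is needed: the increments are integrated by parts at fixed pairs of times. -/
theorem TimePath.integral_vertical {f g u w : ℝ → Pt → ℝ} (H : TimePath h f g) (hh : 0 < h)
    {L : ℝ} {φ : Plane → ℝ} {φ1 : Fin 3 → Plane → ℝ} {χ : Plane → ℝ} (Φ : Cutoff h L φ φ1 χ)
    {τ B : ℝ} (hτ : 0 < τ) (hu : ∀ t, 0 ≤ t → D1 h 2 (f t) (u t))
    (hw : ∀ᵐ t ∂volume.restrict (Ioo 0 τ),
      D1 h 2 (u t) (w t) ∧ normSq h (w t) ≤ ENNReal.ofReal B)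
    (hg : ∀ᵐ t ∂volume.restrict (Ioo 0 τ), ∃ gz, D1 h 2 (g t) gz)
    (cont : ∀ s, 0 ≤ s → Tendsto (fun t => normSq h (u t - u s)) (𝓝[Ici 0] s) (𝓝 0)) :
    IntegrableOn (fun r => ∫ X in Om h, φ X.1 ^ 2 * (w r X * g r X)) (Ioo 0 τ) ∧
      ∀ t ∈ Icc 0 τ, ∫ X in Om h, φ X.1 ^ 2 * (u t X * u t X) =
        (∫ X in Om h, φ X.1 ^ 2 * (u 0 X * u 0 X)) -
        2 * ∫ r in (0 : ℝ)..t, ∫ X in Om h, φ X.1 ^ 2 * (w r X * g r X) := by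
  have hφ1 : ∀ X : Pt, |φ X.1 ^ 2| ≤ 1 := fun X => by
    rw [abs_pow]; exact pow_le_one₀ (abs_nonneg _) (Φ.abs_le_one _)
  have mφ : AEStronglyMeasurable (fun X : Pt => φ X.1 ^ 2) (mu h) := (Φ.d 0).f2.mem.1.pow 2
  have cutL : ∀ {k : Pt → ℝ}, MemLp k 2 (mu h) → MemLp (fun X => φ X.1 ^ 2 * k X) 2 (mu h) := by
    intro k hk
    refine hk.of_le (mφ.mul hk.1) (Eventually.of_forall fun X => ?_)
    simp only [Real.norm_eq_abs, abs_mul]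
    exact mul_le_of_le_one_left (abs_nonneg _) (hφ1 X)
  have hmu : ∀ t, 0 ≤ t → MemLp (u t) 2 (mu h) := fun t ht => (hu t ht).g2.mem
  let P : ℝ → Prop := fun t => t ∈ Ioo 0 τ ∧ D1 h 2 (u t) (w t) ∧ normSq h (w t) ≤ ENNReal.ofReal B
  let β : ℝ → ℝ → ℝ := fun r t => -∫ X in Om h, φ X.1 ^ 2 * (w t X * g r X)
  have hP : ∀ᵐ t ∂volume.restrict (Ioo 0 τ), P t := by
    filter_upwards [hw, ae_restrict_mem measurableSet_Ioo] with t h1 h2 using ⟨h2, h1⟩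
  have hmg : ∀ᵐ t ∂volume.restrict (Ioo 0 τ), MemLp (g t) 2 (mu h) :=
    ae_restrict_of_ae_restrict_of_subset Ioo_subset_Ioi_self H.memg
  have hpair : ∀ r t, ∫ X in Om h, φ X.1 ^ 2 * (w t X * g r X) =
      ∫ X in Om h, g r X * (φ X.1 ^ 2 * w t X) := fun r t =>
    integral_congr_ae (Eventually.of_forall fun X => by simp only; ring)
  have hβN : ∀ t, P t → ∀ r, MemLp (g r) 2 (mu h) →
      |β r t| ≤ (∫ X in Om h, g r X ^ 2) + max B 0 := by
    intro t ht r hr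
    simp only [β, abs_neg]
    have iw : Integrable (fun X => w t X * w t X) (mu h) :=
      integrable_mul_of_memLp ht.2.1.g2.mem ht.2.1.g2.mem
    refine (abs_integral_le_integral_abs).trans
      ((integral_mono_of_nonneg (Eventually.of_forall fun X => abs_nonneg _)
        (hr.integrable_sq.add iw) (Eventually.of_forall fun X => ?_)).trans ?_)
    · simp only [Pi.add_apply]
      rw [abs_mul]
      refine (mul_le_of_le_one_left (abs_nonneg _) (hφ1 X)).trans ?_
      rw [abs_mul]
      nlinarith [sq_abs (g r X), sq_abs (w t X), sq_nonneg (|g r X| - |w t X|),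
        sq_nonneg (g r X), sq_nonneg (w t X)]
    · simp only [Pi.add_apply]
      rw [integral_add hr.integrable_sq iw]
      exact add_le_add le_rfl (integral_mul_self_le ht.2.1.g2.mem ht.2.2)
  have hE : ContinuousOn (fun t => ∫ X in Om h, φ X.1 ^ 2 * (u t X * u t X)) (Icc 0 τ) := by
    intro s hs
    have h1 : Tendsto (fun t => ∫ X in Om h, (u t X - u s X) * (u t X - u s X))
        (𝓝[Icc 0 τ] s) (𝓝 0) := by
      refine tendsto_integral_mul_self (d := fun t X => u t X - u s X) ?_
        ((cont s hs.1).mono_left (nhdsWithin_mono _ Icc_subset_Ici_self))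
      filter_upwards [self_mem_nhdsWithin] with t ht
      exact (hmu t ht.1).sub (hmu s hs.1)
    have h2 := h1.add (((h1.mul_const (∫ X in Om h, u s X * u s X)).sqrt).const_mul 2)
    simp only [zero_mul, Real.sqrt_zero, mul_zero, add_zero] at h2
    rw [ContinuousWithinAt, tendsto_iff_dist_tendsto_zero]
    refine squeeze_zero' (Eventually.of_forall fun _ => dist_nonneg) ?_ h2
    filter_upwards [self_mem_nhdsWithin] with t ht
    exact abs_weighted_sub_le mφ hφ1 (hmu t ht.1) (hmu s hs.1)
  have main := integral_diagonal (E := fun t => ∫ X in Om h, φ X.1 ^ 2 * (u t X * u t X))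
    (N := fun r => (∫ X in Om h, g r X ^ 2) + max B 0) (B := β) (P := P) hτ hE
    (fun t ht => ht.1) hP ((H.integrable_sq hτ).integral_prod_left.add (integrable_const _))
    (fun t ht => by
      have := (H.integrable_pairing (cutL ht.2.1.g2.mem) hτ).integral_prod_left.1.neg
      refine this.congr (Eventually.of_forall fun r => ?_)
      simp only [β, hpair, Pi.neg_apply])
    (fun t ht => by filter_upwards [hmg] with r hr using hβN t ht r hr)
    ?_ (by filter_upwards [hmg, hP] with r hr hr2 using hβN r hr2 r hr) ?_
  · refine ⟨main.1.neg.congr (Eventually.of_forall fun r => by simp [β]), fun t ht => ?_⟩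
    rw [main.2 t ht]
    simp only [β, intervalIntegral.integral_neg]
    ring
  · -- continuity along good times: move one vertical derivative to `∂_t f`
    filter_upwards [hP, hg] with r hr hgr t ht htr
    obtain ⟨gz, hgz⟩ := hgr
    have e : ∀ t, P t → β r t = ∫ X in Om h, u t X * (φ X.1 ^ 2 * gz X) := by
      intro t ht
      have := ht.2.1.ibp hh (Φ.cut_vertical hh hgz)
      simp only [β]
      rw [← neg_eq_iff_eq_neg] at this
      rw [← this]
      congr 1
      exact integral_congr_ae (Eventually.of_forall fun X => by simp only; ring)
    have hψ := cutL hgz.g2.mem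
    have htr' : Tendsto t atTop (𝓝[Ici 0] r) := tendsto_nhdsWithin_iff.2
      ⟨htr, Eventually.of_forall fun n => (ht n).1.1.le⟩
    have h1 := tendsto_integral_mul (d := fun n => u (t n) - u r) (b := fun X => φ X.1 ^ 2 * gz X)
      (Eventually.of_forall fun n => (hmu _ (ht n).1.1.le).sub (hmu r hr.1.1.le)) hψ
      ((cont r hr.1.1.le).comp htr')
    rw [e r hr]
    have h2 := h1.add_const (∫ X in Om h, u r X * (φ X.1 ^ 2 * gz X))
    rw [zero_add] at h2
    refine h2.congr fun n => ?_
    rw [e _ (ht n), ← integral_add]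
    · exact integral_congr_ae (Eventually.of_forall fun X => by simp only [Pi.sub_apply]; ring)
    · exact integrable_mul_of_memLp ((hmu _ (ht n).1.1.le).sub (hmu r hr.1.1.le)) hψ
    · exact integrable_mul_of_memLp (hmu r hr.1.1.le) hψ
  · -- increments: `∫ φ² (u(t)² - u(s)²) = -∫ (f(t) - f(s)) φ² (w(t) + w(s))`
    intro s t hs ht hst
    have ms := hs.2.1
    have mt := ht.2.1
    have ius := integrable_mul_of_memLp (hmu s hs.1.1.le) (hmu s hs.1.1.le)
    have iut := integrable_mul_of_memLp (hmu t ht.1.1.le) (hmu t ht.1.1.le)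
    have bd : ∀ {k : Pt → ℝ}, Integrable k (mu h) → Integrable (fun X => φ X.1 ^ 2 * k X) (mu h) :=
      fun hk => hk.bdd_mul (c := 1) mφ (Eventually.of_forall hφ1)
    have hd : D1 h 2 (fun X => f t X + (-1) * f s X) fun X => u t X + (-1) * u s X :=
      (hu t ht.1.1.le).add hh ((hu s hs.1.1.le).smul (-1))
    have hψ : D1 h 2 (fun X => φ X.1 ^ 2 * (u t X + u s X)) fun X => φ X.1 ^ 2 * (w t X + w s X) :=
      Φ.cut_vertical hh (mt.add hh ms)
    have h1 := hd.ibp hh hψ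
    have h2 : (∫ X in Om h, φ X.1 ^ 2 * (u t X * u t X)) -
        (∫ X in Om h, φ X.1 ^ 2 * (u s X * u s X)) =
        ∫ X in Om h, (u t X + (-1) * u s X) * (φ X.1 ^ 2 * (u t X + u s X)) := by
      rw [← integral_sub (bd iut) (bd ius)]
      exact integral_congr_ae (Eventually.of_forall fun X => by simp only; ring)
    have h3 := H.pairing hψ.g2.mem hs.1.1.le hst
    have h4 : ∫ X in Om h, (f t X + (-1) * f s X) * (φ X.1 ^ 2 * (w t X + w s X)) =
        ∫ X in Om h, (f t X - f s X) * (φ X.1 ^ 2 * (w t X + w s X)) :=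
      integral_congr_ae (Eventually.of_forall fun X => by simp only; ring)
    rw [h2, h1, h4, h3, ← intervalIntegral.integral_neg]
    simp only [intervalIntegral.integral_of_le hst]
    refine integral_congr_ae (ae_restrict_of_ae_restrict_of_subset
      (Ioc_subset_Ioo_right ht.1.2 |>.trans (Ioo_subset_Ioo_left hs.1.1.le)) ?_)
    filter_upwards [hmg] with r hr
    simp only [β, hpair]
    rw [← neg_add, ← integral_add (integrable_mul_of_memLp hr (cutL ms.g2.mem))
      (integrable_mul_of_memLp hr (cutL mt.g2.mem))]
    congr 1
    exact integral_congr_ae (Eventually.of_forall fun X => by simp only; ring)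

end

/-! ### Orthogonality of the time derivative -/

section

variable {h : ℝ}

/-- A fixed field orthogonal to the path at almost all times is orthogonal to its time derivative. -/
theorem TimePath.pairing_zero {V Vt : Fin 2 → ℝ → Pt → ℝ} (H : ∀ i, TimePath h (V i) (Vt i))
    {G : Set ℝ} (hG : ∀ᵐ t ∂volume.restrict (Ioi (0 : ℝ)), t ∈ G) {w : Fin 2 → Pt → ℝ}
    (hw : ∀ i, MemLp (w i) 2 (mu h))
    (h0 : ∀ s ∈ G, 0 < s → ∑ i, ∫ X in Om h, V i s X * w i X = 0) :
    ∀ᵐ t ∂volume.restrict (Ioi (0 : ℝ)), ∑ i, ∫ X in Om h, Vt i t X * w i X = 0 := by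
  let γ : ℝ → ℝ := fun t => ∑ i, ∫ X in Om h, Vt i t X * w i X
  let m : ℝ := ∑ i, ∫ X in Om h, V i 0 X * w i X
  have hi : ∀ i, ∀ t, 0 ≤ t → IntervalIntegrable (fun t => ∫ X in Om h, Vt i t X * w i X)
      volume 0 t := by
    intro i t ht
    rcases ht.eq_or_lt with rfl | ht'
    · exact IntervalIntegrable.refl
    · exact (intervalIntegrable_iff_integrableOn_Ioo_of_le ht).2
        ((H i).integrable_pairing (hw i) ht').integral_prod_left
  have hγ : ∀ t, 0 ≤ t → IntervalIntegrable γ volume 0 t := fun t ht => by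
    simp only [γ, Fin.sum_univ_two]; exact (hi 0 t ht).add (hi 1 t ht)
  have hm : ∀ t, 0 ≤ t → (∑ i, ∫ X in Om h, V i t X * w i X) - m = ∫ r in (0 : ℝ)..t, γ r := by
    intro t ht
    have e : ∀ i, (∫ X in Om h, V i t X * w i X) - ∫ X in Om h, V i 0 X * w i X =
        ∫ r in (0 : ℝ)..t, ∫ X in Om h, Vt i r X * w i X := fun i => by
      rw [← (H i).pairing (hw i) le_rfl ht,
        ← integral_sub (integrable_mul_of_memLp ((H i).memf t ht) (hw i))
          (integrable_mul_of_memLp ((H i).memf 0 le_rfl) (hw i))]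
      exact integral_congr_ae (Eventually.of_forall fun X => by simp only; ring)
    simp only [γ, m, Fin.sum_univ_two]
    rw [intervalIntegral.integral_add (hi 0 t ht) (hi 1 t ht), ← e 0, ← e 1]
    ring
  have hae : ∀ᵐ t ∂volume.restrict (Ioi (0 : ℝ)), ∫ r in (0 : ℝ)..t, γ r = -m := by
    filter_upwards [hG, ae_restrict_mem measurableSet_Ioi] with t ht ht0
    rw [← hm t (le_of_lt ht0), h0 t ht ht0, zero_sub]
  have m0 : m = 0 := by
    have hsel : ∀ n : ℕ, ∃ t ∈ Ioo (0 : ℝ) (1 / (n + 1)), ∫ r in (0 : ℝ)..t, γ r = -m :=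
      fun n => exists_of_ae_Ioo (by positivity)
        (ae_restrict_of_ae_restrict_of_subset Ioo_subset_Ioi_self hae)
    choose a ha hae using hsel
    have a0 : Tendsto a atTop (𝓝 0) := squeeze_zero (fun n => (ha n).1.le)
      (fun n => (ha n).2.le) tendsto_one_div_add_atTop_nhds_zero_nat
    have hc := intervalIntegral.continuousOn_primitive_interval' (hγ 1 zero_le_one) left_mem_uIcc
    rw [uIcc_of_le zero_le_one] at hc
    have := (hc 0 ⟨le_rfl, zero_le_one⟩).tendsto.comp (tendsto_nhdsWithin_iff.2
      ⟨a0, Eventually.of_forall fun n => ⟨(ha n).1.le, (ha n).2.le.trans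
        (div_le_one_of_le₀ (by linarith [n.cast_nonneg (α := ℝ)]) (by positivity))⟩⟩)
    rw [intervalIntegral.integral_same] at this
    have h2 : Tendsto (fun _ : ℕ => -m) atTop (𝓝 0) := this.congr hae
    have := tendsto_nhds_unique h2 tendsto_const_nhds
    linarith
  rw [m0, neg_zero] at hae
  exact (eq_zero_of_integral_eq_zero hγ hae).2

/-- For almost every time, the time derivative is orthogonal to all fields orthogonal to the
path itself. The exceptional set of times does not depend on the field, since `L²` is separable. -/
theorem TimePath.ae_orthogonal {V Vt : Fin 2 → ℝ → Pt → ℝ} (H : ∀ i, TimePath h (V i) (Vt i))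
    {G : Set ℝ} (hG : ∀ᵐ t ∂volume.restrict (Ioi (0 : ℝ)), t ∈ G) :
    ∀ᵐ t ∂volume.restrict (Ioi (0 : ℝ)), ∀ w : Fin 2 → Pt → ℝ, (∀ i, MemLp (w i) 2 (mu h)) →
      (∀ s ∈ G, 0 < s → ∑ i, ∫ X in Om h, V i s X * w i X = 0) →
      ∑ i, ∫ X in Om h, Vt i t X * w i X = 0 := by
  let S : Set (Lp ℝ 2 (mu h) × Lp ℝ 2 (mu h)) := {w | ∀ s ∈ G, 0 < s →
    ∑ i, ∫ X in Om h, V i s X * (![w.1, w.2] i : Pt → ℝ) X = 0}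
  have : Fact ((2 : ℝ≥0∞) ≠ ⊤) := ⟨ENNReal.ofNat_ne_top⟩
  have hS : (0 : Lp ℝ 2 (mu h) × Lp ℝ 2 (mu h)) ∈ S := by
    intro s _ _
    refine Finset.sum_eq_zero fun i _ => ?_
    refine integral_eq_zero_of_ae ?_
    have : (![(0 : Lp ℝ 2 (mu h)), 0] i : Pt → ℝ) =ᵐ[mu h] 0 := by
      fin_cases i <;> exact Lp.coeFn_zero _ _ _
    filter_upwards [this] with X hX
    simp only [Prod.fst_zero, Prod.snd_zero, hX, Pi.zero_apply, mul_zero]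
  have : Nonempty S := ⟨⟨0, hS⟩⟩
  have : SecondCountableTopology (Lp ℝ 2 (mu h)) := inferInstance
  have : SecondCountableTopology (Lp ℝ 2 (mu h) × Lp ℝ 2 (mu h)) := inferInstance
  have : SecondCountableTopology S := inferInstance
  obtain ⟨d, hd⟩ := TopologicalSpace.exists_dense_seq S
  have h1 : ∀ᵐ t ∂volume.restrict (Ioi (0 : ℝ)), ∀ n,
      ∑ i, ∫ X in Om h, Vt i t X * (![(d n).1.1, (d n).1.2] i : Pt → ℝ) X = 0 := by
    rw [ae_all_iff]; intro n
    exact TimePath.pairing_zero H hG (w := fun i => (![(d n).1.1, (d n).1.2] i : Pt → ℝ))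
      (fun i => Lp.memLp _) (d n).2
  filter_upwards [h1, (H 0).memg, (H 1).memg] with t ht g0 g1 w hw h0
  let Φ : S → ℝ := fun x => inner ℝ (g0.toLp _) x.1.1 + inner ℝ (g1.toLp _) x.1.2
  have hΦc : Continuous Φ := by
    refine (Continuous.inner continuous_const ?_).add (Continuous.inner continuous_const ?_) <;>
      fun_prop
  have inn : ∀ {a : Pt → ℝ} (ha : MemLp a 2 (mu h)) (b : Lp ℝ 2 (mu h)) {b' : Pt → ℝ},
      b =ᵐ[mu h] b' → inner ℝ (ha.toLp a) b = ∫ X in Om h, a X * b' X := by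
    intro a ha b b' hb
    rw [L2.inner_def]
    refine integral_congr_ae ?_
    filter_upwards [ha.coeFn_toLp, hb] with X hX hX2
    rw [hX, hX2]; simp [mul_comm]
  have hΦ0 : Φ = fun _ => 0 := by
    refine hd.equalizer hΦc continuous_const (funext fun n => ?_)
    have := ht n
    simp only [Fin.sum_univ_two] at this
    simp only [Φ, Function.comp]
    rw [inn g0 _ EventuallyEq.rfl, inn g1 _ EventuallyEq.rfl]
    exact this
  have e : ∀ i, (![(hw 0).toLp _, (hw 1).toLp _] i : Pt → ℝ) =ᵐ[mu h] w i := by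
    intro i; fin_cases i
    · exact (hw 0).coeFn_toLp
    · exact (hw 1).coeFn_toLp
  have hwS : ((hw 0).toLp _, (hw 1).toLp _) ∈ S := by
    intro s hs hs0
    rw [← h0 s hs hs0]
    refine Finset.sum_congr rfl fun i _ => integral_congr_ae ?_
    filter_upwards [e i] with X hX
    simp only [hX]
  have := congrFun hΦ0 ⟨_, hwS⟩
  simp only [Φ] at this
  rw [inn g0 _ (hw 0).coeFn_toLp, inn g1 _ (hw 1).coeFn_toLp] at this
  rw [Fin.sum_univ_two]; exact this

end

/-! ### Components of a solution at a fixed time -/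

section

variable {h : ℝ}

theorem dir_castSucc (j : Fin 2) : dir j.castSucc = eH j := by
  fin_cases j <;> rfl

theorem dir_two : dir 2 = eZ := rfl

theorem HasWeakDeriv.sub {E F : Type*} [NormedAddCommGroup E] [NormedSpace ℝ E]
    [FiniteDimensional ℝ E] [MeasureSpace E] [BorelSpace E] [(volume : Measure E).IsAddHaarMeasure]
    [NormedAddCommGroup F] [NormedSpace ℝ F] {d : E} {f f' g g' : E → F}
    (H : HasWeakDeriv univ d f g) (H' : HasWeakDeriv univ d f' g') :
    HasWeakDeriv univ d (f - f') (g - g') := by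
  refine ⟨H.1.sub H'.1, H.2.1.sub H'.2.1, fun φ φs φc φU => ?_⟩
  have c1 : HasCompactSupport fun X => fderiv ℝ φ X d := φc.fderiv_apply (𝕜 := ℝ) d
  simp only [Pi.sub_apply, smul_sub]
  rw [integral_sub (integrable_test_smul H.1 (contDiff_fderiv_apply φs d).continuous c1
      (subset_univ _)) (integrable_test_smul H'.1 (contDiff_fderiv_apply φs d).continuous c1
      (subset_univ _)),
    integral_sub (integrable_test_smul H.2.1 φs.continuous φc φU)
      (integrable_test_smul H'.2.1 φs.continuous φc φU),
    H.2.2 φ φs φc φU, H'.2.2 φ φs φc φU]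
  abel

theorem MemH.wd_sub {F : Type*} [NormedAddCommGroup F] [NormedSpace ℝ F] [CompleteSpace F]
    {m : ℕ} {f f' : Pt → F} (H : MemH h (m + 1) f) (H' : MemH h (m + 1) f') (a : Fin 3) :
    wd (dir a) (f - f') =ᵐ[volume] wd (dir a) f - wd (dir a) f' :=
  ((memH_succ H a).1.sub (memH_succ H' a).1).wd_eq

/-- The components of a solution and of its derivatives at a fixed time. -/
def fieldsOf (h : ℝ) (v : Pt → Plane) (T : Pt → ℝ) (vt : Pt → Plane) (Tt : Pt → ℝ)
    (p : Plane → ℝ) : Fields where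
  V i X := v X i
  V1 i a X := wd (dir a) v X i
  V2 i a b X := wd (dir b) (wd (dir a) v) X i
  V3 i a b c X := wd (dir c) (wd (dir b) (wd (dir a) v)) X i
  T := T
  T1 a X := wd (dir a) T X
  T2 a b X := wd (dir b) (wd (dir a) T) X
  Vt i X := vt X i
  Tt := Tt
  P j X := wd (eH j) (pressure h p T) X + vint h (wd (eH j) T) X

/-- The equations at a fixed time, together with the regularity that holds at almost every time. -/
structure EquationsAt (h f₀ ε : ℝ) (v : Pt → Plane) (T : Pt → ℝ) (vt : Pt → Plane) (Tt : Pt → ℝ)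
    (p : Plane → ℝ) : Prop where
  v3 : MemH h 3 v
  T2 : MemH h 2 T
  vper : Periodic h v
  Tper : Periodic h T
  Todd : OddZ T
  vt1 : MemH h 1 vt
  Tt1 : MemH h 1 Tt
  adm : AdmissiblePressure h p T
  mom : ∀ᵐ X : Pt, vt X + advH v v X - vint h (divH v) X • wd eZ v X
          - lapH v X - ε • wd eZ (wd eZ v) X + f₀ • kCross (v X) + gradH (pressure h p T) X = 0
  inc : ∀ᵐ x : Plane, ∫ ξ in (-h)..h, divH v (x, ξ) = 0
  temp : ∀ᵐ X : Pt, Tt X + advH v T X - vint h (divH v) X * (wd eZ T X + 1 / h)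
          - lapH T X - ε * wd eZ (wd eZ T) X = 0

/-- Evaluation of a component of a horizontal vector. -/
def comp (i : Fin 2) : Plane →L[ℝ] ℝ := EuclideanSpace.proj i

theorem comp_apply (i : Fin 2) (x : Plane) : comp i x = x i := rfl

theorem MemLp.comp_plane {μ : Measure Pt} {f : Pt → Plane} (hf : MemLp f 2 μ) (i : Fin 2) :
    MemLp (fun X => f X i) 2 μ := (comp i).comp_memLp' hf

namespace EquationsAt

variable {f₀ ε : ℝ} {v : Pt → Plane} {T : Pt → ℝ} {vt : Pt → Plane} {Tt : Pt → ℝ}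
  {p : Plane → ℝ} (H : EquationsAt h f₀ ε v T vt Tt p) (hh : 0 < h)

theorem fieldsOf_div : (fieldsOf h v T vt Tt p).div = divH v := by
  funext X
  simp only [Fields.div, divH, fieldsOf, dir_castSucc]

include H hh

theorem slice : Slice h f₀ ε (fieldsOf h v T vt Tt p) where
  hV i := H.v3.h3 H.vper (comp i)
  sym i a b := by
    filter_upwards [ae_restrict_of_ae (MemH.symm (m := 1) H.v3 a b)] with X hX
    simp only [fieldsOf, hX]
  sym' i a b c := by
    filter_upwards [ae_restrict_of_ae (MemH.symm (m := 0) (memH_succ H.v3 a).2 b c)] with X hX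
    simp only [fieldsOf, hX]
  hT := H.T2.h2 H.Tper (ContinuousLinearMap.id ℝ ℝ)
  vzT := H.Todd.vz
  vzD := by rw [fieldsOf_div]; exact H.inc
  hVt i := MemLp.comp_plane (memH_memLp H.vt1) i
  hTt := memH_memLp H.Tt1
  hP := ⟨p, H.adm.decomp hh (Tg := fun j => wd (eH j) T) (fun j => by
    have := (H.T2.h2 H.Tper (ContinuousLinearMap.id ℝ ℝ)).1 j.castSucc
    simp only [dir_castSucc] at this
    exact this) H.Todd.vz⟩
  mom i := by
    filter_upwards [ae_restrict_of_ae H.mom] with X hX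
    have := congrArg (fun x : Plane => x i) hX
    have e1 : ∀ (F : Fin 2 → Plane), (∑ j, F j) i = ∑ j, F j i := fun F => by
      simp [Fin.sum_univ_two]
    simp only [PiLp.add_apply, PiLp.sub_apply, PiLp.smul_apply, smul_eq_mul, PiLp.zero_apply, advH,
      lapH, e1] at this
    rw [Fields.W, fieldsOf_div]
    simp only [Fields.gradP, fieldsOf, dir_castSucc, dir_two]
    rw [add_sub_cancel_right]
    have e2 : kCross (v X) i = (fieldsOf h v T vt Tt p).rot i X := by fin_cases i <;> rfl
    have e3 : gradH (pressure h p T) X i = wd (eH i) (pressure h p T) X := by fin_cases i <;> rfl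
    rw [e2, e3] at this
    exact this
  temp := by
    filter_upwards [ae_restrict_of_ae H.temp] with X hX
    rw [Fields.W, fieldsOf_div]
    simp only [fieldsOf, dir_castSucc, dir_two]
    simpa only [advH, lapH, smul_eq_mul] using hX

/-- The time derivative of the velocity inherits the periodicity of the other terms. -/
theorem vt_periodic : Periodic h vt := by
  have S := H.slice hh
  have hp := H.vper
  have w1 : ∀ a, Periodic h (wd (dir a) v) := fun a => MemH.wd_periodic H.v3 hp a
  have w2 : ∀ a, Periodic h (wd (dir a) (wd (dir a) v)) := fun a =>
    MemH.wd_periodic (m := 1) (memH_succ H.v3 a).2 (w1 a) a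
  have hW : Periodic h (vint h (divH v)) := by
    have := (S.hWz hh).f2.per.2
    rwa [Fields.W, fieldsOf_div] at this
  have hpr : Periodic h (pressure h p T) := by
    obtain ⟨q, hq⟩ := S.hP
    have h1 : Per h fun X => p X.1 := (H.adm.decomp hh (Tg := fun j => wd (eH j) T) (fun j => by
      have := (H.T2.h2 H.Tper (ContinuousLinearMap.id ℝ ℝ)).1 j.castSucc
      simp only [dir_castSucc] at this
      exact this) H.Todd.vz 0).pf
    exact h1.2.comp₂ (S.hΘz hh).f2.per.2 fun a b => a - b
  have hg : ∀ j, Periodic h (wd (eH j) (pressure h p T)) := fun j =>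
    (wd_spec (H.adm.2.2 j)).periodic hpr
  have hgr : Periodic h (gradH (pressure h p T)) := (hg 0).comp₂ (hg 1) fun a b => !₂[a, b]
  have hadv : Periodic h (advH v v) := by
    have e : advH v v = fun X => v X 0 • wd (dir 0) v X + v X 1 • wd (dir 1) v X := by
      funext X; simp only [advH, Fin.sum_univ_two]; rfl
    rw [e]
    exact (hp.comp₂ (w1 0) fun a b => a 0 • b).comp₂ (hp.comp₂ (w1 1) fun a b => a 1 • b) (· + ·)
  have hlap : Periodic h (lapH v) := by
    have e : lapH v = fun X => wd (dir 0) (wd (dir 0) v) X + wd (dir 1) (wd (dir 1) v) X := by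
      funext X; simp only [lapH, Fin.sum_univ_two]; rfl
    rw [e]
    exact (w2 0).comp₂ (w2 1) (· + ·)
  have hWv : Periodic h fun X => vint h (divH v) X • wd eZ v X := hW.comp₂ (w1 2) (· • ·)
  have hall : Periodic h fun X => -(advH v v X - vint h (divH v) X • wd eZ v X
          - lapH v X - ε • wd eZ (wd eZ v) X + f₀ • kCross (v X) + gradH (pressure h p T) X) :=
    (((((hadv.comp₂ hWv (· - ·)).comp₂ hlap (· - ·)).comp₂ ((w2 2).comp (ε • ·)) (· - ·)).comp₂
      (hp.comp fun a => f₀ • kCross a) (· + ·)).comp₂ hgr (· + ·)).comp (- ·)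
  refine hall.congr ?_
  filter_upwards [H.mom] with X hX
  rw [eq_comm, eq_neg_iff_add_eq_zero, ← hX]
  abel

end EquationsAt

end

/-! ### The evolution of the energies -/

section

variable {h : ℝ}

theorem normSq_comp_le (f : Pt → Plane) (i : Fin 2) : normSq h (fun X => f X i) ≤ normSq h f := by
  refine lintegral_mono fun X => ?_
  have : ‖f X i‖ₑ ≤ ‖f X‖ₑ := by
    simpa only [enorm_le_iff_norm_le] using PiLp.norm_apply_le (f X) i
  gcongr

theorem normSq_mono_ae {F G : Type*} [NormedAddCommGroup F] [NormedAddCommGroup G] {f : Pt → F}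
    {g : Pt → G} (H : ∀ᵐ X ∂mu h, ‖f X‖ₑ ≤ ‖g X‖ₑ) : normSq h f ≤ normSq h g := by
  refine lintegral_mono_ae ?_
  filter_upwards [H] with X hX
  gcongr

theorem normSq_add_le {f g : Pt → ℝ} (hf : AEStronglyMeasurable f (mu h)) :
    normSq h (fun X => f X + g X) ≤ 2 * (normSq h f + normSq h g) := by
  rw [normSq, normSq, normSq, ← lintegral_add_left' (hf.enorm.pow_const 2),
    ← lintegral_const_mul' _ _ ENNReal.ofNat_ne_top]
  refine lintegral_mono fun X => ?_
  have h1 : ‖f X + g X‖ₑ ^ 2 ≤ (‖f X‖ₑ + ‖g X‖ₑ) ^ 2 := by gcongr; exact enorm_add_le _ _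
  refine h1.trans ?_
  have := add_sq_le (a := ‖f X‖₊) (b := ‖g X‖₊)
  have h2 := ENNReal.coe_le_coe.2 this
  push_cast at h2
  exact h2

/-- The product of an `H²` function and an `H¹` function is in `L²`, with a bound by the norms. -/
theorem H2.normSq_mul_bound (hh : 0 < h) {f k : Pt → ℝ} {Df Dk : Fin 3 → Pt → ℝ}
    {D2f : Fin 3 → Fin 3 → Pt → ℝ} (hf : H2 h f Df D2f) (hk : H1 h k Dk) {A C : ℝ≥0∞}
    (a0 : normSq h f ≤ A) (a1 : ∀ a, normSq h (Df a) ≤ A) (a2 : ∀ a b, normSq h (D2f a b) ≤ A)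
    (c0 : normSq h k ≤ C) (c1 : ∀ a, normSq h (Dk a) ≤ C) :
    normSq h (fun X => f X * k X) ≤ 4 * cz h * ((A + A + A) + (A + A + A)) * (C + C + C) := by
  refine (normSq_mul_le hh (hf.1 2) (hf.1 0) (hf.1 1) (hf.2 2 0) (hf.2 2 1) (hk 0) (hk 1)).trans ?_
  gcongr
  exacts [a1 0, a1 1, a1 2, a2 2 0, a2 2 1, c1 0, c1 1]

theorem cz_lt_top (h : ℝ) : cz h < ⊤ := by
  unfold cz; exact ENNReal.add_lt_top.2 ⟨ENNReal.ofReal_lt_top, ENNReal.one_lt_top⟩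

/-- `|v|² v` is bounded in `L²(Ω)` in terms of the `H²` norm of `v`. -/
theorem exists_cubic_bound (hh : 0 < h) {A : ℝ≥0∞} (hA : A < ⊤) : ∃ C : ℝ≥0∞, C < ⊤ ∧
    ∀ v : Pt → Plane, MemH h 2 v → Periodic h v → hNormSq h 2 v ≤ A → ∀ j,
      normSq h (fun X => (∑ i, v X i * v X i) * v X j) ≤ C := by
  let M1 : ℝ≥0∞ := 4 * cz h * ((A + A + A) + (A + A + A)) * (A + A + A)
  let M2 : ℝ≥0∞ := 2 * (2 * (M1 + M1) + 2 * (M1 + M1))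
  have fin : ∀ {a b : ℝ≥0∞}, a < ⊤ → b < ⊤ →
      4 * cz h * ((a + a + a) + (a + a + a)) * (b + b + b) < ⊤ := by
    intro a b ha hb
    have h3 : ∀ {a : ℝ≥0∞}, a < ⊤ → a + a + a < ⊤ := fun ha => by
      simp only [ENNReal.add_lt_top, ha, and_self]
    exact ENNReal.mul_lt_top (ENNReal.mul_lt_top (ENNReal.mul_lt_top ENNReal.ofNat_lt_top
      (cz_lt_top h)) (ENNReal.add_lt_top.2 ⟨h3 ha, h3 ha⟩)) (h3 hb)
  have hM1 : M1 < ⊤ := fin hA hA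
  have hM2 : M2 < ⊤ := by
    refine ENNReal.mul_lt_top ENNReal.ofNat_lt_top (ENNReal.add_lt_top.2 ⟨?_, ?_⟩) <;>
      exact ENNReal.mul_lt_top ENNReal.ofNat_lt_top (ENNReal.add_lt_top.2 ⟨hM1, hM1⟩)
  refine ⟨_, fin hA hM2, fun v hv hp hb j => ?_⟩
  have H : ∀ i, H2 h (fun X => v X i) (fun a X => wd (dir a) v X i)
      fun a b X => wd (dir b) (wd (dir a) v) X i := fun i => hv.h2 hp (comp i)
  have n0 : ∀ i, normSq h (fun X => v X i) ≤ A := fun i =>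
    (normSq_comp_le v i).trans ((normSq_le_hNormSq 2 v).trans hb)
  have n1 : ∀ i a, normSq h (fun X => wd (dir a) v X i) ≤ A := fun i a =>
    (normSq_comp_le _ i).trans ((normSq_le_hNormSq 1 _).trans ((hNormSq_wd_le 1 v a).trans hb))
  have n2 : ∀ i a b, normSq h (fun X => wd (dir b) (wd (dir a) v) X i) ≤ A := fun i a b =>
    (normSq_comp_le _ i).trans ((normSq_le_hNormSq 0 _).trans
      ((hNormSq_wd_le 0 _ b).trans ((hNormSq_wd_le 1 v a).trans hb)))
  have hqq : H1 h (fun X => ∑ i, v X i * v X i)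
      fun a X => ∑ i, (wd (dir a) v X i * v X i + v X i * wd (dir a) v X i) := fun a =>
    D1.sum hh fun i => (H i).mul hh (H i) a
  have b0 : ∀ i, normSq h (fun X => v X i * v X i) ≤ M1 := fun i =>
    (H i).normSq_mul_bound hh (H i).1 (n0 i) (n1 i) (n2 i) (n0 i) (n1 i)
  have b1 : ∀ i a, normSq h (fun X => v X i * wd (dir a) v X i) ≤ M1 := fun i a =>
    (H i).normSq_mul_bound hh ((H i).2 a) (n0 i) (n1 i) (n2 i) (n1 i a) (n2 i a)
  have b2 : ∀ i a, normSq h (fun X => wd (dir a) v X i * v X i) ≤ M1 := fun i a => by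
    have := b1 i a
    simpa only [mul_comm] using this
  have l0 : ∀ i, L2P h (fun X => v X i * v X i) := fun i => (H i).mul_l2 hh (H i).1
  have l1 : ∀ i a, L2P h (fun X => v X i * wd (dir a) v X i) := fun i a =>
    (H i).mul_l2 hh ((H i).2 a)
  have q0 : normSq h (fun X => ∑ i, v X i * v X i) ≤ M2 := by
    simp only [Fin.sum_univ_two]
    refine (normSq_add_le (l0 0).mem.1).trans ?_
    simp only [M2]
    have hM : M1 ≤ 2 * (M1 + M1) := by
      rw [two_mul, add_assoc]; exact le_self_add
    gcongr
    exacts [(b0 0).trans hM, (b0 1).trans hM]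
  have q1 : ∀ a, normSq h (fun X => ∑ i, (wd (dir a) v X i * v X i + v X i * wd (dir a) v X i)) ≤
      M2 := by
    intro a
    simp only [Fin.sum_univ_two]
    refine (normSq_add_le ((l1 0 a).mul_comm.mem.1.add (l1 0 a).mem.1)).trans ?_
    simp only [M2]
    refine mul_le_mul_right (add_le_add ((normSq_add_le (l1 0 a).mul_comm.mem.1).trans ?_)
      ((normSq_add_le (l1 1 a).mul_comm.mem.1).trans ?_)) _
    · exact mul_le_mul_right (add_le_add (b2 0 a) (b1 0 a)) _
    · exact mul_le_mul_right (add_le_add (b2 1 a) (b1 1 a)) _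
  have := (H j).normSq_mul_bound hh hqq (n0 j) (n1 j) (n2 j) q0 q1
  simpa only [mul_comm] using this

/-- The properties of the evolution of a solution on which the a priori estimates rest: the
equations at almost every time, and the time derivatives of the energies that are estimated. -/
structure Evolution (h f₀ ε : ℝ) (s : ℝ → Fields) : Prop where
  slice : ∀ᵐ t ∂volume.restrict (Ioi (0 : ℝ)), Slice h f₀ ε (s t)
  ortho : ∀ᵐ t ∂volume.restrict (Ioi (0 : ℝ)),
    ∫ X in Om h, ((s t).P 0 X * (s t).Vt 0 X + (s t).P 1 X * (s t).Vt 1 X) = 0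
  four : ∀ t, 0 < t →
    IntegrableOn (fun r => ∫ X in Om h, ∑ i, (s r).q X * (s r).V i X * (s r).Vt i X) (Ioo 0 t) ∧
    (s t).y4 h = (s 0).y4 h +
      4 * ∫ r in (0 : ℝ)..t, ∫ X in Om h, ∑ i, (s r).q X * (s r).V i X * (s r).Vt i X
  temp : ∀ t, 0 < t →
    IntegrableOn (fun r => ∫ X in Om h, (s r).T X * (s r).Tt X) (Ioo 0 t) ∧
    ∫ X in Om h, (s t).T X * (s t).T X = (∫ X in Om h, (s 0).T X * (s 0).T X) +
      2 * ∫ r in (0 : ℝ)..t, ∫ X in Om h, (s r).T X * (s r).Tt X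
  vert : ∀ (L : ℝ) (φ : Plane → ℝ) (φ1 : Fin 3 → Plane → ℝ) (χ : Plane → ℝ),
    Cutoff h L φ φ1 χ → ∀ τ, 0 < τ →
    IntegrableOn (fun r => ∫ X in Om h, φ X.1 ^ 2 * (s r).uzVt X) (Ioo 0 τ) ∧
    ∀ t ∈ Icc 0 τ, ∫ X in Om h, φ X.1 ^ 2 * (s t).u2 X =
      (∫ X in Om h, φ X.1 ^ 2 * (s 0).u2 X) -
        2 * ∫ r in (0 : ℝ)..t, ∫ X in Om h, φ X.1 ^ 2 * (s r).uzVt X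
  u_mem : ∀ t, 0 ≤ t → ∀ i, MemLp ((s t).V1 i 2) 2 (mu h)
  u_cont : ∀ r, 0 ≤ r → ∀ i, Tendsto (fun t => ∫ X in Om h,
    ((s t).V1 i 2 X - (s r).V1 i 2 X) * ((s t).V1 i 2 X - (s r).V1 i 2 X)) (𝓝[Ici 0] r) (𝓝 0)

end

/-! ### Strong solutions -/

section

variable {h : ℝ}

theorem ae_Ioi_of_Ioo {P : ℝ → Prop} (H : ∀ τ : ℝ, 0 < τ → ∀ᵐ t ∂volume.restrict (Ioo 0 τ), P t) :
    ∀ᵐ t ∂volume.restrict (Ioi (0 : ℝ)), P t := by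
  have h1 : ∀ᵐ t : ℝ, ∀ n : ℕ, t ∈ Ioo (0 : ℝ) (n + 1) → P t := ae_all_iff.2 fun n =>
    (ae_restrict_iff' measurableSet_Ioo).1 (H (n + 1) (by positivity))
  rw [ae_restrict_iff' measurableSet_Ioi]
  filter_upwards [h1] with t ht h0
  obtain ⟨n, hn⟩ := exists_nat_gt t
  exact ht n ⟨h0, by linarith⟩

theorem lintegral_lt_top_of_ae_le {F : ℝ → ℝ≥0∞} {τ : ℝ} {C : ℝ≥0∞} (hC : C < ⊤)
    (H : ∀ᵐ t ∂volume.restrict (Ioo 0 τ), F t ≤ C) : ∫⁻ t in Ioo 0 τ, F t < ⊤ := by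
  refine (lintegral_mono_ae H).trans_lt ?_
  rw [setLIntegral_const, Real.volume_Ioo]
  exact ENNReal.mul_lt_top hC ENNReal.ofReal_lt_top

section Solution

variable {f₀ ε : ℝ} {v : ℝ → Pt → Plane} {T : ℝ → Pt → ℝ} {vt : ℝ → Pt → Plane}
  {Tt : ℝ → Pt → ℝ}

theorem timePath_velocity (hv : ContH h 1 v) (ht : HasWeakTimeDeriv v vt) (h2 : L2LocH h 1 vt)
    (i : Fin 2) : TimePath h (fun t X => v t X i) fun t X => vt t X i := by
  refine TimePath.of_hasWeakDeriv (ht.comp_clm (comp i))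
    (fun t h0 => MemLp.comp_plane (memH_memLp (hv.1 t h0)) i) (fun s hs => ?_) ?_ (fun τ hτ => ?_)
  · refine tendsto_of_tendsto_of_tendsto_of_le_of_le tendsto_const_nhds (hv.2 s hs)
      (fun _ => zero_le) fun t => ?_
    exact (normSq_comp_le (v t - v s) i).trans (normSq_le_hNormSq 1 _)
  · filter_upwards [h2.1] with t h3 using MemLp.comp_plane (memH_memLp h3) i
  · exact (lintegral_mono fun t => (normSq_comp_le (vt t) i).trans
      (normSq_le_hNormSq 1 _)).trans_lt (h2.2 τ hτ)

theorem timePath_temperature (hT : ContH h 1 T) (ht : HasWeakTimeDeriv T Tt)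
    (h2 : L2LocH h 1 Tt) : TimePath h T Tt := by
  refine TimePath.of_hasWeakDeriv ht (fun t h0 => memH_memLp (hT.1 t h0)) (fun s hs => ?_) ?_
    (fun τ hτ => ?_)
  · exact tendsto_of_tendsto_of_tendsto_of_le_of_le tendsto_const_nhds (hT.2 s hs)
      (fun _ => zero_le) fun t => normSq_le_hNormSq 1 _
  · filter_upwards [h2.1] with t h3 using memH_memLp h3
  · exact (lintegral_mono fun t => normSq_le_hNormSq 1 _).trans_lt (h2.2 τ hτ)

theorem tendsto_normSq_wd (hv : ContH h 1 v) (a : Fin 3) (i : Fin 2) {s : ℝ} (hs : 0 ≤ s) :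
    Tendsto (fun t => normSq h fun X => wd (dir a) (v t) X i - wd (dir a) (v s) X i)
      (𝓝[Ici 0] s) (𝓝 0) := by
  refine tendsto_of_tendsto_of_tendsto_of_le_of_le' tendsto_const_nhds (hv.2 s hs)
    (Eventually.of_forall fun _ => zero_le) ?_
  filter_upwards [self_mem_nhdsWithin] with t ht
  have e := (hv.1 t ht).wd_sub (hv.1 s hs) a
  refine le_trans ?_ (hNormSq_wd_le 0 (v t - v s) a)
  refine (normSq_comp_le (fun X => wd (dir a) (v t) X - wd (dir a) (v s) X) i).trans
    (normSq_mono_ae ?_)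
  filter_upwards [ae_restrict_of_ae e] with X hX
  rw [hX]; rfl

/-- A global strong solution satisfies the hypotheses of the a priori estimates. -/
theorem exists_evolution (hh : 0 < h) {v₀ : Pt → Plane} {T₀ : Pt → ℝ} (h0 : InitialData h v₀ T₀)
    (H : IsGlobalStrongSolution h f₀ ε v₀ T₀ v T) :
    ∃ (vt : ℝ → Pt → Plane) (Tt : ℝ → Pt → ℝ) (p : ℝ → Plane → ℝ),
      Evolution h f₀ ε fun t => fieldsOf h (v t) (T t) (vt t) (Tt t) (p t) := by
  obtain ⟨hper, -, -, hvb, hvc, hv3, hTb, hTc, -, hv0, -, vt, Tt, p, dv, v1, dT, T1, heq⟩ := H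
  refine ⟨vt, Tt, p, ?_⟩
  have path := timePath_velocity hvc dv v1
  have pathT := timePath_temperature hTc dT T1
  have hT2 : ∀ᵐ t ∂volume.restrict (Ioi (0 : ℝ)), MemH h 2 (T t) := ae_Ioi_of_Ioo fun τ hτ => by
    obtain ⟨B, hB⟩ := hTb τ hτ
    filter_upwards [hB] with t ht using ht.1
  have hE : ∀ᵐ t ∂volume.restrict (Ioi (0 : ℝ)),
      EquationsAt h f₀ ε (v t) (T t) (vt t) (Tt t) (p t) := by
    filter_upwards [hv3.1, hT2, v1.1, T1.1, heq, ae_restrict_mem measurableSet_Ioi]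
      with t e1 e2 e3 e4 e5 e6
    obtain ⟨p1, p2, p3, p4⟩ := hper t (le_of_lt e6)
    exact ⟨e1, e2, p1, p2, p4, e3, e4, e5.1, e5.2.1, e5.2.2.1, e5.2.2.2⟩
  have hu : ∀ t, 0 ≤ t → ∀ i, D1 h 2 (fun X => v t X i) fun X => wd (dir 2) (v t) X i :=
    fun t ht i => (hvc.1 t ht).h1 (hper t ht).1 (comp i) 2
  refine ⟨?_, ?_, ?_, ?_, ?_, fun t ht i => (hu t ht i).g2.mem, ?_⟩
  · filter_upwards [hE] with t ht using ht.slice hh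
  · -- the gradient of the surface pressure is orthogonal to the velocity at all times
    have hG : ∀ᵐ t ∂volume.restrict (Ioi (0 : ℝ)),
        t ∈ {t | EquationsAt h f₀ ε (v t) (T t) (vt t) (Tt t) (p t)} := hE
    filter_upwards [TimePath.ae_orthogonal path hG, hE] with t ht hEt
    have S := hEt.slice hh
    obtain ⟨q, qz, q0, q1⟩ := S.pressure_exists hh
    have hP := fun i => (S.P_l2 hh i).mem
    have hz := ht (fun i => (fieldsOf h (v t) (T t) (vt t) (Tt t) (p t)).P i) hP ?_
    · rw [Fin.sum_univ_two] at hz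
      rw [integral_add (integrable_mul_of_memLp (hP 0) (S.hVt 0))
        (integrable_mul_of_memLp (hP 1) (S.hVt 1)), ← hz]
      congr 1 <;> exact integral_congr_ae (Eventually.of_forall fun X => mul_comm _ _)
    · intro r hr _
      have S' := EquationsAt.slice hr hh
      have key := integral_grad_mul_eq_zero hh qz q0 q1 ((S'.hV 0).1 0) ((S'.hV 1).1 1) (by
        have := S'.vzD
        have e : (fieldsOf h (v r) (T r) (vt r) (Tt r) (p r)).div = fun X =>
            (fieldsOf h (v r) (T r) (vt r) (Tt r) (p r)).V1 0 0 X +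
            (fieldsOf h (v r) (T r) (vt r) (Tt r) (p r)).V1 1 1 X := by
          funext X; simp only [Fields.div, Fin.sum_univ_two]; rfl
        rwa [e] at this)
      have m := fun i => ((S'.hV i).1 0).f2.mem
      rw [integral_add (integrable_mul_of_memLp (hP 0) (m 0))
        (integrable_mul_of_memLp (hP 1) (m 1))] at key
      rw [Fin.sum_univ_two, ← key]
      congr 1 <;> exact integral_congr_ae (Eventually.of_forall fun X => mul_comm _ _)
  · intro t ht
    obtain ⟨B, hB⟩ := hvb t ht
    obtain ⟨C, hC, hC2⟩ := exists_cubic_bound hh (A := ENNReal.ofReal B) ENNReal.ofReal_lt_top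
    have h0' : MemH h 2 v₀ := h0.v_mem
    have hq0 : Integrable (fun X => (∑ i, v 0 X i * v 0 X i) * ∑ i, v 0 X i * v 0 X i) (mu h) := by
      have hc := fun i => h0'.h2 h0.v_per (comp i)
      have := (D1.sum hh fun i => (hc i).mul hh (hc i) 0).f2
      refine (this.integrable_mul this).congr ?_
      filter_upwards [ae_restrict_of_ae hv0] with X hX
      simp only [hX, comp_apply]
    exact TimePath.integral_four path ht hq0 fun j => lintegral_lt_top_of_ae_le hC (by
      filter_upwards [hB, ae_restrict_mem measurableSet_Ioo] with r hr hr0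
      exact hC2 (v r) hr.1 (hper r hr0.1.le).1 hr.2 j)
  · intro t ht
    obtain ⟨B, hB⟩ := hTb t ht
    exact pathT.integral_sq ht (lintegral_lt_top_of_ae_le (C := ENNReal.ofReal B)
      ENNReal.ofReal_lt_top (by
        filter_upwards [hB] with r hr using (normSq_le_hNormSq 2 _).trans hr.2))
  · intro L φ φ1 χ Φ τ hτ
    obtain ⟨B, hB⟩ := hvb τ hτ
    have hEτ := ae_restrict_of_ae_restrict_of_subset (s := Ioo 0 τ) Ioo_subset_Ioi_self hE
    have key := fun i => (path i).integral_vertical hh Φ hτ (B := B)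
      (u := fun t X => wd (dir 2) (v t) X i) (w := fun t X => wd (dir 2) (wd (dir 2) (v t)) X i)
      (fun t ht => hu t ht i) (by
        filter_upwards [hB, ae_restrict_mem measurableSet_Ioo] with r hr hr0
        exact ⟨(hr.1.h2 (hper r hr0.1.le).1 (comp i)).2 2 2, (normSq_comp_le _ i).trans
          ((hNormSq_wd_le 0 _ 2).trans ((hNormSq_wd_le 1 (v r) 2).trans hr.2))⟩) (by
        filter_upwards [hEτ] with r hr
        exact ⟨_, (hr.vt1.h1 (hr.vt_periodic hh) (comp i)) 2⟩)
      fun s hs => tendsto_normSq_wd hvc 2 i hs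
    have split : ∀ᵐ r ∂volume.restrict (Ioo 0 τ), ∫ X in Om h, φ X.1 ^ 2 *
        (fieldsOf h (v r) (T r) (vt r) (Tt r) (p r)).uzVt X =
        (∫ X in Om h, φ X.1 ^ 2 * (wd (dir 2) (wd (dir 2) (v r)) X 0 * vt r X 0)) +
        ∫ X in Om h, φ X.1 ^ 2 * (wd (dir 2) (wd (dir 2) (v r)) X 1 * vt r X 1) := by
      filter_upwards [hEτ] with r hr
      have S := hr.slice hh
      have i1 : ∀ i : Fin 2, Integrable (fun X : Pt => φ X.1 ^ 2 *
          (wd (dir 2) (wd (dir 2) (v r)) X i * vt r X i)) (mu h) := fun i => Φ.integrable_sq_mul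
        (integrable_mul_of_memLp ((S.hV2 i).2 2 2).g2.mem (S.hVt i))
      rw [← integral_add (i1 0) (i1 1)]
      refine integral_congr_ae (Eventually.of_forall fun X => ?_)
      simp only [Fields.uzVt, Fin.sum_univ_two, mul_add]
      rfl
    refine ⟨((key 0).1.add (key 1).1).congr (by
      filter_upwards [split] with r hr using hr.symm), fun t ht => ?_⟩
    have splitu : ∀ t, 0 ≤ t → ∫ X in Om h, φ X.1 ^ 2 *
        (fieldsOf h (v t) (T t) (vt t) (Tt t) (p t)).u2 X =
        (∫ X in Om h, φ X.1 ^ 2 * (wd (dir 2) (v t) X 0 * wd (dir 2) (v t) X 0)) +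
        ∫ X in Om h, φ X.1 ^ 2 * (wd (dir 2) (v t) X 1 * wd (dir 2) (v t) X 1) := by
      intro t ht
      have i1 := fun i => Φ.integrable_sq_mul
        (integrable_mul_of_memLp (hu t ht i).g2.mem (hu t ht i).g2.mem)
      rw [← integral_add (i1 0) (i1 1)]
      refine integral_congr_ae (Eventually.of_forall fun X => ?_)
      simp only [Fields.u2, Fin.sum_univ_two, mul_add]
      rfl
    rw [splitu t ht.1, splitu 0 le_rfl, (key 0).2 t ht, (key 1).2 t ht]
    have sub : Ioo 0 t ⊆ Ioo 0 τ := Ioo_subset_Ioo_right ht.2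
    have e : ∫ r in (0 : ℝ)..t, ∫ X in Om h, φ X.1 ^ 2 *
        (fieldsOf h (v r) (T r) (vt r) (Tt r) (p r)).uzVt X =
        (∫ r in (0 : ℝ)..t, ∫ X in Om h, φ X.1 ^ 2 *
          (wd (dir 2) (wd (dir 2) (v r)) X 0 * vt r X 0)) +
        ∫ r in (0 : ℝ)..t, ∫ X in Om h, φ X.1 ^ 2 *
          (wd (dir 2) (wd (dir 2) (v r)) X 1 * vt r X 1) := by
      simp only [intervalIntegral.integral_of_le ht.1, integral_Ioc_eq_integral_Ioo]
      rw [← integral_add ((key 0).1.mono_set sub) ((key 1).1.mono_set sub)]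
      exact integral_congr_ae (ae_restrict_of_ae_restrict_of_subset sub split)
    rw [e]
    ring
  · intro r hr i
    refine tendsto_integral_mul_self
      (d := fun t X => wd (dir 2) (v t) X i - wd (dir 2) (v r) X i) ?_ (tendsto_normSq_wd hvc 2 i hr)
    filter_upwards [self_mem_nhdsWithin] with t ht
    exact (hu t ht i).g2.mem.sub (hu r hr i).g2.mem

end Solution

end

/-! ### Continuation in time -/

section

variable {h : ℝ}

/-- Continuation of a family of bounds: if the weaker bound `c` on `[0, t]` implies the stronger
bound `b` at `t`, and the family is equicontinuous, then the stronger bound holds throughout. -/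
theorem continuation {ι : Type*} {F : ι → ℝ → ℝ} {τ b c : ℝ} (hbc : b < c)
    (hc : ∀ s ∈ Icc 0 τ, ∀ η > 0, ∀ᶠ t in 𝓝[Icc 0 τ] s, ∀ i, |F i t - F i s| ≤ η)
    (h0 : ∀ i, F i 0 ≤ b)
    (step : ∀ t ∈ Icc 0 τ, (∀ s ∈ Icc 0 t, ∀ i, F i s ≤ c) → ∀ i, F i t ≤ b) :
    ∀ t ∈ Icc 0 τ, ∀ i, F i t ≤ b := by
  let A : Set ℝ := {t | ∀ s ∈ Icc 0 t, ∀ i, F i s ≤ b}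
  have hcl : IsClosed (A ∩ Icc 0 τ) := by
    refine isClosed_of_closure_subset fun t ht => ?_
    have htI : t ∈ Icc 0 τ := closure_minimal inter_subset_right isClosed_Icc ht
    have hlt : ∀ s, 0 ≤ s → s < t → ∀ i, F i s ≤ b := by
      intro s hs hst
      obtain ⟨t', h1, h2⟩ := mem_closure_iff.1 ht (Ioi s) isOpen_Ioi hst
      exact h2.1 s ⟨hs, le_of_lt h1⟩
    refine ⟨fun s hs => ?_, htI⟩
    rcases hs.2.eq_or_lt with rfl | hst
    · rcases hs.1.eq_or_lt with rfl | hpos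
      · exact h0
      · refine step s htI fun r hr i => ?_
        rcases hr.2.eq_or_lt with rfl | hrs
        · obtain ⟨η, hη, hball⟩ := Metric.mem_nhdsWithin_iff.1 (hc r htI (c - b) (by linarith))
          have hm : max 0 (r - η / 2) < r := max_lt hpos (by linarith)
          have hmem : max 0 (r - η / 2) ∈ Metric.ball r η ∩ Icc 0 τ := by
            refine ⟨?_, le_max_left _ _, hm.le.trans htI.2⟩
            rw [Metric.mem_ball, Real.dist_eq, abs_sub_lt_iff]
            constructor <;> linarith [le_max_right 0 (r - η / 2)]
          have h1 : ∀ i, _ := hball hmem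
          have h2 := (abs_le.1 (h1 i)).1
          have h3 := hlt _ (le_max_left 0 (r - η / 2)) hm i
          linarith
        · exact (hlt r hr.1 hrs i).trans hbc.le
    · exact hlt s hs.1 hst
  have h0A : (0 : ℝ) ∈ A := by
    intro s hs
    rw [show s = 0 from le_antisymm hs.2 hs.1]; exact h0
  have := IsClosed.Icc_subset_of_forall_exists_gt hcl h0A (by
    rintro x ⟨hxA, hx⟩ y hy
    have hxI : x ∈ Icc 0 τ := ⟨hx.1, hx.2.le⟩
    obtain ⟨η, hη, hball⟩ := Metric.mem_nhdsWithin_iff.1 (hc x hxI (c - b) (by linarith))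
    let z := min (min y τ) (x + η / 2)
    have hxz : x < z := lt_min (lt_min hy hx.2) (by linarith)
    have hzy : z ≤ y := (min_le_left _ _).trans (min_le_left _ _)
    have hzτ : z ≤ τ := (min_le_left _ _).trans (min_le_right _ _)
    have hzη : z ≤ x + η / 2 := min_le_right _ _
    have hcz : ∀ r ∈ Icc 0 z, ∀ i, F i r ≤ c := by
      intro r hr i
      rcases le_or_gt r x with hrx | hrx
      · exact (hxA r ⟨hr.1, hrx⟩ i).trans hbc.le
      · have hmem : r ∈ Metric.ball x η ∩ Icc 0 τ := by
          refine ⟨?_, hr.1, hr.2.trans hzτ⟩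
          rw [Metric.mem_ball, Real.dist_eq, abs_of_pos (by linarith)]
          linarith [hr.2]
        have h1 : ∀ i, _ := hball hmem
        have h2 := (abs_le.1 (h1 i)).2
        have h3 := hxA x ⟨hx.1, le_rfl⟩ i
        linarith
    exact ⟨z, fun r hr => step r ⟨hr.1, hr.2.trans hzτ⟩ fun q hq => hcz q ⟨hq.1, hq.2.trans hr.2⟩,
      hxz, hzy⟩)
  exact fun t ht => this ht t ⟨ht.1, le_rfl⟩

theorem integral_le_of_ae_le {R : ℝ → ℝ} {t K : ℝ} (ht : 0 ≤ t) (hR : IntegrableOn R (Ioo 0 t))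
    (H : ∀ᵐ r ∂volume.restrict (Ioo 0 t), R r ≤ K) : ∫ r in (0 : ℝ)..t, R r ≤ t * K := by
  rw [intervalIntegral.integral_of_le ht, integral_Ioc_eq_integral_Ioo]
  refine (integral_mono_ae hR (integrable_const K) H).trans (le_of_eq ?_)
  simp [Measure.real, ht]

namespace Evolution

variable {f₀ ε : ℝ} {s : ℝ → Fields} (E : Evolution h f₀ ε s) (hh : 0 < h) (hε : 0 < ε)

include E hh hε

/-- The bound of `‖v‖₄⁴ + ‖T‖₂²` on a time interval that depends only on the initial bound. -/
theorem energy_bound {Y : ℝ} (hY : 0 ≤ Y) (h4 : (s 0).y4 h ≤ Y)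
    (hT : ∫ X in Om h, (s 0).T X * (s 0).T X ≤ Y) :
    ∀ t ∈ Icc 0 (1 / (rateConst h f₀ * (9 + 4 * Y) ^ 2)),
      (s t).y4 h + ∫ X in Om h, (s t).T X * (s t).T X ≤ 6 + 6 * Y := by
  have c0 := rateConst_pos hh f₀
  set K := rateConst h f₀ * (9 + 4 * Y) ^ 2 with hK
  have K0 : 0 < K := by positivity
  have t0 : 0 < 1 / K := by positivity
  let R : ℝ → ℝ := fun r => (∫ X in Om h, ∑ i, (s r).q X * (s r).V i X * (s r).Vt i X) +
    ∫ X in Om h, (s r).T X * (s r).Tt X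
  -- the rate is at most `K` as long as `Z ≤ Y + 2`, since then `1 + y4 ≤ 1 + 4 (Y + 2)`
  let Z : ℝ → ℝ := fun t => (s t).y4 h / 4 + (∫ X in Om h, (s t).T X * (s t).T X) / 2
  have hR : ∀ t, 0 < t → IntegrableOn R (Ioo 0 t) := fun t ht =>
    (E.four t ht).1.add (E.temp t ht).1
  have hZ : ∀ t, 0 ≤ t → Z t = Z 0 + ∫ r in (0 : ℝ)..t, R r := by
    intro t ht
    rcases ht.eq_or_lt with rfl | ht0
    · simp
    · have e1 := (E.four t ht0)
      have e2 := (E.temp t ht0)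
      have i1 := (intervalIntegrable_iff_integrableOn_Ioo_of_le ht).2 e1.1
      have i2 := (intervalIntegrable_iff_integrableOn_Ioo_of_le ht).2 e2.1
      simp only [Z, R]
      rw [e1.2, e2.2, intervalIntegral.integral_add i1 i2]
      ring
  have T0 : ∀ t, 0 ≤ ∫ X in Om h, (s t).T X * (s t).T X := fun t =>
    integral_nonneg fun X => mul_self_nonneg _
  have y0 : ∀ t, 0 ≤ (s t).y4 h := fun t => (s t).y4_nonneg
  have hrate : ∀ᵐ r ∂volume.restrict (Ioi (0 : ℝ)), R r ≤ rateConst h f₀ * (1 + (s r).y4 h) ^ 2 := by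
    filter_upwards [E.slice, E.ortho] with r h1 h2 using h1.rate hh hε h2
  have key := continuation (ι := Unit) (F := fun _ => Z) (τ := 1 / K) (b := Y + 1) (c := Y + 2)
    (by linarith) ?_ ?_ ?_
  · intro t ht
    have := key t ht ()
    simp only [Z] at this
    linarith [T0 t, y0 t]
  · have hI := (intervalIntegrable_iff_integrableOn_Ioo_of_le t0.le).2 (hR _ t0)
    have hcont := intervalIntegral.continuousOn_primitive_interval' hI left_mem_uIcc
    rw [uIcc_of_le t0.le] at hcont
    have hZc : ContinuousOn Z (Icc 0 (1 / K)) :=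
      (continuousOn_const.add hcont).congr fun t ht => hZ t ht.1
    intro r hr η hη
    have := Metric.tendsto_nhds.1 (hZc r hr) η hη
    filter_upwards [this] with t ht _
    exact (le_of_lt ht)
  · intro _
    simp only [Z]
    linarith [T0 0, y0 0]
  · intro t ht hc _
    rw [hZ t ht.1]
    have hZ0 : Z 0 ≤ Y := by simp only [Z]; linarith [T0 0, y0 0]
    rcases ht.1.eq_or_lt with rfl | ht0
    · simp; linarith
    have h1 : ∫ r in (0 : ℝ)..t, R r ≤ t * K := by
      refine integral_le_of_ae_le ht.1 (hR t ht0) ?_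
      filter_upwards [ae_restrict_of_ae_restrict_of_subset (s := Ioo 0 t) Ioo_subset_Ioi_self hrate,
        ae_restrict_mem measurableSet_Ioo] with r hr hrt
      refine hr.trans ?_
      have h2 := hc r ⟨hrt.1.le, hrt.2.le⟩ ()
      simp only [Z] at h2
      have h3 : 1 + (s r).y4 h ≤ 9 + 4 * Y := by linarith [T0 r]
      rw [hK]
      refine mul_le_mul_of_nonneg_left (pow_le_pow_left₀ (by linarith [y0 r]) h3 2) c0.le
    have h2 : t * K ≤ 1 := by
      have := mul_le_mul_of_nonneg_right ht.2 K0.le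
      rwa [one_div, inv_mul_cancel₀ K0.ne'] at this
    linarith

/-- The localized energies `∫ φ_a² |∂_z v|²` stay small, and their dissipation is integrable in
time. -/
theorem local_bound {ρ L τ Z δ : ℝ}
    (Φ : ∀ a, Cutoff h L (cutφ ρ a) (cutφ1 ρ a) (cutχ ρ a)) (hτ : 0 < τ) (hδ : 0 < δ)
    (hZ : ∀ t ∈ Icc 0 τ, 1 + (s t).y4 h + ∫ X in Om h, (s t).T X * (s t).T X ≤ Z)
    (hs : smallConst h * (27 * δ) ≤ 1) (hsmall : 2 * (localConst h L * Z) * τ ≤ δ)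
    (hinit : ∀ a, ∫ X in Om h, cutφ ρ a X.1 ^ 2 * (s 0).u2 X ≤ δ) :
    (∀ t ∈ Icc 0 τ, ∀ a, ∫ X in Om h, cutφ ρ a X.1 ^ 2 * (s t).u2 X ≤ 2 * δ) ∧
    ∀ a, ∃ G : ℝ → ℝ, IntegrableOn G (Ioo 0 τ) ∧ ∫ t in Ioo 0 τ, G t ≤ δ ∧
      ∀ᵐ t ∂volume.restrict (Ioo 0 τ), (∫ X in Om h, cutφ ρ a X.1 ^ 2 * (s t).gradu X) / 4 +
        ε * (∫ X in Om h, cutφ ρ a X.1 ^ 2 * (s t).uz X) ≤ G t := by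
  have L0 : 0 ≤ localConst h L := by
    have := (Φ 0).L_nonneg
    unfold localConst; positivity
  have hφ1 : ∀ a (X : Pt), |cutφ ρ a X.1 ^ 2| ≤ 1 := fun a X => by
    rw [abs_pow]; exact pow_le_one₀ (abs_nonneg _) ((Φ a).abs_le_one _)
  have mφ : ∀ a, AEStronglyMeasurable (fun X : Pt => cutφ ρ a X.1 ^ 2) (mu h) := fun a =>
    ((Φ a).d 0).f2.mem.1.pow 2
  have iu : ∀ t, 0 ≤ t → ∀ a i, Integrable (fun X : Pt => cutφ ρ a X.1 ^ 2 *
      ((s t).V1 i 2 X * (s t).V1 i 2 X)) (mu h) := fun t ht a i =>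
    (Φ a).integrable_sq_mul (integrable_mul_of_memLp (E.u_mem t ht i) (E.u_mem t ht i))
  have hF : ∀ t, 0 ≤ t → ∀ a, ∫ X in Om h, cutφ ρ a X.1 ^ 2 * (s t).u2 X =
      (∫ X in Om h, cutφ ρ a X.1 ^ 2 * ((s t).V1 0 2 X * (s t).V1 0 2 X)) +
      ∫ X in Om h, cutφ ρ a X.1 ^ 2 * ((s t).V1 1 2 X * (s t).V1 1 2 X) := by
    intro t ht a
    rw [← integral_add (iu t ht a 0) (iu t ht a 1)]
    exact integral_congr_ae (Eventually.of_forall fun X => by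
      simp only [Fields.u2, Fin.sum_univ_two]; ring)
  -- the local rate, as long as all the localized energies are at most `3 δ`
  have rate : ∀ t ∈ Icc 0 τ,
      (∀ r ∈ Icc 0 t, ∀ a, ∫ X in Om h, cutφ ρ a X.1 ^ 2 * (s r).u2 X ≤ 3 * δ) →
      ∀ a, ∀ᵐ r ∂volume.restrict (Ioo 0 t),
        (∫ X in Om h, cutφ ρ a X.1 ^ 2 * (s r).gradu X) / 4 +
        ε * (∫ X in Om h, cutφ ρ a X.1 ^ 2 * (s r).uz X) ≤
        localConst h L * Z + ∫ X in Om h, cutφ ρ a X.1 ^ 2 * (s r).uzVt X := by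
    intro t ht hc a
    filter_upwards [ae_restrict_of_ae_restrict_of_subset (s := Ioo 0 t) Ioo_subset_Ioi_self E.slice,
        ae_restrict_mem measurableSet_Ioo] with r S hr
    -- nine cutoffs cover the support, and `27 = 9 · 3`
    have hm : ∫ X in Om h, cutχ ρ a X.1 * (s r).u2 X ≤ 27 * δ := by
      have e : ∀ X : Pt, cutχ ρ a X.1 * (s r).u2 X =
          ∑ k, cutφ ρ (nine ρ a k) X.1 ^ 2 * (s r).u2 X := fun X => by
        rw [cutχ_eq, Finset.sum_mul]
      simp only [e]
      rw [integral_finsetSum _ fun k _ => (Φ (nine ρ a k)).integrable_sq_mul (S.integrable_u2 hh)]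
      refine (Finset.sum_le_sum fun k _ => hc r ⟨hr.1.le, hr.2.le⟩ (nine ρ a k)).trans ?_
      simp only [Finset.sum_const, Finset.card_univ, Fintype.card_prod, Fintype.card_fin,
        nsmul_eq_mul]
      push_cast; linarith
    have sc : 0 ≤ smallConst h := by unfold smallConst; positivity
    have := S.local_rate hh (Φ a) ((mul_le_mul_of_nonneg_left hm sc).trans hs)
    have h2 := mul_le_mul_of_nonneg_left (hZ r ⟨hr.1.le, hr.2.le.trans ht.2⟩) L0
    linarith
  have diss0 : ∀ r a, 0 ≤ (∫ X in Om h, cutφ ρ a X.1 ^ 2 * (s r).gradu X) / 4 +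
        ε * (∫ X in Om h, cutφ ρ a X.1 ^ 2 * (s r).uz X) := fun r a => by
    have h1 : 0 ≤ ∫ X in Om h, cutφ ρ a X.1 ^ 2 * (s r).gradu X := integral_nonneg fun X =>
      mul_nonneg (sq_nonneg _) ((s r).gradu_nonneg X)
    have h2 : 0 ≤ ∫ X in Om h, cutφ ρ a X.1 ^ 2 * (s r).uz X := integral_nonneg fun X =>
      mul_nonneg (sq_nonneg _) ((s r).uz_nonneg X)
    positivity
  have main := continuation (F := fun a t => ∫ X in Om h, cutφ ρ a X.1 ^ 2 * (s t).u2 X) (τ := τ)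
    (b := 2 * δ) (c := 3 * δ) (by linarith) ?_ (fun a => (hinit a).trans (by linarith)) ?_
  · -- the dissipation is dominated by a function whose integral is computed from the balance
    refine ⟨main, fun a => ⟨fun r => localConst h L * Z +
      ∫ X in Om h, cutφ ρ a X.1 ^ 2 * (s r).uzVt X, ?_, ?_,
      rate τ ⟨hτ.le, le_rfl⟩ (fun r hr b => (main r hr b).trans (by linarith)) a⟩⟩
    · exact (integrable_const _).add (E.vert _ _ _ _ (Φ a) τ hτ).1
    · obtain ⟨h1, h2⟩ := E.vert _ _ _ _ (Φ a) τ hτ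
      have h3 := h2 τ ⟨hτ.le, le_rfl⟩
      rw [intervalIntegral.integral_of_le hτ.le, integral_Ioc_eq_integral_Ioo] at h3
      rw [integral_add (integrable_const _) h1]
      have h4 : 0 ≤ ∫ X in Om h, cutφ ρ a X.1 ^ 2 * (s τ).u2 X := integral_nonneg fun X =>
        mul_nonneg (sq_nonneg _) ((s τ).u2_nonneg X)
      have h5 := hinit a
      have h6 : ∫ _ in Ioo 0 τ, localConst h L * Z = τ * (localConst h L * Z) := by
        simp [Measure.real, hτ.le]
      rw [h6]
      linarith
  · -- continuity in time, uniformly in the centre, since `0 ≤ φ ≤ 1`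
    intro r hr η hη
    have hD := fun i => E.u_cont r hr.1 i
    have hlim := fun i => (hD i).add ((((hD i).mul_const
      (∫ X in Om h, (s r).V1 i 2 X * (s r).V1 i 2 X)).sqrt).const_mul 2)
    have hsum := (hlim 0).add (hlim 1)
    simp only [zero_mul, Real.sqrt_zero, mul_zero, add_zero] at hsum
    have hev := (hsum.mono_left (nhdsWithin_mono (s := Icc 0 τ) r Icc_subset_Ici_self)).eventually
      (gt_mem_nhds hη)
    filter_upwards [hev, self_mem_nhdsWithin] with t ht htI a
    have b := fun i => abs_weighted_sub_le (mφ a) (hφ1 a) (E.u_mem t htI.1 i) (E.u_mem r hr.1 i)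
    rw [hF t htI.1, hF r hr.1, add_sub_add_comm]
    exact (abs_add_le _ _).trans ((add_le_add (b 0) (b 1)).trans ht.le)
  · intro t ht hc a
    rw [(E.vert _ _ _ _ (Φ a) τ hτ).2 t ht]
    have h1 : ∫ r in (0 : ℝ)..t, -∫ X in Om h, cutφ ρ a X.1 ^ 2 * (s r).uzVt X ≤
        t * (localConst h L * Z) := by
      refine integral_le_of_ae_le ht.1
        ((E.vert _ _ _ _ (Φ a) τ hτ).1.mono_set (Ioo_subset_Ioo_right ht.2)).neg ?_
      filter_upwards [rate t ht hc a] with r hr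
      linarith [diss0 r a]
    rw [intervalIntegral.integral_neg] at h1
    have hZ0 : 0 ≤ Z := by
      have := hZ 0 ⟨le_rfl, hτ.le⟩
      have h2 : 0 ≤ ∫ X in Om h, (s 0).T X * (s 0).T X := integral_nonneg fun X => mul_self_nonneg _
      linarith [(s 0).y4_nonneg (h := h)]
    have h2 : t * (localConst h L * Z) ≤ τ * (localConst h L * Z) :=
      mul_le_mul_of_nonneg_right ht.2 (by positivity)
    linarith [hinit a]

/-- The bound of the full energy, by covering the square with the supports of the cutoffs. -/
theorem covered_bound {ρ L τ Z δ : ℝ} (h0 : 0 < ρ) (h1 : ρ ≤ 1 / 8)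
    (Φ : ∀ a, Cutoff h L (cutφ ρ a) (cutφ1 ρ a) (cutχ ρ a)) (hτ : 0 < τ) (hδ : 0 < δ)
    (hZ : ∀ t ∈ Icc 0 τ, 1 + (s t).y4 h + ∫ X in Om h, (s t).T X * (s t).T X ≤ Z)
    (hs : smallConst h * (27 * δ) ≤ 1) (hsmall : 2 * (localConst h L * Z) * τ ≤ δ)
    (hinit : ∀ a, ∫ X in Om h, cutφ ρ a X.1 ^ 2 * (s 0).u2 X ≤ δ) :
    (∀ t ∈ Icc 0 τ, ∫ X in Om h, (s t).u2 X ≤ (ncover ρ : ℝ) ^ 2 * (2 * δ)) ∧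
    ∫⁻ t in Ioo 0 τ, ENNReal.ofReal ((∫ X in Om h, (s t).gradu X) +
      ε * ∫ X in Om h, (s t).uz X) ≤ ENNReal.ofReal ((ncover ρ : ℝ) ^ 2 * (4 * δ)) := by
  obtain ⟨hb, hG⟩ := E.local_bound hh hε Φ hτ hδ hZ hs hsmall hinit
  have cover : ∀ f : Pt → ℝ, (∀ X, 0 ≤ f X) → Integrable f (mu h) →
      ∫ X in Om h, f X ≤ ∑ k, ∫ X in Om h, cutφ ρ (grid ρ k) X.1 ^ 2 * f X := by
    intro f hf hi
    rw [← integral_finsetSum _ fun k _ => (Φ (grid ρ k)).integrable_sq_mul hi]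
    refine integral_mono hi (integrable_finsetSum _ fun k _ =>
      (Φ (grid ρ k)).integrable_sq_mul hi) fun X => ?_
    simp only
    rw [← Finset.sum_mul]
    exact le_mul_of_one_le_left (hf X) (one_le_sum_grid h0 h1 X.1)
  constructor
  · intro t ht
    have hi : Integrable (s t).u2 (mu h) := integrable_finsetSum _ fun i _ =>
      integrable_mul_of_memLp (E.u_mem t ht.1 i) (E.u_mem t ht.1 i)
    refine (cover _ (s t).u2_nonneg hi).trans
      ((Finset.sum_le_sum fun k _ => hb t ht (grid ρ k)).trans (le_of_eq ?_))
    simp only [Finset.sum_const, Finset.card_univ, Fintype.card_prod, Fintype.card_fin,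
      nsmul_eq_mul]
    push_cast; ring
  · choose G hG1 hG2 hG3 using hG
    have hsum : IntegrableOn (fun t => ∑ k, 4 * G (grid ρ k) t) (Ioo 0 τ) :=
      integrable_finsetSum _ fun k _ => (hG1 _).const_mul 4
    have hle : ∀ᵐ t ∂volume.restrict (Ioo 0 τ), (∫ X in Om h, (s t).gradu X) +
        ε * ∫ X in Om h, (s t).uz X ≤ ∑ k, 4 * G (grid ρ k) t := by
      filter_upwards [ae_restrict_of_ae_restrict_of_subset (s := Ioo 0 τ) Ioo_subset_Ioi_self
        E.slice, ae_all_iff.2 fun k => hG3 (grid ρ k)] with t S ht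
      have c1 := cover _ (s t).gradu_nonneg (S.integrable_gradu hh)
      have c2 := cover _ (s t).uz_nonneg (S.integrable_uz hh)
      have c3 : ∀ k, (∫ X in Om h, cutφ ρ (grid ρ k) X.1 ^ 2 * (s t).gradu X) +
          ε * (∫ X in Om h, cutφ ρ (grid ρ k) X.1 ^ 2 * (s t).uz X) ≤ 4 * G (grid ρ k) t := by
        intro k
        have h2 : 0 ≤ ∫ X in Om h, cutφ ρ (grid ρ k) X.1 ^ 2 * (s t).uz X :=
          integral_nonneg fun X => mul_nonneg (sq_nonneg _) ((s t).uz_nonneg X)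
        have := mul_nonneg hε.le h2
        linarith [ht k]
      refine le_trans ?_ (Finset.sum_le_sum fun k _ => c3 k)
      rw [Finset.sum_add_distrib, ← Finset.mul_sum]
      exact add_le_add c1 (mul_le_mul_of_nonneg_left c2 hε.le)
    have hnn : 0 ≤ᵐ[volume.restrict (Ioo 0 τ)] fun t => ∑ k, 4 * G (grid ρ k) t := by
      filter_upwards [hle] with t ht
      have g1 : 0 ≤ ∫ X in Om h, (s t).gradu X := integral_nonneg (s t).gradu_nonneg
      have g2 : 0 ≤ ∫ X in Om h, (s t).uz X := integral_nonneg (s t).uz_nonneg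
      exact (add_nonneg g1 (mul_nonneg hε.le g2)).trans ht
    refine (lintegral_mono_ae (g := fun t => ENNReal.ofReal (∑ k, 4 * G (grid ρ k) t)) (by
      filter_upwards [hle] with t ht using ENNReal.ofReal_le_ofReal ht)).trans ?_
    rw [← ofReal_integral_eq_lintegral_ofReal hsum hnn]
    refine ENNReal.ofReal_le_ofReal ?_
    rw [integral_finsetSum _ fun k _ => (hG1 _).const_mul 4]
    simp only [integral_const_mul]
    refine (Finset.sum_le_sum fun k _ => mul_le_mul_of_nonneg_left (hG2 (grid ρ k))
      (by norm_num : (0 : ℝ) ≤ 4)).trans (le_of_eq ?_)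
    simp only [Finset.sum_const, Finset.card_univ, Fintype.card_prod, Fintype.card_fin,
      nsmul_eq_mul]
    push_cast; ring

end Evolution

end

/-! ### Initial data and the full energy -/

section

variable {h : ℝ}

theorem enorm_plane_sq (x : Plane) : ‖x‖ₑ ^ 2 = ENNReal.ofReal (∑ i, x i * x i) := by
  rw [← ofReal_norm, ← ENNReal.ofReal_pow (norm_nonneg _), EuclideanSpace.real_norm_sq_eq]
  simp only [sq]

theorem normSq_eq_sum {w : Pt → Plane} (hw : ∀ i, MemLp (fun X => w X i) 2 (mu h)) :
    normSq h w = ENNReal.ofReal (∫ X in Om h, ∑ i, w X i * w X i) := by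
  rw [ofReal_integral_eq_lintegral_ofReal
    (integrable_finsetSum _ fun i _ => integrable_mul_of_memLp (hw i) (hw i))
    (Eventually.of_forall fun X => Finset.sum_nonneg fun i _ => mul_self_nonneg _)]
  exact lintegral_congr fun X => enorm_plane_sq _

theorem integral_le_of_lintegral_le {f : Pt → ℝ} (hf : ∀ X, 0 ≤ f X) {C : ℝ} (hC : 0 ≤ C)
    (H : ∫⁻ X in Om h, ENNReal.ofReal (f X) ≤ ENNReal.ofReal C) : ∫ X in Om h, f X ≤ C := by
  by_cases hi : Integrable f (mu h)
  · rw [← ofReal_integral_eq_lintegral_ofReal hi (Eventually.of_forall hf)] at H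
    exact (ENNReal.ofReal_le_ofReal_iff hC).1 H
  · rw [integral_undef hi]; exact hC

/-- A cutoff centred anywhere in the plane is dominated, after a shift by periodicity, by a disk
centred in the open unit square. -/
theorem lintegral_cut_le_localMass (hh : 0 < h) {r₀ : ℝ} (h0 : 0 < r₀) (h1 : r₀ ≤ 1)
    {u : Pt → Plane} (hu : AEStronglyMeasurable u volume) (hp : Periodic h u) (a : Plane)
    (Φ : Per h fun X => cutφ (r₀ / 8) a X.1) (hφ : ∀ x, |cutφ (r₀ / 8) a x| ≤ 1) :
    ∫⁻ X in Om h, ENNReal.ofReal (cutφ (r₀ / 8) a X.1 ^ 2) * ‖u X‖ₑ ^ 2 ≤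
      localMass h (2 * r₀) u := by
  -- a point of the open square at distance at most `r₀ / 4` in each coordinate from a translate
  -- of `a`; `Int.fract` alone could lie on the boundary of the square
  let c : Plane := !₂[(1 - r₀ / 4) * Int.fract (a 0) + r₀ / 8, (1 - r₀ / 4) * Int.fract (a 1) + r₀ / 8]
  have hci : ∀ i, c i = (1 - r₀ / 4) * Int.fract (a i) + r₀ / 8 := by
    intro i; fin_cases i <;> rfl
  have hcM : c ∈ M := by
    intro i
    rw [hci]
    have f0 := Int.fract_nonneg (a i)
    have f1 := Int.fract_lt_one (a i)
    constructor <;> nlinarith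
  have hca : ∀ i, |c i - a i + ⌊a i⌋| ≤ r₀ / 4 := by
    intro i
    have f0 := Int.fract_nonneg (a i)
    have f1 := Int.fract_lt_one (a i)
    have e : c i - a i + ⌊a i⌋ = r₀ / 8 - r₀ / 4 * Int.fract (a i) := by
      rw [hci]; linarith [Int.self_sub_floor (a i)]
    rw [e, abs_le]
    constructor <;> nlinarith
  let F : Pt → ℝ≥0∞ := fun X => ENNReal.ofReal (cutφ (r₀ / 8) a X.1 ^ 2) * ‖u X‖ₑ ^ 2
  have hFm : AEMeasurable F volume :=
    ((Φ.1.aemeasurable.pow_const 2).ennreal_ofReal).mul (hu.enorm.pow_const 2)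
  have hFp : Periodic h F := Φ.2.comp₂ hp fun x y => ENNReal.ofReal (x ^ 2) * ‖y‖ₑ ^ 2
  -- integrate over the period cell centred at `c`
  let Y : Pt := (c - !₂[1 / 2, 1 / 2], 0)
  rw [← lintegral_shift hh hFm hFp Y]
  let D : Set Pt := Metric.ball c (2 * r₀) ×ˢ Ioo (-h) h
  have hD : MeasurableSet D := measurableSet_ball.prod measurableSet_Ioo
  have hle : ∀ X, (Om h).indicator (fun X => F (X + Y)) X ≤
      D.indicator (fun X => ‖u X‖ₑ ^ 2) (X + Y) := by
    intro X
    by_cases hX : X ∈ Om h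
    swap
    · rw [indicator_of_notMem hX]; exact zero_le
    rw [indicator_of_mem hX]
    by_cases hz : cutφ (r₀ / 8) a (X + Y).1 = 0
    · simp only [F, hz]; simp
    have hYi : ∀ i, (X + Y).1 i - c i = X.1 i - 1 / 2 := by
      intro i
      have : (X + Y).1 i = X.1 i + (c i - (!₂[1 / 2, 1 / 2] : Plane) i) := rfl
      rw [this]
      have : (!₂[1 / 2, 1 / 2] : Plane) i = 1 / 2 := by fin_cases i <;> rfl
      rw [this]; ring
    have hθ : ∀ i, theta (r₀ / 8) ((X + Y).1 i - a i) ≠ 0 := by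
      have h2 := mul_ne_zero_iff.1 hz
      intro i; fin_cases i
      exacts [h2.1, h2.2]
    have hclose : ∀ i, |(X + Y).1 i - c i| ≤ r₀ / 2 := by
      intro i
      obtain ⟨n, hn⟩ := exists_int_of_theta_ne_zero (by positivity) (by linarith) (hθ i)
      have hc := hca i
      have hx : |(X + Y).1 i - c i| < 1 / 2 := by
        rw [hYi, abs_lt]
        have := hX.1 i
        constructor <;> linarith [this.1, this.2]
      rw [abs_le] at hn hc
      rw [abs_lt] at hx
      -- in the cell centred at `c` only one of the periodic copies of the support occurs
      have hn0 : n + ⌊a i⌋ = 0 := by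
        have b1 : ((n + ⌊a i⌋ : ℤ) : ℝ) < 1 := by push_cast; linarith
        have b2 : (-1 : ℝ) < ((n + ⌊a i⌋ : ℤ) : ℝ) := by push_cast; linarith
        have b1' : n + ⌊a i⌋ < 1 := by exact_mod_cast b1
        have b2' : -1 < n + ⌊a i⌋ := by exact_mod_cast b2
        omega
      have hn1 : (n : ℝ) + ⌊a i⌋ = 0 := by exact_mod_cast hn0
      rw [abs_le]
      constructor <;> linarith
    have hmem : X + Y ∈ D := by
      refine ⟨?_, ?_⟩
      · rw [Metric.mem_ball, EuclideanSpace.dist_eq, Real.sqrt_lt' (by positivity)]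
        simp only [Fin.sum_univ_two, Real.dist_eq]
        have e0 := pow_le_pow_left₀ (abs_nonneg _) (hclose 0) 2
        have e1 := pow_le_pow_left₀ (abs_nonneg _) (hclose 1) 2
        nlinarith
      · have : (X + Y).2 = X.2 := by simp [Y]
        rw [this]; exact hX.2
    rw [indicator_of_mem hmem]
    refine mul_le_of_le_one_left zero_le ?_
    rw [ENNReal.ofReal_le_one, ← sq_abs]
    exact pow_le_one₀ (abs_nonneg _) (hφ _)
  calc ∫⁻ X in Om h, F (X + Y) = ∫⁻ X, (Om h).indicator (fun X => F (X + Y)) X :=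
        (lintegral_indicator (measurableSet_Om h) _).symm
    _ ≤ ∫⁻ X, D.indicator (fun X => ‖u X‖ₑ ^ 2) (X + Y) := lintegral_mono hle
    _ = ∫⁻ X, D.indicator (fun X => ‖u X‖ₑ ^ 2) X :=
        lintegral_add_right_eq_self (D.indicator fun X => ‖u X‖ₑ ^ 2) Y
    _ = ∫⁻ X in D, ‖u X‖ₑ ^ 2 := lintegral_indicator hD _
    _ ≤ localMass h (2 * r₀) u :=
        le_iSup₂_of_le (f := fun x (_ : x ∈ M) =>
          ∫⁻ X in Metric.ball x (2 * r₀) ×ˢ Ioo (-h) h, ‖u X‖ₑ ^ 2) c hcM le_rfl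

/-- The bound of `‖v₀‖₄⁴` and `‖T₀‖₂²` for data with `‖v₀‖₆ + ‖T₀‖₆ ≤ K`, from `x^m ≤ 1 + x⁶`.
Negative `K` is replaced by `0`, as in `ENNReal.ofReal K`. -/
def initConst (h K : ℝ) : ℝ := (volume (Om h)).toReal + max K 0 ^ 6

theorem initConst_nonneg (h K : ℝ) : 0 ≤ initConst h K := by
  unfold initConst; positivity

theorem lintegral_six_le {F : Type*} [NormedAddCommGroup F] {f : Pt → F} {K : ℝ}
    (hf : eLpNorm f 6 (mu h) ≤ ENNReal.ofReal K) {m : ℕ} (hm : m ≤ 6) :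
    ∫⁻ X in Om h, ‖f X‖ₑ ^ m ≤ ENNReal.ofReal (initConst h K) := by
  have e := eLpNorm_nnreal_pow_eq_lintegral (f := f) (μ := mu h) (p := 6) (by norm_num)
  simp only [NNReal.coe_ofNat, ENNReal.coe_ofNat, ENNReal.rpow_ofNat] at e
  have hp : ∀ x : ℝ≥0∞, x ^ m ≤ 1 + x ^ 6 := by
    intro x
    rcases le_total x 1 with hx | hx
    · exact (pow_le_one₀ zero_le hx).trans le_self_add
    · exact (pow_le_pow_right₀ hx hm).trans le_add_self
  calc ∫⁻ X in Om h, ‖f X‖ₑ ^ m ≤ ∫⁻ X in Om h, (1 + ‖f X‖ₑ ^ 6) :=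
        lintegral_mono fun X => hp _
    _ = volume (Om h) + ∫⁻ X in Om h, ‖f X‖ₑ ^ 6 := by
        rw [lintegral_add_left measurable_const, setLIntegral_one]
    _ ≤ volume (Om h) + ENNReal.ofReal K ^ 6 := by
        refine add_le_add le_rfl ?_
        rw [← e]; gcongr
    _ = ENNReal.ofReal (initConst h K) := by
        rw [initConst, ENNReal.ofReal_add ENNReal.toReal_nonneg (by positivity),
          ENNReal.ofReal_toReal (volume_Om_lt_top h).ne, ENNReal.ofReal_pow (le_max_right _ _)]
        congr 2
        rcases le_total K 0 with hK | hK
        · rw [max_eq_right hK, ENNReal.ofReal_zero, ENNReal.ofReal_of_nonpos hK]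
        · rw [max_eq_left hK]

theorem localConst_pos (hh : 0 < h) {L : ℝ} (hL : 0 ≤ L) : 0 < localConst h L := by
  unfold localConst; positivity

theorem smallConst_pos (hh : 0 < h) : 0 < smallConst h := by
  unfold smallConst; positivity

section Assembly

variable {f₀ ε : ℝ} {v : ℝ → Pt → Plane} {T : ℝ → Pt → ℝ} {v₀ : Pt → Plane} {T₀ : Pt → ℝ}

theorem initial_four {K : ℝ} (hv : v 0 =ᵐ[volume] v₀)
    (hK : eLpNorm v₀ 6 (mu h) ≤ ENNReal.ofReal K) {vt : Pt → Plane} {Tt : Pt → ℝ}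
    {p : Plane → ℝ} : (fieldsOf h (v 0) (T 0) vt Tt p).y4 h ≤ initConst h K := by
  refine integral_le_of_lintegral_le (fun X => mul_self_nonneg _) (initConst_nonneg h K)
    (le_trans (lintegral_mono_ae ?_) (lintegral_six_le hK (m := 4) (by norm_num)))
  filter_upwards [ae_restrict_of_ae hv] with X hX
  have hq : 0 ≤ (fieldsOf h (v 0) (T 0) vt Tt p).q X := Fields.q_nonneg _ X
  have e : ‖v 0 X‖ₑ ^ 2 = ENNReal.ofReal ((fieldsOf h (v 0) (T 0) vt Tt p).q X) :=
    enorm_plane_sq _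
  rw [ENNReal.ofReal_mul hq, ← e, hX, ← pow_add]

theorem initial_temp {K : ℝ} (hT : T 0 =ᵐ[volume] T₀)
    (hK : eLpNorm T₀ 6 (mu h) ≤ ENNReal.ofReal K) :
    ∫ X in Om h, T 0 X * T 0 X ≤ initConst h K := by
  refine integral_le_of_lintegral_le (fun X => mul_self_nonneg _) (initConst_nonneg h K)
    (le_trans (lintegral_mono_ae ?_) (lintegral_six_le hK (m := 2) (by norm_num)))
  filter_upwards [ae_restrict_of_ae hT] with X hX
  rw [hX, ← enorm_sq_eq, Real.enorm_of_nonneg (mul_self_nonneg _)]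

/-- The smallness of the local mass of `∂_z v₀` passes to all localized energies at time `0`. -/
theorem initial_local (hh : 0 < h) (h0 : InitialData h v₀ T₀) (hv1 : MemH h 1 (v 0))
    (hv : v 0 =ᵐ[volume] v₀) {r₀ δ : ℝ} (hr0 : 0 < r₀) (hr1 : r₀ ≤ 1)
    (hmass : localMass h (2 * r₀) (wd eZ v₀) ≤ ENNReal.ofReal (δ ^ 2)) {L : ℝ} {a : Plane}
    (Φ : Cutoff h L (cutφ (r₀ / 8) a) (cutφ1 (r₀ / 8) a) (cutχ (r₀ / 8) a))
    {vt : Pt → Plane} {Tt : Pt → ℝ} {p : Plane → ℝ} :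
    ∫ X in Om h, cutφ (r₀ / 8) a X.1 ^ 2 * (fieldsOf h (v 0) (T 0) vt Tt p).u2 X ≤ δ ^ 2 := by
  have hw := (memH_succ (m := 1) h0.v_mem 2).1
  have e : wd (dir 2) (v 0) =ᵐ[volume] wd eZ v₀ :=
    ((memH_succ hv1 2).1.congr hv EventuallyEq.rfl).unique hw
  refine integral_le_of_lintegral_le (fun X => mul_nonneg (sq_nonneg _) (Fields.u2_nonneg _ X))
    (sq_nonneg δ) (le_trans (lintegral_mono_ae ?_) ((lintegral_cut_le_localMass hh hr0 hr1 hw.aesm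
      (hw.periodic h0.v_per) a (Φ.d 0).f2.per Φ.abs_le_one).trans hmass))
  filter_upwards [ae_restrict_of_ae e] with X hX
  have e2 : ‖wd (dir 2) (v 0) X‖ₑ ^ 2 =
      ENNReal.ofReal ((fieldsOf h (v 0) (T 0) vt Tt p).u2 X) := enorm_plane_sq _
  rw [ENNReal.ofReal_mul (sq_nonneg _), ← e2, hX]
  rfl

/-- `‖∂_z w‖₂²` in terms of the components of a solution. -/
theorem normSq_vertical {w : Pt → Plane} {T : Pt → ℝ} (hw : MemH h 1 w) {vt : Pt → Plane}
    {Tt : Pt → ℝ} {p : Plane → ℝ} :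
    normSq h (wd eZ w) = ENNReal.ofReal (∫ X in Om h, (fieldsOf h w T vt Tt p).u2 X) :=
  normSq_eq_sum fun i => MemLp.comp_plane (memH_memLp (memH_succ hw 2).2) i

/-- The dissipation in `energy`, in terms of the components of a solution. -/
theorem dissipation_eq (hε : 0 < ε) {w : Pt → Plane} {T : Pt → ℝ} {vt : Pt → Plane}
    {Tt : Pt → ℝ} {p : Plane → ℝ} (S : Slice h f₀ ε (fieldsOf h w T vt Tt p)) :
    (∑ j, normSq h (wd (eH j) (wd eZ w))) + ENNReal.ofReal ε * normSq h (wd eZ (wd eZ w)) =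
      ENNReal.ofReal ((∫ X in Om h, (fieldsOf h w T vt Tt p).gradu X) +
        ε * ∫ X in Om h, (fieldsOf h w T vt Tt p).uz X) := by
  have m : ∀ b i, MemLp (fun X => wd (dir b) (wd (dir 2) w) X i) 2 (mu h) := fun b i =>
    ((S.hV2 i).2 2 b).g2.mem
  have e : ∀ b, normSq h (wd (dir b) (wd (dir 2) w)) =
      ENNReal.ofReal (∫ X in Om h, ∑ i, wd (dir b) (wd (dir 2) w) X i *
        wd (dir b) (wd (dir 2) w) X i) := fun b => normSq_eq_sum (m b)
  have i1 : ∀ b, Integrable (fun X => ∑ i, wd (dir b) (wd (dir 2) w) X i *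
      wd (dir b) (wd (dir 2) w) X i) (mu h) := fun b =>
    integrable_finsetSum _ fun i _ => integrable_mul_of_memLp (m b i) (m b i)
  have n1 : ∀ b, 0 ≤ ∫ X in Om h, ∑ i, wd (dir b) (wd (dir 2) w) X i *
      wd (dir b) (wd (dir 2) w) X i := fun b =>
    integral_nonneg fun X => Finset.sum_nonneg fun i _ => mul_self_nonneg _
  have eg : ∫ X in Om h, (fieldsOf h w T vt Tt p).gradu X =
      (∫ X in Om h, ∑ i, wd (dir 0) (wd (dir 2) w) X i * wd (dir 0) (wd (dir 2) w) X i) +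
      ∫ X in Om h, ∑ i, wd (dir 1) (wd (dir 2) w) X i * wd (dir 1) (wd (dir 2) w) X i := by
    rw [← integral_add (i1 0) (i1 1)]
    refine integral_congr_ae (Eventually.of_forall fun X => ?_)
    simp only [Fields.gradu, fieldsOf, Fin.sum_univ_two, Fin.castSucc_zero, Fin.castSucc_one]
    ring
  have e0 := e 0
  have e1 := e 1
  have e2 := e 2
  have d0 : dir 0 = eH 0 := rfl
  have d1 : dir 1 = eH 1 := rfl
  have ez : ∫ X in Om h, (fieldsOf h w T vt Tt p).uz X =
      ∫ X in Om h, ∑ i, wd (dir 2) (wd (dir 2) w) X i * wd (dir 2) (wd (dir 2) w) X i := rfl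
  rw [Fin.sum_univ_two, ← d0, ← d1, ← dir_two, e0, e1, e2, eg, ez,
    ENNReal.ofReal_add (add_nonneg (n1 0) (n1 1)) (mul_nonneg hε.le (n1 2)),
    ENNReal.ofReal_add (n1 0) (n1 1), ENNReal.ofReal_mul hε.le]

/-- The estimate for one solution, on any time interval on which the growth is small. -/
theorem energy_le (hh : 0 < h) (hε : 0 < ε) (h0 : InitialData h v₀ T₀) {K r₀ δ L τ : ℝ}
    (hK : eLpNorm v₀ 6 (mu h) + eLpNorm T₀ 6 (mu h) ≤ ENNReal.ofReal K)
    (H : IsGlobalStrongSolution h f₀ ε v₀ T₀ v T) (hr0 : 0 < r₀) (hr1 : r₀ ≤ 1) (hδ : 0 < δ)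
    (hs : smallConst h * (27 * δ ^ 2) ≤ 1)
    (Φ : ∀ a, Cutoff h L (cutφ (r₀ / 8) a) (cutφ1 (r₀ / 8) a) (cutχ (r₀ / 8) a))
    (hmass : localMass h (2 * r₀) (wd eZ v₀) ≤ ENNReal.ofReal (δ ^ 2)) (hτ : 0 < τ)
    (hτ1 : τ ≤ 1 / (rateConst h f₀ * (9 + 4 * initConst h K) ^ 2))
    (hτ2 : 2 * (localConst h L * (7 + 6 * initConst h K)) * τ ≤ δ ^ 2) :
    energy h ε τ (fun t => wd eZ (v t)) ≤
      ENNReal.ofReal (6 * (ncover (r₀ / 8) : ℝ) ^ 2 * δ ^ 2) := by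
  have hvc := H.2.2.2.2.1
  obtain ⟨hv0, hT0⟩ := H.2.2.2.2.2.2.2.2.2.1, H.2.2.2.2.2.2.2.2.2.2.1
  obtain ⟨vt, Tt, p, E⟩ := exists_evolution hh h0 H
  have hY := initConst_nonneg h K
  have bound := E.energy_bound hh hε hY (initial_four hv0 (le_self_add.trans hK))
    (initial_temp hT0 (le_add_self.trans hK))
  obtain ⟨b1, b2⟩ := E.covered_bound hh hε (Z := 7 + 6 * initConst h K) (δ := δ ^ 2)
    (by positivity) (by linarith) Φ hτ (by positivity)
    (fun t ht => by have := bound t ⟨ht.1, ht.2.trans hτ1⟩; linarith) hs hτ2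
    (fun a => initial_local hh h0 (hvc.1 0 le_rfl) hv0 hr0 hr1 hmass (Φ a))
  have hsum : (6 * (ncover (r₀ / 8) : ℝ) ^ 2 * δ ^ 2) =
      (ncover (r₀ / 8) : ℝ) ^ 2 * (2 * δ ^ 2) + (ncover (r₀ / 8) : ℝ) ^ 2 * (4 * δ ^ 2) := by ring
  rw [energy, hsum, ENNReal.ofReal_add (by positivity) (by positivity)]
  refine add_le_add (iSup₂_le fun t ht => ?_) (le_trans (lintegral_mono_ae ?_) b2)
  · rw [normSq_vertical (T := T t) (vt := vt t) (Tt := Tt t) (p := p t) (hvc.1 t ht.1)]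
    exact ENNReal.ofReal_le_ofReal (b1 t ht)
  · filter_upwards [ae_restrict_of_ae_restrict_of_subset (s := Ioo 0 τ) Ioo_subset_Ioi_self E.slice]
      with t S
    exact (dissipation_eq hε S).le

end Assembly

end

end PrimitiveEq

end

theorem proposition3p2 :
    -- `C` depends only on `δ₀` and `r₀`
    ∃ C : ℝ → ℝ → ℝ, ∀ h : ℝ, 0 < h →
      ∃ δ₀ : ℝ, 0 < δ₀ ∧ δ₀ ≤ 1 ∧
        ∀ f₀ r₀ K : ℝ, 0 < r₀ → r₀ ≤ 1 →
          ∃ C₀ : ℝ, 0 < C₀ ∧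
            ∀ (ε : ℝ) (v₀ : PrimitiveEq.Pt → PrimitiveEq.Plane) (T₀ : PrimitiveEq.Pt → ℝ)
              (v : ℝ → PrimitiveEq.Pt → PrimitiveEq.Plane) (T : ℝ → PrimitiveEq.Pt → ℝ),
              0 < ε →
              PrimitiveEq.InitialData h v₀ T₀ →
              eLpNorm v₀ 6 (volume.restrict (PrimitiveEq.Om h))
                + eLpNorm T₀ 6 (volume.restrict (PrimitiveEq.Om h)) ≤ ENNReal.ofReal K →
              PrimitiveEq.IsGlobalStrongSolution h f₀ ε v₀ T₀ v T →
              PrimitiveEq.localMass h (2 * r₀) (PrimitiveEq.wd PrimitiveEq.eZ v₀)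
                ≤ ENNReal.ofReal (δ₀ ^ 2) →
              PrimitiveEq.energy h ε (min 1 (6 * r₀ ^ 2 * δ₀ ^ 2 / C₀))
                  (fun t => PrimitiveEq.wd PrimitiveEq.eZ (v t))
                ≤ ENNReal.ofReal (C δ₀ r₀) := by
  refine ⟨fun δ r => 6 * (PrimitiveEq.ncover (r / 8) : ℝ) ^ 2 * δ ^ 2, fun h hh => ?_⟩
  have hS := PrimitiveEq.smallConst_pos hh
  set S := PrimitiveEq.smallConst h
  have hδ : 0 < min 1 (1 / (27 * S)) := by positivity
  refine ⟨min 1 (1 / (27 * S)), hδ, min_le_left _ _, fun f₀ r₀ K hr0 hr1 => ?_⟩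
  have hδ1 : min 1 (1 / (27 * S)) ≤ 1 := min_le_left _ _
  have hδ2 : min 1 (1 / (27 * S)) * (27 * S) ≤ 1 :=
    (le_div_iff₀ (by positivity)).1 (min_le_right _ _)
  set δ := min 1 (1 / (27 * S))
  obtain ⟨L, hL⟩ := PrimitiveEq.exists_cutoff (ρ := r₀ / 8) (by linarith) (by linarith)
  have hY := PrimitiveEq.initConst_nonneg h K
  have hR := PrimitiveEq.rateConst_pos hh f₀
  have hloc := PrimitiveEq.localConst_pos hh (hL h 0).L_nonneg
  set Y := PrimitiveEq.initConst h K
  have hZ : 0 < 2 * (PrimitiveEq.localConst h L * (7 + 6 * Y)) := by positivity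
  set τ := min (1 / (PrimitiveEq.rateConst h f₀ * (9 + 4 * Y) ^ 2))
    (δ ^ 2 / (2 * (PrimitiveEq.localConst h L * (7 + 6 * Y))))
  have hτ : 0 < τ := lt_min (by positivity) (by positivity)
  -- this choice of `C₀` turns `6 r₀² δ₀² / C₀` into the time of validity `τ`
  refine ⟨6 * r₀ ^ 2 * δ ^ 2 / τ, by positivity, fun ε v₀ T₀ v T hε h0 hK H hmass => ?_⟩
  have hC : 6 * r₀ ^ 2 * δ ^ 2 / (6 * r₀ ^ 2 * δ ^ 2 / τ) = τ := by field_simp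
  rw [hC]
  have hle : min 1 τ ≤ τ := min_le_right _ _
  refine PrimitiveEq.energy_le hh hε h0 hK H hr0 hr1 hδ ?_ (hL h) hmass (lt_min one_pos hτ)
    (hle.trans (min_le_left _ _)) ?_
  · have : S * (27 * δ ^ 2) = δ * (27 * S) * δ := by ring
    rw [this]
    exact mul_le_one₀ hδ2 hδ.le hδ1
  · rw [mul_comm, ← le_div_iff₀ hZ]
    exact hle.trans (min_le_right _ _)
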